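/- **Setting.** Let $d\in\{2,3\}$, $L,T>0$, $\Omega=[0,L]^d$ with periodic boundary conditions. Let $K,B,C_b,b,c,B_0,q>0$ and $A,a\in\mathbb R$, with $A<0$ if $d=2$ and $A<B^2/(27C_b)$ if $d=3$, and put $s_+=\sqrt{-2A/C_b}$ if $d=2$, $s_+=\frac{B+\sqrt{B^2-24AC_b}}{4C_b}$ if $d=3$. For symmetric traceless $Q\in\mathbb R^{d\times d}$ put $M=M(Q)=Q/s_++I/d$, $f_{bn}(Q)=\frac A2\operatorname{tr}Q^2-\frac B3\operatorname{tr}Q^3+\frac{C_b}4(\operatorname{tr}Q^2)^2$ (the cubic term is $0$ for $d=2$), $f_s(u)=\frac a2u^2+\frac b3u^3+\frac c4u^4$, and $$E_1(Q,u)=\int_\Omega 2B_0q^2\,D^2u:(Mu)+B_0q^4|Mu|^2+f_{bn}(Q)+f_s(u)\,dx,$$ $$H=AQ-B\big(Q^2-\tfrac{\operatorname{tr}Q^2}{d}I\big)+C_b\operatorname{tr}(Q^2)Q+\tfrac{2B_0q^2}{s_+}\big(uD^2u-\tfrac{\operatorname{tr}(uD^2u)}{d}I\big)+\tfrac{2B_0q^4}{s_+^2}u^2Q,$$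 $$\mu=au+bu^2+cu^3+2B_0q^2M:D^2u+2B_0q^2\nabla\cdot(\nabla\cdot(Mu))+2B_0q^4|M|^2u.$$ **Exact solution.** Let $(Q,u,s)$, with $Q(t,x)$ symmetric and traceless and $s(t)=E_1(Q(t),u(t))$, be an $\Omega$-periodic solution on $[0,T]$ of $$\partial_tQ-K\Delta Q=-gH,\quad \partial_tu+2B_0\Delta^2u=-g\mu,\quad \dot s=g\Big(\int_\Omega H:\partial_tQ+\int_\Omega\mu\,\partial_tu\Big),\quad g=e^{s}/e^{E_1(Q,u)},$$ with $Q,u,\partial_tQ,\partial_tu\in L^\infty(0,T;H^4(\Omega))$. **Grid.** For an integer $J\ge1$ let $h=L/J$; grid functions are indexed by $(\mathbb Z/J)^d$, $D_k^{+},D_k^-,D_k^c$ are the forward, backward and central differences in direction $k$, $\Delta_h=\sum_kD_k^+D_k^-$, $D_{k,l}^c=D_k^cD_l^c$, $D_h^2U=(D^c_{k,l}U)_{k,l}$, and the discrete double divergence of a matrix field $F$ is $\sum_{k,l}D_{k,l}^cF^{kl}$. Further $\langle U,V\rangle_h=h^d\sum_pU_pV_p$ over one full period, $\|U\|_{H^1_h}^2=\|U\|_h^2+\sum_k\|D_k^+U\|_h^2$,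 $\|U\|_{H_h^2}^2=\|U\|_{H^1_h}^2+\|\Delta_hU\|_h^2$, entrywise (summing squares) for matrices. $E_{1h},H_h,\mu_h$ are $E_1,H,\mu$ with $\int_\Omega$, $D^2$ and $\nabla\cdot\nabla\cdot$ replaced by $h^d\sum_p$, $D_h^2$ and the discrete double divergence. **Scheme (ETD1).** Fix $\kappa_1,\kappa_2>0$, $\eta_0\in[0,1]$. Given $(Q_h^n,u_h^n,s^n)$ let $g^n=e^{s^n}/e^{E_{1h}^n}$ with $E^n_{1h}=E_{1h}(Q_h^n,u_h^n)$, $\mathcal L=-K\Delta_h+g^n\kappa_1$, $\mathcal D=2B_0\Delta_h^2+g^n\kappa_2$, $\varphi_1(z)=(e^z-1)/z$ and $$Q_h^{n+1}=e^{-\tau\mathcal L}Q_h^n+\tau\varphi_1(-\tau\mathcal L)\big(-g^nH_h^n+g^n\kappa_1Q_h^n\big),\quad u_h^{n+1}=e^{-\tau\mathcal D}u_h^n+\tau\varphi_1(-\tau\mathcal D)\big(-g^n\mu_h^n+g^n\kappa_2u_h^n\big),$$ $$\tilde s^{n+1}=s^n+g^n\big(\langle H_h^n,Q_h^{n+1}-Q_h^n\rangle_h+\langle\mu_h^n,u_h^{n+1}-u_h^n\rangle_h\big),\quad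 s^{n+1}=\xi^{n+1}\tilde s^{n+1}+(1-\xi^{n+1})E_{1h}^{n+1},$$ where $\xi^{n+1}\in[0,1]$ is any number for which $s^{n+1}-\tilde s^{n+1}\le\eta_0\big(\langle\mathcal Q_1(\tau\mathcal L)\delta Q,\delta Q\rangle_h+\langle\mathcal Q_1(\tau\mathcal D)\delta u,\delta u\rangle_h\big)$, with $\delta Q=Q_h^{n+1}-Q_h^n$, $\delta u=u_h^{n+1}-u_h^n$, $\mathcal Q_1(z)=\frac z{e^z-1}+\frac z2$. The initial $Q_h^0$ is symmetric and traceless at every node. **Theorem.** Let $E_Q^n=Q_h^n-Q(t_n)$ and $e_u^n=u_h^n-u(t_n)$ at the nodes, $e_s^n=s^n-s(t_n)$, $t_n=n\tau$. For every $C_0$ there are $C,\tau_0,h_0>0$, independent of $\tau$, $h$ and $n$, such that for all $0<\tau\le\tau_0$, all $h=L/J\le h_0$ and every numerical solution with $\|E_Q^0\|_{H^1_h}+\|e_u^0\|_{H^2_h}+|e_s^0|\le C_0(\tau+h^2)$, $$\|E_Q^n\|_{H_h^1}+\|e_u^n\|_{H_h^2}+|e_s^n|\le C(\tau+h^2)\qquad\text{for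 all } n\ge 0 \text{ with } n\tau\le T.$$ -/

import Mathlib

open MeasureTheory Set
open scoped ContDiff

namespace SmA

noncomputable section

/-! ### Material parameters and pointwise algebra (dimension `d`) -/

/-- Material constants of the modified Landau-de Gennes model. -/
structure Params where
  K : ℝ
  A : ℝ
  B : ℝ
  C : ℝ
  a : ℝ
  b : ℝ
  c : ℝ
  B0 : ℝ
  q : ℝ

/-- Sign conditions on the constants, the dimension `d = 2, 3`, and the temperature regime in which
`s₊` is defined (the regime in which the two fields are coupled). -/
structure Params.Admissible (P : Params) (d : ℕ) : Prop where
  K_pos : 0 < P.K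
  B_pos : 0 < P.B
  C_pos : 0 < P.C
  b_pos : 0 < P.b
  c_pos : 0 < P.c
  B0_pos : 0 < P.B0
  q_pos : 0 < P.q
  regime : (d = 2 ∧ P.A < 0) ∨ (d = 3 ∧ P.A < P.B ^ 2 / (27 * P.C))

/-- The equilibrium scalar order parameter `s₊`. -/
def sPlus (P : Params) (d : ℕ) : ℝ :=
  if d = 3 then (P.B + √(P.B ^ 2 - 24 * P.A * P.C)) / (4 * P.C) else √(-2 * P.A / P.C)

variable {d : ℕ}

abbrev Mat (d : ℕ) := Matrix (Fin d) (Fin d) ℝ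

/-- Symmetric traceless matrices. -/
def IsQTensor (X : Mat d) : Prop := X.IsSymm ∧ X.trace = 0

/-- Frobenius product `X : Y`. -/
def frob (X Y : Mat d) : ℝ := ∑ i, ∑ j, X i j * Y i j

/-- `M = Q / s₊ + I / d`. -/
def Mten (P : Params) (X : Mat d) : Mat d := (sPlus P d)⁻¹ • X + (d : ℝ)⁻¹ • (1 : Mat d)

/-- Nematic bulk density `f_bn`. For `d = 2` the cubic term vanishes on symmetric traceless
matrices, so the same formula serves both dimensions. -/
def fbn (P : Params) (X : Mat d) : ℝ :=
  P.A / 2 * (X * X).trace - P.B / 3 * (X * X * X).trace + P.C / 4 * (X * X).trace ^ 2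

/-- Smectic bulk density `f_s`. -/
def fs (P : Params) (v : ℝ) : ℝ := P.a / 2 * v ^ 2 + P.b / 3 * v ^ 3 + P.c / 4 * v ^ 4

/-- Density of `E₁` at a point where `Q = X`, `u = v` and the Hessian of `u` is `D`. -/
def e1Density (P : Params) (X : Mat d) (v : ℝ) (D : Mat d) : ℝ :=
  2 * P.B0 * P.q ^ 2 * frob D (v • Mten P X)
    + P.B0 * P.q ^ 4 * frob (v • Mten P X) (v • Mten P X) + fbn P X + fs P v

/-- The variation `H` of `E₁` in `Q` (projected on symmetric traceless matrices), at a point where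
`Q = X`, `u = v` and the Hessian of `u` is `D`. -/
def HVar (P : Params) (X : Mat d) (v : ℝ) (D : Mat d) : Mat d :=
  P.A • X - P.B • (X * X - ((X * X).trace / d) • (1 : Mat d)) + (P.C * (X * X).trace) • X
    + (2 * P.B0 * P.q ^ 2 / sPlus P d) • (v • D - ((v • D).trace / d) • (1 : Mat d))
    + (2 * P.B0 * P.q ^ 4 / sPlus P d ^ 2 * v ^ 2) • X

/-- The variation `μ` of `E₁` in `u`, at a point where `Q = X`, `u = v`, the Hessian of `u` is `D`
and the double divergence of `M u` is `w`. -/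
def muVar (P : Params) (X : Mat d) (v : ℝ) (D : Mat d) (w : ℝ) : ℝ :=
  P.a * v + P.b * v ^ 2 + P.c * v ^ 3 + 2 * P.B0 * P.q ^ 2 * frob (Mten P X) D
    + 2 * P.B0 * P.q ^ 2 * w + 2 * P.B0 * P.q ^ 4 * frob (Mten P X) (Mten P X) * v

/-! ### Periodic Sobolev functions and the continuous system -/

abbrev Pt (d : ℕ) := Fin d → ℝ

/-- `f` is `L`-periodic in every coordinate. -/
def IsPer {α : Type} (L : ℝ) (f : Pt d → α) : Prop := ∀ x i, f (x + Pi.single i L) = f x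

/-- Lebesgue measure on the cell `Ω = [0, L]^d`. -/
def cellMeasure (d : ℕ) (L : ℝ) : Measure (Pt d) :=
  volume.restrict (Icc (0 : Pt d) (fun _ => L))

/-- `g ∈ L²(Ω)` is the weak derivative of `f` in direction `i`, tested against smooth periodic
functions. -/
def HasWeakPartial (L : ℝ) (i : Fin d) (f g : Pt d → ℝ) : Prop :=
  MemLp g 2 (cellMeasure d L) ∧
    ∀ φ : Pt d → ℝ, ContDiff ℝ ∞ φ → IsPer L φ →
      ∫ x, f x * fderiv ℝ φ x (Pi.single i 1) ∂(cellMeasure d L)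
        = - ∫ x, g x * φ x ∂(cellMeasure d L)

open Classical in
/-- The weak derivative (a representative; `0` when there is none). -/
def wd (L : ℝ) (i : Fin d) (f : Pt d → ℝ) : Pt d → ℝ :=
  if h : ∃ g, HasWeakPartial L i f g then h.choose else 0

/-- `f` belongs to the periodic Sobolev space `H^m(Ω)`, and each of its weak derivatives of order
at most `m` has `L²(Ω)`-norm at most `R`. -/
def SobolevBound (L R : ℝ) : ℕ → (Pt d → ℝ) → Prop
  | 0, f => MemLp f 2 (cellMeasure d L) ∧ eLpNorm f 2 (cellMeasure d L) ≤ ENNReal.ofReal R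
  | m + 1, f =>
      (MemLp f 2 (cellMeasure d L) ∧ eLpNorm f 2 (cellMeasure d L) ≤ ENNReal.ofReal R) ∧
        ∀ i, ∃ g, HasWeakPartial L i f g ∧ SobolevBound L R m g

/-- `w` and its time derivative `wt` both belong to `L^∞(0, T; H^m(Ω))`. Here `w t`, `t ∈ [0, T]`,
is the continuous periodic representative, and `wt` is the time derivative in the sense that `w` is
the indefinite integral of `wt`. -/
structure TimeSobolev (L T : ℝ) (m : ℕ) (w wt : ℝ → Pt d → ℝ) : Prop where
  cont : ∀ t ∈ Icc 0 T, Continuous (w t)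
  per : ∀ t ∈ Icc 0 T, IsPer L (w t)
  bound : ∃ R, ∀ t ∈ Icc 0 T, SobolevBound L R m (w t)
  meas : AEStronglyMeasurable (Function.uncurry wt)
    ((volume.restrict (Ioc 0 T)).prod (cellMeasure d L))
  bound_deriv : ∃ R, ∀ᵐ t ∂(volume.restrict (Ioc 0 T)), SobolevBound L R m (wt t)
  integral_deriv : ∀ t ∈ Icc 0 T, ∀ᵐ x ∂(cellMeasure d L),
    w t x = w 0 x + ∫ r in (0 : ℝ)..t, wt r x

/-- Hessian `D² u`. -/
def hess (L : ℝ) (u : Pt d → ℝ) (x : Pt d) : Mat d :=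
  Matrix.of fun k l => wd L k (wd L l u) x

/-- Laplacian. -/
def lap (L : ℝ) (f : Pt d → ℝ) : Pt d → ℝ := fun x => ∑ k, wd L k (wd L k f) x

/-- Bi-Laplacian `∑_{k,l} ∂_k ∂_k ∂_l ∂_l f`. -/
def biLap (L : ℝ) (f : Pt d → ℝ) : Pt d → ℝ := fun x =>
  ∑ k, ∑ l, wd L k (wd L k (wd L l (wd L l f))) x

/-- Double divergence `∇·(∇·F)` of a matrix field. -/
def divDiv (L : ℝ) (F : Pt d → Mat d) : Pt d → ℝ := fun x =>
  ∑ k, ∑ l, wd L k (wd L l (fun y => F y k l)) x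

/-- The functional `E₁(Q, u)`. -/
def E1 (P : Params) (L : ℝ) (Q : Pt d → Mat d) (u : Pt d → ℝ) : ℝ :=
  ∫ x, e1Density P (Q x) (u x) (hess L u x) ∂(cellMeasure d L)

/-- `H(Q, u)` as a field. -/
def HField (P : Params) (L : ℝ) (Q : Pt d → Mat d) (u : Pt d → ℝ) : Pt d → Mat d := fun x =>
  HVar P (Q x) (u x) (hess L u x)

/-- `μ(Q, u)` as a field. -/
def muField (P : Params) (L : ℝ) (Q : Pt d → Mat d) (u : Pt d → ℝ) : Pt d → ℝ := fun x =>
  muVar P (Q x) (u x) (hess L u x) (divDiv L (fun y => u y • Mten P (Q y)) x)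

/-- The factor `g(Q, u, s) = e^s / e^{E₁(Q, u)}`. -/
def gFactor (P : Params) (L : ℝ) (Q : Pt d → Mat d) (u : Pt d → ℝ) (s : ℝ) : ℝ :=
  Real.exp s / Real.exp (E1 P L Q u)

/-- `(Q, u, s)` is an exact solution on `[0, T]` of the coupled system, with
`Q, u, ∂ₜQ, ∂ₜu ∈ L^∞(0, T; H^m(Ω))`; `Qt` and `ut` are the time derivatives. -/
structure IsExactSolution (P : Params) (L T : ℝ) (m : ℕ)
    (Q Qt : ℝ → Pt d → Mat d) (u ut : ℝ → Pt d → ℝ) (s : ℝ → ℝ) : Prop where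
  reg_Q : ∀ i j, TimeSobolev L T m (fun t x => Q t x i j) (fun t x => Qt t x i j)
  reg_u : TimeSobolev L T m u ut
  qtensor : ∀ t ∈ Icc 0 T, ∀ x, IsQTensor (Q t x)
  eq_Q : ∀ᵐ t ∂(volume.restrict (Ioc 0 T)), ∀ᵐ x ∂(cellMeasure d L), ∀ i j,
    Qt t x i j - P.K * lap L (fun y => Q t y i j) x
      = - (gFactor P L (Q t) (u t) (s t) * HField P L (Q t) (u t) x i j)
  eq_u : ∀ᵐ t ∂(volume.restrict (Ioc 0 T)), ∀ᵐ x ∂(cellMeasure d L),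
    ut t x + 2 * P.B0 * biLap L (u t) x
      = - (gFactor P L (Q t) (u t) (s t) * muField P L (Q t) (u t) x)
  s_def : ∀ t ∈ Icc 0 T, s t = E1 P L (Q t) (u t)
  eq_s : ∀ t ∈ Icc 0 T, s t = s 0 + ∫ r in (0 : ℝ)..t,
    gFactor P L (Q r) (u r) (s r) *
      (∫ x, frob (HField P L (Q r) (u r) x) (Qt r x) ∂(cellMeasure d L)
        + ∫ x, muField P L (Q r) (u r) x * ut r x ∂(cellMeasure d L))

/-! ### The periodic grid -/

/-- Nodes of the periodic grid with `J` points per direction (indices modulo `J`). -/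
abbrev Grid (d J : ℕ) := Fin d → ZMod J

/-- Periodic grid functions. -/
abbrev GridFun (d J : ℕ) := Grid d J → ℝ

/-- Operators on periodic grid functions. -/
abbrev GridOp (d J : ℕ) [NeZero J] := GridFun d J →L[ℝ] GridFun d J

/-- The point `h p` of the mesh. -/
def node {J : ℕ} (h : ℝ) (p : Grid d J) : Pt d := fun i => h * ((p i).val : ℝ)

variable {J : ℕ} [NeZero J]

/-- The translation `(S_e U)_p = U_{p + e}`. -/
def shift (e : Grid d J) : GridOp d J :=
  LinearMap.toContinuousLinearMap (LinearMap.funLeft ℝ ℝ (fun p : Grid d J => p + e))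

/-- Forward difference `D_k⁺`. -/
def Dp (h : ℝ) (k : Fin d) : GridOp d J := h⁻¹ • (shift (Pi.single k 1) - 1)

/-- Backward difference `D_k⁻`. -/
def Dm (h : ℝ) (k : Fin d) : GridOp d J := h⁻¹ • (1 - shift (-Pi.single k 1))

/-- Central difference `D_k^c`. -/
def Dc (h : ℝ) (k : Fin d) : GridOp d J :=
  (2 * h)⁻¹ • (shift (Pi.single k 1) - shift (-Pi.single k 1))

/-- Discrete Laplacian `∑_k D_k⁺ D_k⁻`. -/
def lapOp (h : ℝ) : GridOp d J := ∑ k, Dp h k * Dm h k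

/-- Discrete Hessian, made of the mixed central differences `D_{k,l}^c = D_k^c D_l^c`. -/
def hessH (h : ℝ) (U : GridFun d J) (p : Grid d J) : Mat d :=
  Matrix.of fun k l => Dc h k (Dc h l U) p

/-- Discrete double divergence `∑_{k,l} D_{k,l}^c F^{kl}`, the adjoint of the discrete Hessian. -/
def divDivH (h : ℝ) (F : Grid d J → Mat d) (p : Grid d J) : ℝ :=
  ∑ k, ∑ l, Dc h k (Dc h l (fun r => F r k l)) p

/-- Discrete `l²` inner product, over one full period of the grid. -/
def ip (h : ℝ) (U V : GridFun d J) : ℝ := h ^ d * ∑ p, U p * V p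

/-- `‖U‖_{H¹_h}²`. -/
def h1Sq (h : ℝ) (U : GridFun d J) : ℝ := ip h U U + ∑ k, ip h (Dp h k U) (Dp h k U)

/-- `‖U‖_{H²_h}`. -/
def h2Norm (h : ℝ) (U : GridFun d J) : ℝ := √(h1Sq h U + ip h (lapOp h U) (lapOp h U))

/-- `‖Φ‖_{H¹_h}` for matrix-valued grid functions. -/
def h1NormT (h : ℝ) (F : Grid d J → Mat d) : ℝ := √(∑ i, ∑ j, h1Sq h (fun p => F p i j))

/-! ### The fully discrete scheme -/

/-- `φ₁(z) = (e^z - 1) / z`, at an invertible operator. -/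
def phi1 (Z : GridOp d J) : GridOp d J := Ring.inverse Z * (NormedSpace.exp Z - 1)

/-- `𝒬(z) = z / (e^z - 1)`, at an operator for which `e^z - 1` is invertible. -/
def calQ (Z : GridOp d J) : GridOp d J := Z * Ring.inverse (NormedSpace.exp Z - 1)

/-- `𝒬₁(z) = z / (e^z - 1) + z / 2`. -/
def calQ1 (Z : GridOp d J) : GridOp d J := calQ Z + (2 : ℝ)⁻¹ • Z

/-- `ℒ = -K Δ_h + g κ`; it acts on matrix-valued grid functions entry by entry. -/
def opL (P : Params) (h κ g : ℝ) : GridOp d J := -(P.K • lapOp h) + (g * κ) • 1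

/-- `𝒟 = 2 B₀ Δ_h² + g κ`. -/
def opD (P : Params) (h κ g : ℝ) : GridOp d J :=
  (2 * P.B0) • (lapOp h * lapOp h) + (g * κ) • 1

/-- The discrete functional `E_{1h}`. -/
def E1h (P : Params) (h : ℝ) (Q : Grid d J → Mat d) (u : GridFun d J) : ℝ :=
  h ^ d * ∑ p, e1Density P (Q p) (u p) (hessH h u p)

/-- `g = e^s / e^{E_{1h}}`. -/
def gH (P : Params) (h : ℝ) (Q : Grid d J → Mat d) (u : GridFun d J) (s : ℝ) : ℝ :=
  Real.exp s / Real.exp (E1h P h Q u)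

/-- The discrete variation `H_h`. -/
def HH (P : Params) (h : ℝ) (Q : Grid d J → Mat d) (u : GridFun d J) : Grid d J → Mat d :=
  fun p => HVar P (Q p) (u p) (hessH h u p)

/-- The discrete variation `μ_h`. -/
def muH (P : Params) (h : ℝ) (Q : Grid d J → Mat d) (u : GridFun d J) : GridFun d J :=
  fun p => muVar P (Q p) (u p) (hessH h u p) (divDivH h (fun r => u r • Mten P (Q r)) p)

/-- The entry `(i, j)` of a matrix-valued grid function. -/
def entry (F : Grid d J → Mat d) (i j : Fin d) : GridFun d J := fun p => F p i j

/-- `τ ℛ^{n+1}`, the squared `𝒬₁(τℒ)`- and `𝒬₁(τ𝒟)`-norms of the increments. -/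
def tauDissip (P : Params) (h τ κ₁ κ₂ g : ℝ) (dQ : Grid d J → Mat d) (du : GridFun d J) : ℝ :=
  (∑ i, ∑ j, ip h (calQ1 (τ • opL P h κ₁ g) (entry dQ i j)) (entry dQ i j))
    + ip h (calQ1 (τ • opD P h κ₂ g) du) du

/-- One step of the scheme, from `(Q, u, s)` to `(Q', u', s')`: the two exponential integrators, the
provisional auxiliary variable `st`, and the relaxation with some feasible parameter `ξ`. -/
def IsStep (P : Params) (h τ κ₁ κ₂ η₀ : ℝ) (Q : Grid d J → Mat d) (u : GridFun d J) (s : ℝ)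
    (Q' : Grid d J → Mat d) (u' : GridFun d J) (s' : ℝ) : Prop :=
  let g := gH P h Q u s
  (∀ i j, entry Q' i j = NormedSpace.exp (-(τ • opL P h κ₁ g)) (entry Q i j)
      + τ • phi1 (-(τ • opL P h κ₁ g)) (-(g • entry (HH P h Q u) i j) + (g * κ₁) • entry Q i j)) ∧
  u' = NormedSpace.exp (-(τ • opD P h κ₂ g)) u
      + τ • phi1 (-(τ • opD P h κ₂ g)) (-(g • muH P h Q u) + (g * κ₂) • u) ∧
  ∃ st ξ : ℝ,
    st = s + g * ((∑ i, ∑ j, ip h (entry (HH P h Q u) i j) (entry (Q' - Q) i j))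
      + ip h (muH P h Q u) (u' - u)) ∧
    ξ ∈ Icc (0 : ℝ) 1 ∧
    s' = ξ * st + (1 - ξ) * E1h P h Q' u' ∧
    s' - st ≤ η₀ * tauDissip P h τ κ₁ κ₂ g (Q' - Q) (u' - u)

/-- A numerical solution: a sequence produced by the scheme from an initial state whose tensor
component is symmetric and traceless at every node. -/
structure IsNumericalSolution (P : Params) (h τ κ₁ κ₂ η₀ : ℝ)
    (Qh : ℕ → Grid d J → Mat d) (uh : ℕ → GridFun d J) (sh : ℕ → ℝ) : Prop where
  init : ∀ p, IsQTensor (Qh 0 p)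
  step : ∀ n, IsStep P h τ κ₁ κ₂ η₀ (Qh n) (uh n) (sh n) (Qh (n + 1)) (uh (n + 1)) (sh (n + 1))

/-- The error `‖E_Q‖_{H¹_h} + ‖e_u‖_{H²_h} + |e_s|` between a discrete state and a continuous one
sampled on the mesh. -/
def totalError (h : ℝ) (Qh : Grid d J → Mat d) (uh : GridFun d J) (sh : ℝ)
    (Q : Pt d → Mat d) (u : Pt d → ℝ) (s : ℝ) : ℝ :=
  h1NormT h (fun p => Qh p - Q (node h p)) + h2Norm h (fun p => uh p - u (node h p)) + |sh - s|

end

end SmA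

namespace SmA

open scoped Real
open Finset (mul_sum sum_le_sum sum_congr sum_nonneg sum_add_distrib single_le_sum
  sum_comm sum_mul sum_sub_distrib abs_sum_le_sum_abs sum_div sum_neg_distrib)
open Real (cos sin exp sq_sqrt norm_eq_abs sqrt_nonneg sqrt_le_sqrt
  sqrt_mul le_sqrt_of_sq_le norm_of_nonneg abs_cos_le_one exp_pos rpow_natCast exp_le_exp
  cos_add cos_sub sqrt_sq rpow_mul add_one_le_exp sqrt_le_left)

local notation "ℳ" => cellMeasure _

noncomputable section

theorem mul_le_left {a b c : ℝ} (h : b ≤ c) (ha : 0 ≤ a) : a * b ≤ a * c :=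
  mul_le_mul_of_nonneg_left h ha

theorem mul_le_right {a b c : ℝ} (h : b ≤ c) (ha : 0 ≤ a) : b * a ≤ c * a :=
  mul_le_mul_of_nonneg_right h ha

theorem mesh_pos {L h : ℝ} {J : ℕ} [NeZero J] (hL : 0 < L) (hh : h = L / J) : 0 < h :=
  hh ▸ div_pos hL (Nat.cast_pos.mpr (NeZero.pos J))

/-! ### Discrete inner product, seminorms and difference operators -/

section Discrete

theorem le_sum_sum {d : ℕ} {f : Fin d → Fin d → ℝ} (hf : ∀ i j, 0 ≤ f i j) (i j : Fin d) :
    f i j ≤ ∑ i, ∑ j, f i j :=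
  (single_le_sum (fun j _ => hf i j) (Finset.mem_univ j)).trans
    (single_le_sum (f := fun i => ∑ j, f i j)
      (fun i _ => sum_nonneg fun j _ => hf i j) (Finset.mem_univ i))

variable {d J : ℕ} [NeZero J]

theorem ip_comm (h : ℝ) (U V : GridFun d J) : ip h U V = ip h V U := by
  simp only [ip, mul_comm]

theorem ip_add_left (h : ℝ) (U V W : GridFun d J) : ip h (U + V) W = ip h U W + ip h V W := by
  simp only [ip, Pi.add_apply, add_mul, sum_add_distrib, mul_add]

theorem ip_sub_left (h : ℝ) (U V W : GridFun d J) : ip h (U - V) W = ip h U W - ip h V W := by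
  simp only [ip, Pi.sub_apply, sub_mul, sum_sub_distrib, mul_sub]

theorem ip_smul_left (h c : ℝ) (U V : GridFun d J) : ip h (c • U) V = c * ip h U V := by
  simp only [ip, Pi.smul_apply, smul_eq_mul, mul_assoc, ← mul_sum]; ring

theorem ip_neg_left (h : ℝ) (U V : GridFun d J) : ip h (-U) V = -ip h U V := by
  simp [ip]

theorem ip_add_right (h : ℝ) (U V W : GridFun d J) : ip h U (V + W) = ip h U V + ip h U W := by
  rw [ip_comm, ip_add_left, ip_comm h V, ip_comm h W]

theorem ip_sub_right (h : ℝ) (U V W : GridFun d J) : ip h U (V - W) = ip h U V - ip h U W := by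
  rw [ip_comm, ip_sub_left, ip_comm h V, ip_comm h W]

theorem ip_smul_right (h c : ℝ) (U V : GridFun d J) : ip h U (c • V) = c * ip h U V := by
  rw [ip_comm, ip_smul_left, ip_comm]

theorem ip_neg_right (h : ℝ) (U V : GridFun d J) : ip h U (-V) = -ip h U V := by
  simp [ip]

theorem ip_sum_left {ι : Type*} (h : ℝ) (s : Finset ι) (F : ι → GridFun d J) (V : GridFun d J) :
    ip h (∑ i ∈ s, F i) V = ∑ i ∈ s, ip h (F i) V := by
  simp only [ip, Finset.sum_apply, sum_mul]
  rw [sum_comm, mul_sum]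

theorem ip_sum_right {ι : Type*} (h : ℝ) (s : Finset ι) (F : ι → GridFun d J) (V : GridFun d J) :
    ip h V (∑ i ∈ s, F i) = ∑ i ∈ s, ip h V (F i) := by
  rw [ip_comm, ip_sum_left]; simp only [ip_comm h V]

theorem ip_self_nonneg {h : ℝ} (hh : 0 ≤ h) (U : GridFun d J) : 0 ≤ ip h U U :=
  mul_nonneg (pow_nonneg hh d) (sum_nonneg fun _ _ => mul_self_nonneg _)

/-- The grid function viewed through a finite family of operators, as a vector of a Euclidean space
whose norm is the corresponding discrete Sobolev norm. -/
def emb {ι : Type} [Fintype ι] (h : ℝ) (T : ι → GridOp d J) :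
    GridFun d J →ₗ[ℝ] EuclideanSpace ℝ (ι × Grid d J) where
  toFun f := WithLp.toLp 2 fun ip => √(h ^ d) * T ip.1 f ip.2
  map_add' f g := by ext x; simp [mul_add]
  map_smul' c f := by ext x; simp; ring

/-- Discrete Sobolev seminorm attached to a finite family of operators. -/
def semi {ι : Type} [Fintype ι] (h : ℝ) (T : ι → GridOp d J) : Seminorm ℝ (GridFun d J) :=
  (normSeminorm ℝ (EuclideanSpace ℝ (ι × Grid d J))).comp (emb h T)

theorem semi_sq {ι : Type} [Fintype ι] {h : ℝ} (hh : 0 ≤ h) (T : ι → GridOp d J)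
    (f : GridFun d J) : semi h T f ^ 2 = ∑ i, ip h (T i f) (T i f) := by
  have : semi h T f = ‖emb h T f‖ := rfl
  rw [this, EuclideanSpace.norm_sq_eq, Fintype.sum_prod_type]
  refine sum_congr rfl fun i _ => ?_
  rw [ip, mul_sum]
  refine sum_congr rfl fun p _ => ?_
  simp only [emb, LinearMap.coe_mk, AddHom.coe_mk, norm_eq_abs, sq_abs, mul_pow,
    sq_sqrt (pow_nonneg hh d)]
  ring

/-- Discrete `L²` norm. -/
def N0 (h : ℝ) : Seminorm ℝ (GridFun d J) := semi h (fun _ : Unit => 1)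

/-- Discrete `H¹` norm. -/
def N1 (h : ℝ) : Seminorm ℝ (GridFun d J) :=
  semi h (fun o : Option (Fin d) => o.elim 1 (Dp h))

/-- Discrete `H²` norm. -/
def N2 (h : ℝ) : Seminorm ℝ (GridFun d J) :=
  semi h (fun o : Option (Option (Fin d)) => o.elim (lapOp h) (fun o' => o'.elim 1 (Dp h)))

variable {h : ℝ}

theorem N0_sq (hh : 0 ≤ h) (f : GridFun d J) : N0 h f ^ 2 = ip h f f := by
  simp [N0, semi_sq hh]

theorem N1_sq (hh : 0 ≤ h) (f : GridFun d J) : N1 h f ^ 2 = h1Sq h f := by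
  simp [N1, semi_sq hh, h1Sq]

theorem N2_sq (hh : 0 ≤ h) (f : GridFun d J) :
    N2 h f ^ 2 = h1Sq h f + ip h (lapOp h f) (lapOp h f) := by
  simp [N2, semi_sq hh, h1Sq]; ring

theorem N2_eq (hh : 0 ≤ h) (f : GridFun d J) : h2Norm h f = N2 h f := by
  rw [h2Norm, ← N2_sq hh, sqrt_sq (apply_nonneg _ _)]

theorem N1_sq' (hh : 0 ≤ h) (f : GridFun d J) :
    N1 h f ^ 2 = N0 h f ^ 2 + ∑ k, N0 h (Dp h k f) ^ 2 := by
  rw [N1_sq hh, h1Sq]; simp only [N0_sq hh]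

theorem N2_sq' (hh : 0 ≤ h) (f : GridFun d J) :
    N2 h f ^ 2 = N1 h f ^ 2 + N0 h (lapOp h f) ^ 2 := by
  rw [N2_sq hh, N1_sq hh, N0_sq hh]

theorem N0_le_N1 (hh : 0 ≤ h) (f : GridFun d J) : N0 h f ≤ N1 h f := by
  refine le_of_sq_le_sq ?_ (apply_nonneg _ _)
  rw [N1_sq' hh]
  exact le_add_of_nonneg_right (sum_nonneg fun k _ => sq_nonneg _)

theorem N0_Dp_le_N1 (hh : 0 ≤ h) (k : Fin d) (f : GridFun d J) : N0 h (Dp h k f) ≤ N1 h f := by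
  refine le_of_sq_le_sq ?_ (apply_nonneg _ _)
  rw [N1_sq' hh]
  have := single_le_sum (f := fun k => N0 h (Dp h k f) ^ 2) (fun k _ => sq_nonneg _)
    (Finset.mem_univ k)
  have h0 := sq_nonneg (N0 h f)
  linarith

theorem N1_le_N2 (hh : 0 ≤ h) (f : GridFun d J) : N1 h f ≤ N2 h f := by
  refine le_of_sq_le_sq ?_ (apply_nonneg _ _)
  rw [N2_sq' hh]
  exact le_add_of_nonneg_right (sq_nonneg _)

theorem N0_lap_le_N2 (hh : 0 ≤ h) (f : GridFun d J) : N0 h (lapOp h f) ≤ N2 h f := by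
  refine le_of_sq_le_sq ?_ (apply_nonneg _ _)
  rw [N2_sq' hh]
  exact le_add_of_nonneg_left (sq_nonneg _)

theorem abs_ip_le (hh : 0 ≤ h) (f g : GridFun d J) : |ip h f g| ≤ N0 h f * N0 h g := by
  refine abs_le_of_sq_le_sq ?_ (mul_nonneg (apply_nonneg _ _) (apply_nonneg _ _))
  rw [mul_pow, N0_sq hh, N0_sq hh]
  have := Finset.sum_mul_sq_le_sq_mul_sq Finset.univ f g
  have h2 : (0 : ℝ) ≤ (h ^ d) ^ 2 := sq_nonneg _
  calc ip h f g ^ 2 = (h ^ d) ^ 2 * (∑ p, f p * g p) ^ 2 := by rw [ip]; ring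
    _ ≤ (h ^ d) ^ 2 * ((∑ p, f p ^ 2) * ∑ p, g p ^ 2) := mul_le_left this h2
    _ = _ := by simp only [ip, ← pow_two]; ring

theorem ip_le (hh : 0 ≤ h) (f g : GridFun d J) : ip h f g ≤ N0 h f * N0 h g :=
  (le_abs_self _).trans (abs_ip_le hh f g)

/-- Monotonicity of the discrete `L²` norm. -/
theorem N0_mono (hh : 0 ≤ h) {f g : GridFun d J} (hfg : ∀ p, |f p| ≤ |g p|) :
    N0 h f ≤ N0 h g := by
  refine le_of_sq_le_sq ?_ (apply_nonneg _ _)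
  rw [N0_sq hh, N0_sq hh]
  refine mul_le_left (sum_le_sum fun p _ => ?_) (pow_nonneg hh d)
  rw [← pow_two, ← pow_two]
  exact sq_le_sq.mpr (hfg p)

theorem N0_mul_le (hh : 0 ≤ h) {f g : GridFun d J} {M : ℝ} (hM : ∀ p, |f p| ≤ M) :
    N0 h (f * g) ≤ M * N0 h g := by
  have hM0 : 0 ≤ M := (abs_nonneg _).trans (hM 0)
  calc N0 h (f * g) ≤ N0 h (M • g) := N0_mono hh fun p => by
        simp only [Pi.mul_apply, abs_mul, Pi.smul_apply, smul_eq_mul, abs_of_nonneg hM0]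
        exact mul_le_right (hM p) (abs_nonneg _)
    _ = M * N0 h g := by rw [map_smul_eq_mul, norm_of_nonneg hM0]

theorem card_grid : Fintype.card (Grid d J) = J ^ d := by
  simp [Fintype.card_pi]

theorem vol_grid {L : ℝ} (hh : h = L / J) : h ^ d * (Fintype.card (Grid d J) : ℝ) = L ^ d := by
  have : (J : ℝ) ≠ 0 := Nat.cast_ne_zero.mpr (NeZero.ne J)
  rw [card_grid, Nat.cast_pow, ← mul_pow, hh, div_mul_cancel₀ _ this]

theorem N0_le_sup {L : ℝ} (hL : 0 ≤ L) (hh : h = L / J) {f : GridFun d J} {M : ℝ}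
    (hM : ∀ p, |f p| ≤ M) : N0 h f ≤ √(L ^ d) * M := by
  have h0 : 0 ≤ h := by rw [hh]; positivity
  have hM0 : 0 ≤ M := (abs_nonneg _).trans (hM 0)
  refine le_of_sq_le_sq ?_ (by positivity)
  rw [N0_sq h0, mul_pow, sq_sqrt (by positivity), ← vol_grid (d := d) hh, ip, mul_assoc]
  refine mul_le_left ?_ (by positivity)
  calc ∑ p, f p * f p ≤ ∑ _p : Grid d J, M ^ 2 := sum_le_sum fun p _ => by
        rw [← pow_two, ← sq_abs]; exact pow_le_pow_left₀ (abs_nonneg _) (hM p) 2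
    _ = _ := by simp

theorem N0_sum_le {ι : Type*} (s : Finset ι) (F : ι → GridFun d J) :
    N0 h (∑ i ∈ s, F i) ≤ ∑ i ∈ s, N0 h (F i) := by
  induction s using Finset.cons_induction with
  | empty => simp
  | cons a s ha ih =>
    rw [Finset.sum_cons, Finset.sum_cons]; exact (map_add_le_add _ _ _).trans (by gcongr)

/-! Shifts. -/

@[simp] theorem shift_apply (e : Grid d J) (f : GridFun d J) (p : Grid d J) :
    shift e f p = f (p + e) := rfl

theorem ip_shift_left (e : Grid d J) (f g : GridFun d J) :
    ip h (shift e f) g = ip h f (shift (-e) g) := by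
  simp only [ip, shift_apply]
  congr 1
  exact Fintype.sum_equiv (Equiv.addRight e) _ _ fun p => by simp

theorem N0_shift (hh : 0 ≤ h) (e : Grid d J) (f : GridFun d J) : N0 h (shift e f) = N0 h f := by
  refine (sq_eq_sq₀ (apply_nonneg _ _) (apply_nonneg _ _)).mp ?_
  rw [N0_sq hh, N0_sq hh, ip_shift_left]
  congr 1
  ext p; simp

theorem shift_shift (e e' : Grid d J) (f : GridFun d J) :
    shift e (shift e' f) = shift (e + e') f := by
  ext p; simp [add_assoc]

theorem shift_comm (e e' : Grid d J) (f : GridFun d J) :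
    shift e (shift e' f) = shift e' (shift e f) := by
  rw [shift_shift, shift_shift, add_comm]

theorem Dp_apply (k : Fin d) (f : GridFun d J) :
    Dp h k f = h⁻¹ • (shift (Pi.single k 1) f - f) := rfl

theorem Dm_apply (k : Fin d) (f : GridFun d J) :
    Dm h k f = h⁻¹ • (f - shift (-Pi.single k 1) f) := rfl

theorem Dc_apply (k : Fin d) (f : GridFun d J) :
    Dc h k f = (2 * h)⁻¹ • (shift (Pi.single k 1) f - shift (-Pi.single k 1) f) := rfl

theorem Dp_apply_apply (k : Fin d) (f : GridFun d J) (p : Grid d J) :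
    Dp h k f p = h⁻¹ * (f (p + Pi.single k 1) - f p) := rfl

theorem Dc_apply_apply (k : Fin d) (f : GridFun d J) (p : Grid d J) :
    Dc h k f p = (2 * h)⁻¹ * (f (p + Pi.single k 1) - f (p + -Pi.single k 1)) := rfl

theorem lapOp_apply (f : GridFun d J) : lapOp h f = ∑ k, Dp h k (Dm h k f) := by
  simp [lapOp]

theorem Dp_shift (k : Fin d) (e : Grid d J) (f : GridFun d J) :
    Dp h k (shift e f) = shift e (Dp h k f) := by
  rw [Dp_apply, Dp_apply, map_smul, map_sub, shift_comm]

theorem Dm_eq (k : Fin d) (f : GridFun d J) : Dm h k f = shift (-Pi.single k 1) (Dp h k f) := by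
  rw [Dp_apply, Dm_apply, map_smul, map_sub, shift_shift]
  simp only [neg_add_cancel]
  congr 2
  ext p; simp

theorem Dp_Dp_comm (k l : Fin d) (f : GridFun d J) :
    Dp h k (Dp h l f) = Dp h l (Dp h k f) := by
  rw [Dp_apply l, map_smul, map_sub, Dp_shift, ← Dp_apply]

theorem Dc_eq (k : Fin d) (f : GridFun d J) :
    Dc h k f = (2 : ℝ)⁻¹ • (Dp h k f + Dm h k f) := by
  rw [Dc_apply, Dp_apply, Dm_apply, ← smul_add, smul_smul, mul_inv]
  congr 1
  abel

theorem Dc_eq' (k : Fin d) (f : GridFun d J) :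
    Dc h k f = (2 : ℝ)⁻¹ • (Dp h k f + shift (-Pi.single k 1) (Dp h k f)) := by
  rw [Dc_eq, Dm_eq]

theorem Dp_Dc_comm (k l : Fin d) (f : GridFun d J) :
    Dp h k (Dc h l f) = Dc h l (Dp h k f) := by
  rw [Dc_eq', Dc_eq', map_smul, map_add, Dp_shift, Dp_Dp_comm]

theorem Dc_Dc_comm (k l : Fin d) (f : GridFun d J) :
    Dc h k (Dc h l f) = Dc h l (Dc h k f) := by
  rw [Dc_eq' k, Dp_Dc_comm, Dc_eq' k f, map_smul, map_add]
  congr 2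
  rw [Dc_apply, Dc_apply, map_smul, map_sub, shift_comm, shift_comm _ (-Pi.single l 1)]

theorem Dp_Dm_comm (k l : Fin d) (f : GridFun d J) :
    Dp h k (Dm h l f) = Dm h l (Dp h k f) := by
  rw [Dm_eq, Dm_eq, Dp_shift, Dp_Dp_comm]

theorem ip_Dp_left (k : Fin d) (f g : GridFun d J) : ip h (Dp h k f) g = -ip h f (Dm h k g) := by
  rw [Dp_apply, Dm_apply, ip_smul_left, ip_sub_left, ip_shift_left, ip_smul_right, ip_sub_right]
  ring

theorem ip_Dm_left (k : Fin d) (f g : GridFun d J) : ip h (Dm h k f) g = -ip h f (Dp h k g) := by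
  rw [ip_comm, ip_comm h f, ip_Dp_left, neg_neg]

theorem ip_Dc_left (k : Fin d) (f g : GridFun d J) : ip h (Dc h k f) g = -ip h f (Dc h k g) := by
  rw [Dc_eq, Dc_eq, ip_smul_left, ip_add_left, ip_Dp_left, ip_Dm_left, ip_smul_right, ip_add_right]
  ring

theorem ip_Dc_Dc (k l : Fin d) (f g : GridFun d J) :
    ip h (Dc h k (Dc h l f)) g = ip h f (Dc h k (Dc h l g)) := by
  rw [ip_Dc_left, ip_Dc_left, neg_neg, Dc_Dc_comm]

theorem ip_lap_left (f g : GridFun d J) :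
    ip h (lapOp h f) g = -∑ k, ip h (Dp h k f) (Dp h k g) := by
  rw [lapOp_apply, ip_sum_left, ← sum_neg_distrib]
  refine sum_congr rfl fun k _ => ?_
  rw [ip_Dp_left, Dm_eq, Dm_eq, ip_shift_left, shift_shift]
  simp only [neg_neg, add_neg_cancel]
  congr 2
  ext p; simp

theorem ip_lap_comm (f g : GridFun d J) : ip h (lapOp h f) g = ip h f (lapOp h g) := by
  rw [ip_lap_left, ip_comm h f, ip_lap_left]
  simp only [ip_comm]

theorem sum_ip_Dp_Dp (f : GridFun d J) :
    ∑ k, ∑ l, ip h (Dp h k (Dp h l f)) (Dp h k (Dp h l f)) = ip h (lapOp h f) (lapOp h f) := by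
  have key : ∀ k l, ip h (Dp h k (Dp h l f)) (Dp h k (Dp h l f))
      = ip h (Dp h l (Dm h l f)) (Dp h k (Dm h k f)) := by
    intro k l
    rw [ip_Dp_left, ← Dp_Dm_comm k k, ← Dp_Dm_comm l k, Dp_Dp_comm k l, ← ip_Dm_left,
      ← Dp_Dm_comm l l]
  simp only [key]
  rw [sum_comm, lapOp_apply, ip_sum_left]
  simp only [ip_sum_right]

theorem N0_Dp_Dp_le (hh : 0 ≤ h) (k l : Fin d) (f : GridFun d J) :
    N0 h (Dp h k (Dp h l f)) ≤ N0 h (lapOp h f) := by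
  refine le_of_sq_le_sq ?_ (apply_nonneg _ _)
  rw [N0_sq hh, N0_sq hh, ← sum_ip_Dp_Dp]
  exact le_sum_sum (f := fun k l => ip h (Dp h k (Dp h l f)) (Dp h k (Dp h l f)))
    (fun _ _ => ip_self_nonneg hh _) k l

theorem N0_Dc_le (hh : 0 ≤ h) (k : Fin d) (f : GridFun d J) :
    N0 h (Dc h k f) ≤ N0 h (Dp h k f) := by
  rw [Dc_eq', map_smul_eq_mul]
  have := map_add_le_add (N0 h) (Dp h k f) (shift (-Pi.single k 1) (Dp h k f))
  rw [N0_shift hh] at this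
  norm_num
  linarith

theorem N0_Dc_Dc_le_Dp_Dp (hh : 0 ≤ h) (k l : Fin d) (f : GridFun d J) :
    N0 h (Dc h k (Dc h l f)) ≤ N0 h (Dp h k (Dp h l f)) := by
  refine (N0_Dc_le hh k _).trans ?_
  rw [Dp_Dc_comm, Dp_Dp_comm]
  exact N0_Dc_le hh l _

theorem N0_Dc_Dc_le (hh : 0 ≤ h) (k l : Fin d) (f : GridFun d J) :
    N0 h (Dc h k (Dc h l f)) ≤ N0 h (lapOp h f) :=
  (N0_Dc_Dc_le_Dp_Dp hh k l f).trans (N0_Dp_Dp_le hh k l f)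

theorem N0_Dc_Dc_le_N2 (hh : 0 ≤ h) (k l : Fin d) (f : GridFun d J) :
    N0 h (Dc h k (Dc h l f)) ≤ N2 h f :=
  (N0_Dc_Dc_le hh k l f).trans (N0_lap_le_N2 hh f)

/-- Interpolation of the gradient between the function and its Laplacian. -/
theorem sum_N0_Dp_sq_le (hh : 0 ≤ h) (f : GridFun d J) :
    ∑ k, N0 h (Dp h k f) ^ 2 ≤ N0 h f * N0 h (lapOp h f) := by
  have := ip_lap_left (h := h) f f
  have h2 := abs_ip_le hh (lapOp h f) f
  simp only [N0_sq hh]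
  have h3 := neg_abs_le (ip h (lapOp h f) f)
  nlinarith

theorem N1_Dp_le_N2 (hh : 0 ≤ h) (k : Fin d) (f : GridFun d J) : N1 h (Dp h k f) ≤ N2 h f := by
  refine le_of_sq_le_sq ?_ (apply_nonneg _ _)
  rw [N1_sq' hh, N2_sq' hh]
  have h1 := pow_le_pow_left₀ (apply_nonneg _ _) (N0_Dp_le_N1 hh k f) 2
  have h2 : ∑ l, N0 h (Dp h l (Dp h k f)) ^ 2 ≤ N0 h (lapOp h f) ^ 2 := by
    simp only [N0_sq hh]; rw [← sum_ip_Dp_Dp]; refine sum_le_sum fun l _ => ?_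
    exact single_le_sum (f := fun k => ip h (Dp h l (Dp h k f)) (Dp h l (Dp h k f)))
      (fun _ _ => ip_self_nonneg hh _) (Finset.mem_univ k)
  exact add_le_add h1 h2

/-- The `H²` norm is controlled by the function and its Laplacian. -/
theorem N2_sq_le (hh : 0 ≤ h) (f : GridFun d J) :
    N2 h f ^ 2 ≤ 2 * (N0 h f ^ 2 + N0 h (lapOp h f) ^ 2) := by
  rw [N2_sq' hh, N1_sq' hh]
  have := sum_N0_Dp_sq_le hh f
  nlinarith [sq_nonneg (N0 h f - N0 h (lapOp h f)), sq_nonneg (N0 h f),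
    sq_nonneg (N0 h (lapOp h f))]

/-- Discrete product rule. -/
theorem Dp_mul (k : Fin d) (f g : GridFun d J) :
    Dp h k (f * g) = Dp h k f * g + shift (Pi.single k 1) f * Dp h k g := by
  ext p
  simp only [Dp_apply_apply, Pi.mul_apply, Pi.add_apply, shift_apply]
  ring

theorem Dp_Dp_mul (k l : Fin d) (f g : GridFun d J) :
    Dp h k (Dp h l (f * g)) = Dp h k (Dp h l f) * g
      + shift (Pi.single k 1) (Dp h l f) * Dp h k g
      + shift (Pi.single l 1) (Dp h k f) * Dp h l g
      + shift (Pi.single k 1) (shift (Pi.single l 1) f) * Dp h k (Dp h l g) := by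
  rw [Dp_mul, map_add, Dp_mul, Dp_mul, Dp_shift]
  ring

theorem N1_shift (hh : 0 ≤ h) (e : Grid d J) (f : GridFun d J) : N1 h (shift e f) = N1 h f := by
  refine (sq_eq_sq₀ (apply_nonneg _ _) (apply_nonneg _ _)).mp ?_
  rw [N1_sq' hh, N1_sq' hh]
  simp only [Dp_shift, N0_shift hh]

end Discrete

/-! ### Discrete Sobolev inequality `H¹ ⊂ L⁶` -/

section SobolevSix

set_option linter.unusedSectionVars false

variable {d J : ℕ} [NeZero J]

/-- On a cycle, a value is at most another value plus the total variation. -/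
theorem cycle_le_add_variation (φ : ZMod J → ℝ) (a b : ZMod J) :
    φ a ≤ φ b + ∑ j, |φ (j + 1) - φ j| := by
  have tel : ∀ n : ℕ, φ (b + n) ≤ φ b + ∑ i ∈ Finset.range n, |φ (b + i + 1) - φ (b + i)| := by
    intro n
    induction n with
    | zero => simp
    | succ n ih =>
      rw [Finset.sum_range_succ]; have := le_abs_self (φ (b + n + 1) - φ (b + n)); push_cast
      rw [← add_assoc]; linarith
  have h1 := tel (a - b).val
  rw [ZMod.natCast_zmod_val, add_sub_cancel] at h1
  refine h1.trans (add_le_add le_rfl ?_)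
  have hlt : (a - b).val ≤ J := (ZMod.val_lt _).le
  have hsum : ∑ i ∈ Finset.range J, |φ (b + i + 1) - φ (b + i)| = ∑ j, |φ (j + 1) - φ j| := by
    refine Finset.sum_bij (fun i _ => b + (i : ZMod J)) (fun _ _ => Finset.mem_univ _) ?_ ?_ ?_
    · intro i hi j hj hij
      have : (i : ZMod J) = j := add_left_cancel hij; rw [ZMod.natCast_eq_natCast_iff'] at this
      rwa [Nat.mod_eq_of_lt (Finset.mem_range.mp hi), Nat.mod_eq_of_lt (Finset.mem_range.mp hj)]
        at this
    · intro j _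
      exact ⟨(j - b).val, Finset.mem_range.mpr (ZMod.val_lt _), by simp⟩
    · intro i _; rfl
  rw [← hsum]
  exact Finset.sum_le_sum_of_subset_of_nonneg (Finset.range_mono hlt) fun _ _ _ => abs_nonneg _

theorem cycle_le_mean_add_variation (φ : ZMod J → ℝ) (a : ZMod J) :
    φ a ≤ ∑ j, (|φ (j + 1) - φ j| + (J : ℝ)⁻¹ * φ j) := by
  have hJ : (0 : ℝ) < J := Nat.cast_pos.mpr (NeZero.pos J)
  rw [sum_add_distrib, ← mul_sum]
  have h1 : ∑ _b : ZMod J, φ a ≤ ∑ b, (φ b + ∑ j, |φ (j + 1) - φ j|) :=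
    sum_le_sum fun b _ => cycle_le_add_variation φ a b
  rw [sum_add_distrib] at h1
  simp only [Finset.sum_const, Finset.card_univ, ZMod.card, nsmul_eq_mul] at h1
  have h2 := mul_le_left h1 (inv_nonneg.mpr hJ.le)
  rw [mul_add, ← mul_assoc, ← mul_assoc, inv_mul_cancel₀ hJ.ne', one_mul, one_mul] at h2
  linarith

/-- The `W^{1,1}` density of a grid function. -/
def w11 (F : GridFun d J) (q : Grid d J) : ℝ :=
  ∑ k, |F (q + Pi.single k 1) - F q| + (J : ℝ)⁻¹ * |F q|

theorem w11_nonneg (F : GridFun d J) (q : Grid d J) : 0 ≤ w11 F q := by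
  unfold w11; positivity

theorem update_add_single (p : Grid d J) (k : Fin d) (j : ZMod J) :
    Function.update p k j + Pi.single k 1 = Function.update p k (j + 1) := by
  ext i
  by_cases hi : i = k
  · subst hi; simp
  · simp [hi]

theorem abs_le_line_sum (F : GridFun d J) (p : Grid d J) (k : Fin d) :
    |F p| ≤ ∑ j, w11 F (Function.update p k j) := by
  have h1 := cycle_le_mean_add_variation (fun j => |F (Function.update p k j)|) (p k)
  simp only [Function.update_eq_self] at h1
  refine h1.trans (sum_le_sum fun j _ => ?_)
  unfold w11
  refine add_le_add ?_ le_rfl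
  refine (abs_abs_sub_abs_le_abs_sub _ _).trans ?_
  rw [← update_add_single]
  exact single_le_sum
    (f := fun k' => |F (Function.update p k j + Pi.single k' 1) - F (Function.update p k j)|)
    (fun _ _ => abs_nonneg _) (Finset.mem_univ k)

theorem lintegral_grid (f : Grid d J → ENNReal) :
    ∫⁻ x, f x ∂(Measure.pi fun _ : Fin d => (Measure.count : Measure (ZMod J))) = ∑ p, f p := by
  rw [lintegral_fintype]
  simp [Measure.pi_singleton]

/-- Loomis-Whitney type inequality on the grid. -/
theorem sum_rpow_le (hd : 2 ≤ d) (F : GridFun d J) :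
    ∑ p, |F p| ^ ((d : ℝ) / (d - 1)) ≤ (∑ q, w11 F q) ^ ((d : ℝ) / (d - 1)) := by
  have hd1 : (1 : ℝ) < d := by exact_mod_cast hd
  have hd0 : (0 : ℝ) < d - 1 := by linarith
  set f : Grid d J → ENNReal := fun q => ENNReal.ofReal (w11 F q) with hf
  have hp : Real.HolderConjugate (Fintype.card (Fin d)) ((d : ℝ) / (d - 1)) := by
    rw [Fintype.card_fin]; exact Real.HolderConjugate.conjExponent hd1
  have key := lintegral_prod_lintegral_pow_le
    (μ := fun _ : Fin d => (Measure.count : Measure (ZMod J))) hp (f := f) (measurable_of_finite f)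
  rw [lintegral_grid, lintegral_grid] at key
  have hsum : ∑ p, f p = ENNReal.ofReal (∑ q, w11 F q) := by
    rw [ENNReal.ofReal_sum_of_nonneg fun q _ => w11_nonneg F q]
  have hS : 0 ≤ ∑ q, w11 F q := sum_nonneg fun q _ => w11_nonneg F q
  rw [hsum, ENNReal.ofReal_rpow_of_nonneg hS (by positivity)] at key
  have hpt : ∀ p, ENNReal.ofReal (|F p| ^ ((d : ℝ) / (d - 1))) ≤
      ∏ k, (∫⁻ j, f (Function.update p k j) ∂Measure.count)
        ^ ((1 : ℝ) / (Fintype.card (Fin d) - 1 : ℝ)) := by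
    intro p
    have h1 : ∀ k, ENNReal.ofReal |F p| ^ ((1 : ℝ) / (Fintype.card (Fin d) - 1 : ℝ)) ≤
        (∫⁻ j, f (Function.update p k j) ∂Measure.count)
        ^ ((1 : ℝ) / (Fintype.card (Fin d) - 1 : ℝ)) := by
      intro k; refine ENNReal.rpow_le_rpow ?_ (by rw [Fintype.card_fin]; positivity)
      rw [lintegral_count, tsum_fintype]; simp only [hf]
      rw [← ENNReal.ofReal_sum_of_nonneg fun q _ => w11_nonneg F _]
      exact ENNReal.ofReal_le_ofReal (abs_le_line_sum F p k)
    refine le_trans (le_of_eq ?_) (Finset.prod_le_prod' fun k _ => h1 k)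
    rw [Finset.prod_const, Finset.card_univ, Fintype.card_fin, ← ENNReal.rpow_natCast,
      ← ENNReal.rpow_mul, ENNReal.ofReal_rpow_of_nonneg (abs_nonneg _) (by positivity)]
    congr 2
    field_simp
  have h2 := (sum_le_sum fun p _ => hpt p).trans key
  rw [← ENNReal.ofReal_sum_of_nonneg fun p _ => by positivity] at h2
  exact (ENNReal.ofReal_le_ofReal_iff (by positivity)).mp h2

theorem sum_abs_le (F : GridFun d J) (k : Fin d) : ∑ p, |F p| ≤ J * ∑ q, w11 F q := by
  have h1 : ∑ p, |F p| ≤ ∑ p : Grid d J, ∑ j, w11 F (Function.update p k j) :=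
    sum_le_sum fun p _ => abs_le_line_sum F p k
  refine h1.trans (le_of_eq ?_)
  rw [sum_comm]
  have h2 : ∀ j : ZMod J, ∑ p : Grid d J, w11 F (Function.update p k (p k + j)) = ∑ q, w11 F q := by
    intro j; refine Fintype.sum_equiv (Equiv.addRight (Pi.single k j)) _ _ fun p => ?_
    congr 1
    ext i
    by_cases hi : i = k
    · subst hi; simp
    · simp [hi]
  rw [sum_comm]
  have h3 : ∀ p : Grid d J, ∑ j, w11 F (Function.update p k j)
      = ∑ j, w11 F (Function.update p k (p k + j)) := fun p =>
    (Fintype.sum_equiv (Equiv.addLeft (p k)) _ _ fun j => rfl).symm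
  simp only [h3]
  rw [sum_comm]
  simp only [h2]
  simp

/-- A `W^{1,1} ⊂ L^{3/2}` inequality in dimensions two and three, with the scaling of the grid. -/
theorem sum_rpow_three_halves_le {L h : ℝ} (hL : 0 < L) (hh : h = L / J) (hd : d = 2 ∨ d = 3)
    (F : GridFun d J) :
    h ^ d * ∑ p, |F p| ^ (3 / 2 : ℝ) ≤ (1 + √L) * (h ^ (d - 1) * ∑ q, w11 F q) ^ (3 / 2 : ℝ) := by
  have hJ : (0 : ℝ) < J := Nat.cast_pos.mpr (NeZero.pos J)
  have h0 : 0 < h := by rw [hh]; positivity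
  have hS : 0 ≤ ∑ q, w11 F q := sum_nonneg fun q _ => w11_nonneg F q
  have hsq : 0 ≤ √L := sqrt_nonneg L
  rcases hd with rfl | rfl
  · have h1 := sum_rpow_le le_rfl F
    norm_num at h1; have h2 := sum_abs_le F 0
    have h3 : ∑ p, |F p| ^ (3 / 2 : ℝ) ≤ √(∑ p, |F p|) * √(∑ p, F p ^ 2) := by
      have := Real.sum_sqrt_mul_sqrt_le Finset.univ (f := fun p => |F p|) (g := fun p => F p ^ 2)
        (fun p => abs_nonneg _) (fun p => sq_nonneg _)
      refine le_trans (le_of_eq (sum_congr rfl fun p _ => ?_)) this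
      rw [Real.sqrt_sq_eq_abs, Real.sqrt_eq_rpow]
      rcases (abs_nonneg (F p)).eq_or_lt with h | h
      · rw [← h]; norm_num
      · nth_rewrite 3 [← Real.rpow_one |F p|]
        rw [← Real.rpow_add h]; norm_num
    set S := ∑ q, w11 F q with hSdef
    have h4 : √(∑ p, |F p|) ≤ √(J * S) := sqrt_le_sqrt h2
    have h5 : √(∑ p, F p ^ 2) ≤ S := by
      rw [sqrt_le_left hS]; exact h1
    have h6 : ∑ p, |F p| ^ (3 / 2 : ℝ) ≤ √(J * S) * S :=
      h3.trans (mul_le_mul h4 h5 (sqrt_nonneg _) (sqrt_nonneg _))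
    have h7 : (h ^ (2 - 1) * S) ^ (3 / 2 : ℝ) = √(h * S) * (h * S) := by
      rw [Real.sqrt_eq_rpow]; simp only [Nat.add_one_sub_one, pow_one]
      rcases (mul_nonneg h0.le hS).eq_or_lt with hz | hz
      · rw [← hz]; norm_num
      · nth_rewrite 3 [← Real.rpow_one (h * S)]
        rw [← Real.rpow_add hz]; norm_num
    rw [h7]; have hJh : (J : ℝ) * h = L := by rw [hh]; field_simp
    calc h ^ 2 * ∑ p, |F p| ^ (3 / 2 : ℝ) ≤ h ^ 2 * (√(J * S) * S) := by gcongr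
      _ = √(J * h) * (√(h * S) * (h * S)) := by
          rw [sqrt_mul hJ.le, sqrt_mul hJ.le, sqrt_mul h0.le]
          nth_rewrite 1 [pow_two, ← Real.mul_self_sqrt h0.le]
          ring
      _ ≤ (1 + √L) * (√(h * S) * (h * S)) := by
          rw [hJh]; refine mul_le_right (by linarith) (by positivity)
  · have h1 := sum_rpow_le (by norm_num) F
    norm_num at h1
    have h7 : (h ^ (3 - 1) * ∑ q, w11 F q) ^ (3 / 2 : ℝ) = h ^ 3 * (∑ q, w11 F q) ^ (3 / 2 : ℝ) := by
      rw [Real.mul_rpow (by positivity) hS, ← rpow_natCast, ← rpow_natCast,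
        ← rpow_mul h0.le]
      norm_num
    rw [h7]; have : 0 ≤ h ^ 3 * (∑ q, w11 F q) ^ (3 / 2 : ℝ) := by positivity
    calc h ^ 3 * ∑ p, |F p| ^ (3 / 2 : ℝ) ≤ h ^ 3 * (∑ q, w11 F q) ^ (3 / 2 : ℝ) := by gcongr
      _ ≤ _ := by nlinarith

theorem sum_abs_mul_abs_le (a b : GridFun d J) :
    ∑ p, |a p| * |b p| ≤ √(∑ p, a p ^ 2) * √(∑ p, b p ^ 2) := by
  have := Real.sum_mul_le_sqrt_mul_sqrt Finset.univ (fun p => |a p|) (fun p => |b p|)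
  simpa only [sq_abs] using this

theorem N0_eq_sqrt {h : ℝ} (h0 : 0 ≤ h) (f : GridFun d J) :
    N0 h f = √(h ^ d) * √(∑ p, f p ^ 2) := by
  rw [← sqrt_mul (pow_nonneg h0 d), ← sqrt_sq (apply_nonneg (N0 h) f), N0_sq h0, ip]
  simp only [pow_two]

theorem abs_pow_four_sub_le (a b : ℝ) :
    |a ^ 4 - b ^ 4| ≤ 2 * (|a ^ 3| * |a - b| + |b ^ 3| * |a - b|) := by
  have h1 : a ^ 4 - b ^ 4 = (a - b) * ((a + b) * (a ^ 2 + b ^ 2)) := by ring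
  rw [h1, abs_mul, ← add_mul, mul_comm, ← mul_assoc]
  refine mul_le_right ?_ (abs_nonneg _)
  rw [abs_mul, abs_pow, abs_pow, abs_of_nonneg (by positivity : 0 ≤ a ^ 2 + b ^ 2), ← sq_abs a,
    ← sq_abs b]
  have h2 := abs_add_le a b
  have ha := abs_nonneg a
  have hb := abs_nonneg b
  nlinarith [mul_nonneg (add_nonneg ha hb) (sq_nonneg (|a| - |b|)),
    mul_le_right h2 (by positivity : 0 ≤ |a| ^ 2 + |b| ^ 2)]

theorem w11_pow_four_sum_le {L h : ℝ} (hL : 0 < L) (hh : h = L / J) (f : GridFun d J) :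
    h ^ d * ∑ q, w11 (f ^ 4) q ≤ h * ((4 * d + L⁻¹) * (√(h ^ d * ∑ p, f p ^ 6) * N1 h f)) := by
  have h0 : 0 < h := mesh_pos hL hh
  set X := ∑ p, f p ^ 6 with hX
  have hX0 : 0 ≤ X := sum_nonneg fun p _ => by positivity
  have hcube : ∀ e : Grid d J, ∑ p, ((shift e f) p ^ 3) ^ 2 = X := by
    intro e; rw [hX]; refine Fintype.sum_equiv (Equiv.addRight e) _ _ fun p => ?_
    simp only [shift_apply, Equiv.coe_addRight]; ring
  have hN1 : ∀ g : GridFun d J, N0 h g ≤ N1 h f →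
      h ^ d * (√X * √(∑ p, g p ^ 2)) ≤ √(h ^ d * X) * N1 h f := by
    intro g hg; rw [N0_eq_sqrt h0.le] at hg; rw [sqrt_mul (by positivity)]
    nth_rewrite 1 [← Real.mul_self_sqrt (pow_nonneg h0.le d)]
    calc _ = √(h ^ d) * √X * (√(h ^ d) * √(∑ p, g p ^ 2)) := by ring
      _ ≤ _ := mul_le_left hg (by positivity)
  have hk : ∀ k : Fin d, ∑ q, |(f ^ 4) (q + Pi.single k 1) - (f ^ 4) q|
      ≤ 4 * h * (√X * √(∑ p, (Dp h k f) p ^ 2)) := by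
    intro k
    have e1 : ∀ q, |(f ^ 4) (q + Pi.single k 1) - (f ^ 4) q| ≤
        2 * h * (|shift (Pi.single k 1) f q ^ 3| * |Dp h k f q| + |f q ^ 3| * |Dp h k f q|) := by
      intro q
      have hD : |f (q + Pi.single k 1) - f q| = h * |Dp h k f q| := by
        rw [Dp_apply_apply, abs_mul, abs_of_pos (inv_pos.mpr h0), ← mul_assoc,
          mul_inv_cancel₀ h0.ne', one_mul]
      have := abs_pow_four_sub_le (f (q + Pi.single k 1)) (f q); rw [hD] at this
      simp only [Pi.pow_apply, shift_apply]; linarith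
    refine (sum_le_sum fun q _ => e1 q).trans ?_; rw [← mul_sum, sum_add_distrib]
    have e2 := sum_abs_mul_abs_le ((shift (Pi.single k 1) f) ^ 3) (Dp h k f)
    have e3 := sum_abs_mul_abs_le (f ^ 3) (Dp h k f); simp only [Pi.pow_apply] at e2 e3
    rw [hcube] at e2; have e4 := hcube 0; simp only [shift_apply, add_zero] at e4; rw [e4] at e3
    nlinarith
  have hm : ∑ q, (J : ℝ)⁻¹ * |(f ^ 4) q| ≤ h * L⁻¹ * (√X * √(∑ p, f p ^ 2)) := by
    rw [← mul_sum]; have : (J : ℝ)⁻¹ = h * L⁻¹ := by rw [hh]; field_simp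
    rw [this]; refine mul_le_left ?_ (by positivity); have e3 := sum_abs_mul_abs_le (f ^ 3) f
    simp only [Pi.pow_apply] at e3; have e4 := hcube 0; simp only [shift_apply, add_zero] at e4
    rw [e4] at e3; refine le_trans (le_of_eq (sum_congr rfl fun p _ => ?_)) e3
    rw [← abs_mul, Pi.pow_apply]
    congr 1
  have hsum : ∑ q, w11 (f ^ 4) q ≤ ∑ k : Fin d, 4 * h * (√X * √(∑ p, (Dp h k f) p ^ 2))
      + h * L⁻¹ * (√X * √(∑ p, f p ^ 2)) := by
    unfold w11; rw [sum_add_distrib, sum_comm]; exact add_le_add (sum_le_sum fun k _ => hk k) hm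
  calc h ^ d * ∑ q, w11 (f ^ 4) q
      ≤ h ^ d * (∑ k : Fin d, 4 * h * (√X * √(∑ p, (Dp h k f) p ^ 2))
        + h * L⁻¹ * (√X * √(∑ p, f p ^ 2))) := by gcongr
    _ = ∑ k : Fin d, 4 * h * (h ^ d * (√X * √(∑ p, (Dp h k f) p ^ 2)))
        + h * L⁻¹ * (h ^ d * (√X * √(∑ p, f p ^ 2))) := by
        rw [mul_add, mul_sum]
        congr 1
        · exact sum_congr rfl fun k _ => by ring
        · ring
    _ ≤ ∑ k : Fin d, 4 * h * (√(h ^ d * X) * N1 h f) + h * L⁻¹ * (√(h ^ d * X) * N1 h f) := by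
        refine add_le_add (sum_le_sum fun k _ => ?_) ?_
        · exact mul_le_left (hN1 _ (N0_Dp_le_N1 h0.le k f)) (by positivity)
        · exact mul_le_left (hN1 _ (N0_le_N1 h0.le f)) (by positivity)
    _ = _ := by simp; ring

/-- Discrete Sobolev inequality `H¹ ⊂ L⁶` in dimensions two and three. -/
theorem sum_pow_six_le {L : ℝ} (hL : 0 < L) (hd : d = 2 ∨ d = 3) :
    ∃ C > 0, ∀ (J : ℕ) [NeZero J] (h : ℝ), h = L / J → ∀ f : GridFun d J,
      h ^ d * ∑ p, f p ^ 6 ≤ C * N1 h f ^ 6 := by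
  refine ⟨(1 + √L) ^ 4 * (4 * d + L⁻¹) ^ 6, by positivity, fun J _ h hh f => ?_⟩
  have h0 : 0 < h := mesh_pos hL hh
  set Y := h ^ d * ∑ p, f p ^ 6 with hY
  have hY0 : 0 ≤ Y := mul_nonneg (by positivity) (sum_nonneg fun p _ => by positivity)
  set c := (4 * d + L⁻¹ : ℝ) with hc
  have hc0 : 0 < c := by positivity
  have hS : 0 ≤ ∑ q, w11 (f ^ 4) q := sum_nonneg fun q _ => w11_nonneg _ q
  have hn : 0 ≤ N1 h f := apply_nonneg _ _
  have h1 := sum_rpow_three_halves_le hL hh hd (f ^ 4)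
  have h2 : ∑ p, |(f ^ 4) p| ^ (3 / 2 : ℝ) = ∑ p, f p ^ 6 := by
    refine sum_congr rfl fun p _ => ?_
    rw [Pi.pow_apply, abs_pow, ← rpow_natCast, ← rpow_mul (abs_nonneg _)]; norm_num
    exact Even.pow_abs (by decide) _
  rw [h2, ← hY] at h1
  have h3 := w11_pow_four_sum_le hL hh f
  have h4 : h ^ (d - 1) * ∑ q, w11 (f ^ 4) q ≤ c * (√Y * N1 h f) := by
    have hdd : h ^ d = h * h ^ (d - 1) := by
      rw [← pow_succ']; congr 1; omega
    have h5 : h * (h ^ (d - 1) * ∑ q, w11 (f ^ 4) q) ≤ h * (c * (√Y * N1 h f)) := by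
      calc _ = h ^ d * ∑ q, w11 (f ^ 4) q := by rw [hdd]; ring
        _ ≤ _ := h3
    exact le_of_mul_le_mul_left h5 h0
  set z := c * (√Y * N1 h f) with hz
  have hz0 : 0 ≤ z := by positivity
  have h5 : Y ≤ (1 + √L) * z ^ (3 / 2 : ℝ) :=
    h1.trans (mul_le_left
      (Real.rpow_le_rpow (by positivity) h4 (by norm_num)) (by positivity))
  have h6 : (z ^ (3 / 2 : ℝ)) ^ 2 = z ^ 3 := by
    rw [← rpow_natCast, ← rpow_mul hz0, ← rpow_natCast]; norm_num
  have h7 : Y ^ 2 ≤ (1 + √L) ^ 2 * z ^ 3 := by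
    rw [← h6, ← mul_pow]; exact pow_le_pow_left₀ hY0 h5 2
  have h8 : (Y ^ 2) ^ 2 ≤ ((1 + √L) ^ 2 * z ^ 3) ^ 2 := pow_le_pow_left₀ (by positivity) h7 2
  have h9 : ((1 + √L) ^ 2 * z ^ 3) ^ 2 = Y ^ 3 * ((1 + √L) ^ 4 * c ^ 6 * N1 h f ^ 6) := by
    have : z ^ 6 = c ^ 6 * (Y ^ 3 * N1 h f ^ 6) := by
      rw [hz, mul_pow, mul_pow]
      congr 2
      calc √Y ^ 6 = (√Y ^ 2) ^ 3 := by ring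
        _ = Y ^ 3 := by rw [sq_sqrt hY0]
    calc _ = (1 + √L) ^ 4 * z ^ 6 := by ring
      _ = _ := by rw [this]; ring
  rw [h9] at h8
  rcases hY0.eq_or_lt with hy | hy
  · rw [← hy]; positivity
  · have h10 : Y ^ 3 * Y ≤ Y ^ 3 * ((1 + √L) ^ 4 * c ^ 6 * N1 h f ^ 6) := by
      calc _ = (Y ^ 2) ^ 2 := by ring
        _ ≤ _ := h8
    exact le_of_mul_le_mul_left h10 (by positivity)

theorem mul_mul_le_cubes {x y z : ℝ} (hx : 0 ≤ x) (hy : 0 ≤ y) (hz : 0 ≤ z) :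
    x * y * z ≤ (x ^ 3 + y ^ 3 + z ^ 3) / 3 := by
  nlinarith [mul_nonneg (add_nonneg (add_nonneg hx hy) hz) (sq_nonneg (x - y)),
    mul_nonneg (add_nonneg (add_nonneg hx hy) hz) (sq_nonneg (y - z)),
    mul_nonneg (add_nonneg (add_nonneg hx hy) hz) (sq_nonneg (x - z))]

/-- Products of three `H¹` grid functions are in `L²`. -/
theorem N0_mul_mul_le {L : ℝ} (hL : 0 < L) (hd : d = 2 ∨ d = 3) :
    ∃ C > 0, ∀ (J : ℕ) [NeZero J] (h : ℝ), h = L / J → ∀ f g k : GridFun d J,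
      N0 h (f * g * k) ≤ C * (N1 h f * N1 h g * N1 h k) := by
  obtain ⟨C, hC, hsob⟩ := sum_pow_six_le (d := d) hL hd
  refine ⟨√C, by positivity, fun J _ h hh f g k => ?_⟩
  have h0 : 0 < h := mesh_pos hL hh
  have hzero : ∀ f : GridFun d J, N1 h f = 0 → f = 0 := by
    intro f hf; have := hsob J h hh f; rw [hf] at this
    have h1 : ∑ p, f p ^ 6 ≤ 0 := by
      by_contra hcon
      push Not at hcon
      have := mul_pos (pow_pos h0 d) hcon; norm_num at *; linarith
    have h2 := (Finset.sum_eq_zero_iff_of_nonneg (fun p _ => by positivity)).mp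
      (le_antisymm h1 (sum_nonneg fun p _ => by positivity : 0 ≤ ∑ p, f p ^ 6))
    ext p
    exact pow_eq_zero_iff (by norm_num) |>.mp (h2 p (Finset.mem_univ p))
  have hn : ∀ f : GridFun d J, 0 ≤ N1 h f := fun f => apply_nonneg _ _
  rcases (hn f).eq_or_lt with hf | hf
  · rw [hzero f hf.symm]; simp
  rcases (hn g).eq_or_lt with hg | hg
  · rw [hzero g hg.symm]; simp
  rcases (hn k).eq_or_lt with hk | hk
  · rw [hzero k hk.symm]; simp
  refine le_of_sq_le_sq ?_ (by positivity)
  rw [N0_sq h0.le, mul_pow, sq_sqrt hC.le, ip, mul_sum]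
  set a := N1 h f
  set b := N1 h g
  set c := N1 h k
  have hpt : ∀ p, h ^ d * ((f * g * k) p * (f * g * k) p) ≤
      (a * b * c) ^ 2 * ((h ^ d * f p ^ 6 / a ^ 6 + h ^ d * g p ^ 6 / b ^ 6
        + h ^ d * k p ^ 6 / c ^ 6) / 3) := by
    intro p
    have := mul_mul_le_cubes (x := f p ^ 2 / a ^ 2) (y := g p ^ 2 / b ^ 2) (z := k p ^ 2 / c ^ 2)
      (by positivity) (by positivity) (by positivity)
    have e1 : h ^ d * ((f * g * k) p * (f * g * k) p) = (a * b * c) ^ 2 * h ^ d *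
        (f p ^ 2 / a ^ 2 * (g p ^ 2 / b ^ 2) * (k p ^ 2 / c ^ 2)) := by
      simp only [Pi.mul_apply]; field_simp
    rw [e1]
    calc _ ≤ (a * b * c) ^ 2 * h ^ d *
          (((f p ^ 2 / a ^ 2) ^ 3 + (g p ^ 2 / b ^ 2) ^ 3 + (k p ^ 2 / c ^ 2) ^ 3) / 3) := by gcongr
      _ = _ := by field_simp
  refine (sum_le_sum fun p _ => hpt p).trans ?_
  rw [← mul_sum, ← sum_div, sum_add_distrib, sum_add_distrib,
    ← sum_div, ← sum_div, ← sum_div, ← mul_sum, ← mul_sum,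
    ← mul_sum, mul_comm C]
  refine mul_le_left ?_ (by positivity)
  have h1 : (h ^ d * ∑ p, f p ^ 6) / a ^ 6 ≤ C := by
    rw [div_le_iff₀ (by positivity)]; exact hsob J h hh f
  have h2 : (h ^ d * ∑ p, g p ^ 6) / b ^ 6 ≤ C := by
    rw [div_le_iff₀ (by positivity)]; exact hsob J h hh g
  have h3 : (h ^ d * ∑ p, k p ^ 6) / c ^ 6 ≤ C := by
    rw [div_le_iff₀ (by positivity)]; exact hsob J h hh k
  linarith

end SobolevSix

/-! ### Discrete Sobolev inequality `H² ⊂ L^∞`, by the discrete Fourier transform -/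

section SobolevSup


/-- The one-dimensional summand of the lattice sums below. -/
def latt (c : ℝ) (j : ℤ) : ℝ := (1 + c * (j : ℝ) ^ 2) ^ (-(2 / 3) : ℝ)

theorem latt_nonneg {c : ℝ} (hc : 0 < c) (j : ℤ) : 0 ≤ latt c j := by
  unfold latt; positivity

theorem summable_latt {c : ℝ} (hc : 0 < c) : Summable (latt c) := by
  have h1 := (Real.summable_abs_int_rpow (b := 4 / 3) (by norm_num)).mul_left
    (c ^ (-(2 / 3) : ℝ))
  refine h1.of_norm_bounded_eventually ?_
  have : ∀ᶠ j : ℤ in Filter.cofinite, j ≠ 0 := by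
    rw [Filter.eventually_cofinite]; simp
  filter_upwards [this] with j hj
  rw [norm_of_nonneg (latt_nonneg hc j)]
  have hj' : 0 < |(j : ℝ)| := abs_pos.mpr (Int.cast_ne_zero.mpr hj)
  have e1 : c ^ (-(2 / 3) : ℝ) * |(j : ℝ)| ^ (-(4 / 3) : ℝ)
      = (c * (j : ℝ) ^ 2) ^ (-(2 / 3) : ℝ) := by
    rw [Real.mul_rpow hc.le (sq_nonneg _), ← sq_abs (j : ℝ), ← rpow_natCast,
      ← rpow_mul hj'.le]
    norm_num
  rw [e1]
  unfold latt
  have hj2 : 0 < (j : ℝ) ^ 2 := by rw [← sq_abs]; positivity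
  refine Real.rpow_le_rpow_of_nonpos (by positivity) (by linarith) (by norm_num)

theorem inv_sq_le_prod_latt {d : ℕ} (hd : d ≤ 3) {c : ℝ} (hc : 0 < c) (m : Fin d → ℤ) {x : ℝ}
    (hx : 1 + ∑ k, c * (m k : ℝ) ^ 2 ≤ x) : (x ^ 2)⁻¹ ≤ ∏ k, latt c (m k) := by
  have hS : 0 ≤ ∑ k, c * (m k : ℝ) ^ 2 := sum_nonneg fun k _ => by positivity
  have hx1 : 1 ≤ x := by linarith
  have hx0 : 0 < x := by linarith
  have h1 : ∀ k, x ^ (-(2 / 3) : ℝ) ≤ latt c (m k) := by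
    intro k
    have := single_le_sum (f := fun k => c * (m k : ℝ) ^ 2) (fun k _ => by positivity)
      (Finset.mem_univ k)
    exact Real.rpow_le_rpow_of_nonpos (by positivity) (by linarith) (by norm_num)
  have h2 := Finset.prod_le_prod (s := Finset.univ)
    (fun (k : Fin d) _ => Real.rpow_nonneg hx0.le _) (fun k _ => h1 k)
  refine le_trans ?_ h2
  rw [Finset.prod_const, Finset.card_univ, Fintype.card_fin, ← Real.rpow_mul_natCast hx0.le,
    ← rpow_natCast x 2, ← Real.rpow_neg hx0.le]
  refine Real.rpow_le_rpow_of_exponent_le hx1 ?_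
  have : (d : ℝ) ≤ 3 := by exact_mod_cast hd
  push_cast
  linarith

variable {d J : ℕ} [NeZero J]

/-- Characters of the grid. -/
def chi (m p : Grid d J) : ℂ := ∏ k, ZMod.stdAddChar (m k * p k)

theorem chi_add (m p q : Grid d J) : chi m (p + q) = chi m p * chi m q := by
  simp [chi, mul_add, AddChar.map_add_eq_mul, Finset.prod_mul_distrib]

theorem chi_neg (m p : Grid d J) : chi m (-p) = (starRingEnd ℂ) (chi m p) := by
  simp [chi, AddChar.map_neg_eq_conj, map_prod]

theorem chi_zero (m : Grid d J) : chi m 0 = 1 := by simp [chi]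

theorem norm_chi (m p : Grid d J) : ‖chi m p‖ = 1 := by
  simp [chi, norm_prod, AddChar.norm_apply]

theorem chi_single (m : Grid d J) (k : Fin d) : chi m (Pi.single k 1) = ZMod.stdAddChar (m k) := by
  unfold chi
  rw [Finset.prod_eq_single k]
  · simp
  · intro j _ hj; simp [hj]
  · simp

theorem sum_chi (p : Grid d J) :
    ∑ m : Grid d J, chi m p = if p = 0 then ((J : ℂ) ^ d) else 0 := by
  have h1 : ∑ m : Grid d J, chi m p = ∏ k, ∑ j : ZMod J, ZMod.stdAddChar (j * p k) := by
    rw [Finset.prod_univ_sum]; simp [chi]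
  rw [h1]
  have h2 : ∀ k, ∑ j : ZMod J, (ZMod.stdAddChar (j * p k) : ℂ) = if p k = 0 then (J : ℂ) else 0 := by
    intro k; rw [AddChar.sum_mulShift _ (ZMod.isPrimitive_stdAddChar J)]; simp
  simp only [h2]
  split_ifs with hp
  · subst hp; simp
  · obtain ⟨k, hk⟩ := Function.ne_iff.mp hp
    exact Finset.prod_eq_zero (Finset.mem_univ k) (if_neg hk)

/-- Discrete Fourier coefficients. -/
def dft (f : GridFun d J) (m : Grid d J) : ℂ := ∑ p, (f p : ℂ) * chi m (-p)

theorem dft_sub (f g : GridFun d J) (m : Grid d J) : dft (f - g) m = dft f m - dft g m := by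
  simp [dft, sub_mul]

theorem dft_sum {ι : Type*} (s : Finset ι) (F : ι → GridFun d J) (m : Grid d J) :
    dft (∑ i ∈ s, F i) m = ∑ i ∈ s, dft (F i) m := by
  simp only [dft, Finset.sum_apply, Complex.ofReal_sum, sum_mul]
  rw [sum_comm]

theorem dft_smul (c : ℝ) (f : GridFun d J) (m : Grid d J) : dft (c • f) m = c * dft f m := by
  simp [dft, mul_assoc, mul_sum]

theorem dft_shift (e : Grid d J) (f : GridFun d J) (m : Grid d J) :
    dft (shift e f) m = chi m e * dft f m := by
  rw [dft, dft, mul_sum]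
  refine Fintype.sum_equiv (Equiv.addRight e) _ _ fun p => ?_
  simp only [shift_apply, Equiv.coe_addRight, neg_add, chi_add]
  have : chi m e * chi m (-e) = 1 := by rw [← chi_add, add_neg_cancel, chi_zero]
  linear_combination (-(f (p + e) : ℂ) * chi m (-p)) * this

theorem dft_inversion (f : GridFun d J) (p : Grid d J) :
    ∑ m, dft f m * chi m p = (J : ℂ) ^ d * f p := by
  simp only [dft, sum_mul, mul_assoc, ← chi_add]
  rw [sum_comm]
  simp only [← mul_sum, sum_chi]
  rw [Finset.sum_eq_single p]
  · simp [mul_comm]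
  · intro q _ hq
    rw [if_neg]
    · simp
    · intro h; exact hq (neg_add_eq_zero.mp h)
  · simp

theorem dft_parseval (f : GridFun d J) :
    ∑ m, ‖dft f m‖ ^ 2 = (J : ℝ) ^ d * ∑ p, f p ^ 2 := by
  have h1 : ((∑ m, ‖dft f m‖ ^ 2 : ℝ) : ℂ) = ((J : ℝ) ^ d * ∑ p, f p ^ 2 : ℝ) := by
    have h2 : ∀ m, ((‖dft f m‖ ^ 2 : ℝ) : ℂ) = ∑ p, (f p : ℂ) * (dft f m * chi m p) := by
      intro m
      have : (starRingEnd ℂ) (dft f m) = ∑ p, (f p : ℂ) * chi m p := by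
        simp only [dft, map_sum, map_mul, Complex.conj_ofReal, chi_neg, Complex.conj_conj]
      push_cast; rw [← Complex.mul_conj', this, mul_sum]; exact sum_congr rfl fun p _ => by ring
    rw [Complex.ofReal_sum]; simp only [h2]; rw [sum_comm]; simp only [← mul_sum, dft_inversion]
    push_cast; rw [mul_sum]; exact sum_congr rfl fun p _ => by ring
  exact_mod_cast h1

variable {h : ℝ}

/-- Symbol of `-Δ_h`. -/
def lam (h : ℝ) (m : Grid d J) : ℝ :=
  ∑ k, (h ^ 2)⁻¹ * (2 - 2 * cos (2 * π * (m k).valMinAbs / J))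

theorem stdAddChar_add_conj (j : ZMod J) :
    (ZMod.stdAddChar j : ℂ) + (starRingEnd ℂ) (ZMod.stdAddChar j)
      = (2 * cos (2 * π * j.valMinAbs / J) : ℝ) := by
  have h1 : (ZMod.stdAddChar j : ℂ)
      = Complex.exp ((2 * π * j.valMinAbs / J : ℝ) * Complex.I) := by
    conv_lhs => rw [← ZMod.coe_valMinAbs j]
    rw [ZMod.stdAddChar_coe]
    congr 1
    push_cast; ring
  rw [Complex.add_conj, h1, Complex.exp_ofReal_mul_I_re]

theorem dft_lap (f : GridFun d J) (m : Grid d J) :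
    dft (lapOp h f) m = -(lam h m : ℂ) * dft f m := by
  rw [lapOp_apply, dft_sum, lam, Complex.ofReal_sum, ← sum_neg_distrib, sum_mul]
  refine sum_congr rfl fun k _ => ?_
  have e1 : Dp h k (Dm h k f) = ((h ^ 2)⁻¹ : ℝ) •
      ((shift (Pi.single k 1) f - f) - (f - shift (-Pi.single k 1) f)) := by
    rw [Dp_apply, Dm_apply, map_smul, map_sub, shift_shift, add_neg_cancel, ← smul_sub, smul_smul,
      pow_two, mul_inv]
    congr 2
    have : shift (0 : Grid d J) f = f := by ext p; simp
    rw [this]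
  rw [e1, dft_smul, dft_sub, dft_sub, dft_sub, dft_shift, dft_shift, chi_neg, chi_single]
  have := stdAddChar_add_conj (m k)
  push_cast at this ⊢
  linear_combination ((h : ℂ) ^ 2)⁻¹ * dft f m * this

theorem lam_ge {L : ℝ} (hL : 0 < L) (hh : h = L / J) (m : Grid d J) :
    ∑ k, 16 / L ^ 2 * ((m k).valMinAbs : ℝ) ^ 2 ≤ lam h m := by
  have hJ : (0 : ℝ) < J := Nat.cast_pos.mpr (NeZero.pos J)
  refine sum_le_sum fun k _ => ?_
  set j := (m k).valMinAbs with hj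
  have hpi := Real.pi_pos
  have hjle : |(j : ℝ)| ≤ J / 2 := by
    have := ZMod.valMinAbs_mem_Ioc (m k); rw [← hj] at this
    have h1 : (-(J : ℝ)) < j * 2 := by exact_mod_cast this.1
    have h2 : (j : ℝ) * 2 ≤ J := by exact_mod_cast this.2
    rw [abs_le]; constructor <;> linarith
  have habs : |2 * π * j / J| ≤ π := by
    rw [abs_div, abs_mul, abs_of_pos (by positivity : 0 < 2 * π), abs_of_pos hJ,
      div_le_iff₀ hJ]
    nlinarith
  have hcos := Real.cos_le_one_sub_mul_cos_sq habs
  have e : (2 : ℝ) / π ^ 2 * (2 * π * j / J) ^ 2 = 8 * j ^ 2 / J ^ 2 := by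
    field_simp; ring
  rw [e] at hcos
  have e2 : 16 / L ^ 2 * (j : ℝ) ^ 2 = (h ^ 2)⁻¹ * (16 * j ^ 2 / J ^ 2) := by
    rw [hh]; field_simp
  rw [e2]
  refine mul_le_left ?_ (by positivity)
  have : (16 * (j : ℝ) ^ 2 / J ^ 2) = 2 * (8 * j ^ 2 / J ^ 2) := by ring
  linarith

/-- Discrete Sobolev inequality `H² ⊂ L^∞` in dimensions at most three. -/
theorem abs_le_N2 {L : ℝ} (hL : 0 < L) (hd : d ≤ 3) :
    ∃ C > 0, ∀ (J : ℕ) [NeZero J] (h : ℝ), h = L / J → ∀ (f : GridFun d J) (p : Grid d J),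
      |f p| ≤ C * N2 h f := by
  set c : ℝ := 16 / L ^ 2 with hc
  have hc0 : 0 < c := by positivity
  set S : ℝ := (∑' j, latt c j) ^ d with hS
  have hS0 : 0 ≤ S := pow_nonneg (tsum_nonneg fun j => latt_nonneg hc0 j) d
  refine ⟨2 * √(S * (L ^ d)⁻¹) + 1, by positivity, fun J _ h hh f p => ?_⟩
  have hJ : (0 : ℝ) < J := Nat.cast_pos.mpr (NeZero.pos J)
  have h0 : 0 < h := by rw [hh]; positivity
  have hlam : ∀ m : Grid d J, 1 + ∑ k, c * ((m k).valMinAbs : ℝ) ^ 2 ≤ 1 + lam h m := fun m => by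
    have := lam_ge hL hh m; linarith
  have hlam0 : ∀ m : Grid d J, 0 < 1 + lam h m := fun m => by
    have h1 : 0 ≤ ∑ k, c * ((m k).valMinAbs : ℝ) ^ 2 := sum_nonneg fun k _ => by positivity
    linarith [hlam m]
  have hsum : ∑ m : Grid d J, ((1 + lam h m) ^ 2)⁻¹ ≤ S := by
    calc ∑ m : Grid d J, ((1 + lam h m) ^ 2)⁻¹
        ≤ ∑ m : Grid d J, ∏ k, latt c ((m k).valMinAbs) := sum_le_sum fun m _ =>
          inv_sq_le_prod_latt hd hc0 (fun k => (m k).valMinAbs) (hlam m)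
      _ = ∏ _k : Fin d, ∑ j : ZMod J, latt c j.valMinAbs := by
          rw [Finset.prod_univ_sum]; simp
      _ = (∑ j : ZMod J, latt c j.valMinAbs) ^ d := by simp
      _ ≤ S := by
          refine pow_le_pow_left₀ (sum_nonneg fun j _ => latt_nonneg hc0 _) ?_ d
          have := (summable_latt hc0).sum_le_tsum
            (Finset.univ.map ⟨ZMod.valMinAbs (n := J), ZMod.injective_valMinAbs⟩)
            (fun j _ => latt_nonneg hc0 j)
          rwa [Finset.sum_map] at this
  set g := f - lapOp h f with hg
  have hdft : ∀ m, ‖dft g m‖ = (1 + lam h m) * ‖dft f m‖ := by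
    intro m; rw [hg, dft_sub, dft_lap]
    have : dft f m - -(lam h m : ℂ) * dft f m = ((1 + lam h m : ℝ) : ℂ) * dft f m := by
      push_cast; ring
    rw [this, norm_mul, Complex.norm_real, norm_of_nonneg (hlam0 m).le]
  have h1 : (J : ℝ) ^ d * |f p| ≤ ∑ m, ‖dft f m‖ := by
    have := congrArg norm (dft_inversion f p)
    rw [norm_mul, norm_pow, Complex.norm_natCast, Complex.norm_real, norm_eq_abs] at this
    rw [← this]; refine (norm_sum_le _ _).trans (le_of_eq (sum_congr rfl fun m _ => ?_))
    rw [norm_mul, norm_chi, mul_one]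
  have h2 : ∑ m, ‖dft f m‖ ≤ √S * √((J : ℝ) ^ d * ∑ p, g p ^ 2) := by
    have e1 : ∀ m, ‖dft f m‖ = (1 + lam h m)⁻¹ * ‖dft g m‖ := fun m => by
      rw [hdft, ← mul_assoc, inv_mul_cancel₀ (hlam0 m).ne', one_mul]
    simp only [e1]; refine (Real.sum_mul_le_sqrt_mul_sqrt _ _ _).trans ?_; rw [dft_parseval]
    refine mul_le_right (sqrt_le_sqrt ?_) (sqrt_nonneg _); simpa only [inv_pow] using hsum
  have hg2 : √((J : ℝ) ^ d * ∑ p, g p ^ 2) = (J : ℝ) ^ d * (√((L ^ d)⁻¹) * N0 h g) := by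
    rw [N0_eq_sqrt h0.le, ← sqrt_mul (by positivity), ← sqrt_mul (by positivity)]
    have : (J : ℝ) ^ d = √(((J : ℝ) ^ d) ^ 2) := (sqrt_sq (by positivity)).symm
    nth_rewrite 2 [this]
    rw [← sqrt_mul (by positivity)]
    congr 1
    rw [hh, div_pow]; field_simp
  have hgN : N0 h g ≤ 2 * N2 h f := by
    have e1 := map_sub_le_add (N0 h) f (lapOp h f); have e2 := N0_lap_le_N2 h0.le f
    have e3 := (N0_le_N1 h0.le f).trans (N1_le_N2 h0.le f); rw [hg]; linarith
  have hN : 0 ≤ N2 h f := apply_nonneg _ _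
  have h3 : (J : ℝ) ^ d * |f p| ≤ (J : ℝ) ^ d * (√S * (√((L ^ d)⁻¹) * N0 h g)) := by
    calc _ ≤ _ := h1.trans h2
      _ = _ := by rw [hg2]; ring
  have h4 := le_of_mul_le_mul_left h3 (by positivity)
  calc |f p| ≤ √S * (√((L ^ d)⁻¹) * N0 h g) := h4
    _ ≤ √S * (√((L ^ d)⁻¹) * (2 * N2 h f)) := by gcongr
    _ = 2 * √(S * (L ^ d)⁻¹) * N2 h f := by rw [sqrt_mul hS0]; ring
    _ ≤ _ := by nlinarith

end SobolevSup

/-! ### Lipschitz estimates for the discrete nonlinearities -/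

section Nonlinear


variable {d : ℕ}

theorem Dp_one {J : ℕ} [NeZero J] {h : ℝ} (k : Fin d) : Dp h k (1 : GridFun d J) = 0 := by
  ext p; simp [Dp_apply_apply]

theorem N1_one {J : ℕ} [NeZero J] {L h : ℝ} (hL : 0 ≤ L) (hh : h = L / J) :
    N1 h (1 : GridFun d J) ≤ √(L ^ d) := by
  have h0 : 0 ≤ h := by rw [hh]; positivity
  refine le_of_sq_le_sq ?_ (sqrt_nonneg _)
  rw [N1_sq' h0]
  simp only [Dp_one, map_zero]
  have := N0_le_sup hL hh (f := (1 : GridFun d J)) (M := 1) (fun p => by simp)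
  rw [mul_one] at this
  simpa using pow_le_pow_left₀ (apply_nonneg _ _) this 2

/-- `H²` grid functions form an algebra, in the form needed for the discrete Hessian. -/
theorem N0_Dc_Dc_mul_le {L : ℝ} (hL : 0 < L) (hd : d = 2 ∨ d = 3) :
    ∃ C > 0, ∀ (J : ℕ) [NeZero J] (h : ℝ), h = L / J → ∀ (f g : GridFun d J) (k l : Fin d),
      N0 h (Dc h k (Dc h l (f * g))) ≤ C * (N2 h f * N2 h g) := by
  obtain ⟨C, hC, hsup⟩ := abs_le_N2 (d := d) hL (by omega)
  obtain ⟨C', hC', htri⟩ := N0_mul_mul_le (d := d) hL hd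
  refine ⟨2 * C + 2 * (C' * √(L ^ d)), by positivity, fun J _ h hh f g k l => ?_⟩
  have h0 : 0 ≤ h := by rw [hh]; positivity
  have two : ∀ a b : GridFun d J, N0 h (a * b) ≤ C' * √(L ^ d) * (N1 h a * N1 h b) := by
    intro a b; have := htri J h hh a b 1; rw [mul_one] at this; refine this.trans ?_
    have h1 := N1_one (d := d) (J := J) hL.le hh
    have h2 : 0 ≤ N1 h a * N1 h b := mul_nonneg (apply_nonneg _ _) (apply_nonneg _ _)
    calc C' * (N1 h a * N1 h b * N1 h 1) ≤ C' * (N1 h a * N1 h b * √(L ^ d)) := by gcongr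
      _ = _ := by ring
  refine (N0_Dc_Dc_le_Dp_Dp h0 k l _).trans ?_
  rw [Dp_Dp_mul]
  have hf : 0 ≤ N2 h f := apply_nonneg _ _
  have hg : 0 ≤ N2 h g := apply_nonneg _ _
  have t1 : N0 h (Dp h k (Dp h l f) * g) ≤ C * (N2 h f * N2 h g) := by
    rw [mul_comm]; refine (N0_mul_le h0 (hsup J h hh g)).trans ?_
    calc C * N2 h g * N0 h (Dp h k (Dp h l f)) ≤ C * N2 h g * N2 h f := by
          gcongr; exact (N0_Dp_Dp_le h0 k l f).trans (N0_lap_le_N2 h0 f)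
      _ = _ := by ring
  have t4 : N0 h (shift (Pi.single k 1) (shift (Pi.single l 1) f) * Dp h k (Dp h l g))
      ≤ C * (N2 h f * N2 h g) := by
    refine (N0_mul_le h0 (fun p => hsup J h hh f _)).trans ?_
    calc C * N2 h f * N0 h (Dp h k (Dp h l g)) ≤ C * N2 h f * N2 h g := by
          gcongr; exact (N0_Dp_Dp_le h0 k l g).trans (N0_lap_le_N2 h0 g)
      _ = _ := by ring
  have t23 : ∀ k l : Fin d, N0 h (shift (Pi.single k 1) (Dp h l f) * Dp h k g)
      ≤ C' * √(L ^ d) * (N2 h f * N2 h g) := by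
    intro k l; refine (two _ _).trans ?_; rw [N1_shift h0]; gcongr
    · exact N1_Dp_le_N2 h0 l f
    · exact N1_Dp_le_N2 h0 k g
  have a1 := map_add_le_add (N0 h) (Dp h k (Dp h l f) * g
      + shift (Pi.single k 1) (Dp h l f) * Dp h k g
      + shift (Pi.single l 1) (Dp h k f) * Dp h l g)
      (shift (Pi.single k 1) (shift (Pi.single l 1) f) * Dp h k (Dp h l g))
  have a2 := map_add_le_add (N0 h) (Dp h k (Dp h l f) * g
      + shift (Pi.single k 1) (Dp h l f) * Dp h k g)
      (shift (Pi.single l 1) (Dp h k f) * Dp h l g)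
  have a3 := map_add_le_add (N0 h) (Dp h k (Dp h l f) * g)
      (shift (Pi.single k 1) (Dp h l f) * Dp h k g)
  have b1 := t23 k l
  have b2 := t23 l k
  linarith

/-- A pair of discrete states, the second one regular, at distance at most `δ ≤ 1`. -/
structure Cfg (d : ℕ) (L R : ℝ) where
  J : ℕ
  hJ : NeZero J
  h : ℝ
  hh : h = L / J
  X : Grid d J → Mat d
  X' : Grid d J → Mat d
  v : GridFun d J
  v' : GridFun d J
  δ : ℝ
  δ_nonneg : 0 ≤ δ
  δ_le : δ ≤ 1
  X_sub : ∀ i j, N1 h (entry X i j - entry X' i j) ≤ δ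
  v_sub : N2 h (v - v') ≤ δ
  X'_bd : ∀ i j, N2 h (entry X' i j) ≤ R
  v'_bd : N2 h v' ≤ R
  X'_sup : ∀ i j p, |entry X' i j p| ≤ R
  hess_sup : ∀ k l p, |Dc h k (Dc h l v') p| ≤ R

attribute [instance] Cfg.hJ

variable {L R : ℝ}

/-- Families of grid functions over the configurations. -/
abbrev Fam (d : ℕ) (L R : ℝ) := (c : Cfg d L R) → GridFun d c.J

/-- Bounded and Lipschitz in the discrete norm `N`. -/
def PairIn (N : (c : Cfg d L R) → Seminorm ℝ (GridFun d c.J)) (f f' : Fam d L R) : Prop :=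
  ∃ C, 0 ≤ C ∧ ∀ c, N c (f c) ≤ C ∧ N c (f' c) ≤ C ∧ N c (f c - f' c) ≤ C * c.δ

/-- Bounded and Lipschitz in the discrete `L²` norm. -/
def Pair0 (f f' : Fam d L R) : Prop := PairIn (fun c => N0 c.h) f f'

/-- Bounded and Lipschitz in the discrete `H¹` norm. -/
def Pair1 (f f' : Fam d L R) : Prop := PairIn (fun c => N1 c.h) f f'

/-- Bounded and Lipschitz in the maximum norm. -/
def PairSup (f f' : Fam d L R) : Prop :=
  ∃ C, 0 ≤ C ∧ ∀ c p, |f c p| ≤ C ∧ |f' c p| ≤ C ∧ |f c p - f' c p| ≤ C * c.δ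

section closure

variable {N : (c : Cfg d L R) → Seminorm ℝ (GridFun d c.J)} {f f' g g' k k' : Fam d L R}

theorem PairIn.add (hf : PairIn N f f') (hg : PairIn N g g') :
    PairIn N (fun c => f c + g c) (fun c => f' c + g' c) := by
  obtain ⟨C, hC, h1⟩ := hf
  obtain ⟨D, hD, h2⟩ := hg
  refine ⟨C + D, by positivity, fun c => ⟨?_, ?_, ?_⟩⟩
  · exact (map_add_le_add _ _ _).trans (add_le_add (h1 c).1 (h2 c).1)
  · exact (map_add_le_add _ _ _).trans (add_le_add (h1 c).2.1 (h2 c).2.1)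
  · have : f c + g c - (f' c + g' c) = (f c - f' c) + (g c - g' c) := by abel
    rw [this, add_mul]; exact (map_add_le_add _ _ _).trans (add_le_add (h1 c).2.2 (h2 c).2.2)

theorem PairIn.smul (a : ℝ) (hf : PairIn N f f') :
    PairIn N (fun c => a • f c) (fun c => a • f' c) := by
  obtain ⟨C, hC, h1⟩ := hf
  refine ⟨|a| * C, by positivity, fun c => ⟨?_, ?_, ?_⟩⟩
  · rw [map_smul_eq_mul]; exact mul_le_left (h1 c).1 (abs_nonneg a)
  · rw [map_smul_eq_mul]; exact mul_le_left (h1 c).2.1 (abs_nonneg a)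
  · rw [← smul_sub, map_smul_eq_mul, mul_assoc]
    exact mul_le_left (h1 c).2.2 (abs_nonneg a)

theorem PairIn.sub (hf : PairIn N f f') (hg : PairIn N g g') :
    PairIn N (fun c => f c - g c) (fun c => f' c - g' c) := by
  have := hf.add (hg.smul (-1))
  simpa only [neg_smul, one_smul, ← sub_eq_add_neg] using this

theorem PairIn.zero : PairIn N (fun _ => 0) (fun _ => 0) :=
  ⟨0, le_rfl, fun c => by simp⟩

theorem PairIn.sum {ι : Type*} (s : Finset ι) {F F' : ι → Fam d L R}
    (hF : ∀ i, PairIn N (F i) (F' i)) :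
    PairIn N (fun c => ∑ i ∈ s, F i c) (fun c => ∑ i ∈ s, F' i c) := by
  induction s using Finset.cons_induction with
  | empty => simpa using PairIn.zero
  | cons a s ha ih =>
    simp only [Finset.sum_cons]; exact (hF a).add ih

theorem PairSup.mul (hf : PairSup f f') (hg : PairSup g g') :
    PairSup (fun c => f c * g c) (fun c => f' c * g' c) := by
  obtain ⟨C, hC, h1⟩ := hf
  obtain ⟨D, hD, h2⟩ := hg
  refine ⟨C * D + C * D, by positivity, fun c p => ?_⟩
  obtain ⟨a1, a2, a3⟩ := h1 c p
  obtain ⟨b1, b2, b3⟩ := h2 c p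
  have hδ := c.δ_nonneg
  have e1 : |f c p * g c p| ≤ C * D := by
    rw [abs_mul]; exact mul_le_mul a1 b1 (abs_nonneg _) hC
  have e2 : |f' c p * g' c p| ≤ C * D := by
    rw [abs_mul]; exact mul_le_mul a2 b2 (abs_nonneg _) hC
  have hCD : 0 ≤ C * D := by positivity
  refine ⟨by simpa using e1.trans (by linarith), by simpa using e2.trans (by linarith), ?_⟩
  have e3 : f c p * g c p - f' c p * g' c p
      = (f c p - f' c p) * g c p + f' c p * (g c p - g' c p) := by ring
  simp only [Pi.mul_apply]
  rw [e3]
  refine (abs_add_le _ _).trans ?_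
  rw [abs_mul, abs_mul, add_mul]
  refine add_le_add ?_ ?_
  · calc |f c p - f' c p| * |g c p| ≤ C * c.δ * D := mul_le_mul a3 b1 (abs_nonneg _) (by positivity)
      _ = _ := by ring
  · calc |f' c p| * |g c p - g' c p| ≤ C * (D * c.δ) := mul_le_mul a2 b3 (abs_nonneg _) hC
      _ = _ := by ring

theorem h_nonneg (hL : 0 < L) (c : Cfg d L R) : 0 ≤ c.h := by
  rw [c.hh]; positivity

theorem PairSup.mul_pair0 (hL : 0 < L) (hf : PairSup f f') (hg : Pair0 g g') :
    Pair0 (fun c => f c * g c) (fun c => f' c * g' c) := by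
  obtain ⟨C, hC, h1⟩ := hf
  obtain ⟨D, hD, h2⟩ := hg
  refine ⟨C * D + C * D, by positivity, fun c => ?_⟩
  obtain ⟨b1, b2, b3⟩ := h2 c
  have h0 := h_nonneg hL c
  have hδ := c.δ_nonneg
  have hCD : 0 ≤ C * D := by positivity
  have e1 := N0_mul_le h0 (g := g c) (fun p => (h1 c p).1)
  have e2 := N0_mul_le h0 (g := g' c) (fun p => (h1 c p).2.1)
  have e1' := mul_le_left b1 hC
  have e2' := mul_le_left b2 hC
  refine ⟨by linarith, by linarith, ?_⟩
  have e3 : f c * g c - f' c * g' c = (f c - f' c) * g c + f' c * (g c - g' c) := by ring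
  rw [e3]
  have m1 := N0_mul_le h0 (f := f c - f' c) (g := g c) (fun p => (h1 c p).2.2)
  have m2 := N0_mul_le h0 (f := f' c) (g := g c - g' c) (fun p => (h1 c p).2.1)
  have m1' := mul_le_left b1 (by positivity : 0 ≤ C * c.δ)
  have m2' := mul_le_left b3 hC
  refine (map_add_le_add _ _ _).trans ?_
  calc _ ≤ C * c.δ * D + C * (D * c.δ) := by linarith
    _ = _ := by ring

theorem PairSup.pair0 (hL : 0 < L) (hf : PairSup f f') : Pair0 f f' := by
  obtain ⟨C, hC, h1⟩ := hf
  refine ⟨√(L ^ d) * C, by positivity, fun c => ⟨?_, ?_, ?_⟩⟩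
  · exact N0_le_sup hL.le c.hh fun p => (h1 c p).1
  · exact N0_le_sup hL.le c.hh fun p => (h1 c p).2.1
  · rw [mul_assoc]; exact N0_le_sup hL.le c.hh fun p => (h1 c p).2.2

theorem Pair1.pair0 (hL : 0 < L) (hf : Pair1 f f') : Pair0 f f' := by
  obtain ⟨C, hC, h1⟩ := hf
  exact ⟨C, hC, fun c => ⟨(N0_le_N1 (h_nonneg hL c) _).trans (h1 c).1,
    (N0_le_N1 (h_nonneg hL c) _).trans (h1 c).2.1,
    (N0_le_N1 (h_nonneg hL c) _).trans (h1 c).2.2⟩⟩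

theorem Pair1.one (hL : 0 < L) : Pair1 (d := d) (L := L) (R := R) (fun _ => 1) (fun _ => 1) :=
  ⟨√(L ^ d), by positivity, fun c => ⟨N1_one hL.le c.hh, N1_one hL.le c.hh, by
    simp only [sub_self, map_zero]
    exact mul_nonneg (sqrt_nonneg _) c.δ_nonneg⟩⟩

theorem Pair1.mul_mul (hL : 0 < L) (hd : d = 2 ∨ d = 3) (hf : Pair1 f f') (hg : Pair1 g g')
    (hk : Pair1 k k') :
    Pair0 (fun c => f c * g c * k c) (fun c => f' c * g' c * k' c) := by
  obtain ⟨T, hT, htri⟩ := N0_mul_mul_le (d := d) hL hd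
  obtain ⟨A, hA, h1⟩ := hf
  obtain ⟨B, hB, h2⟩ := hg
  obtain ⟨C, hC, h3⟩ := hk
  refine ⟨3 * (T * (A * B * C)), by positivity, fun c => ?_⟩
  obtain ⟨a1, a2, a3⟩ := h1 c
  obtain ⟨b1, b2, b3⟩ := h2 c
  obtain ⟨c1, c2, c3⟩ := h3 c
  have hδ := c.δ_nonneg
  have tri : ∀ {x y z : GridFun d c.J} {α β γ : ℝ}, N1 c.h x ≤ α → N1 c.h y ≤ β → N1 c.h z ≤ γ →
      N0 c.h (x * y * z) ≤ T * (α * β * γ) := by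
    intro x y z α β γ hx hy hz; refine (htri c.J c.h c.hh x y z).trans ?_
    have hα : 0 ≤ α := (apply_nonneg _ _).trans hx; have hβ : 0 ≤ β := (apply_nonneg _ _).trans hy
    gcongr
  have hpos : 0 ≤ T * (A * B * C) := by positivity
  refine ⟨(tri a1 b1 c1).trans (by linarith), (tri a2 b2 c2).trans (by linarith), ?_⟩
  have e : f c * g c * k c - f' c * g' c * k' c = (f c - f' c) * g c * k c
      + f' c * (g c - g' c) * k c + f' c * g' c * (k c - k' c) := by ring
  rw [e]
  have m1 := tri a3 b1 c1
  have m2 := tri a2 b3 c1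
  have m3 := tri a2 b2 c3
  refine (map_add_le_add _ _ _).trans ?_
  refine (add_le_add (map_add_le_add _ _ _) le_rfl).trans ?_
  calc _ ≤ T * (A * c.δ * B * C) + T * (A * (B * c.δ) * C) + T * (A * B * (C * c.δ)) := by linarith
    _ = _ := by ring

theorem Pair1.mul (hL : 0 < L) (hd : d = 2 ∨ d = 3) (hf : Pair1 f f') (hg : Pair1 g g') :
    Pair0 (fun c => f c * g c) (fun c => f' c * g' c) := by
  simpa using hf.mul_mul hL hd hg (Pair1.one hL)

end closure

/-- Scalar quantities that are Lipschitz in the distance of the states. -/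
def LipScalar (F F' : Cfg d L R → ℝ) : Prop := ∃ C, 0 ≤ C ∧ ∀ c, |F c - F' c| ≤ C * c.δ

section scalar

variable {F F' G G' : Cfg d L R → ℝ} {f f' g g' : Fam d L R}

theorem LipScalar.add (hF : LipScalar F F') (hG : LipScalar G G') :
    LipScalar (fun c => F c + G c) (fun c => F' c + G' c) := by
  obtain ⟨C, hC, h1⟩ := hF
  obtain ⟨D, hD, h2⟩ := hG
  refine ⟨C + D, by positivity, fun c => ?_⟩
  have : F c + G c - (F' c + G' c) = (F c - F' c) + (G c - G' c) := by ring
  rw [this, add_mul]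
  exact (abs_add_le _ _).trans (add_le_add (h1 c) (h2 c))

theorem LipScalar.mul_left (a : ℝ) (hF : LipScalar F F') :
    LipScalar (fun c => a * F c) (fun c => a * F' c) := by
  obtain ⟨C, hC, h1⟩ := hF
  refine ⟨|a| * C, by positivity, fun c => ?_⟩
  rw [← mul_sub, abs_mul, mul_assoc]
  exact mul_le_left (h1 c) (abs_nonneg a)

theorem LipScalar.zero : LipScalar (fun _ : Cfg d L R => 0) (fun _ => 0) :=
  ⟨0, le_rfl, fun c => by simp⟩

theorem LipScalar.sum {ι : Type*} (s : Finset ι) {F F' : ι → Cfg d L R → ℝ}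
    (hF : ∀ i, LipScalar (F i) (F' i)) :
    LipScalar (fun c => ∑ i ∈ s, F i c) (fun c => ∑ i ∈ s, F' i c) := by
  induction s using Finset.cons_induction with
  | empty => simpa using LipScalar.zero
  | cons a s ha ih =>
    simp only [Finset.sum_cons]; exact (hF a).add ih

theorem Pair0.ip (hL : 0 < L) (hf : Pair0 f f') (hg : Pair0 g g') :
    LipScalar (fun c => ip c.h (f c) (g c)) (fun c => ip c.h (f' c) (g' c)) := by
  obtain ⟨C, hC, h1⟩ := hf
  obtain ⟨D, hD, h2⟩ := hg
  refine ⟨C * D + C * D, by positivity, fun c => ?_⟩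
  obtain ⟨a1, a2, a3⟩ := h1 c
  obtain ⟨b1, b2, b3⟩ := h2 c
  have h0 := h_nonneg hL c
  have hδ := c.δ_nonneg
  have e : SmA.ip c.h (f c) (g c) - SmA.ip c.h (f' c) (g' c)
      = SmA.ip c.h (f c - f' c) (g c) + SmA.ip c.h (f' c) (g c - g' c) := by
    rw [ip_sub_left, ip_sub_right]; ring
  rw [e]
  refine (abs_add_le _ _).trans ?_
  refine (add_le_add (abs_ip_le h0 _ _) (abs_ip_le h0 _ _)).trans ?_
  have m1 := mul_le_mul a3 b1 (apply_nonneg _ _) (by positivity)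
  have m2 := mul_le_mul a2 b3 (apply_nonneg _ _) hC
  calc _ ≤ C * c.δ * D + C * (D * c.δ) := by linarith
    _ = _ := by ring

end scalar

section basic

theorem pair1_entry (hL : 0 < L) (hR : 0 ≤ R) (i j : Fin d) :
    Pair1 (d := d) (L := L) (R := R) (fun c => entry c.X i j) (fun c => entry c.X' i j) := by
  refine ⟨R + 1, by linarith, fun c => ?_⟩
  have h0 := h_nonneg hL c
  have h1 := (N1_le_N2 h0 _).trans (c.X'_bd i j)
  have h2 := c.X_sub i j
  have h3 := c.δ_le
  have h4 := c.δ_nonneg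
  refine ⟨?_, by linarith, h2.trans (by nlinarith)⟩
  have : entry c.X i j = (entry c.X i j - entry c.X' i j) + entry c.X' i j := by abel
  beta_reduce
  rw [this]
  exact (map_add_le_add _ _ _).trans (by linarith)

theorem pair0_hess (hL : 0 < L) (hR : 0 ≤ R) (k l : Fin d) :
    Pair0 (d := d) (L := L) (R := R) (fun c => Dc c.h k (Dc c.h l c.v))
      (fun c => Dc c.h k (Dc c.h l c.v')) := by
  refine ⟨R + 1, by linarith, fun c => ?_⟩
  have h0 := h_nonneg hL c
  have h1 := (N0_Dc_Dc_le_N2 h0 k l c.v').trans c.v'_bd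
  have h2 := (N0_Dc_Dc_le_N2 h0 k l (c.v - c.v')).trans c.v_sub
  rw [map_sub, map_sub] at h2
  have h3 := c.δ_le
  have h4 := c.δ_nonneg
  refine ⟨?_, by linarith, h2.trans (by nlinarith)⟩
  have : Dc c.h k (Dc c.h l c.v)
      = (Dc c.h k (Dc c.h l c.v) - Dc c.h k (Dc c.h l c.v')) + Dc c.h k (Dc c.h l c.v') := by abel
  beta_reduce
  rw [this]
  exact (map_add_le_add _ _ _).trans (by linarith)

theorem pairSup_v (hL : 0 < L) (hd : d = 2 ∨ d = 3) (hR : 0 ≤ R) :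
    PairSup (d := d) (L := L) (R := R) (fun c => c.v) (fun c => c.v') := by
  obtain ⟨C, hC, hsup⟩ := abs_le_N2 (d := d) hL (by omega)
  refine ⟨C * (R + 1), by positivity, fun c p => ?_⟩
  have h1 := (hsup c.J c.h c.hh c.v' p).trans (mul_le_left c.v'_bd hC.le)
  have h2 := (hsup c.J c.h c.hh (c.v - c.v') p).trans (mul_le_left c.v_sub hC.le)
  rw [Pi.sub_apply] at h2
  have h3 := c.δ_le
  have h4 := c.δ_nonneg
  have hCR : 0 ≤ C * R := by positivity
  have hCδ : C * c.δ ≤ C * 1 := mul_le_left h3 hC.le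
  refine ⟨?_, by linarith, h2.trans (by nlinarith)⟩
  have : c.v p = (c.v p - c.v' p) + c.v' p := by ring
  beta_reduce
  rw [this]
  exact (abs_add_le _ _).trans (by linarith)

end basic

/-- The grid function `(tr X²)`. -/
def trSq {J : ℕ} (X : Grid d J → Mat d) : GridFun d J :=
  ∑ k, ∑ l, entry X k l * entry X l k

theorem trace_sq_apply {J : ℕ} (X : Grid d J → Mat d) (p : Grid d J) :
    (X p * X p).trace = trSq X p := by
  simp [Matrix.trace, Matrix.mul_apply, trSq, entry, Finset.sum_apply]

theorem entry_HH (P : Params) {J : ℕ} [NeZero J] (h : ℝ) (X : Grid d J → Mat d) (v : GridFun d J)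
    (i j : Fin d) :
    entry (HH P h X v) i j = P.A • entry X i j
      - P.B • (∑ k, entry X i k * entry X k j - ((1 : Mat d) i j / d) • trSq X)
      + P.C • ∑ k, ∑ l, entry X k l * entry X l k * entry X i j
      + (2 * P.B0 * P.q ^ 2 / sPlus P d) • (v * Dc h i (Dc h j v)
          - ((1 : Mat d) i j / d) • ∑ k, v * Dc h k (Dc h k v))
      + (2 * P.B0 * P.q ^ 4 / sPlus P d ^ 2) • (v * (v * entry X i j)) := by
  ext p
  have hXX : (X p * X p) i j = ∑ k, entry X i k p * entry X k j p := by
    simp [Matrix.mul_apply, entry]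
  have ht := trace_sq_apply X p
  have hD : ((v p) • hessH h v p).trace = ∑ k, v p * Dc h k (Dc h k v) p := by
    simp [Matrix.trace, hessH]
  have hc : (∑ k, ∑ l, entry X k l * entry X l k * entry X i j) p = trSq X p * X p i j := by
    simp [trSq, Finset.sum_apply, sum_mul, entry]
  simp only [entry, HH, HVar, Matrix.add_apply, Matrix.sub_apply, Matrix.smul_apply, smul_eq_mul,
    hXX, ht, hD, Pi.add_apply, Pi.sub_apply, Pi.smul_apply, Pi.mul_apply, Finset.sum_apply]
  have hc' : ∑ x, ∑ x_1, X p x x_1 * X p x_1 x * X p i j = trSq X p * X p i j := by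
    rw [← hc]; simp [entry, Finset.sum_apply]
  rw [hc']
  simp only [hessH, Matrix.of_apply]
  ring

/-- The discrete tensor variation is Lipschitz from `H¹ × H²` to `L²`. -/
theorem HH_lipschitz (P : Params) (hL : 0 < L) (hd : d = 2 ∨ d = 3) (hR : 0 ≤ R) :
    ∃ C, 0 ≤ C ∧ ∀ (c : Cfg d L R) (i j : Fin d),
      N0 c.h (entry (HH P c.h c.X c.v) i j - entry (HH P c.h c.X' c.v') i j) ≤ C * c.δ := by
  have key : ∀ i j, Pair0 (fun c : Cfg d L R => entry (HH P c.h c.X c.v) i j)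
      (fun c => entry (HH P c.h c.X' c.v') i j) := by
    intro i j; have hX := pair1_entry (d := d) (L := L) (R := R) hL hR
    have hv := pairSup_v (d := d) (L := L) (R := R) hL hd hR
    have hD := pair0_hess (d := d) (L := L) (R := R) hL hR
    have htr : Pair0 (fun c : Cfg d L R => trSq c.X) (fun c => trSq c.X') := by
      unfold trSq; exact PairIn.sum _ fun k => PairIn.sum _ fun l => (hX k l).mul hL hd (hX l k)
    simp only [entry_HH]; refine PairIn.add (PairIn.add (PairIn.add (PairIn.sub ?_ ?_) ?_) ?_) ?_
    · exact ((hX i j).pair0 hL).smul _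
    · exact ((PairIn.sum _ fun k => (hX i k).mul hL hd (hX k j)).sub (htr.smul _)).smul _
    · exact (PairIn.sum _ fun k => PairIn.sum _ fun l =>
        (hX k l).mul_mul hL hd (hX l k) (hX i j)).smul _
    · exact ((hv.mul_pair0 hL (hD i j)).sub
        ((PairIn.sum _ fun k => hv.mul_pair0 hL (hD k k)).smul _)).smul _
    · exact (hv.mul_pair0 hL (hv.mul_pair0 hL ((hX i j).pair0 hL))).smul _
  choose C hC hCC using key
  refine ⟨∑ i, ∑ j, C i j, sum_nonneg fun i _ => sum_nonneg fun j _ => hC i j,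
    fun c i j => ?_⟩
  exact (hCC i j c).2.2.trans (mul_le_right (le_sum_sum hC i j) c.δ_nonneg)

/-- Entries of `M` along a grid tensor. -/
def Ment (P : Params) {J : ℕ} (X : Grid d J → Mat d) (k l : Fin d) : GridFun d J :=
  (sPlus P d)⁻¹ • entry X k l + ((d : ℝ)⁻¹ * (1 : Mat d) k l) • (1 : GridFun d J)

theorem Mten_apply (P : Params) {J : ℕ} (X : Grid d J → Mat d) (k l : Fin d) (p : Grid d J) :
    Mten P (X p) k l = Ment P X k l p := by
  simp [Mten, Ment, entry]

theorem pair1_Ment (P : Params) (hL : 0 < L) (hR : 0 ≤ R) (k l : Fin d) :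
    Pair1 (fun c : Cfg d L R => Ment P c.X k l) (fun c => Ment P c.X' k l) :=
  ((pair1_entry hL hR k l).smul _).add ((Pair1.one hL).smul _)

theorem E1h_eq (P : Params) {J : ℕ} [NeZero J] (h : ℝ) (X : Grid d J → Mat d) (v : GridFun d J) :
    E1h P h X v = 2 * P.B0 * P.q ^ 2 * ∑ k, ∑ l, ip h (Dc h k (Dc h l v)) (v * Ment P X k l)
      + P.B0 * P.q ^ 4 * ∑ k, ∑ l, ip h (v * Ment P X k l) (v * Ment P X k l)
      + (P.A / 2 * ∑ k, ∑ l, ip h (entry X k l) (entry X l k)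
      + -(P.B / 3) * ∑ k, ∑ l, ip h (∑ m, entry X k m * entry X m l) (entry X l k)
      + P.C / 4 * ip h (trSq X) (trSq X))
      + (P.a / 2 * ip h v v + P.b / 3 * ip h (v * v) v + P.c / 4 * ip h (v * v) (v * v)) := by
  have e1 : ∑ k, ∑ l, ip h (Dc h k (Dc h l v)) (v * Ment P X k l)
      = h ^ d * ∑ p, frob (hessH h v p) (v p • Mten P (X p)) := by
    simp only [ip, ← mul_sum, frob]
    congr 1
    rw [sum_congr rfl fun k _ => sum_comm, sum_comm]; simp [hessH, Mten_apply]
  have e2 : ∑ k, ∑ l, ip h (v * Ment P X k l) (v * Ment P X k l)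
      = h ^ d * ∑ p, frob (v p • Mten P (X p)) (v p • Mten P (X p)) := by
    simp only [ip, ← mul_sum, frob]
    congr 1
    rw [sum_congr rfl fun k _ => sum_comm, sum_comm]; simp [Mten_apply]
  have e3 : ∑ k, ∑ l, ip h (entry X k l) (entry X l k) = h ^ d * ∑ p, (X p * X p).trace := by
    simp only [ip, ← mul_sum]
    congr 1
    rw [sum_congr rfl fun k _ => sum_comm, sum_comm]; simp [Matrix.trace, Matrix.mul_apply, entry]
  have e4 : ∑ k, ∑ l, ip h (∑ m, entry X k m * entry X m l) (entry X l k)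
      = h ^ d * ∑ p, (X p * X p * X p).trace := by
    simp only [ip, ← mul_sum]
    congr 1
    rw [sum_congr rfl fun k _ => sum_comm, sum_comm]
    simp [Matrix.trace, Matrix.mul_apply, entry, Finset.sum_apply]
  have e5 : ip h (trSq X) (trSq X) = h ^ d * ∑ p, (X p * X p).trace ^ 2 := by
    simp only [ip, trace_sq_apply, pow_two]
  rw [e1, e2, e3, e4, e5]
  simp only [ip, E1h, e1Density, fbn, fs, sum_add_distrib, sum_sub_distrib,
    ← mul_sum, Pi.mul_apply]
  have q2 : ∑ p, v p ^ 2 = ∑ p, v p * v p := by simp only [pow_two]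
  have q3 : ∑ p, v p ^ 3 = ∑ p, v p * v p * v p := sum_congr rfl fun p _ => by ring
  have q4 : ∑ p, v p ^ 4 = ∑ p, v p * v p * (v p * v p) := sum_congr rfl fun p _ => by ring
  rw [q2, q3, q4]
  ring

/-- The discrete energy is Lipschitz in `H¹ × H²`. -/
theorem E1h_lipschitz (P : Params) (hL : 0 < L) (hd : d = 2 ∨ d = 3) (hR : 0 ≤ R) :
    ∃ C, 0 ≤ C ∧ ∀ (c : Cfg d L R), |E1h P c.h c.X c.v - E1h P c.h c.X' c.v'| ≤ C * c.δ := by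
  have hX := pair1_entry (d := d) (L := L) (R := R) hL hR
  have hv := pairSup_v (d := d) (L := L) (R := R) hL hd hR
  have hD := pair0_hess (d := d) (L := L) (R := R) hL hR
  have hM := fun k l => (pair1_Ment (d := d) (L := L) (R := R) P hL hR k l).pair0 hL
  have hvM := fun k l => hv.mul_pair0 hL (hM k l)
  have htr : Pair0 (fun c : Cfg d L R => trSq c.X) (fun c => trSq c.X') := by
    unfold trSq; exact PairIn.sum _ fun k => PairIn.sum _ fun l => (hX k l).mul hL hd (hX l k)
  have hv0 := hv.pair0 hL
  have hvv := (hv.mul hv).pair0 hL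
  have key : LipScalar (fun c : Cfg d L R => E1h P c.h c.X c.v)
      (fun c => E1h P c.h c.X' c.v') := by
    simp only [E1h_eq]
    refine ((LipScalar.add (LipScalar.mul_left _ ?_) (LipScalar.mul_left _ ?_)).add
      ((LipScalar.add (LipScalar.mul_left _ ?_) (LipScalar.mul_left _ ?_)).add
        (LipScalar.mul_left _ ?_))).add
      ((LipScalar.add (LipScalar.mul_left _ ?_) (LipScalar.mul_left _ ?_)).add
        (LipScalar.mul_left _ ?_))
    · exact LipScalar.sum _ fun k => LipScalar.sum _ fun l => (hD k l).ip hL (hvM k l)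
    · exact LipScalar.sum _ fun k => LipScalar.sum _ fun l => (hvM k l).ip hL (hvM k l)
    · exact LipScalar.sum _ fun k => LipScalar.sum _ fun l =>
        ((hX k l).pair0 hL).ip hL ((hX l k).pair0 hL)
    · refine LipScalar.sum _ fun k => LipScalar.sum _ fun l => ?_
      have : Pair0 (fun c : Cfg d L R => ∑ m, entry c.X k m * entry c.X m l)
          (fun c => ∑ m, entry c.X' k m * entry c.X' m l) :=
        PairIn.sum _ fun m => (hX k m).mul hL hd (hX m l)
      exact this.ip hL ((hX l k).pair0 hL)
    · exact htr.ip hL htr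
    · exact hv0.ip hL hv0
    · exact hvv.ip hL hv0
    · exact hvv.ip hL hvv
  exact key

end Nonlinear

/-! ### The variation in the scalar field -/

section MuVariation


variable {d : ℕ} {L R : ℝ}

theorem muH_eq (P : Params) {J : ℕ} [NeZero J] (h : ℝ) (X : Grid d J → Mat d) (v : GridFun d J) :
    muH P h X v = P.a • v + P.b • (v * v) + P.c • (v * (v * v))
      + (2 * P.B0 * P.q ^ 2) • ∑ k, ∑ l, Ment P X k l * Dc h k (Dc h l v)
      + (2 * P.B0 * P.q ^ 2) • ∑ k, ∑ l, Dc h k (Dc h l (v * Ment P X k l))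
      + (2 * P.B0 * P.q ^ 4) • ∑ k, ∑ l, v * (Ment P X k l * Ment P X k l) := by
  ext p
  have e2 : divDivH h (fun r => v r • Mten P (X r)) p
      = ∑ k, ∑ l, Dc h k (Dc h l (v * Ment P X k l)) p := by
    unfold divDivH; refine sum_congr rfl fun k _ => sum_congr rfl fun l _ => ?_
    have : (fun r => (v r • Mten P (X r)) k l) = v * Ment P X k l := by
      ext r; simp [Mten_apply]
    rw [this]
  simp only [muH, muVar, e2, frob, Mten_apply, hessH, Matrix.of_apply, Pi.add_apply, Pi.smul_apply,
    Pi.mul_apply, smul_eq_mul, Finset.sum_apply, ← mul_sum]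
  ring

/-- The part of the difference of the scalar variations that is not controlled in `L²` by the
`H¹ × H²` distance. -/
def muRough (P : Params) {J : ℕ} [NeZero J] (h : ℝ) (X X' : Grid d J → Mat d)
    (v v' : GridFun d J) : GridFun d J :=
  (2 * P.B0 * P.q ^ 2 * (sPlus P d)⁻¹) • ∑ k, ∑ l,
    ((entry X k l - entry X' k l) * Dc h k (Dc h l (v - v'))
      + Dc h k (Dc h l (v * (entry X k l - entry X' k l))))

theorem muH_sub_eq (P : Params) {J : ℕ} [NeZero J] (h : ℝ) (X X' : Grid d J → Mat d)
    (v v' : GridFun d J) :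
    muH P h X v - muH P h X' v' - muRough P h X X' v v'
      = ((P.a • v + P.b • (v * v) + P.c • (v * (v * v)))
          - (P.a • v' + P.b • (v' * v') + P.c • (v' * (v' * v'))))
        + (2 * P.B0 * P.q ^ 2) • ∑ k, ∑ l,
          (Ment P X' k l * Dc h k (Dc h l (v - v'))
            + (sPlus P d)⁻¹ • ((entry X k l - entry X' k l) * Dc h k (Dc h l v'))
            + Dc h k (Dc h l ((v - v') * Ment P X' k l)))
        + (2 * P.B0 * P.q ^ 4) • ((∑ k, ∑ l, v * (Ment P X k l * Ment P X k l))
          - ∑ k, ∑ l, v' * (Ment P X' k l * Ment P X' k l)) := by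
  have hM : ∀ k l, Ment P X k l = Ment P X' k l + (sPlus P d)⁻¹ • (entry X k l - entry X' k l) := by
    intro k l; unfold Ment; rw [smul_sub]; abel
  have e1 : ∀ k l, Ment P X k l * Dc h k (Dc h l v) = Ment P X' k l * Dc h k (Dc h l v')
      + Ment P X' k l * Dc h k (Dc h l (v - v'))
      + (sPlus P d)⁻¹ • ((entry X k l - entry X' k l) * Dc h k (Dc h l v'))
      + (sPlus P d)⁻¹ • ((entry X k l - entry X' k l) * Dc h k (Dc h l (v - v'))) := by
    intro k l; rw [hM, map_sub, map_sub]; simp only [Algebra.smul_def]; ring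
  have e2 : ∀ k l, Dc h k (Dc h l (v * Ment P X k l)) = Dc h k (Dc h l (v' * Ment P X' k l))
      + Dc h k (Dc h l ((v - v') * Ment P X' k l))
      + (sPlus P d)⁻¹ • Dc h k (Dc h l (v * (entry X k l - entry X' k l))) := by
    intro k l; rw [hM, ← map_smul, ← map_smul, ← map_add, ← map_add, ← map_add, ← map_add]
    congr 2
    simp only [Algebra.smul_def]; ring
  rw [muH_eq, muH_eq, muRough]
  simp only [e1, e2, sum_add_distrib, smul_add, smul_sub, mul_smul, ← Finset.smul_sum]
  abel

theorem N0_sum_sum_le {J : ℕ} [NeZero J] {h : ℝ} {F : Fin d → Fin d → GridFun d J} {M : ℝ}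
    (hF : ∀ k l, N0 h (F k l) ≤ M) : N0 h (∑ k, ∑ l, F k l) ≤ d ^ 2 * M := by
  refine (N0_sum_le _ _).trans ?_
  calc ∑ k, N0 h (∑ l, F k l) ≤ ∑ _k : Fin d, ∑ _l : Fin d, M :=
        sum_le_sum fun k _ => (N0_sum_le _ _).trans (sum_le_sum fun l _ => hF k l)
    _ = _ := by simp; ring

theorem abs_Ment_le (P : Params) (c : Cfg d L R) (k l : Fin d) (p : Grid d c.J) :
    |Ment P c.X' k l p| ≤ |(sPlus P d)⁻¹| * R + |(d : ℝ)⁻¹| := by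
  unfold Ment
  simp only [Pi.add_apply, Pi.smul_apply, smul_eq_mul, Pi.one_apply, mul_one]
  refine (abs_add_le _ _).trans (add_le_add ?_ ?_)
  · rw [abs_mul]; exact mul_le_left (c.X'_sup k l p) (abs_nonneg _)
  · rw [abs_mul]
    refine mul_le_of_le_one_right (abs_nonneg _) ?_; rw [Matrix.one_apply]; split_ifs <;> simp

theorem lapOp_one {J : ℕ} [NeZero J] {h : ℝ} : lapOp h (1 : GridFun d J) = 0 := by
  rw [lapOp_apply]
  refine Finset.sum_eq_zero fun k _ => ?_
  rw [Dm_eq, Dp_one, map_zero, map_zero]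

theorem N2_one {J : ℕ} [NeZero J] {L h : ℝ} (hL : 0 ≤ L) (hh : h = L / J) :
    N2 h (1 : GridFun d J) ≤ √(L ^ d) := by
  have h0 : 0 ≤ h := by rw [hh]; positivity
  refine le_of_sq_le_sq ?_ (sqrt_nonneg _)
  rw [N2_sq' h0, lapOp_one, map_zero]
  simpa using pow_le_pow_left₀ (apply_nonneg _ _) (N1_one (d := d) (J := J) hL hh) 2

theorem N2_Ment_le (P : Params) (hL : 0 < L) (c : Cfg d L R) (k l : Fin d) :
    N2 c.h (Ment P c.X' k l) ≤ |(sPlus P d)⁻¹| * R + |(d : ℝ)⁻¹| * √(L ^ d) := by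
  unfold Ment
  refine (map_add_le_add _ _ _).trans (add_le_add ?_ ?_)
  · rw [map_smul_eq_mul]
    exact mul_le_left (c.X'_bd k l) (norm_nonneg _)
  · rw [map_smul_eq_mul]
    refine mul_le_mul ?_ (N2_one hL.le c.hh) (apply_nonneg _ _) (abs_nonneg _)
    rw [norm_eq_abs, abs_mul]; refine mul_le_of_le_one_right (abs_nonneg _) ?_
    rw [Matrix.one_apply]; split_ifs <;> simp

/-- Up to the rough part, the scalar variation is Lipschitz from `H¹ × H²` to `L²`. -/
theorem muH_lipschitz (P : Params) (hL : 0 < L) (hd : d = 2 ∨ d = 3) (hR : 0 ≤ R) :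
    ∃ C, 0 ≤ C ∧ ∀ (c : Cfg d L R),
      N0 c.h (muH P c.h c.X c.v - muH P c.h c.X' c.v' - muRough P c.h c.X c.X' c.v c.v')
        ≤ C * c.δ := by
  have hv := pairSup_v (d := d) (L := L) (R := R) hL hd hR
  have hv0 := hv.pair0 hL
  have hM := pair1_Ment (d := d) (L := L) (R := R) P hL hR
  have p1 : Pair0 (fun c : Cfg d L R => P.a • c.v + P.b • (c.v * c.v) + P.c • (c.v * (c.v * c.v)))
      (fun c => P.a • c.v' + P.b • (c.v' * c.v') + P.c • (c.v' * (c.v' * c.v'))) :=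
    ((hv0.smul _).add (((hv.mul hv).pair0 hL).smul _)).add
      (((hv.mul (hv.mul hv)).pair0 hL).smul _)
  have p3 : Pair0 (fun c : Cfg d L R => ∑ k, ∑ l, c.v * (Ment P c.X k l * Ment P c.X k l))
      (fun c => ∑ k, ∑ l, c.v' * (Ment P c.X' k l * Ment P c.X' k l)) :=
    PairIn.sum _ fun k => PairIn.sum _ fun l => hv.mul_pair0 hL ((hM k l).mul hL hd (hM k l))
  obtain ⟨C1, hC1, h1⟩ := p1
  obtain ⟨C3, hC3, h3⟩ := p3
  obtain ⟨A, hA, halg⟩ := N0_Dc_Dc_mul_le (d := d) hL hd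
  set m0 := |(sPlus P d)⁻¹| * R + |(d : ℝ)⁻¹| with hm0
  set m2 := |(sPlus P d)⁻¹| * R + |(d : ℝ)⁻¹| * √(L ^ d) with hm2
  have hm0' : 0 ≤ m0 := by positivity
  have hm2' : 0 ≤ m2 := by positivity
  refine ⟨C1 + |2 * P.B0 * P.q ^ 2| * (d ^ 2 * (m0 + |(sPlus P d)⁻¹| * R + A * m2))
    + |2 * P.B0 * P.q ^ 4| * C3, by positivity, fun c => ?_⟩
  have h0 := h_nonneg hL c
  have hδ := c.δ_nonneg
  rw [muH_sub_eq]
  refine (map_add_le_add _ _ _).trans ?_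
  refine (add_le_add (map_add_le_add _ _ _) le_rfl).trans ?_
  rw [map_smul_eq_mul, map_smul_eq_mul]
  have t : ∀ k l, N0 c.h (Ment P c.X' k l * Dc c.h k (Dc c.h l (c.v - c.v'))
            + (sPlus P d)⁻¹ • ((entry c.X k l - entry c.X' k l) * Dc c.h k (Dc c.h l c.v'))
            + Dc c.h k (Dc c.h l ((c.v - c.v') * Ment P c.X' k l)))
      ≤ (m0 + |(sPlus P d)⁻¹| * R + A * m2) * c.δ := by
    intro k l; refine (map_add_le_add _ _ _).trans ?_
    refine (add_le_add (map_add_le_add _ _ _) le_rfl).trans ?_; rw [add_mul, add_mul]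
    refine add_le_add (add_le_add ?_ ?_) ?_
    · refine (N0_mul_le h0 (abs_Ment_le P c k l)).trans ?_
      exact mul_le_left ((N0_Dc_Dc_le_N2 h0 k l _).trans c.v_sub) hm0'
    · rw [map_smul_eq_mul, mul_assoc]
      refine mul_le_left ?_ (norm_nonneg _); rw [mul_comm]
      refine (N0_mul_le h0 (c.hess_sup k l)).trans ?_
      exact mul_le_left ((N0_le_N1 h0 _).trans (c.X_sub k l)) hR
    · refine (halg c.J c.h c.hh _ _ k l).trans ?_
      have e1 := c.v_sub; have e2 := N2_Ment_le P hL c k l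
      calc A * (N2 c.h (c.v - c.v') * N2 c.h (Ment P c.X' k l)) ≤ A * (c.δ * m2) := by gcongr
        _ = _ := by ring
  have t2 := N0_sum_sum_le t
  have e1 := (h1 c).2.2
  have e3 := (h3 c).2.2
  have e2' := mul_le_left t2 (norm_nonneg (2 * P.B0 * P.q ^ 2))
  have e3' := mul_le_left e3 (norm_nonneg (2 * P.B0 * P.q ^ 4))
  simp only [norm_eq_abs] at *
  calc _ ≤ C1 * c.δ + |2 * P.B0 * P.q ^ 2| * (d ^ 2 * ((m0 + |(sPlus P d)⁻¹| * R + A * m2) * c.δ))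
        + |2 * P.B0 * P.q ^ 4| * (C3 * c.δ) := add_le_add (add_le_add e1 e2') e3'
    _ = _ := by ring

/-- The rough part is controlled in `L²` by the `H²` norm of the tensor error. -/
theorem muRough_le (P : Params) (hL : 0 < L) (hd : d = 2 ∨ d = 3) (hR : 0 ≤ R) :
    ∃ C, 0 ≤ C ∧ ∀ (c : Cfg d L R) (y : ℝ), (∀ i j, N2 c.h (entry c.X i j - entry c.X' i j) ≤ y) →
      N0 c.h (muRough P c.h c.X c.X' c.v c.v') ≤ C * y := by
  obtain ⟨A, hA, halg⟩ := N0_Dc_Dc_mul_le (d := d) hL hd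
  obtain ⟨S, hS, hsup⟩ := abs_le_N2 (d := d) hL (by omega)
  refine ⟨|2 * P.B0 * P.q ^ 2 * (sPlus P d)⁻¹| * (d ^ 2 * (S + A * (R + 1))), by positivity,
    fun c y hy => ?_⟩
  have h0 := h_nonneg hL c
  have hδ := c.δ_nonneg
  have hi : Fin d := ⟨0, by omega⟩
  have hy0 : 0 ≤ y := (apply_nonneg _ _).trans (hy hi hi)
  have hvN : N2 c.h c.v ≤ R + 1 := by
    have : c.v = (c.v - c.v') + c.v' := by abel
    rw [this]; have := map_add_le_add (N2 c.h) (c.v - c.v') c.v'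
    linarith [c.v_sub, c.v'_bd, c.δ_le]
  unfold muRough
  rw [map_smul_eq_mul, norm_eq_abs]
  have t : ∀ k l, N0 c.h ((entry c.X k l - entry c.X' k l) * Dc c.h k (Dc c.h l (c.v - c.v'))
      + Dc c.h k (Dc c.h l (c.v * (entry c.X k l - entry c.X' k l))))
      ≤ (S + A * (R + 1)) * y := by
    intro k l; refine (map_add_le_add _ _ _).trans ?_; rw [add_mul]; refine add_le_add ?_ ?_
    · refine (N0_mul_le h0 (hsup c.J c.h c.hh _)).trans ?_
      have e1 := (N0_Dc_Dc_le_N2 h0 k l (c.v - c.v')).trans (c.v_sub.trans c.δ_le)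
      have e2 := hy k l; have e3 : 0 ≤ N2 c.h (entry c.X k l - entry c.X' k l) := apply_nonneg _ _
      calc S * N2 c.h (entry c.X k l - entry c.X' k l) * N0 c.h (Dc c.h k (Dc c.h l (c.v - c.v')))
          ≤ S * N2 c.h (entry c.X k l - entry c.X' k l) * 1 := by gcongr
        _ ≤ S * y := by rw [mul_one]; gcongr
    · refine (halg c.J c.h c.hh _ _ k l).trans ?_
      have e2 := hy k l
      calc A * (N2 c.h c.v * N2 c.h (entry c.X k l - entry c.X' k l)) ≤ A * ((R + 1) * y) := by
            gcongr
        _ = _ := by ring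
  calc _ ≤ |2 * P.B0 * P.q ^ 2 * (sPlus P d)⁻¹| * (d ^ 2 * ((S + A * (R + 1)) * y)) :=
        mul_le_left (N0_sum_sum_le t) (abs_nonneg _)
    _ = _ := by ring

/-- The rough part is controlled by duality with `H²`. -/
theorem ip_muRough_le (P : Params) (hL : 0 < L) (hd : d = 2 ∨ d = 3) (hR : 0 ≤ R) :
    ∃ C, 0 ≤ C ∧ ∀ (c : Cfg d L R) (w : GridFun d c.J),
      |ip c.h (muRough P c.h c.X c.X' c.v c.v') w| ≤ C * c.δ * N2 c.h w := by
  obtain ⟨S, hS, hsup⟩ := abs_le_N2 (d := d) hL (by omega)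
  obtain ⟨V, hV, hvsup⟩ := pairSup_v (d := d) (L := L) (R := R) hL hd hR
  refine ⟨|2 * P.B0 * P.q ^ 2 * (sPlus P d)⁻¹| * (d ^ 2 * (S + V)), by positivity, fun c w => ?_⟩
  have h0 := h_nonneg hL c
  have hδ := c.δ_nonneg
  have hw : 0 ≤ N2 c.h w := apply_nonneg _ _
  unfold muRough
  rw [ip_smul_left, abs_mul, ip_sum_left]
  simp only [ip_sum_left]
  have t : ∀ k l, |ip c.h ((entry c.X k l - entry c.X' k l) * Dc c.h k (Dc c.h l (c.v - c.v'))
      + Dc c.h k (Dc c.h l (c.v * (entry c.X k l - entry c.X' k l)))) w|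
      ≤ (S + V) * (c.δ * N2 c.h w) := by
    intro k l; rw [ip_add_left, add_mul]; refine (abs_add_le _ _).trans (add_le_add ?_ ?_)
    · have e : ip c.h ((entry c.X k l - entry c.X' k l) * Dc c.h k (Dc c.h l (c.v - c.v'))) w
          = ip c.h (Dc c.h k (Dc c.h l (c.v - c.v'))) (w * (entry c.X k l - entry c.X' k l)) := by
        simp only [ip, Pi.mul_apply]
        congr 1
        exact sum_congr rfl fun p _ => by ring
      rw [e]; refine (abs_ip_le h0 _ _).trans ?_
      have e1 := (N0_Dc_Dc_le_N2 h0 k l (c.v - c.v')).trans c.v_sub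
      have e2 := N0_mul_le h0 (g := entry c.X k l - entry c.X' k l) (hsup c.J c.h c.hh w)
      have e3 := (N0_le_N1 h0 _).trans ((c.X_sub k l).trans c.δ_le)
      have e4 : N0 c.h (w * (entry c.X k l - entry c.X' k l)) ≤ S * N2 c.h w * 1 :=
        e2.trans (mul_le_left e3 (by positivity))
      calc _ ≤ c.δ * (S * N2 c.h w * 1) := mul_le_mul e1 e4 (apply_nonneg _ _) hδ
        _ = _ := by ring
    · rw [ip_Dc_Dc]
      refine (abs_ip_le h0 _ _).trans ?_; have e1 := N0_Dc_Dc_le_N2 h0 k l w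
      have e2 := N0_mul_le h0 (g := entry c.X k l - entry c.X' k l) (fun p => (hvsup c p).1)
      have e3 := (N0_le_N1 h0 _).trans (c.X_sub k l); have e4 := e2.trans (mul_le_left e3 hV)
      calc _ ≤ V * c.δ * N2 c.h w := mul_le_mul e4 e1 (apply_nonneg _ _) (by positivity)
        _ = _ := by ring
  have t2 : |∑ k, ∑ l,
      ip c.h ((entry c.X k l - entry c.X' k l) * Dc c.h k (Dc c.h l (c.v - c.v'))
      + Dc c.h k (Dc c.h l (c.v * (entry c.X k l - entry c.X' k l)))) w|
      ≤ d ^ 2 * ((S + V) * (c.δ * N2 c.h w)) := by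
    refine (abs_sum_le_sum_abs _ _).trans ?_
    calc _ ≤ ∑ _k : Fin d, ∑ _l : Fin d, (S + V) * (c.δ * N2 c.h w) :=
          sum_le_sum fun k _ => (abs_sum_le_sum_abs _ _).trans
            (sum_le_sum fun l _ => t k l)
      _ = _ := by simp; ring
  calc _ ≤ |2 * P.B0 * P.q ^ 2 * (sPlus P d)⁻¹| * (d ^ 2 * ((S + V) * (c.δ * N2 c.h w))) :=
        mul_le_left t2 (abs_nonneg _)
    _ = _ := by ring

end MuVariation

/-! ### Energy estimates for linear evolution equations on the grid -/

section Energy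


open Filter Topology

/-- Grönwall's inequality in differential form. -/
theorem gronwall_Icc {ψ ψ' : ℝ → ℝ} {a b c β : ℝ} (hab : a ≤ b) (hc : 0 ≤ c) (hβ : 0 ≤ β)
    (hψ : ∀ t ∈ Icc a b, HasDerivWithinAt ψ (ψ' t) (Icc a b) t)
    (hle : ∀ t ∈ Icc a b, ψ' t ≤ c * ψ t + β) :
    ψ b ≤ exp (c * (b - a)) * (ψ a + β * (b - a)) := by
  set f : ℝ → ℝ := fun t => exp (-(c * (t - a))) * ψ t - β * (t - a) with hf
  have hE : ∀ t, HasDerivAt (fun t => exp (-(c * (t - a))))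
      (exp (-(c * (t - a))) * (-c)) t := by
    intro t
    have : HasDerivAt (fun t => -(c * (t - a))) (-c) t := by
      have := ((hasDerivAt_id t).sub_const a).const_mul (-c); simp only [mul_one] at this
      exact this.congr_of_eventuallyEq (Filter.Eventually.of_forall fun y => by simp)
    exact this.exp
  have hder : ∀ t ∈ Icc a b, HasDerivWithinAt f
      (exp (-(c * (t - a))) * (-c) * ψ t + exp (-(c * (t - a))) * ψ' t - β)
      (Icc a b) t := by
    intro t ht; have h1 := ((hE t).hasDerivWithinAt (s := Icc a b)).mul (hψ t ht)
    have h2 : HasDerivWithinAt (fun t => β * (t - a)) β (Icc a b) t := by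
      have := ((hasDerivWithinAt_id t (Icc a b)).sub_const a).const_mul β; simpa using this
    exact h1.sub h2
  have hanti : AntitoneOn f (Icc a b) := by
    refine antitoneOn_of_deriv_nonpos (convex_Icc a b)
      (fun t ht => (hder t ht).continuousWithinAt) ?_ ?_
    · intro t ht
      have ht' := interior_subset ht
      exact ((hder t ht').differentiableWithinAt).mono interior_subset
    · intro t ht
      have ht' := interior_subset ht
      rw [((hder t ht').hasDerivAt (mem_interior_iff_mem_nhds.mp ht)).deriv]; have h1 := hle t ht'
      have h2 : exp (-(c * (t - a))) ≤ 1 := by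
        rw [Real.exp_le_one_iff]; have : 0 ≤ c * (t - a) := mul_nonneg hc (by linarith [ht'.1])
        linarith
      have h3 := exp_pos (-(c * (t - a))); nlinarith
  have := hanti (left_mem_Icc.mpr hab) (right_mem_Icc.mpr hab) hab
  simp only [hf, sub_self, mul_zero, neg_zero, Real.exp_zero, one_mul, sub_zero] at this
  have hpos := exp_pos (c * (b - a))
  have h4 : exp (c * (b - a)) * (exp (-(c * (b - a))) * ψ b) = ψ b := by
    rw [← mul_assoc, ← Real.exp_add]; simp
  rw [← h4]
  exact mul_le_left (by linarith) hpos.le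

/-- The indefinite integral of a function that is continuous on an interval. -/
theorem hasDerivWithinAt_integral_Icc {n : ℝ → ℝ} {a b : ℝ} (hab : a ≤ b)
    (hn : ContinuousOn n (Icc a b)) {t : ℝ} (ht : t ∈ Icc a b) :
    HasDerivWithinAt (fun t => ∫ s in a..t, n s) (n t) (Icc a b) t := by
  set m : ℝ → ℝ := IccExtend hab ((Icc a b).domRestrict n) with hm
  have hmc : Continuous m := continuous_IccExtend_iff.mpr (continuousOn_iff_continuous_domRestrict.mp hn)
  have hmn : ∀ s ∈ Icc a b, m s = n s := fun s hs => by
    rw [hm, IccExtend_of_mem hab _ hs]; rfl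
  have h1 : HasDerivWithinAt (fun t => ∫ s in a..t, m s) (m t) (Icc a b) t :=
    (hmc.integral_hasStrictDerivAt a t).hasDerivAt.hasDerivWithinAt
  rw [hmn t ht] at h1
  refine h1.congr (fun r hr => ?_) ?_
  · refine intervalIntegral.integral_congr fun s hs => ?_
    rw [uIcc_of_le hr.1] at hs; exact (hmn s ⟨hs.1, hs.2.trans hr.2⟩).symm
  · refine intervalIntegral.integral_congr fun s hs => ?_
    rw [uIcc_of_le ht.1] at hs; exact (hmn s ⟨hs.1, hs.2.trans ht.2⟩).symm

variable {d J : ℕ} [NeZero J] {h : ℝ}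

theorem HasDerivWithinAt.gridIp {F G : ℝ → GridFun d J} {F' G' : GridFun d J} {s : Set ℝ} {t : ℝ}
    (hF : HasDerivWithinAt F F' s t) (hG : HasDerivWithinAt G G' s t) :
    HasDerivWithinAt (fun t => ip h (F t) (G t)) (ip h F' (G t) + ip h (F t) G') s t := by
  have h1 := hasDerivWithinAt_pi.mp hF
  have h2 := hasDerivWithinAt_pi.mp hG
  have h3 := (HasDerivWithinAt.fun_sum (u := Finset.univ)
    fun p _ => (h1 p).mul (h2 p)).const_mul (h ^ d)
  refine h3.congr_deriv ?_
  simp only [ip, ← mul_add, ← sum_add_distrib]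

theorem continuousOn_ip {F G : ℝ → GridFun d J} {s : Set ℝ} (hF : ContinuousOn F s)
    (hG : ContinuousOn G s) : ContinuousOn (fun t => ip h (F t) (G t)) s := by
  unfold ip
  refine continuousOn_const.mul (continuousOn_finsetSum _ fun p _ => ?_)
  exact (continuousOn_pi.mp hF p).mul (continuousOn_pi.mp hG p)

theorem continuous_ip_self : Continuous (fun f : GridFun d J => ip h f f) := by
  unfold ip
  exact continuous_const.mul (continuous_finsetSum _ fun p _ =>
    (continuous_apply p).mul (continuous_apply p))

/-- The energy of a symmetric operator. -/
def energy (h : ℝ) (𝒜 : GridOp d J) (f : GridFun d J) : ℝ := ip h f f + ip h (𝒜 f) f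

theorem energy_sub_le (hh : 0 ≤ h) {𝒜 : GridOp d J} (hpos : ∀ f, 0 ≤ ip h (𝒜 f) f)
    (f g : GridFun d J) : energy h 𝒜 (f - g) ≤ 2 * energy h 𝒜 f + 2 * energy h 𝒜 g := by
  have h1 := ip_self_nonneg hh (f + g)
  have h2 := hpos (f + g)
  simp only [energy, map_add, map_sub, ip_add_left, ip_add_right, ip_sub_left, ip_sub_right] at *
  linarith

theorem energy_nonneg (hh : 0 ≤ h) {𝒜 : GridOp d J} (hpos : ∀ f, 0 ≤ ip h (𝒜 f) f)
    (f : GridFun d J) : 0 ≤ energy h 𝒜 f := add_nonneg (ip_self_nonneg hh f) (hpos f)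

/-- Differential inequality behind the energy estimates. -/
theorem energy_deriv_le (hh : 0 ≤ h) {𝒜 : GridOp d J}
    (hsymm : ∀ f g, ip h (𝒜 f) g = ip h f (𝒜 g))
    {E Ed G : ℝ → GridFun d J} {Y : GridFun d J} {a b : ℝ} (hab : a ≤ b)
    (hE : ∀ t ∈ Icc a b, HasDerivWithinAt E (Ed t) (Icc a b) t)
    (hEd : ContinuousOn Ed (Icc a b))
    (heq : ∀ t ∈ Icc a b, Ed t = -𝒜 (E t) + G t + Y) :
    ∃ ψ' : ℝ → ℝ, ∀ t ∈ Icc a b,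
      HasDerivWithinAt (fun t => energy h 𝒜 (E t) + (∫ s in a..t, ip h (Ed s) (Ed s))
        - 2 * ip h Y (E t - E a)) (ψ' t) (Icc a b) t ∧
      ψ' t ≤ 2 * ip h (E t) (E t) + 2 * ip h (G t) (G t) := by
  refine ⟨fun t => 2 * ip h (E t) (Ed t) + 2 * ip h (𝒜 (E t)) (Ed t) + ip h (Ed t) (Ed t)
    - 2 * ip h Y (Ed t), fun t ht => ⟨?_, ?_⟩⟩
  · have h1 := HasDerivWithinAt.gridIp (h := h) (hE t ht) (hE t ht)
    have h2 := HasDerivWithinAt.gridIp (h := h)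
      (𝒜.hasFDerivAt.comp_hasDerivWithinAt t (hE t ht)) (hE t ht)
    have h3 := hasDerivWithinAt_integral_Icc hab (continuousOn_ip (h := h) hEd hEd) ht
    have h4 := (HasDerivWithinAt.gridIp (h := h) (hasDerivWithinAt_const t (Icc a b) Y)
      ((hE t ht).sub_const (E a))).const_mul 2
    refine ((((h1.add h2).add h3).sub h4)).congr_deriv ?_
    have e1 : ip h (Ed t) (E t) = ip h (E t) (Ed t) := ip_comm _ _ _
    have e2 : ip h (𝒜 (Ed t)) (E t) = ip h (𝒜 (E t)) (Ed t) := by rw [hsymm, ip_comm]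
    have e3 : ip h (0 : GridFun d J) (E t - E a) = 0 := by simp [ip]
    simp only [Function.comp_apply] at *; rw [e1, e2, e3]; ring
  · have e : 𝒜 (E t) = G t + Y - Ed t := by rw [heq t ht]; abel
    have i1 := ip_self_nonneg hh ((2 : ℝ) • E t - Ed t)
    have i2 := ip_self_nonneg hh ((2 : ℝ) • G t - Ed t)
    beta_reduce
    rw [e]; simp only [ip_sub_left, ip_sub_right, ip_smul_left, ip_smul_right, ip_add_left] at *
    have c1 : ip h (Ed t) (E t) = ip h (E t) (Ed t) := ip_comm _ _ _
    have c2 : ip h (Ed t) (G t) = ip h (G t) (Ed t) := ip_comm _ _ _; rw [c1] at i1; rw [c2] at i2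
    nlinarith

/-- Energy estimate over one time step. -/
theorem energy_estimate (hh : 0 ≤ h) {𝒜 : GridOp d J}
    (hsymm : ∀ f g, ip h (𝒜 f) g = ip h f (𝒜 g)) (hpos : ∀ f, 0 ≤ ip h (𝒜 f) f)
    {E Ed G : ℝ → GridFun d J} {a b c β : ℝ} (hab : a ≤ b) (hc : 0 ≤ c) (hβ : 0 ≤ β)
    (hE : ∀ t ∈ Icc a b, HasDerivWithinAt E (Ed t) (Icc a b) t)
    (hEd : ContinuousOn Ed (Icc a b))
    (heq : ∀ t ∈ Icc a b, Ed t = -𝒜 (E t) + G t)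
    (hG : ∀ t ∈ Icc a b, ip h (G t) (G t) ≤ β + c * ip h (E t) (E t)) :
    energy h 𝒜 (E b) + ∫ s in a..b, ip h (Ed s) (Ed s)
      ≤ exp ((2 + 2 * c) * (b - a)) * (energy h 𝒜 (E a) + 2 * β * (b - a)) := by
  obtain ⟨ψ', hψ⟩ := energy_deriv_le hh hsymm hab (Y := 0) hE hEd
    (fun t ht => by rw [heq t ht, add_zero])
  have h0 : ∀ f : GridFun d J, ip h 0 f = 0 := fun f => by simp [ip]
  have := gronwall_Icc (c := 2 + 2 * c) (β := 2 * β) hab (by positivity) (by positivity)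
    (fun t ht => (hψ t ht).1) (fun t ht => (hψ t ht).2.trans ?_)
  · simpa [h0] using this
  · have h1 := hG t ht
    have h2 := hpos (E t)
    have h3 : 0 ≤ ∫ s in a..t, ip h (Ed s) (Ed s) :=
      intervalIntegral.integral_nonneg ht.1 fun s _ => ip_self_nonneg hh _
    simp only [h0, mul_zero, sub_zero, energy]; have h4 := ip_self_nonneg hh (E t)
    nlinarith [mul_nonneg hc h2, mul_nonneg hc h3]

/-- Energy estimate over one time step, with a rough time-independent source. -/
theorem energy_estimate_rough (hh : 0 ≤ h) {𝒜 : GridOp d J}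
    (hsymm : ∀ f g, ip h (𝒜 f) g = ip h f (𝒜 g)) (hpos : ∀ f, 0 ≤ ip h (𝒜 f) f)
    {E Ed G : ℝ → GridFun d J} {Y : GridFun d J} {a b c β : ℝ} (hab : a ≤ b) (hc : 0 ≤ c)
    (hβ : 0 ≤ β)
    (hE : ∀ t ∈ Icc a b, HasDerivWithinAt E (Ed t) (Icc a b) t)
    (hEd : ContinuousOn Ed (Icc a b))
    (heq : ∀ t ∈ Icc a b, Ed t = -𝒜 (E t) + G t + Y)
    (hG : ∀ t ∈ Icc a b, ip h (G t) (G t) ≤ β + c * ip h (E t) (E t))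
    (hY : ∀ w, ip h Y w ^ 2 ≤ β * energy h 𝒜 w) :
    energy h 𝒜 (E b) + ∫ s in a..b, ip h (Ed s) (Ed s)
      ≤ 2 * exp ((4 + 4 * c) * (b - a)) *
          (energy h 𝒜 (E a) + ((2 + 2 * c) * (8 * β + energy h 𝒜 (E a)) + 2 * β) * (b - a))
        + 8 * β + energy h 𝒜 (E a) := by
  obtain ⟨ψ', hψ⟩ := energy_deriv_le hh hsymm hab hE hEd heq
  have he0 := energy_nonneg hh hpos (E a)
  have hYb : ∀ t, 2 * ip h Y (E t - E a)
      ≤ 4 * β + energy h 𝒜 (E t) / 2 + energy h 𝒜 (E a) / 2 := by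
    intro t; have h1 := hY (E t - E a); have h2 := energy_sub_le hh hpos (E t) (E a)
    have h3 := mul_le_left h2 hβ; have e1 := energy_nonneg hh hpos (E t)
    have h5 : (ip h Y (E t - E a)) ^ 2
        ≤ (2 * β + (energy h 𝒜 (E t) + energy h 𝒜 (E a)) / 4) ^ 2 := by
      nlinarith [sq_nonneg (2 * β - (energy h 𝒜 (E t) + energy h 𝒜 (E a)) / 4)]
    have h6 := abs_le_of_sq_le_sq h5 (by positivity); have h7 := le_abs_self (ip h Y (E t - E a))
    linarith
  have hitg : ∀ t ∈ Icc a b, 0 ≤ ∫ s in a..t, ip h (Ed s) (Ed s) := fun t ht =>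
    intervalIntegral.integral_nonneg ht.1 fun s _ => ip_self_nonneg hh _
  have key := gronwall_Icc (c := 4 + 4 * c)
    (β := (2 + 2 * c) * (8 * β + energy h 𝒜 (E a)) + 2 * β) hab (by positivity) (by positivity)
    (fun t ht => (hψ t ht).1) (fun t ht => (hψ t ht).2.trans ?_)
  · have e0 : ip h Y (E a - E a) = 0 := by simp [ip]
    simp only [intervalIntegral.integral_same, e0, mul_zero, sub_zero, add_zero] at key
    have h1 := hYb b; have h2 := hitg b (right_mem_Icc.mpr hab); linarith
  · have h1 := hG t ht
    have h2 := hpos (E t); have h3 := hitg t ht; have h4 := hYb t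
    have h5 : energy h 𝒜 (E t) ≤ 2 * (energy h 𝒜 (E t) + (∫ s in a..t, ip h (Ed s) (Ed s))
        - 2 * ip h Y (E t - E a)) + 8 * β + energy h 𝒜 (E a) := by linarith
    have h6 : ip h (E t) (E t) ≤ energy h 𝒜 (E t) := by unfold energy; linarith
    have h7 := mul_le_left (h6.trans h5) (by positivity : 0 ≤ 2 + 2 * c); linarith

/-- The increment over a time step is controlled by the `L²` norm of the velocity. -/
theorem ip_increment_le (hh : 0 ≤ h) {E Ed : ℝ → GridFun d J} {a b : ℝ} (hab : a < b)
    (hE : ∀ t ∈ Icc a b, HasDerivWithinAt E (Ed t) (Icc a b) t)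
    (hEd : ContinuousOn Ed (Icc a b)) :
    ip h (E b - E a) (E b - E a) ≤ (b - a) * ∫ s in a..b, ip h (Ed s) (Ed s) := by
  set D := E b - E a with hD
  have hba : 0 < b - a := by linarith
  have hder : ∀ t ∈ Icc a b, HasDerivWithinAt (fun t => 2 * ip h D (E t - E a)
      - (b - a) * (∫ s in a..t, ip h (Ed s) (Ed s)) - (t - a) * (ip h D D / (b - a)))
      (2 * ip h D (Ed t) - (b - a) * ip h (Ed t) (Ed t) - ip h D D / (b - a)) (Icc a b) t := by
    intro t ht
    have h3 := (hasDerivWithinAt_integral_Icc hab.le (continuousOn_ip (h := h) hEd hEd) ht).const_mul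
      (b - a)
    have h4 := (HasDerivWithinAt.gridIp (h := h) (hasDerivWithinAt_const t (Icc a b) D)
      ((hE t ht).sub_const (E a))).const_mul 2
    have h5 := ((hasDerivWithinAt_id t (Icc a b)).sub_const a).mul_const (ip h D D / (b - a))
    refine ((h4.sub h3).sub h5).congr_deriv ?_
    have e3 : ip h (0 : GridFun d J) (E t - E a) = 0 := by simp [ip]
    rw [e3]; ring
  have key := gronwall_Icc (c := 0) (β := 0) hab.le le_rfl le_rfl hder (fun t ht => by
    have i1 := ip_self_nonneg hh ((b - a) • Ed t - D)
    simp only [ip_sub_left, ip_sub_right, ip_smul_left, ip_smul_right] at i1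
    rw [ip_comm h (Ed t) D] at i1; rw [zero_mul, zero_add]
    have e : 2 * ip h D (Ed t) - (b - a) * ip h (Ed t) (Ed t) - ip h D D / (b - a)
        = -(((b - a) * ((b - a) * ip h (Ed t) (Ed t)) - (b - a) * ip h D (Ed t)
          - ((b - a) * ip h D (Ed t) - ip h D D)) / (b - a)) := by
      field_simp; ring
    rw [e]
    exact neg_nonpos.mpr (div_nonneg (by linarith) hba.le))
  have e0 : ip h D 0 = 0 := by simp [ip]
  simp only [intervalIntegral.integral_same, mul_zero, zero_mul, sub_self, add_zero,
    Real.exp_zero, ← hD, e0] at key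
  have : (b - a) * (ip h D D / (b - a)) = ip h D D := by field_simp
  linarith

theorem tendsto_slope_right {E : ℝ → GridFun d J} {E' : GridFun d J} {a b t : ℝ}
    (ht : t ∈ Ico a b) (hE : HasDerivWithinAt E E' (Icc a b) t) :
    Tendsto (fun σ : ℝ => σ⁻¹ • (E (t + σ) - E t)) (𝓝[>] 0) (𝓝 E') := by
  have h1 : HasDerivWithinAt E E' (Ioi t) t :=
    hE.mono_of_mem_nhdsWithin (Icc_mem_nhdsGT_of_mem ht)
  rw [hasDerivWithinAt_iff_tendsto_slope' (by simp)] at h1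
  have h2 : Tendsto (fun σ : ℝ => t + σ) (𝓝[>] 0) (𝓝[>] t) := by
    refine tendsto_nhdsWithin_iff.mpr ⟨?_, ?_⟩
    · have : Tendsto (fun σ : ℝ => t + σ) (𝓝 0) (𝓝 (t + 0)) :=
        (continuous_const.add continuous_id).tendsto 0
      rw [add_zero] at this; exact this.mono_left nhdsWithin_le_nhds
    · filter_upwards [self_mem_nhdsWithin] with σ hσ
      simpa using hσ
  refine (h1.comp h2).congr fun σ => ?_
  simp [slope_def_module]

theorem tendsto_slope_left {E : ℝ → GridFun d J} {E' : GridFun d J} {a b t : ℝ}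
    (ht : t ∈ Ioc a b) (hE : HasDerivWithinAt E E' (Icc a b) t) :
    Tendsto (fun σ : ℝ => σ⁻¹ • (E t - E (t - σ))) (𝓝[>] 0) (𝓝 E') := by
  have h1 : HasDerivWithinAt E E' (Iio t) t :=
    hE.mono_of_mem_nhdsWithin (Icc_mem_nhdsLT_of_mem ht)
  rw [hasDerivWithinAt_iff_tendsto_slope' (by simp)] at h1
  have h2 : Tendsto (fun σ : ℝ => t - σ) (𝓝[>] 0) (𝓝[<] t) := by
    refine tendsto_nhdsWithin_iff.mpr ⟨?_, ?_⟩
    · have : Tendsto (fun σ : ℝ => t - σ) (𝓝 0) (𝓝 (t - 0)) :=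
        (continuous_const.sub continuous_id).tendsto 0
      rw [sub_zero] at this; exact this.mono_left nhdsWithin_le_nhds
    · filter_upwards [self_mem_nhdsWithin] with σ hσ
      simpa using hσ
  refine (h1.comp h2).congr fun σ => ?_
  simp only [Function.comp_apply, slope_def_module]
  rw [show t - σ - t = -σ by ring, inv_neg, neg_smul, ← smul_neg, neg_sub]

/-- The velocity at the end of a time step is controlled by earlier velocities when the source is
Lipschitz in time. -/
theorem end_velocity_le_of_mem (hh : 0 ≤ h) {𝓛 : GridOp d J} (hpos : ∀ f, 0 ≤ ip h (𝓛 f) f)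
    {E Ed g : ℝ → GridFun d J} {a b C : ℝ}
    (hE : ∀ t ∈ Icc a b, HasDerivWithinAt E (Ed t) (Icc a b) t)
    (heq : ∀ t ∈ Icc a b, Ed t = -𝓛 (E t) + g t)
    (hg : ∀ t ∈ Icc a b, ∀ s ∈ Icc a b, N0 h (g t - g s) ≤ C * |t - s|) {t : ℝ}
    (ht : t ∈ Ico a b) :
    ip h (Ed b) (Ed b) ≤ exp 1 * (ip h (Ed t) (Ed t) + C ^ 2 * (b - a) ^ 2) := by
  have hab : a < b := ht.1.trans_lt ht.2
  set τ := b - a with hτ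
  have hτ0 : 0 < τ := by rw [hτ]; linarith
  have step : ∀ σ ∈ Ioo 0 (b - t), ip h (σ⁻¹ • (E b - E (b - σ))) (σ⁻¹ • (E b - E (b - σ)))
      ≤ exp 1 * (ip h (σ⁻¹ • (E (t + σ) - E t)) (σ⁻¹ • (E (t + σ) - E t))
        + C ^ 2 * τ ^ 2) := by
    intro σ hσ; have hσ0 := hσ.1; have htb : t ≤ b - σ := by linarith [hσ.2]
    have hm1 : ∀ s ∈ Icc t (b - σ), s ∈ Icc a b := fun s hs =>
      ⟨ht.1.trans hs.1, by linarith [hs.2]⟩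
    have hm2 : ∀ s ∈ Icc t (b - σ), s + σ ∈ Icc a b := fun s hs =>
      ⟨by linarith [ht.1, hs.1], by linarith [hs.2]⟩
    have hD : ∀ s ∈ Icc t (b - σ), HasDerivWithinAt (fun s => E (s + σ) - E s)
        (Ed (s + σ) - Ed s) (Icc t (b - σ)) s := by
      intro s hs
      have h1 : HasDerivWithinAt (fun s => E (s + σ)) (Ed (s + σ)) (Icc t (b - σ)) s := by
        have := (hE (s + σ) (hm2 s hs)).scomp s
          ((hasDerivWithinAt_id s (Icc t (b - σ))).add_const σ) (fun r hr => hm2 r hr)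
        simpa [Function.comp_def] using this
      exact h1.sub ((hE s (hm1 s hs)).mono fun r hr => hm1 r hr)
    have key := gronwall_Icc (c := τ⁻¹) (β := τ * C ^ 2 * σ ^ 2) htb (by positivity) (by positivity)
      (fun s hs => HasDerivWithinAt.gridIp (h := h) (hD s hs) (hD s hs)) (fun s hs => by
        set D := E (s + σ) - E s with hDdef
        have e1 : Ed (s + σ) - Ed s = -𝓛 D + (g (s + σ) - g s) := by
          rw [heq _ (hm1 s hs), heq _ (hm2 s hs), hDdef, map_sub]; abel
        have e2 : ip h (Ed (s + σ) - Ed s) D = ip h D (Ed (s + σ) - Ed s) := ip_comm _ _ _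
        rw [e2, e1, ip_add_right, ip_neg_right, ip_comm h D (𝓛 D)]; have p1 := hpos D
        have p2 := ip_le hh D (g (s + σ) - g s); have p3 := hg _ (hm2 s hs) _ (hm1 s hs)
        rw [show s + σ - s = σ by ring, abs_of_pos hσ0] at p3; have p4 := N0_sq hh D
        have p5 : N0 h D * N0 h (g (s + σ) - g s) ≤ N0 h D * (C * σ) :=
          mul_le_left p3 (apply_nonneg _ _)
        have p6 : 2 * (N0 h D * (C * σ)) ≤ τ⁻¹ * N0 h D ^ 2 + τ * C ^ 2 * σ ^ 2 := by
          have := sq_nonneg (N0 h D - τ * (C * σ))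
          have e : τ⁻¹ * N0 h D ^ 2 + τ * C ^ 2 * σ ^ 2 - 2 * (N0 h D * (C * σ))
              = τ⁻¹ * (N0 h D - τ * (C * σ)) ^ 2 := by field_simp; ring
          have : 0 ≤ τ⁻¹ * (N0 h D - τ * (C * σ)) ^ 2 := by positivity
          linarith
        rw [p4] at p6
        linarith)
    simp only [sub_add_cancel] at key
    have hexp : exp (τ⁻¹ * (b - σ - t)) ≤ exp 1 := by
      rw [exp_le_exp, inv_mul_le_iff₀ hτ0]; linarith [ht.1]
    have hlen : τ * C ^ 2 * σ ^ 2 * (b - σ - t) ≤ σ ^ 2 * (C ^ 2 * τ ^ 2) := by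
      have : b - σ - t ≤ τ := by rw [hτ]; linarith [ht.1]
      have h0 : 0 ≤ τ * C ^ 2 * σ ^ 2 := by positivity
      nlinarith [mul_le_left this h0]
    have hN := ip_self_nonneg hh (E (t + σ) - E t)
    have hfin : ip h (E b - E (b - σ)) (E b - E (b - σ)) ≤ exp 1 *
        (ip h (E (t + σ) - E t) (E (t + σ) - E t) + σ ^ 2 * (C ^ 2 * τ ^ 2)) :=
      key.trans (mul_le_mul hexp (by linarith)
        (add_nonneg hN (mul_nonneg (by positivity) (by linarith))) (exp_pos 1).le)
    simp only [ip_smul_left, ip_smul_right, ← mul_assoc]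
    have hs2 : (0 : ℝ) < σ⁻¹ * σ⁻¹ := by positivity
    calc _ ≤ σ⁻¹ * σ⁻¹ * (exp 1 *
        (ip h (E (t + σ) - E t) (E (t + σ) - E t) + σ ^ 2 * (C ^ 2 * τ ^ 2))) :=
          mul_le_left hfin hs2.le
      _ = _ := by field_simp
  have l1 := (continuous_ip_self (h := h) (d := d) (J := J)).continuousAt.tendsto.comp
    (tendsto_slope_left (right_mem_Ioc.mpr hab) (hE b (right_mem_Icc.mpr hab.le)))
  have l2 := (((continuous_ip_self (h := h) (d := d) (J := J)).continuousAt.tendsto.comp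
    (tendsto_slope_right ht (hE t (Ico_subset_Icc_self ht)))).add_const
      (C ^ 2 * τ ^ 2)).const_mul (exp 1)
  refine le_of_tendsto_of_tendsto l1 l2 ?_
  filter_upwards [Ioo_mem_nhdsGT (by linarith [ht.2] : (0 : ℝ) < b - t)] with σ hσ
  exact step σ hσ

/-- The velocity at the end of a time step is controlled by its mean square. -/
theorem end_velocity_le (hh : 0 ≤ h) {𝓛 : GridOp d J} (hpos : ∀ f, 0 ≤ ip h (𝓛 f) f)
    {E Ed g : ℝ → GridFun d J} {a b C : ℝ} (hab : a < b)
    (hE : ∀ t ∈ Icc a b, HasDerivWithinAt E (Ed t) (Icc a b) t)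
    (hEd : ContinuousOn Ed (Icc a b))
    (heq : ∀ t ∈ Icc a b, Ed t = -𝓛 (E t) + g t)
    (hg : ∀ t ∈ Icc a b, ∀ s ∈ Icc a b, N0 h (g t - g s) ≤ C * |t - s|) :
    (b - a) * ip h (Ed b) (Ed b)
      ≤ exp 1 * ((∫ s in a..b, ip h (Ed s) (Ed s)) + C ^ 2 * (b - a) ^ 3) := by
  have hcont := continuousOn_ip (h := h) hEd hEd
  have hitg : IntervalIntegrable (fun s => ip h (Ed s) (Ed s)) volume a b :=
    hcont.intervalIntegrable_of_Icc hab.le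
  have hle : ∀ t ∈ Ioo a b, ip h (Ed b) (Ed b)
      ≤ exp 1 * (ip h (Ed t) (Ed t) + C ^ 2 * (b - a) ^ 2) := fun t ht =>
    end_velocity_le_of_mem hh hpos hE heq hg (Ioo_subset_Ico_self ht)
  have := intervalIntegral.integral_mono_on_of_le_Ioo hab.le
    (intervalIntegrable_const (c := ip h (Ed b) (Ed b)))
    ((hitg.add (intervalIntegrable_const (c := C ^ 2 * (b - a) ^ 2))).const_mul (exp 1)) hle
  rw [intervalIntegral.integral_const, intervalIntegral.integral_const_mul,
    intervalIntegral.integral_add hitg intervalIntegrable_const,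
    intervalIntegral.integral_const] at this
  simp only [smul_eq_mul] at this
  calc _ ≤ _ := this
    _ = _ := by ring

/-! The exponential integrator as the flow of a linear equation. -/

theorem isUnit_of_pos (hh : 0 < h) {A : GridOp d J} {c : ℝ} (hc : 0 < c)
    (hA : ∀ f, c * ip h f f ≤ ip h (A f) f) : IsUnit A := by
  have hinj : Function.Injective (A : GridFun d J →ₗ[ℝ] GridFun d J) := by
    rw [← LinearMap.ker_eq_bot, LinearMap.ker_eq_bot']
    intro f hf; have h1 := hA f; have hf' : A f = 0 := hf; rw [hf'] at h1
    have h2 : ip h (0 : GridFun d J) f = 0 := by simp [ip]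
    rw [h2] at h1; have h3 := ip_self_nonneg hh.le f; have h4 : ip h f f = 0 := by nlinarith
    rw [ip, mul_eq_zero] at h4; have h5 := h4.resolve_left (pow_pos hh d).ne'
    rw [Finset.sum_eq_zero_iff_of_nonneg fun p _ => mul_self_nonneg _] at h5
    ext p
    exact mul_self_eq_zero.mp (h5 p (Finset.mem_univ p))
  rw [ContinuousLinearMap.isUnit_iff_bijective]
  exact ⟨hinj, LinearMap.injective_iff_surjective.mp hinj⟩

theorem smul_inverse_mul {𝔸 : Type*} [Ring 𝔸] [Algebra ℝ 𝔸] {A : 𝔸} (hA : IsUnit A) {τ : ℝ}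
    (hτ : τ ≠ 0) (e : 𝔸) :
    τ • (Ring.inverse (-(τ • A)) * (e - 1)) = Ring.inverse A * (1 - e) := by
  obtain ⟨u, rfl⟩ := hA
  have h2 : Ring.inverse (-(τ • (u : 𝔸))) = -(τ⁻¹ • ((u⁻¹ : 𝔸ˣ) : 𝔸)) := by
    have : -(τ • (u : 𝔸)) = ((⟨-(τ • (u : 𝔸)), -(τ⁻¹ • ((u⁻¹ : 𝔸ˣ) : 𝔸)), by
        rw [neg_mul_neg, smul_mul_smul_comm, mul_inv_cancel₀ hτ, one_smul, Units.mul_inv], by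
        rw [neg_mul_neg, smul_mul_smul_comm, inv_mul_cancel₀ hτ, one_smul, Units.inv_mul]⟩ : 𝔸ˣ) : 𝔸) := rfl
    rw [this, Ring.inverse_unit]; rfl
  rw [h2, Ring.inverse_unit, neg_mul, smul_neg, smul_mul_assoc, smul_smul, mul_inv_cancel₀ hτ,
    one_smul, ← mul_neg, neg_sub]

/-- The exponential integrator step is the time-`τ` value of a linear flow. -/
theorem exists_flow {A : GridOp d J} (hA : IsUnit A) (q₀ F : GridFun d J) {τ : ℝ} (hτ : 0 < τ) :
    ∃ q : ℝ → GridFun d J, q 0 = q₀ ∧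
      q τ = NormedSpace.exp (-(τ • A)) q₀ + τ • phi1 (-(τ • A)) F ∧
      ∀ r, HasDerivAt q (-A (q r) + F) r := by
  have hcomm : ∀ r : ℝ, A * NormedSpace.exp (r • -A) = NormedSpace.exp (r • -A) * A := fun r =>
    (((Commute.refl A).neg_right.smul_right r).exp_right).eq
  have hinv : A * Ring.inverse A = 1 := Ring.mul_inverse_cancel A hA
  refine ⟨fun r => NormedSpace.exp (r • -A) q₀
    + Ring.inverse A ((1 - NormedSpace.exp (r • -A)) F), ?_, ?_, fun r => ?_⟩
  · simp
  · have e1 : τ • phi1 (-(τ • A)) = Ring.inverse A * (1 - NormedSpace.exp (-(τ • A))) :=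
      smul_inverse_mul hA hτ.ne' _
    have e2 : τ • -A = -(τ • A) := smul_neg _ _
    have e3 : τ • phi1 (-(τ • A)) F = (τ • phi1 (-(τ • A))) F := rfl; rw [e3, e1]; simp only [e2]
    rfl
  · have h1 := hasDerivAt_exp_smul_const (𝕂 := ℝ) (-A) r
    have h2 := h1.clm_apply (hasDerivAt_const r q₀)
    have h3 := (((hasDerivAt_const r (1 : GridOp d J)).sub h1).clm_apply (hasDerivAt_const r F))
    have h4 := (Ring.inverse A).hasFDerivAt.comp_hasDerivAt r h3; refine (h2.add h4).congr_deriv ?_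
    have e : ∀ f, (NormedSpace.exp (r • -A) * -A) f = -A (NormedSpace.exp (r • -A) f) := fun f => by
      have := congrArg (fun B : GridOp d J => -B f) (hcomm r); simpa using this.symm
    have hinv' : Ring.inverse A * A = 1 := Ring.inverse_mul_cancel A hA
    have g1 : ∀ f, Ring.inverse A (A f) = f := fun f => by
      have := congrArg (fun B : GridOp d J => B f) hinv'; simpa using this
    have g2 : ∀ f, A (Ring.inverse A f) = f := fun f => by
      have := congrArg (fun B : GridOp d J => B f) hinv; simpa using this
    have hz : (0 - NormedSpace.exp (r • -A) * -A) F = A (NormedSpace.exp (r • -A) F) := by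
      have h := e F
      calc (0 - NormedSpace.exp (r • -A) * -A) F = 0 - (NormedSpace.exp (r • -A) * -A) F := rfl
        _ = _ := by rw [h]; simp
    have ho : (((fun _ => 1) - fun u => NormedSpace.exp (u • -A) : ℝ → GridOp d J) r) 0 = 0 :=
      map_zero _
    have hs : (1 - NormedSpace.exp (r • -A)) F = F - NormedSpace.exp (r • -A) F := rfl
    rw [hz, ho, map_zero]
    beta_reduce
    rw [hs, e, add_zero, add_zero, g1, map_add, g2]; abel

end Energy

/-! ### The recursive inequality behind the convergence proof -/

/-- The inequalities satisfied by the error quantities of one time step: `a`, `b` are squared energy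
errors, `σ` the error of the auxiliary variable, `y` a squared error in a stronger norm, and `x`,
`z` are dissipations. -/
structure StepIneq (C c₀ τ ε : ℝ) (first : Prop) (a b σ y a' b' σ' y' x z : ℝ) : Prop where
  x_nonneg : 0 ≤ x
  z_nonneg : 0 ≤ z
  ineq_a : a' + x ≤ a + C * τ * (a + b + σ ^ 2 + ε ^ 2)
  ineq_y : τ * y' ≤ C * x + C * τ * (a + b + σ ^ 2 + ε ^ 2 + a')
  ineq_b_first : first → b' ≤ C * (a + b + σ ^ 2 + ε ^ 2)
  ineq_b : ¬first → b' + z ≤ b + C * τ * (a + b + σ ^ 2 + ε ^ 2 + y)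
  ineq_σ_first : first → a' + b' ≤ c₀ →
    σ' ≤ σ + C * √(a + b + σ ^ 2 + ε ^ 2 + (a' + b')) ∨ σ' ≤ C * √(a' + b' + ε ^ 2)
  ineq_σ : ¬first → a' + b' ≤ c₀ →
    σ' ≤ σ + C * (√τ * √(τ * (a + b + σ ^ 2 + ε ^ 2 + y) + x + z)
      + (τ * (a + b + σ ^ 2 + ε ^ 2 + y) + x + z)) ∨
    σ' ≤ C * √(a' + b' + ε ^ 2)

theorem sqrt_mul_sqrt_add_le {a b c d : ℝ} (ha : 0 ≤ a) (hb : 0 ≤ b) (hc : 0 ≤ c) (hd : 0 ≤ d) :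
    √a * √b + √c * √d ≤ √(a + c) * √(b + d) := by
  rw [← sqrt_mul (by positivity : 0 ≤ a + c)]
  refine le_sqrt_of_sq_le ?_
  have e1 := sq_sqrt ha
  have e2 := sq_sqrt hb
  have e3 := sq_sqrt hc
  have e4 := sq_sqrt hd
  have : (√a * √b + √c * √d) ^ 2 + (√a * √d - √c * √b) ^ 2
      = (√a ^ 2 + √c ^ 2) * (√b ^ 2 + √d ^ 2) := by ring
  rw [e1, e2, e3, e4] at this
  nlinarith [sq_nonneg (√a * √d - √c * √b)]

set_option maxHeartbeats 1000000 in
/-- Stability of the recursive inequality. -/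
theorem error_sequence_le {C c₀ T C₀ : ℝ} (hC : 1 ≤ C) (hc₀ : 0 < c₀) (hC₀ : 0 ≤ C₀) :
    ∃ M > 0, ∃ ε₀ > 0, ∀ (τ ε : ℝ), 0 < τ → τ ≤ 1 → 0 < ε → ε ≤ ε₀ →
      ∀ (N : ℕ), N * τ ≤ T → ∀ a b σ y : ℕ → ℝ, (∀ n, 0 ≤ a n) → (∀ n, 0 ≤ b n) →
      (∀ n, 0 ≤ σ n) → (∀ n, 0 ≤ y n) →
      a 0 + b 0 + σ 0 ^ 2 + ε ^ 2 ≤ C₀ * ε ^ 2 →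
      (∀ n < N, a n + b n + σ n ^ 2 + ε ^ 2 ≤ c₀ → ∃ x z, StepIneq C c₀ τ ε (n = 0)
        (a n) (b n) (σ n) (y n) (a (n + 1)) (b (n + 1)) (σ (n + 1)) (y (n + 1)) x z) →
      a N + b N + σ N ^ 2 + ε ^ 2 ≤ M * ε ^ 2 := by
  have hC0 : 0 ≤ C := by linarith
  obtain ⟨D, hD⟩ : ∃ r, r = C + 1 := ⟨_, rfl⟩
  obtain ⟨θ, hθ⟩ : ∃ r, r = D * C + 1 := ⟨_, rfl⟩
  have hD0 : 1 ≤ D := by linarith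
  have hθ1 : 1 ≤ θ := by nlinarith
  obtain ⟨C', hC'⟩ : ∃ r, r = θ * C + C + D * C + D * C * (1 + C) + 1 := ⟨_, rfl⟩
  have hC'0 : 0 ≤ C' := by rw [hC']; positivity
  obtain ⟨C1, hC1⟩ : ∃ r, r = θ * (1 + C) + C + D * (C * (1 + C) + C + C * (1 + C)) := ⟨_, rfl⟩
  have hC1' : 1 ≤ C1 := by
    have : 0 ≤ D * (C * (1 + C) + C + C * (1 + C)) := by positivity
    nlinarith
  obtain ⟨C2, hC2⟩ : ∃ r, r = 1 + C * (2 + 2 * C) := ⟨_, rfl⟩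
  have hC20 : 0 ≤ C2 := by rw [hC2]; positivity
  obtain ⟨C3, hC3⟩ : ∃ r, r = C2 + 2 * C + C * √T + C := ⟨_, rfl⟩
  have hC30 : 0 ≤ C3 := by rw [hC3]; positivity
  obtain ⟨l, hl⟩ : ∃ r, r = C' * (2 + C3 ^ 2) := ⟨_, rfl⟩
  have hl0 : 0 ≤ l := by rw [hl]; positivity
  obtain ⟨K, hK⟩ : ∃ r, r = C1 * C₀ * exp (l * T) := ⟨_, rfl⟩
  have hK0 : 0 ≤ K := by rw [hK]; positivity
  obtain ⟨M, hM⟩ : ∃ r, r = K * (2 + C3 ^ 2) + C₀ + 1 := ⟨_, rfl⟩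
  have hKC : 0 ≤ K * (2 + C3 ^ 2) := by positivity
  have hM0 : 1 ≤ M := by linarith
  obtain ⟨m, hm⟩ : ∃ r, r = min c₀ 1 := ⟨_, rfl⟩
  have hm0 : 0 < m := hm ▸ lt_min hc₀ one_pos
  refine ⟨M, by linarith, √(m / M), by positivity, ?_⟩
  intro τ ε hτ hτ1 hε hεε₀ N hN a b σ y ha hb hσ hy h0 hstep
  have hlτ : 1 ≤ 1 + l * τ := le_add_of_nonneg_right (by positivity)
  have hMε : M * ε ^ 2 ≤ m := by
    have := pow_le_pow_left₀ hε.le hεε₀ 2; rw [sq_sqrt (by positivity)] at this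
    calc M * ε ^ 2 ≤ M * (m / M) := by gcongr
      _ = m := by field_simp
  have hmc : m ≤ c₀ := hm ▸ min_le_left _ _
  have hm1 : m ≤ 1 := hm ▸ min_le_right _ _
  have hε2 : 0 < ε ^ 2 := by positivity
  obtain ⟨S, hS⟩ : ∃ r : ℕ → ℝ, r = fun n => a n + b n + σ n ^ 2 + ε ^ 2 := ⟨_, rfl⟩
  have hS' : ∀ n, a n + b n + σ n ^ 2 + ε ^ 2 = S n := fun n => by rw [hS]
  rw [hS'] at h0
  simp only [hS'] at hstep
  rw [hS']
  have hSε : ∀ n, ε ^ 2 ≤ S n := fun n => by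
    have := ha n; have := hb n; have := sq_nonneg (σ n); simp only [hS]; linarith
  have hS0 : ∀ n, 0 ≤ S n := fun n => hε2.le.trans (hSε n)
  obtain ⟨Z, hZ⟩ : ∃ r : ℕ → ℝ, r = fun n => C1 * S 0 * (1 + l * τ) ^ n := ⟨_, rfl⟩
  have hZ0 : ∀ n, S 0 ≤ Z n := fun n => by
    have h1 : 1 ≤ (1 + l * τ) ^ n := one_le_pow₀ hlτ
    have : 1 ≤ C1 * (1 + l * τ) ^ n := one_le_mul_of_one_le_of_one_le hC1' h1
    calc S 0 ≤ S 0 * (C1 * (1 + l * τ) ^ n) := le_mul_of_one_le_right (hS0 0) this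
      _ = Z n := by rw [hZ]; ring
  have hZnn : ∀ n, 0 ≤ Z n := fun n => (hS0 0).trans (hZ0 n)
  have hZK : ∀ n : ℕ, n ≤ N → Z n ≤ K * ε ^ 2 := fun n hn => by
    have h1 : (1 + l * τ) ^ n ≤ exp (l * T) := by
      calc (1 + l * τ) ^ n ≤ (exp (l * τ)) ^ n := by
            gcongr; linarith [add_one_le_exp (l * τ)]
        _ = exp (n * (l * τ)) := (Real.exp_nat_mul _ _).symm
        _ ≤ _ := by
          apply exp_le_exp.mpr; have : (n : ℝ) * τ ≤ T := le_trans (by gcongr) hN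
          calc (n : ℝ) * (l * τ) = l * (n * τ) := by ring
            _ ≤ l * T := by gcongr
    calc Z n ≤ C1 * (C₀ * ε ^ 2) * exp (l * T) := by
          simp only [hZ]; gcongr
      _ = K * ε ^ 2 := by rw [hK]; ring
  have hKM : K ≤ M := by
    have : 0 ≤ K * (1 + C3 ^ 2) := by positivity
    rw [hM]; linarith
  have hZm : ∀ n : ℕ, n ≤ N → Z n ≤ m := fun n hn =>
    ((hZK n hn).trans (by gcongr)).trans hMε
  have hS0c : S 0 ≤ c₀ := by
    refine h0.trans (le_trans ?_ (hMε.trans hmc)); gcongr; linarith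
  -- the invariant
  have inv : ∀ n : ℕ, n + 1 ≤ N → ∃ p, 0 ≤ p ∧
      θ * a (n + 1) + b (n + 1) + D * (τ * y (n + 1)) + p ≤ Z (n + 1) ∧
      σ (n + 1) ≤ C2 * √(S 0) + 2 * C * √(Z (n + 1)) + C * (√(n * τ) * √p + p) ∧
      S (n + 1) ≤ (2 + C3 ^ 2) * Z (n + 1) := by
    have fin : ∀ n : ℕ, n + 1 ≤ N → ∀ p, 0 ≤ p →
        θ * a (n + 1) + b (n + 1) + D * (τ * y (n + 1)) + p ≤ Z (n + 1) →
        σ (n + 1) ≤ C2 * √(S 0) + 2 * C * √(Z (n + 1)) + C * (√(n * τ) * √p + p) →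
        S (n + 1) ≤ (2 + C3 ^ 2) * Z (n + 1) := by
      intro n hn p hp hΨ hσn
      have hab : a (n + 1) + b (n + 1) ≤ Z (n + 1) ∧ p ≤ Z (n + 1) := by
        have h1 := ha (n + 1); have h2 := hb (n + 1)
        have h3 : 0 ≤ D * (τ * y (n + 1)) := by have := hy (n + 1); positivity
        have h4 : a (n + 1) ≤ θ * a (n + 1) := le_mul_of_one_le_left h1 hθ1
        constructor <;> linarith
      have hZ1 : Z (n + 1) ≤ 1 := (hZm _ hn).trans hm1
      have hsq : Z (n + 1) ≤ √(Z (n + 1)) := by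
        refine le_sqrt_of_sq_le ?_; rw [sq]; exact mul_le_of_le_one_left (hZnn _) hZ1
      have hnT : (n : ℝ) * τ ≤ T := by
        refine le_trans ?_ hN; have : (n : ℝ) ≤ N := by exact_mod_cast (by omega : n ≤ N)
        gcongr
      have h5 : σ (n + 1) ≤ C3 * √(Z (n + 1)) := by
        refine hσn.trans ?_; have e1 : √(S 0) ≤ √(Z (n + 1)) := sqrt_le_sqrt (hZ0 _)
        have e2 : √(n * τ) * √p ≤ √T * √(Z (n + 1)) :=
          mul_le_mul (sqrt_le_sqrt hnT) (sqrt_le_sqrt hab.2) (by positivity)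
            (by positivity)
        have e3 : p ≤ √(Z (n + 1)) := hab.2.trans hsq; have f1 := mul_le_left e1 hC20
        have f2 := mul_le_left (add_le_add e2 e3) hC0; rw [hC3]; linarith
      have h6 : σ (n + 1) ^ 2 ≤ C3 ^ 2 * Z (n + 1) := by
        have := pow_le_pow_left₀ (hσ _) h5 2; rwa [mul_pow, sq_sqrt (hZnn _)] at this
      have h7 := (hSε 0).trans (hZ0 (n + 1)); simp only [hS]; linarith [hab.1]
    intro n
    induction n with
    | zero =>
      intro hn
      obtain ⟨x, z, st⟩ := hstep 0 (by omega) hS0c; have hx := st.x_nonneg; have s1 := st.ineq_a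
      have s2 := st.ineq_y; have s3 := st.ineq_b_first rfl; have s4 := st.ineq_σ_first rfl
      simp only [hS'] at s1 s2 s3 s4; have hSS := hS0 0
      have haS : a 0 ≤ S 0 := by
        have := hb 0; have := sq_nonneg (σ 0); simp only [hS]; linarith
      have t1 : C * τ * S 0 ≤ C * S 0 := by
        have : C * τ ≤ C := mul_le_of_le_one_right hC0 hτ1; gcongr
      have a1 : a (0 + 1) + x ≤ (1 + C) * S 0 := by linarith
      have a1' : a (0 + 1) ≤ (1 + C) * S 0 := by linarith
      have a1'' := ha (0 + 1); have x1 : x ≤ (1 + C) * S 0 := by linarith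
      have y1 : τ * y (0 + 1) ≤ (C * (1 + C) + C + C * (1 + C)) * S 0 := by
        have u1 : C * τ * (S 0 + a (0 + 1)) ≤ C * (S 0 + a (0 + 1)) := by
          have : C * τ ≤ C := mul_le_of_le_one_right hC0 hτ1; gcongr
        have u2 := mul_le_left x1 hC0; have u3 := mul_le_left a1' hC0; linarith
      have hΨ : θ * a (0 + 1) + b (0 + 1) + D * (τ * y (0 + 1)) ≤ C1 * S 0 := by
        have u1 := mul_le_left a1' (by linarith : 0 ≤ θ)
        have u2 := mul_le_left y1 (by linarith : 0 ≤ D); rw [hC1]; linarith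
      have hZ1 : C1 * S 0 ≤ Z (0 + 1) := by
        simp only [hZ]; refine le_mul_of_one_le_right (by positivity) ?_; rw [zero_add, pow_one]
        exact hlτ
      have hab : a (0 + 1) + b (0 + 1) ≤ (1 + 2 * C) * S 0 := by linarith
      have habc : a (0 + 1) + b (0 + 1) ≤ c₀ := by
        refine le_trans ?_ ((hZm (0 + 1) hn).trans hmc); refine le_trans ?_ (hΨ.trans hZ1)
        have h3 : 0 ≤ D * (τ * y (0 + 1)) := by have := hy (0 + 1); positivity
        have h4 : a (0 + 1) ≤ θ * a (0 + 1) := le_mul_of_one_le_left a1'' hθ1; linarith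
      have hroot : √((2 + 2 * C) * S 0) ≤ (2 + 2 * C) * √(S 0) := by
        rw [sqrt_mul (by positivity)]; gcongr; rw [sqrt_le_left (by positivity), sq]
        exact le_mul_of_one_le_left (by positivity) (by linarith)
      have hσ1 : σ (0 + 1) ≤ C2 * √(S 0) := by
        have hσ0 : σ 0 ≤ √(S 0) := by
          refine le_sqrt_of_sq_le ?_; have := ha 0; have := hb 0; simp only [hS]; linarith
        rcases s4 habc with h | h
        · have : √(S 0 + (a (0 + 1) + b (0 + 1))) ≤ (2 + 2 * C) * √(S 0) :=
            (sqrt_le_sqrt (by linarith)).trans hroot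
          have := mul_le_left this hC0; rw [hC2]; linarith
        · have : √(a (0 + 1) + b (0 + 1) + ε ^ 2) ≤ (2 + 2 * C) * √(S 0) :=
            (sqrt_le_sqrt (by linarith [hSε 0])).trans hroot
          have := mul_le_left this hC0; have := sqrt_nonneg (S 0); rw [hC2]; linarith
      have i1 : θ * a (0 + 1) + b (0 + 1) + D * (τ * y (0 + 1)) + 0 ≤ Z (0 + 1) := by
        rw [add_zero]; exact hΨ.trans hZ1
      have i2 : σ (0 + 1) ≤ C2 * √(S 0) + 2 * C * √(Z (0 + 1))
          + C * (√((0 : ℕ) * τ) * √0 + 0) := by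
        have : 0 ≤ 2 * C * √(Z (0 + 1)) := by positivity
        rw [Real.sqrt_zero, mul_zero, add_zero, mul_zero, add_zero]; linarith
      exact ⟨0, le_rfl, i1, i2, fin 0 hn 0 le_rfl i1 i2⟩
    | succ n ih =>
      intro hn
      obtain ⟨p, hp, hΨ, hσn, hSn⟩ := ih (by omega)
      obtain ⟨k, hk⟩ : ∃ k, k = n + 1 := ⟨_, rfl⟩; rw [← hk] at hn hΨ hσn hSn ⊢
      have hSc : S k ≤ c₀ := by
        refine hSn.trans (le_trans ?_ (hMε.trans hmc))
        have := mul_le_left (hZK k (by omega)) (by positivity : 0 ≤ 2 + C3 ^ 2)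
        refine this.trans ?_; rw [hM]; have : 0 ≤ C₀ * ε ^ 2 := by positivity
        linarith
      obtain ⟨x, z, st⟩ := hstep k (by omega) hSc; have hne : ¬(k = 0) := by omega
      have hx := st.x_nonneg; have hz := st.z_nonneg; have s1 := st.ineq_a; have s2 := st.ineq_y
      have s3 := st.ineq_b hne; have s4 := st.ineq_σ hne; simp only [hS'] at s1 s2 s3 s4
      obtain ⟨q, hq⟩ : ∃ r, r = τ * (S k + y k) + x + z := ⟨_, rfl⟩; rw [← hq] at s4
      have hSS := hS0 k; have hyy := hy k; have hq0 : 0 ≤ q := by rw [hq]; positivity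
      have haS : a k ≤ S k := by
        have := hb k; have := sq_nonneg (σ k); simp only [hS]; linarith
      have t1 : C * τ * S k ≤ C * S k := by
        have : C * τ ≤ C := mul_le_of_le_one_right hC0 hτ1; gcongr
      have a1 : a (k + 1) ≤ (1 + C) * S k := by linarith
      have key : θ * a (k + 1) + b (k + 1) + D * (τ * y (k + 1)) + (p + q)
          ≤ Z (k + 1) := by
        have u1 := mul_le_left s1 (by linarith : 0 ≤ θ)
        have u2 := mul_le_left s2 (by linarith : 0 ≤ D)
        have u3 : D * (C * τ * a (k + 1)) ≤ D * (C * τ * ((1 + C) * S k)) := by gcongr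
        have u4 : Z (k + 1) = Z k + C' * τ * ((2 + C3 ^ 2) * Z k) := by
          simp only [hZ, hl, pow_succ]; ring
        have u5 := mul_le_left hSn (by positivity : 0 ≤ C' * τ)
        have u6 : 0 ≤ τ * y k := by positivity
        rw [u4]; have u7 : D * (τ * y k) = C * τ * y k + τ * y k := by rw [hD]; ring
        have u8 : θ * x = D * (C * x) + x := by rw [hθ]; ring
        rw [hC'] at u5; rw [hC', hq]; linarith
      have hab : a (k + 1) + b (k + 1) ≤ Z (k + 1) := by
        have h1 := ha (k + 1)
        have h3 : 0 ≤ D * (τ * y (k + 1)) := by have := hy (k + 1); positivity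
        have h4 : a (k + 1) ≤ θ * a (k + 1) := le_mul_of_one_le_left h1 hθ1; linarith
      have hZmono : Z k ≤ Z (k + 1) := by
        simp only [hZ]; have := hS0 0
        refine mul_le_left (pow_le_pow_right₀ hlτ (by omega))
          (by positivity)
      have i2 : σ (k + 1) ≤ C2 * √(S 0) + 2 * C * √(Z (k + 1))
          + C * (√(k * τ) * √(p + q) + (p + q)) := by
        rcases s4 (hab.trans ((hZm _ hn).trans hmc)) with h | h
        · have c1 := sqrt_mul_sqrt_add_le (by positivity : 0 ≤ (n : ℝ) * τ) hp hτ.le hq0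
          have c2 : (n : ℝ) * τ + τ = k * τ := by rw [hk]; push_cast; ring
          rw [c2] at c1; have c3 := mul_le_left c1 hC0
          have c4 := mul_le_left (sqrt_le_sqrt hZmono)
            (by positivity : 0 ≤ 2 * C)
          linarith
        · refine h.trans ?_
          have c1 : √(a (k + 1) + b (k + 1) + ε ^ 2) ≤ 2 * √(Z (k + 1)) := by
            rw [sqrt_le_left (by positivity), mul_pow, sq_sqrt (hZnn _)]
            linarith [(hSε 0).trans (hZ0 (k + 1)), hZnn (k + 1)]
          have c2 := mul_le_left c1 hC0; have c3 : 0 ≤ C2 * √(S 0) := by positivity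
          have c4 : 0 ≤ C * (√(k * τ) * √(p + q) + (p + q)) := by positivity
          linarith
      exact ⟨p + q, by positivity, key, i2, fin k hn _ (by positivity) key i2⟩
  rcases Nat.eq_zero_or_pos N with rfl | hNpos
  · refine h0.trans ?_
    gcongr; linarith
  · obtain ⟨n, rfl⟩ : ∃ n, N = n + 1 := ⟨N - 1, by omega⟩
    obtain ⟨p, -, -, -, h⟩ := inv n le_rfl; refine h.trans ?_
    have := mul_le_left (hZK (n + 1) le_rfl) (by positivity : 0 ≤ 2 + C3 ^ 2)
    have h2 : 0 ≤ C₀ * ε ^ 2 := by positivity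
    rw [hM]; linarith

/-! ### One step of the exponential integrator against an exact trajectory -/

section OneStep

variable {d J : ℕ} [NeZero J]

/-- An exact trajectory `V' = -𝒜 V - F + ρ` over the time step `[a, a + τ]`, with the regularity in
time that the error analysis of one step needs. -/
structure StepData (h R Λ : ℝ) (𝒜 : GridOp d J) (V F ρ : ℝ → GridFun d J) (a τ g : ℝ) : Prop where
  symm : ∀ f f', ip h (𝒜 f) f' = ip h f (𝒜 f')
  pos : ∀ f, 0 ≤ ip h (𝒜 f) f
  R_nonneg : 0 ≤ R
  h_pos : 0 < h
  τ_pos : 0 < τ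
  τ_le : τ ≤ 1
  g_pos : 0 < g
  g_le : g ≤ Λ
  deriv : ∀ t ∈ Icc a (a + τ), HasDerivWithinAt V (-𝒜 (V t) - F t + ρ t) (Icc a (a + τ)) t
  F_cont : ContinuousOn F (Icc a (a + τ))
  ρ_cont : ContinuousOn ρ (Icc a (a + τ))
  F_lip : ∀ t ∈ Icc a (a + τ), ∀ r ∈ Icc a (a + τ), N0 h (F t - F r) ≤ R * |t - r|
  V_lip : ∀ t ∈ Icc a (a + τ), ∀ r ∈ Icc a (a + τ), N0 h (V t - V r) ≤ R * |t - r|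
  ρ_le : ∀ t ∈ Icc a (a + τ), N0 h (ρ t) ≤ R * h ^ 2

variable {h R Λ κ : ℝ} {𝒜 : GridOp d J} {V F ρ : ℝ → GridFun d J} {a τ g : ℝ}

/-- The part of the consistency error that varies within the step. -/
def stepSource (κ g a : ℝ) (V F ρ : ℝ → GridFun d J) (q : GridFun d J) (t : ℝ) : GridFun d J :=
  (F t - F a) - ρ t + (g * κ) • ((q - V a) - (V t - V a))

/-- The error of one step of the exponential integrator, as the end value of a trajectory. -/
theorem StepData.exists_error (S : StepData h R Λ 𝒜 V F ρ a τ g) (hκ : 0 < κ)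
    {q q' Fh : GridFun d J}
    (hq' : q' = NormedSpace.exp (-(τ • (𝒜 + (g * κ) • 1))) q
      + τ • phi1 (-(τ • (𝒜 + (g * κ) • 1))) (-(g • Fh) + (g * κ) • q)) :
    ∃ E Ed : ℝ → GridFun d J, E a = q - V a ∧ E (a + τ) = q' - V (a + τ) ∧
      (∀ t ∈ Icc a (a + τ), HasDerivWithinAt E (Ed t) (Icc a (a + τ)) t) ∧
      ContinuousOn Ed (Icc a (a + τ)) ∧
      ∀ t ∈ Icc a (a + τ), Ed t = -𝒜 (E t) - (g * κ) • E t
        + stepSource κ g a V F ρ q t - (g • Fh - F a) := by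
  have hgκ : 0 < g * κ := mul_pos S.g_pos hκ
  have hunit : IsUnit (𝒜 + (g * κ) • (1 : GridOp d J)) := by
    refine isUnit_of_pos S.h_pos hgκ fun f => ?_
    have e : (𝒜 + (g * κ) • (1 : GridOp d J)) f = 𝒜 f + (g * κ) • f := rfl
    rw [e, ip_add_left, ip_smul_left]; linarith [S.pos f]
  obtain ⟨w, hw0, hwτ, hw⟩ := exists_flow hunit q (-(g • Fh) + (g * κ) • q) S.τ_pos
  have hd : ∀ t ∈ Icc a (a + τ), HasDerivWithinAt (fun t => w (t - a) - V t)
      (-(𝒜 + (g * κ) • (1 : GridOp d J)) (w (t - a)) + (-(g • Fh) + (g * κ) • q)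
        - (-𝒜 (V t) - F t + ρ t)) (Icc a (a + τ)) t := fun t ht => by
    have h1 := (hw (t - a)).scomp t ((hasDerivAt_id t).sub_const a); rw [one_smul] at h1
    exact h1.hasDerivWithinAt.sub (S.deriv t ht)
  refine ⟨fun t => w (t - a) - V t, _, ?_, ?_, hd, ?_, fun t ht => ?_⟩
  · simp [hw0]
  · simp only [add_sub_cancel_left]
    rw [hwτ, hq']
  · have cV : ContinuousOn V (Icc a (a + τ)) := fun t ht => (S.deriv t ht).continuousWithinAt
    have cw : Continuous w := continuous_iff_continuousAt.mpr fun t => (hw t).continuousAt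
    have c1 : Continuous fun t : ℝ => (𝒜 + (g * κ) • (1 : GridOp d J)) (w (t - a)) :=
      (𝒜 + (g * κ) • (1 : GridOp d J)).continuous.comp (cw.comp (continuous_id.sub continuous_const))
    have c2 : ContinuousOn (fun t => 𝒜 (V t)) (Icc a (a + τ)) :=
      𝒜.continuous.comp_continuousOn cV
    exact (c1.continuousOn.neg.add continuousOn_const).sub ((c2.neg.sub S.F_cont).add S.ρ_cont)
  · have e : (𝒜 + (g * κ) • (1 : GridOp d J)) (w (t - a))
        = 𝒜 (w (t - a)) + (g * κ) • w (t - a) := rfl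
    beta_reduce
    rw [e, map_sub]; unfold stepSource
    module

theorem StepData.source_le (S : StepData h R Λ 𝒜 V F ρ a τ g) (hκ : 0 < κ) (q : GridFun d J)
    {t : ℝ} (ht : t ∈ Icc a (a + τ)) :
    N0 h (stepSource κ g a V F ρ q t)
      ≤ (R + Λ * κ * (1 + R)) * (τ + h ^ 2 + N0 h (q - V a)) := by
  have ha : a ∈ Icc a (a + τ) := left_mem_Icc.mpr (by linarith [S.τ_pos])
  have hta : |t - a| ≤ τ := by rw [abs_of_nonneg] <;> linarith [ht.1, ht.2]
  have hR := S.R_nonneg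
  have hg := S.g_pos
  have b1 := (S.F_lip t ht a ha).trans (mul_le_left hta hR)
  have b2 := (S.V_lip t ht a ha).trans (mul_le_left hta hR)
  have b3 := S.ρ_le t ht
  have hΛ : 0 ≤ Λ := hg.le.trans S.g_le
  have hgκ : g * κ ≤ Λ * κ := mul_le_right S.g_le hκ.le
  unfold stepSource
  have n1 := map_add_le_add (N0 h) ((F t - F a) - ρ t) ((g * κ) • ((q - V a) - (V t - V a)))
  have n2 := map_sub_le_add (N0 h) (F t - F a) (ρ t)
  have n3 := map_sub_le_add (N0 h) (q - V a) (V t - V a)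
  rw [map_smul_eq_mul, norm_of_nonneg (by positivity)] at n1
  have hN : 0 ≤ N0 h (q - V a) := apply_nonneg _ _
  have hτ := S.τ_pos
  have n4 : g * κ * N0 h (q - V a - (V t - V a)) ≤ Λ * κ * (N0 h (q - V a) + R * τ) :=
    mul_le_mul hgκ (n3.trans (by linarith)) (apply_nonneg _ _) (by positivity)
  have n5 : 0 ≤ R * N0 h (q - V a) := by positivity
  have n6 : 0 ≤ Λ * κ * (τ + (1 + R) * h ^ 2 + R * N0 h (q - V a)) := by positivity
  nlinarith

theorem StepData.source_lip (S : StepData h R Λ 𝒜 V F ρ a τ g) (hκ : 0 < κ) (q : GridFun d J)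
    (hρ : ∀ t ∈ Icc a (a + τ), ∀ r ∈ Icc a (a + τ), N0 h (ρ t - ρ r) ≤ R * |t - r|) :
    ∀ t ∈ Icc a (a + τ), ∀ r ∈ Icc a (a + τ),
    N0 h (stepSource κ g a V F ρ q t - stepSource κ g a V F ρ q r)
      ≤ (2 * R + Λ * κ * R) * |t - r| := by
  intro t ht r hr
  have e : stepSource κ g a V F ρ q t - stepSource κ g a V F ρ q r
      = (F t - F r) - (ρ t - ρ r) - (g * κ) • (V t - V r) := by
    unfold stepSource; module
  have hg := S.g_pos
  have hR := S.R_nonneg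
  have hgκ : g * κ ≤ Λ * κ := mul_le_right S.g_le hκ.le
  rw [e]
  have n1 := map_sub_le_add (N0 h) ((F t - F r) - (ρ t - ρ r)) ((g * κ) • (V t - V r))
  have n2 := map_sub_le_add (N0 h) (F t - F r) (ρ t - ρ r)
  rw [map_smul_eq_mul, norm_of_nonneg (by positivity)] at n1
  have n3 : g * κ * N0 h (V t - V r) ≤ Λ * κ * (R * |t - r|) :=
    mul_le_mul hgκ (S.V_lip t ht r hr) (apply_nonneg _ _)
      (mul_nonneg (hg.le.trans S.g_le) hκ.le)
  linarith [S.F_lip t ht r hr, hρ t ht r hr]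

theorem ip_add_three_le (hh : 0 ≤ h) (f₁ f₂ f₃ : GridFun d J) :
    ip h (f₁ + f₂ + f₃) (f₁ + f₂ + f₃) ≤ 3 * (N0 h f₁ ^ 2 + N0 h f₂ ^ 2 + N0 h f₃ ^ 2) := by
  rw [← N0_sq hh]
  have h1 := map_add_le_add (N0 h) (f₁ + f₂) f₃
  have h2 := map_add_le_add (N0 h) f₁ f₂
  have := pow_le_pow_left₀ (apply_nonneg (N0 h) _) (h1.trans (add_le_add_left h2 _)) 2
  nlinarith [sq_nonneg (N0 h f₁ - N0 h f₂), sq_nonneg (N0 h f₁ - N0 h f₃),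
    sq_nonneg (N0 h f₂ - N0 h f₃)]

theorem N0_add_four_sq_le (f₁ f₂ f₃ f₄ : GridFun d J) :
    N0 h (f₁ + f₂ + f₃ + f₄) ^ 2
      ≤ 4 * (N0 h f₁ ^ 2 + N0 h f₂ ^ 2 + N0 h f₃ ^ 2 + N0 h f₄ ^ 2) := by
  have h1 := map_add_le_add (N0 h) (f₁ + f₂ + f₃) f₄
  have h2 := map_add_le_add (N0 h) (f₁ + f₂) f₃
  have h3 := map_add_le_add (N0 h) f₁ f₂
  have h4 : N0 h (f₁ + f₂ + f₃ + f₄) ≤ N0 h f₁ + N0 h f₂ + N0 h f₃ + N0 h f₄ := by linarith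
  have := pow_le_pow_left₀ (apply_nonneg (N0 h) _) h4 2
  nlinarith [sq_nonneg (N0 h f₁ - N0 h f₂), sq_nonneg (N0 h f₁ - N0 h f₃),
    sq_nonneg (N0 h f₂ - N0 h f₃), sq_nonneg (N0 h f₁ - N0 h f₄), sq_nonneg (N0 h f₂ - N0 h f₄),
    sq_nonneg (N0 h f₃ - N0 h f₄)]

theorem exp_mul_le_one_add {c τ : ℝ} (hc : 0 ≤ c) (hτ : 0 ≤ τ) (hτ1 : τ ≤ 1) :
    exp (c * τ) ≤ 1 + c * exp c * τ := by
  have h1 : 1 - c * τ ≤ exp (-(c * τ)) := by linarith [add_one_le_exp (-(c * τ))]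
  have h2 := exp_pos (c * τ)
  have h3 : exp (c * τ) * exp (-(c * τ)) = 1 := by rw [← Real.exp_add]; simp
  have h4 : exp (c * τ) ≤ exp c := exp_le_exp.mpr (mul_le_of_le_one_right hc hτ1)
  have h5 := mul_le_left h1 h2.le
  have h6 := mul_le_left h4 (by positivity : 0 ≤ c * τ)
  nlinarith

theorem StepData.source_sq_le (S : StepData h R Λ 𝒜 V F ρ a τ g) (hκ : 0 < κ) (q : GridFun d J)
    {t : ℝ} (ht : t ∈ Icc a (a + τ)) : N0 h (stepSource κ g a V F ρ q t) ^ 2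
      ≤ 2 * (R + Λ * κ * (1 + R)) ^ 2 * ((τ + h ^ 2) ^ 2 + energy h 𝒜 (q - V a)) := by
  have h1 := pow_le_pow_left₀ (apply_nonneg _ _) (S.source_le hκ q ht) 2
  have h2 := add_sq_le (a := τ + h ^ 2) (b := N0 h (q - V a))
  have h3 := S.pos (q - V a)
  rw [N0_sq S.h_pos.le] at h2
  rw [mul_pow] at h1
  rw [mul_comm (2 : ℝ), mul_assoc]
  exact h1.trans (mul_le_left (h2.trans (mul_le_left
    (add_le_add le_rfl (le_add_of_nonneg_right h3)) zero_le_two)) (sq_nonneg _))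

theorem StepData.damping_sq_le (S : StepData h R Λ 𝒜 V F ρ a τ g) (hκ : 0 < κ) (f : GridFun d J) :
    N0 h (-((g * κ) • f)) ^ 2 ≤ (Λ * κ) ^ 2 * N0 h f ^ 2 := by
  have := S.g_pos
  have := S.g_le
  rw [map_neg_eq_map, map_smul_eq_mul, mul_pow, norm_of_nonneg (by positivity)]
  gcongr

set_option maxHeartbeats 1000000 in
/-- Error propagation over one step when the nonlinear terms are compared in `L²`. -/
theorem step_error_le (hR : 0 ≤ R) (hΛ : 0 ≤ Λ) (hκ : 0 < κ) :
    ∃ C, 0 ≤ C ∧ ∀ {d J : ℕ} [NeZero J] {h : ℝ} {𝒜 : GridOp d J} {V F ρ : ℝ → GridFun d J}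
      {a τ g : ℝ} (_ : StepData h R Λ 𝒜 V F ρ a τ g) {q q' Fh : GridFun d J} {β : ℝ},
      q' = NormedSpace.exp (-(τ • (𝒜 + (g * κ) • 1))) q
        + τ • phi1 (-(τ • (𝒜 + (g * κ) • 1))) (-(g • Fh) + (g * κ) • q) →
      N0 h (g • Fh - F a) ≤ β →
      ∃ x, 0 ≤ x ∧
        energy h 𝒜 (q' - V (a + τ)) + x ≤ energy h 𝒜 (q - V a)
          + C * τ * (energy h 𝒜 (q - V a) + β ^ 2 + (τ + h ^ 2) ^ 2) ∧
        N0 h ((q' - V (a + τ)) - (q - V a)) ^ 2 ≤ τ * x ∧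
        ((∀ t ∈ Icc a (a + τ), ∀ r ∈ Icc a (a + τ), N0 h (ρ t - ρ r) ≤ R * |t - r|) →
          τ * N0 h (𝒜 (q' - V (a + τ))) ^ 2 ≤ C * x + C * τ * (energy h 𝒜 (q - V a)
            + energy h 𝒜 (q' - V (a + τ)) + β ^ 2 + (τ + h ^ 2) ^ 2)) := by
  set A := R + Λ * κ * (1 + R) with hA
  have hA0 : 0 ≤ A := by positivity
  set c := 3 * (Λ * κ) ^ 2 with hc
  set B := 2 * R + Λ * κ * R with hB
  have hB0 : 0 ≤ B := by positivity
  set C₁ := (2 + 2 * c) * exp (2 + 2 * c) with hC₁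
  set C₂ := exp (2 + 2 * c) * (12 * A ^ 2 + 6) with hC₂
  set C₃ := 4 * (exp 1 * (1 + B ^ 2) + (Λ * κ) ^ 2 + 2 * A ^ 2 + 1) with hC₃
  refine ⟨C₁ + C₂ + C₃, by positivity, ?_⟩
  intro d J _ h 𝒜 V F ρ a τ g S q q' Fh β hq' hβ
  obtain ⟨E, Ed, hEa, hEb, hE, hEd, heq⟩ := S.exists_error hκ hq'
  have hh := S.h_pos.le
  have hτ := S.τ_pos
  have hab : a ≤ a + τ := by linarith
  have hβ0 : 0 ≤ β := (apply_nonneg _ _).trans hβ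
  set ε := τ + h ^ 2 with hε
  have hε0 : 0 ≤ ε := by positivity
  have hW := fun t ht => S.source_sq_le hκ q (t := t) ht
  have hX : N0 h (-(g • Fh - F a)) ^ 2 ≤ β ^ 2 := by
    rw [map_neg_eq_map]; exact pow_le_pow_left₀ (apply_nonneg _ _) hβ 2
  have hgE := S.damping_sq_le hκ
  obtain ⟨e₀, he₀⟩ : ∃ r, r = energy h 𝒜 (q - V a) := ⟨_, rfl⟩
  obtain ⟨e₁, he₁⟩ : ∃ r, r = energy h 𝒜 (q' - V (a + τ)) := ⟨_, rfl⟩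
  have en0 : 0 ≤ e₀ := he₀ ▸ energy_nonneg hh S.pos _
  have en1 : 0 ≤ e₁ := he₁ ▸ energy_nonneg hh S.pos _
  have he' : N0 h (q' - V (a + τ)) ^ 2 ≤ e₁ := by
    rw [he₁, N0_sq hh, energy]; linarith [S.pos (q' - V (a + τ))]
  simp only [← he₀, ← hA, ← hε] at hW
  rw [← he₀, ← he₁]
  have main := energy_estimate hh S.symm S.pos (c := c)
    (β := 6 * A ^ 2 * (ε ^ 2 + e₀) + 3 * β ^ 2)
    (G := fun t => -((g * κ) • E t) + stepSource κ g a V F ρ q t + -(g • Fh - F a))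
    hab (by positivity) (by positivity) hE hEd
    (fun t ht => by rw [heq t ht]; abel) (fun t ht => by
      refine (ip_add_three_le hh _ _ _).trans ?_; have h1 := hW t ht; have h2 := hgE (E t)
      rw [N0_sq hh (E t)] at h2; rw [hc]
      linarith)
  rw [hEa, hEb, add_sub_cancel_left, ← he₀, ← he₁] at main
  refine ⟨∫ s in a..(a + τ), ip h (Ed s) (Ed s),
    intervalIntegral.integral_nonneg hab fun s _ => ip_self_nonneg hh _, ?_, ?_, ?_⟩
  · refine main.trans ?_
    have hc0 : 0 ≤ 2 + 2 * c := by positivity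
    have e1 := exp_mul_le_one_add hc0 hτ.le S.τ_le
    have e2 : exp ((2 + 2 * c) * τ) ≤ exp (2 + 2 * c) :=
      exp_le_exp.mpr (mul_le_of_le_one_right hc0 S.τ_le)
    have f1 := mul_le_right e1 en0
    have f2 : exp ((2 + 2 * c) * τ)
        * (2 * (6 * A ^ 2 * (ε ^ 2 + e₀) + 3 * β ^ 2) * τ)
        ≤ C₂ * τ * (e₀ + β ^ 2 + ε ^ 2) := by
      calc _ ≤ exp (2 + 2 * c)
          * ((12 * A ^ 2 + 6) * (e₀ + β ^ 2 + ε ^ 2) * τ) := by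
            refine mul_le_mul e2 (mul_le_right ?_ hτ.le) (by positivity)
              (exp_pos _).le
            have g1 : 0 ≤ A ^ 2 * β ^ 2 := by positivity
            have g2 : 0 ≤ ε ^ 2 := by positivity
            linarith
        _ = _ := by rw [hC₂]; ring
    have f3 : 0 ≤ C₃ * τ * (e₀ + β ^ 2 + ε ^ 2) := by positivity
    have f4 : 0 ≤ C₁ * τ * (β ^ 2 + ε ^ 2) := by positivity
    have f5 : (1 + (2 + 2 * c) * exp (2 + 2 * c) * τ) * e₀
        = e₀ + C₁ * τ * e₀ := by rw [hC₁]; ring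
    rw [mul_add]; linarith
  · have := ip_increment_le hh (by linarith : a < a + τ) hE hEd
    rwa [hEa, hEb, add_sub_cancel_left, ← N0_sq hh] at this
  · intro hρ
    have hb : a + τ ∈ Icc a (a + τ) := right_mem_Icc.mpr hab
    have hpos' : ∀ f, 0 ≤ ip h ((𝒜 + (g * κ) • (1 : GridOp d J)) f) f := fun f => by
      have e : (𝒜 + (g * κ) • (1 : GridOp d J)) f = 𝒜 f + (g * κ) • f := rfl
      rw [e, ip_add_left, ip_smul_left]
      exact add_nonneg (S.pos f) (mul_nonneg (mul_pos S.g_pos hκ).le (ip_self_nonneg hh f))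
    have ev := end_velocity_le hh hpos' (by linarith : a < a + τ) hE hEd
      (g := fun t => stepSource κ g a V F ρ q t - (g • Fh - F a)) (C := B)
      (fun t ht => by
        have e : (𝒜 + (g * κ) • (1 : GridOp d J)) (E t) = 𝒜 (E t) + (g * κ) • E t := rfl
        rw [heq t ht, e]; abel)
      (fun t ht r hr => by
        rw [sub_sub_sub_cancel_right]; exact S.source_lip hκ q hρ t ht r hr)
    rw [add_sub_cancel_left] at ev
    have e : 𝒜 (q' - V (a + τ)) = -((g * κ) • (q' - V (a + τ))) + stepSource κ g a V F ρ q (a + τ)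
        + -(g • Fh - F a) + -Ed (a + τ) := by
      have := heq (a + τ) hb; rw [hEb] at this; rw [this]; abel
    have n0 : N0 h (𝒜 (q' - V (a + τ))) ^ 2 ≤ 4 * (N0 h (-((g * κ) • (q' - V (a + τ)))) ^ 2
        + N0 h (stepSource κ g a V F ρ q (a + τ)) ^ 2 + N0 h (-(g • Fh - F a)) ^ 2
        + ip h (Ed (a + τ)) (Ed (a + τ))) := by
      rw [e]
      have := N0_add_four_sq_le (h := h) (-((g * κ) • (q' - V (a + τ))))
        (stepSource κ g a V F ρ q (a + τ)) (-(g • Fh - F a)) (-Ed (a + τ))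
      rwa [map_neg_eq_map (N0 h) (Ed (a + τ)), N0_sq hh (Ed (a + τ))] at this
    have n1 := hgE (q' - V (a + τ)); have n2 := hW (a + τ) hb; have n3 := mul_le_left n0 hτ.le
    have n4 : (Λ * κ) ^ 2 * N0 h (q' - V (a + τ)) ^ 2
        ≤ (Λ * κ) ^ 2 * e₁ := by gcongr
    set I := ∫ s in a..(a + τ), ip h (Ed s) (Ed s) with hI
    have hI0 : 0 ≤ I := intervalIntegral.integral_nonneg hab fun s _ => ip_self_nonneg hh _
    have n5 : B ^ 2 * τ ^ 3 ≤ B ^ 2 * (τ * ε ^ 2) := by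
      have : τ ≤ ε := by rw [hε]; linarith [sq_nonneg h]
      have : τ ^ 2 ≤ ε ^ 2 := by gcongr
      calc B ^ 2 * τ ^ 3 = B ^ 2 * (τ * τ ^ 2) := by ring
        _ ≤ _ := by gcongr
    set X := e₀ + e₁ + β ^ 2 + ε ^ 2 with hXdef
    have X0 : 0 ≤ X := by positivity
    have k1 : ε ^ 2 ≤ X := by rw [hXdef]; linarith [sq_nonneg β]
    have k2 : e₁ ≤ X := by rw [hXdef]; linarith [sq_nonneg β, sq_nonneg ε]
    have k3 : ε ^ 2 + e₀ ≤ X := by rw [hXdef]; linarith [sq_nonneg β]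
    have k4 : β ^ 2 ≤ X := by rw [hXdef]; linarith [sq_nonneg ε]
    have n6 : N0 h (-((g * κ) • (q' - V (a + τ)))) ^ 2
        + N0 h (stepSource κ g a V F ρ q (a + τ)) ^ 2 + N0 h (-(g • Fh - F a)) ^ 2
        ≤ ((Λ * κ) ^ 2 + 2 * A ^ 2 + 1) * X := by
      have m1 := mul_le_left k2 (by positivity : 0 ≤ (Λ * κ) ^ 2)
      have m2 := mul_le_left k3 (by positivity : 0 ≤ 2 * A ^ 2); linarith
    have n7 : τ * ip h (Ed (a + τ)) (Ed (a + τ)) ≤ exp 1 * (I + B ^ 2 * (τ * X)) := by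
      have n5' : B ^ 2 * τ ^ 3 ≤ B ^ 2 * (τ * X) := n5.trans (by gcongr)
      exact ev.trans (mul_le_left (by linarith) (exp_pos 1).le)
    have n8 := mul_le_left n6 hτ.le
    calc τ * N0 h (𝒜 (q' - V (a + τ))) ^ 2
        ≤ 4 * (τ * (((Λ * κ) ^ 2 + 2 * A ^ 2 + 1) * X)
            + exp 1 * (I + B ^ 2 * (τ * X))) := by linarith
      _ ≤ C₃ * I + C₃ * τ * X := by
        rw [hC₃]
        have : 0 ≤ exp 1 * B ^ 2 * I + ((Λ * κ) ^ 2 + 2 * A ^ 2 + 1) * I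
          + exp 1 * (τ * X) := by positivity
        linarith
      _ ≤ _ := by
        have : 0 ≤ (C₁ + C₂) * I + (C₁ + C₂) * τ * X := by positivity
        linarith

set_option maxHeartbeats 1000000 in
/-- Error propagation over one step when a part of the nonlinear terms is compared in a dual norm
only. -/
theorem step_error_rough_le (hR : 0 ≤ R) (hΛ : 0 ≤ Λ) (hκ : 0 < κ) :
    ∃ C, 0 ≤ C ∧ ∀ {d J : ℕ} [NeZero J] {h : ℝ} {𝒜 : GridOp d J} {V F ρ : ℝ → GridFun d J}
      {a τ g : ℝ} (_ : StepData h R Λ 𝒜 V F ρ a τ g) {q q' Fh Y : GridFun d J} {β : ℝ},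
      q' = NormedSpace.exp (-(τ • (𝒜 + (g * κ) • 1))) q
        + τ • phi1 (-(τ • (𝒜 + (g * κ) • 1))) (-(g • Fh) + (g * κ) • q) →
      N0 h (g • Fh - F a - Y) ≤ β → (∀ w, ip h Y w ^ 2 ≤ β ^ 2 * energy h 𝒜 w) →
      ∃ x, 0 ≤ x ∧
        energy h 𝒜 (q' - V (a + τ)) + x
          ≤ C * (energy h 𝒜 (q - V a) + β ^ 2 + (τ + h ^ 2) ^ 2) ∧
        N0 h ((q' - V (a + τ)) - (q - V a)) ^ 2 ≤ τ * x := by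
  set A := R + Λ * κ * (1 + R) with hA
  have hA0 : 0 ≤ A := by positivity
  set c := 3 * (Λ * κ) ^ 2 with hc
  set B := 6 * A ^ 2 + 3 with hB
  set C := 2 * exp (4 + 4 * c) * (1 + ((2 + 2 * c) * (8 * B + 1) + 2 * B)) + 8 * B + 1 with hC
  refine ⟨C, by positivity, ?_⟩
  intro d J _ h 𝒜 V F ρ a τ g S q q' Fh Y β hq' hβ hY
  obtain ⟨E, Ed, hEa, hEb, hE, hEd, heq⟩ := S.exists_error hκ hq'
  have hh := S.h_pos.le
  have hτ := S.τ_pos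
  have hab : a ≤ a + τ := by linarith
  have hβ0 : 0 ≤ β := (apply_nonneg _ _).trans hβ
  set ε := τ + h ^ 2 with hε
  have hε0 : 0 ≤ ε := by positivity
  have hW := fun t ht => S.source_sq_le hκ q (t := t) ht
  have hX : N0 h (-(g • Fh - F a - Y)) ^ 2 ≤ β ^ 2 := by
    rw [map_neg_eq_map]; exact pow_le_pow_left₀ (apply_nonneg _ _) hβ 2
  have hgE := S.damping_sq_le hκ
  obtain ⟨e₀, he₀⟩ : ∃ r, r = energy h 𝒜 (q - V a) := ⟨_, rfl⟩
  have en0 : 0 ≤ e₀ := he₀ ▸ energy_nonneg hh S.pos _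
  simp only [← he₀, ← hA, ← hε] at hW
  rw [← he₀]
  set X := e₀ + β ^ 2 + ε ^ 2 with hXdef
  have X0 : 0 ≤ X := by positivity
  have k1 : e₀ ≤ X := by rw [hXdef]; linarith [sq_nonneg β, sq_nonneg ε]
  have k2 : β ^ 2 ≤ X := by rw [hXdef]; linarith [sq_nonneg ε]
  have k3 : ε ^ 2 + e₀ ≤ X := by rw [hXdef]; linarith [sq_nonneg β]
  have k4 : 6 * A ^ 2 * (ε ^ 2 + e₀) + 3 * β ^ 2 ≤ B * X := by
    have m2 := mul_le_left k3 (by positivity : 0 ≤ 6 * A ^ 2); rw [hB]; linarith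
  have k5 : β ^ 2 ≤ B * X := by
    have : 0 ≤ (6 * A ^ 2 + 2) * X := by positivity
    rw [hB]; linarith
  have main := energy_estimate_rough hh S.symm S.pos (c := c) (β := B * X) (Y := -Y)
    (G := fun t => -((g * κ) • E t) + stepSource κ g a V F ρ q t + -(g • Fh - F a - Y))
    hab (by positivity) (by positivity) hE hEd
    (fun t ht => by rw [heq t ht]; abel) (fun t ht => by
      refine (ip_add_three_le hh _ _ _).trans ?_; have h1 := hW t ht; have h2 := hgE (E t)
      rw [N0_sq hh (E t)] at h2; rw [hc]
      linarith)
    (fun w => by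
      rw [ip_neg_left, neg_sq]
      exact (hY w).trans (mul_le_right k5 (energy_nonneg hh S.pos w)))
  rw [hEa, hEb, add_sub_cancel_left, ← he₀] at main
  refine ⟨∫ s in a..(a + τ), ip h (Ed s) (Ed s),
    intervalIntegral.integral_nonneg hab fun s _ => ip_self_nonneg hh _, ?_, ?_⟩
  · refine main.trans ?_
    have hc0 : 0 ≤ 4 + 4 * c := by positivity
    have e2 : exp ((4 + 4 * c) * τ) ≤ exp (4 + 4 * c) :=
      exp_le_exp.mpr (mul_le_of_le_one_right hc0 S.τ_le)
    have f1 : ((2 + 2 * c) * (8 * (B * X) + e₀) + 2 * (B * X)) * τ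
        ≤ ((2 + 2 * c) * (8 * (B * X) + X) + 2 * (B * X)) * 1 := by
      gcongr; exact S.τ_le
    calc _ ≤ 2 * exp (4 + 4 * c) * (X + ((2 + 2 * c) * (8 * (B * X) + X) + 2 * (B * X)) * 1)
          + 8 * (B * X) + X := by gcongr
      _ = C * X := by rw [hC]; ring
  · have := ip_increment_le hh (by linarith : a < a + τ) hE hEd
    rwa [hEa, hEb, add_sub_cancel_left, ← N0_sq hh] at this

end OneStep

/-! ### The two energies -/

section Energies

variable {d J : ℕ} [NeZero J] {h : ℝ}

/-- The elastic operator `-K Δ_h`. -/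
def elastic (P : Params) (h : ℝ) : GridOp d J := -(P.K • lapOp h)

/-- The smectic operator `2 B₀ Δ_h²`. -/
def smectic (P : Params) (h : ℝ) : GridOp d J := (2 * P.B0) • (lapOp h * lapOp h)

theorem elastic_apply (P : Params) (f : GridFun d J) :
    elastic P h f = -(P.K • lapOp h f) := rfl

theorem smectic_apply (P : Params) (f : GridFun d J) :
    smectic P h f = (2 * P.B0) • lapOp h (lapOp h f) := rfl

theorem elastic_symm (P : Params) (f g : GridFun d J) :
    ip h (elastic P h f) g = ip h f (elastic P h g) := by
  simp only [elastic_apply, ip_neg_left, ip_neg_right, ip_smul_left, ip_smul_right, ip_lap_comm]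

theorem smectic_symm (P : Params) (f g : GridFun d J) :
    ip h (smectic P h f) g = ip h f (smectic P h g) := by
  simp only [smectic_apply, ip_smul_left, ip_smul_right, ip_lap_comm]

theorem energy_elastic (P : Params) (hh : 0 ≤ h) (f : GridFun d J) :
    energy h (elastic P h) f = N0 h f ^ 2 + P.K * ∑ k, N0 h (Dp h k f) ^ 2 := by
  simp only [energy, elastic_apply, ip_neg_left, ip_smul_left, ip_lap_left, N0_sq hh]
  ring

theorem energy_smectic (P : Params) (hh : 0 ≤ h) (f : GridFun d J) :
    energy h (smectic P h) f = N0 h f ^ 2 + 2 * P.B0 * N0 h (lapOp h f) ^ 2 := by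
  simp only [energy, smectic_apply, ip_smul_left, ip_lap_comm (lapOp h f), N0_sq hh]

theorem elastic_pos {P : Params} (hK : 0 < P.K) (hh : 0 ≤ h) (f : GridFun d J) :
    0 ≤ ip h (elastic P h f) f := by
  have := energy_elastic P hh f
  rw [energy, ← N0_sq hh] at this
  have h2 : 0 ≤ P.K * ∑ k, N0 h (Dp h k f) ^ 2 :=
    mul_nonneg hK.le (sum_nonneg fun k _ => sq_nonneg _)
  linarith

theorem smectic_pos {P : Params} (hB : 0 < P.B0) (hh : 0 ≤ h) (f : GridFun d J) :
    0 ≤ ip h (smectic P h f) f := by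
  have := energy_smectic P hh f
  rw [energy, ← N0_sq hh] at this
  have h2 : 0 ≤ 2 * P.B0 * N0 h (lapOp h f) ^ 2 := by positivity
  linarith

theorem N1_sq_le_energy {P : Params} (hK : 0 < P.K) (hh : 0 ≤ h) (f : GridFun d J) :
    N1 h f ^ 2 ≤ (1 + P.K⁻¹) * energy h (elastic P h) f := by
  rw [N1_sq' hh, energy_elastic P hh]
  have h1 : 0 ≤ ∑ k, N0 h (Dp h k f) ^ 2 := sum_nonneg fun k _ => sq_nonneg _
  have h2 : (1 + P.K⁻¹) * (N0 h f ^ 2 + P.K * ∑ k, N0 h (Dp h k f) ^ 2)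
      = N0 h f ^ 2 + ∑ k, N0 h (Dp h k f) ^ 2
        + (P.K⁻¹ * N0 h f ^ 2 + P.K * ∑ k, N0 h (Dp h k f) ^ 2) := by
    field_simp; ring
  rw [h2]
  have : 0 ≤ P.K⁻¹ * N0 h f ^ 2 + P.K * ∑ k, N0 h (Dp h k f) ^ 2 := by positivity
  linarith

theorem energy_elastic_le {P : Params} (hK : 0 < P.K) (hh : 0 ≤ h) (f : GridFun d J) :
    energy h (elastic P h) f ≤ (1 + P.K) * N1 h f ^ 2 := by
  rw [N1_sq' hh, energy_elastic P hh]
  have h1 : 0 ≤ ∑ k, N0 h (Dp h k f) ^ 2 := sum_nonneg fun k _ => sq_nonneg _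
  have h2 : 0 ≤ P.K * N0 h f ^ 2 := by positivity
  linarith

theorem N2_sq_le_energy {P : Params} (hB : 0 < P.B0) (hh : 0 ≤ h) (f : GridFun d J) :
    N2 h f ^ 2 ≤ (2 + P.B0⁻¹) * energy h (smectic P h) f := by
  refine (N2_sq_le hh f).trans ?_
  rw [energy_smectic P hh]
  have h2 : (2 + P.B0⁻¹) * (N0 h f ^ 2 + 2 * P.B0 * N0 h (lapOp h f) ^ 2)
      = 2 * (N0 h f ^ 2 + N0 h (lapOp h f) ^ 2)
        + (P.B0⁻¹ * N0 h f ^ 2 + 4 * P.B0 * N0 h (lapOp h f) ^ 2) := by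
    field_simp; ring
  rw [h2]
  have : 0 ≤ P.B0⁻¹ * N0 h f ^ 2 + 4 * P.B0 * N0 h (lapOp h f) ^ 2 := by positivity
  linarith

theorem energy_smectic_le {P : Params} (hB : 0 < P.B0) (hh : 0 ≤ h) (f : GridFun d J) :
    energy h (smectic P h) f ≤ (1 + 2 * P.B0) * N2 h f ^ 2 := by
  have h1 := pow_le_pow_left₀ (apply_nonneg _ _) ((N0_le_N1 hh f).trans (N1_le_N2 hh f)) 2
  have h2 := pow_le_pow_left₀ (apply_nonneg _ _) (N0_lap_le_N2 hh f) 2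
  rw [energy_smectic P hh]
  have := mul_le_left h2 (by positivity : 0 ≤ 2 * P.B0)
  linarith

theorem N2_sq_le_elastic {P : Params} (hK : 0 < P.K) (hh : 0 ≤ h) (f : GridFun d J) :
    N2 h f ^ 2 ≤ (1 + P.K⁻¹) * energy h (elastic P h) f
      + (P.K⁻¹) ^ 2 * N0 h (elastic P h f) ^ 2 := by
  rw [N2_sq' hh, elastic_apply, map_neg_eq_map, map_smul_eq_mul, norm_of_nonneg hK.le,
    mul_pow, ← mul_assoc, ← mul_pow, inv_mul_cancel₀ hK.ne', one_pow, one_mul]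
  linarith [N1_sq_le_energy hK hh f]

theorem N0_sq_le_energy (hh : 0 ≤ h) {𝒜 : GridOp d J} (hpos : ∀ f, 0 ≤ ip h (𝒜 f) f)
    (f : GridFun d J) : N0 h f ^ 2 ≤ energy h 𝒜 f := by
  rw [N0_sq hh, energy]; linarith [hpos f]

/-- A path that is Lipschitz in the discrete `L²` norm is continuous. -/
theorem continuousOn_of_N0_lipschitz (hh : 0 < h) {F : ℝ → GridFun d J} {s : Set ℝ} {R : ℝ}
    (hF : ∀ t ∈ s, ∀ r ∈ s, N0 h (F t - F r) ≤ R * |t - r|) : ContinuousOn F s := by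
  have hp : 0 < h ^ d := pow_pos hh d
  rw [continuousOn_pi]
  intro p
  have hlip : LipschitzOnWith (Real.toNNReal ((√(h ^ d))⁻¹ * R)) (fun t => F t p) s := by
    refine LipschitzOnWith.of_dist_le' (K := (√(h ^ d))⁻¹ * R) fun t ht r hr => ?_
    have h1 : h ^ d * (F t p - F r p) ^ 2 ≤ N0 h (F t - F r) ^ 2 := by
      rw [N0_sq hh.le, ip]; refine mul_le_left ?_ hp.le
      have := single_le_sum (f := fun p => (F t - F r) p * (F t - F r) p)
        (fun p _ => mul_self_nonneg _) (Finset.mem_univ p)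
      simpa [sq] using this
    have h2 : √(h ^ d) * |F t p - F r p| ≤ N0 h (F t - F r) := by
      refine abs_le_of_sq_le_sq' ?_ (apply_nonneg _ _) |>.2; rw [mul_pow, sq_sqrt hp.le, sq_abs]
      exact h1
    have h3 := h2.trans (hF t ht r hr); rw [Real.dist_eq, Real.dist_eq, mul_assoc]
    rw [← div_eq_inv_mul, le_div_iff₀ (Real.sqrt_pos.mpr hp), mul_comm]; exact h3
  exact hlip.continuousOn

end Energies

/-! ### Grid restrictions of an exact solution -/

/-- A trajectory `(V, U, s)` of grid functions that satisfies the semi-discrete system up to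
residuals of size `h²`, with uniform bounds. -/
structure GridSolution {d : ℕ} (P : Params) (T R : ℝ) {J : ℕ} [NeZero J] (h : ℝ)
    (V : ℝ → Grid d J → Mat d) (U : ℝ → GridFun d J) (s : ℝ → ℝ)
    (ρ : ℝ → Fin d → Fin d → GridFun d J) (ς : ℝ → GridFun d J) : Prop where
  V_bd : ∀ t ∈ Icc 0 T, ∀ i j, N2 h (entry (V t) i j) ≤ R
  U_bd : ∀ t ∈ Icc 0 T, N2 h (U t) ≤ R
  V_sup : ∀ t ∈ Icc 0 T, ∀ i j p, |V t p i j| ≤ R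
  hess_sup : ∀ t ∈ Icc 0 T, ∀ k l p, |Dc h k (Dc h l (U t)) p| ≤ R
  H_bd : ∀ t ∈ Icc 0 T, ∀ i j, N0 h (entry (HH P h (V t) (U t)) i j) ≤ R
  mu_bd : ∀ t ∈ Icc 0 T, N0 h (muH P h (V t) (U t)) ≤ R
  V_deriv : ∀ t ∈ Icc 0 T, ∀ i j, HasDerivWithinAt (fun t => entry (V t) i j)
    (-elastic P h (entry (V t) i j) - entry (HH P h (V t) (U t)) i j + ρ t i j) (Icc 0 T) t
  U_deriv : ∀ t ∈ Icc 0 T, HasDerivWithinAt U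
    (-smectic P h (U t) - muH P h (V t) (U t) + ς t) (Icc 0 T) t
  V_lip : ∀ t ∈ Icc 0 T, ∀ r ∈ Icc 0 T, ∀ i j,
    N0 h (entry (V t) i j - entry (V r) i j) ≤ R * |t - r|
  U_lip : ∀ t ∈ Icc 0 T, ∀ r ∈ Icc 0 T, N0 h (U t - U r) ≤ R * |t - r|
  H_lip : ∀ t ∈ Icc 0 T, ∀ r ∈ Icc 0 T, ∀ i j,
    N0 h (entry (HH P h (V t) (U t)) i j - entry (HH P h (V r) (U r)) i j) ≤ R * |t - r|
  mu_lip : ∀ t ∈ Icc 0 T, ∀ r ∈ Icc 0 T,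
    N0 h (muH P h (V t) (U t) - muH P h (V r) (U r)) ≤ R * |t - r|
  ρ_lip : ∀ t ∈ Icc 0 T, ∀ r ∈ Icc 0 T, ∀ i j, N0 h (ρ t i j - ρ r i j) ≤ R * |t - r|
  ς_cont : ContinuousOn ς (Icc 0 T)
  ρ_le : ∀ t ∈ Icc 0 T, ∀ i j, N0 h (ρ t i j) ≤ R * h ^ 2
  ς_le : ∀ t ∈ Icc 0 T, N0 h (ς t) ≤ R * h ^ 2
  E1_le : ∀ t ∈ Icc 0 T, |E1h P h (V t) (U t) - s t| ≤ R * h ^ 2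
  s_increment : ∀ t ∈ Icc 0 T, ∀ r ∈ Icc 0 T, t ≤ r →
    |s r - s t - ((∑ i, ∑ j, ip h (entry (HH P h (V t) (U t)) i j)
        (entry (V r) i j - entry (V t) i j)) + ip h (muH P h (V t) (U t)) (U r - U t))|
      ≤ R * (r - t) * (r - t + h ^ 2)

namespace GridSolution

variable {d : ℕ} {P : Params} {L T R : ℝ} {J : ℕ} [NeZero J] {h : ℝ}
  {V : ℝ → Grid d J → Mat d} {U : ℝ → GridFun d J} {s : ℝ → ℝ}
  {ρ : ℝ → Fin d → Fin d → GridFun d J} {ς : ℝ → GridFun d J} {a τ g Λ : ℝ}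

theorem stepData_Q (G : GridSolution P T R h V U s ρ ς) (hK : 0 < P.K) (hR : 0 ≤ R) (hh : 0 < h)
    (ha : 0 ≤ a) (hτ : 0 < τ) (hτ1 : τ ≤ 1) (haT : a + τ ≤ T) (hg : 0 < g) (hgΛ : g ≤ Λ)
    (i j : Fin d) :
    StepData h R Λ (elastic P h) (fun t => entry (V t) i j)
      (fun t => entry (HH P h (V t) (U t)) i j) (fun t => ρ t i j) a τ g := by
  have hs : Icc a (a + τ) ⊆ Icc 0 T := Icc_subset_Icc ha haT
  have hF := fun t (ht : t ∈ Icc a (a + τ)) r (hr : r ∈ Icc a (a + τ)) =>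
    G.H_lip t (hs ht) r (hs hr) i j
  have hρ := fun t (ht : t ∈ Icc a (a + τ)) r (hr : r ∈ Icc a (a + τ)) =>
    G.ρ_lip t (hs ht) r (hs hr) i j
  exact { symm := elastic_symm P, pos := elastic_pos hK hh.le, R_nonneg := hR, h_pos := hh,
          τ_pos := hτ, τ_le := hτ1, g_pos := hg, g_le := hgΛ,
          deriv := fun t ht => (G.V_deriv t (hs ht) i j).mono hs
          F_cont := continuousOn_of_N0_lipschitz hh hF
          ρ_cont := continuousOn_of_N0_lipschitz hh hρ
          F_lip := hF
          V_lip := fun t ht r hr => G.V_lip t (hs ht) r (hs hr) i j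
          ρ_le := fun t ht => G.ρ_le t (hs ht) i j }

theorem stepData_u (G : GridSolution P T R h V U s ρ ς) (hB : 0 < P.B0) (hR : 0 ≤ R) (hh : 0 < h)
    (ha : 0 ≤ a) (hτ : 0 < τ) (hτ1 : τ ≤ 1) (haT : a + τ ≤ T) (hg : 0 < g) (hgΛ : g ≤ Λ) :
    StepData h R Λ (smectic P h) U (fun t => muH P h (V t) (U t)) ς a τ g := by
  have hs : Icc a (a + τ) ⊆ Icc 0 T := Icc_subset_Icc ha haT
  have hF := fun t (ht : t ∈ Icc a (a + τ)) r (hr : r ∈ Icc a (a + τ)) =>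
    G.mu_lip t (hs ht) r (hs hr)
  exact { symm := smectic_symm P, pos := smectic_pos hB hh.le, R_nonneg := hR, h_pos := hh,
          τ_pos := hτ, τ_le := hτ1, g_pos := hg, g_le := hgΛ,
          deriv := fun t ht => (G.U_deriv t (hs ht)).mono hs
          F_cont := continuousOn_of_N0_lipschitz hh hF
          ρ_cont := G.ς_cont.mono hs
          F_lip := hF
          V_lip := fun t ht r hr => G.U_lip t (hs ht) r (hs hr)
          ρ_le := fun t ht => G.ς_le t (hs ht) }

/-- Squared energy error of the tensor. -/
def errQ (P : Params) (h : ℝ) (X Y : Grid d J → Mat d) : ℝ :=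
  ∑ i, ∑ j, energy h (elastic P h) (entry X i j - entry Y i j)

/-- Squared energy error of the layer variable. -/
def errU (P : Params) (h : ℝ) (u v : GridFun d J) : ℝ := energy h (smectic P h) (u - v)

/-- Squared `H²` error of the tensor. -/
def strongErrQ (h : ℝ) (X Y : Grid d J → Mat d) : ℝ :=
  ∑ i, ∑ j, N2 h (entry X i j - entry Y i j) ^ 2

theorem errQ_nonneg (hK : 0 < P.K) (hh : 0 ≤ h) (X Y : Grid d J → Mat d) : 0 ≤ errQ P h X Y :=
  sum_nonneg fun _ _ => sum_nonneg fun _ _ => energy_nonneg hh (elastic_pos hK hh) _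

theorem errU_nonneg (hB : 0 < P.B0) (hh : 0 ≤ h) (u v : GridFun d J) : 0 ≤ errU P h u v :=
  energy_nonneg hh (smectic_pos hB hh) _

theorem strongErrQ_nonneg (X Y : Grid d J → Mat d) : 0 ≤ strongErrQ h X Y :=
  sum_nonneg fun _ _ => sum_nonneg fun _ _ => sq_nonneg _

theorem energy_le_errQ (hK : 0 < P.K) (hh : 0 ≤ h) (X Y : Grid d J → Mat d) (i j : Fin d) :
    energy h (elastic P h) (entry X i j - entry Y i j) ≤ errQ P h X Y := by
  exact le_sum_sum (f := fun i j => energy h (elastic P h) (entry X i j - entry Y i j))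
    (fun _ _ => energy_nonneg hh (elastic_pos hK hh) _) i j

theorem N2_sq_le_strongErrQ (X Y : Grid d J → Mat d) (i j : Fin d) :
    N2 h (entry X i j - entry Y i j) ^ 2 ≤ strongErrQ h X Y := by
  exact le_sum_sum (f := fun i j => N2 h (entry X i j - entry Y i j) ^ 2)
    (fun _ _ => sq_nonneg _) i j

/-- The constant relating the energy errors to discrete Sobolev norms. -/
def sobC (P : Params) : ℝ := 3 + P.K⁻¹ + P.B0⁻¹

theorem N1_sub_le (hK : 0 < P.K) (hB : 0 < P.B0) (hh : 0 ≤ h) (X Y : Grid d J → Mat d)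
    (u v : GridFun d J) (i j : Fin d) :
    N1 h (entry X i j - entry Y i j) ≤ sobC P * √(errQ P h X Y + errU P h u v) := by
  have hS : 1 ≤ sobC P := by
    have : 0 < P.K⁻¹ := by positivity
    have : 0 < P.B0⁻¹ := by positivity
    unfold sobC; linarith
  have h1 := energy_le_errQ hK hh X Y i j
  have h2 := errU_nonneg hB hh u v
  have h3 := errQ_nonneg hK hh X Y
  refine le_of_sq_le_sq ?_ (by positivity)
  rw [mul_pow, sq_sqrt (by positivity)]
  refine (N1_sq_le_energy hK hh _).trans ?_
  have h4 : 1 + P.K⁻¹ ≤ sobC P ^ 2 := by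
    have : 0 < P.B0⁻¹ := by positivity
    have : 1 + P.K⁻¹ ≤ sobC P := by unfold sobC; linarith
    nlinarith
  exact mul_le_mul h4 (by linarith) (energy_nonneg hh (elastic_pos hK hh) _) (by positivity)

theorem N2_sub_le (hK : 0 < P.K) (hB : 0 < P.B0) (hh : 0 ≤ h) (X Y : Grid d J → Mat d)
    (u v : GridFun d J) :
    N2 h (u - v) ≤ sobC P * √(errQ P h X Y + errU P h u v) := by
  have hS : 1 ≤ sobC P := by
    have : 0 < P.K⁻¹ := by positivity
    have : 0 < P.B0⁻¹ := by positivity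
    unfold sobC; linarith
  have h2 := errU_nonneg hB hh u v
  have h3 := errQ_nonneg hK hh X Y
  refine le_of_sq_le_sq ?_ (by positivity)
  rw [mul_pow, sq_sqrt (by positivity)]
  refine (N2_sq_le_energy hB hh _).trans ?_
  have h4 : 2 + P.B0⁻¹ ≤ sobC P ^ 2 := by
    have : 0 < P.K⁻¹ := by positivity
    have : 2 + P.B0⁻¹ ≤ sobC P := by unfold sobC; linarith
    nlinarith
  exact mul_le_mul h4 (by unfold errU at *; linarith) h2 (by positivity)

/-- The comparison of a discrete state with the exact one, in the form used by the Lipschitz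
estimates. -/
def cfg (G : GridSolution P T R h V U s ρ ς) (hK : 0 < P.K) (hB : 0 < P.B0) (hhL : h = L / J)
    (hh : 0 ≤ h) {t : ℝ} (ht : t ∈ Icc 0 T) (X : Grid d J → Mat d) (u : GridFun d J)
    (hδ : sobC P * √(errQ P h X (V t) + errU P h u (U t)) ≤ 1) : Cfg d L R where
  J := J
  hJ := inferInstance
  h := h
  hh := hhL
  X := X
  X' := V t
  v := u
  v' := U t
  δ := sobC P * √(errQ P h X (V t) + errU P h u (U t))
  δ_nonneg := by
    have : 0 < P.K⁻¹ := by positivity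
    have : 0 < P.B0⁻¹ := by positivity
    have : 0 ≤ sobC P := by unfold sobC; linarith
    positivity
  δ_le := hδ
  X_sub := N1_sub_le hK hB hh X (V t) u (U t)
  v_sub := N2_sub_le hK hB hh X (V t) u (U t)
  X'_bd := G.V_bd t ht
  v'_bd := G.U_bd t ht
  X'_sup := G.V_sup t ht
  hess_sup := G.hess_sup t ht

end GridSolution

/-! ### Comparison of the nonlinear terms -/

theorem abs_exp_sub_one_le_mul {x M : ℝ} (hx : |x| ≤ M) : |exp x - 1| ≤ exp M * |x| := by
  have h1 := add_one_le_exp x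
  have h2 := add_one_le_exp (-x)
  have h3 : exp x * exp (-x) = 1 := by rw [← Real.exp_add]; simp
  have h4 : exp x ≤ exp M := exp_le_exp.mpr ((le_abs_self x).trans hx)
  have h5 : 1 ≤ exp M := Real.one_le_exp ((abs_nonneg x).trans hx)
  have h6 := exp_pos x
  have h8 := abs_nonneg x
  rw [abs_le]
  constructor
  · have : |x| ≤ exp M * |x| := le_mul_of_one_le_left h8 h5
    have := neg_abs_le x; linarith
  · have h9 : exp x - 1 ≤ x * exp x := by nlinarith
    have h10 : x * exp x ≤ |x| * exp x :=
      mul_le_right (le_abs_self x) h6.le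
    have h11 := mul_le_left h4 h8; linarith

namespace GridSolution

variable {d : ℕ} {P : Params} {L T R : ℝ}

theorem three_le_sobC (hK : 0 < P.K) (hB : 0 < P.B0) : 3 ≤ sobC P := by
  have : 0 < P.K⁻¹ := by positivity
  have : 0 < P.B0⁻¹ := by positivity
  unfold sobC; linarith

/-- The size of the errors for which the Lipschitz estimates are valid. -/
def smallness (P : Params) : ℝ := (sobC P ^ 2)⁻¹

theorem smallness_pos (hK : 0 < P.K) (hB : 0 < P.B0) : 0 < smallness P := by
  have := three_le_sobC hK hB
  unfold smallness; positivity

theorem smallness_le (hK : 0 < P.K) (hB : 0 < P.B0) : smallness P ≤ 1 := by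
  have := three_le_sobC hK hB
  unfold smallness
  exact inv_le_one_of_one_le₀ (by nlinarith)

theorem sobC_mul_sqrt_le (hK : 0 < P.K) (hB : 0 < P.B0) {x : ℝ} (hx : x ≤ smallness P) :
    sobC P * √x ≤ 1 := by
  have h3 := three_le_sobC hK hB
  have h0 : 0 < sobC P := by linarith
  calc sobC P * √x ≤ sobC P * √((sobC P ^ 2)⁻¹) := by gcongr; exact hx
    _ = 1 := by rw [Real.sqrt_inv, sqrt_sq h0.le]; field_simp

/-- The energy is consistent. -/
theorem E1h_sub_le (hL : 0 < L) (hd : d = 2 ∨ d = 3) (hR : 0 ≤ R) (hK : 0 < P.K) (hB : 0 < P.B0) :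
    ∃ C, 0 ≤ C ∧ ∀ {J : ℕ} [NeZero J] {h : ℝ} {V : ℝ → Grid d J → Mat d} {U : ℝ → GridFun d J}
      {s : ℝ → ℝ} {ρ : ℝ → Fin d → Fin d → GridFun d J} {ς : ℝ → GridFun d J}
      (_ : GridSolution P T R h V U s ρ ς) (_ : h = L / J) {t : ℝ} (_ : t ∈ Icc 0 T)
      (X : Grid d J → Mat d) (u : GridFun d J) {ε : ℝ}, h ^ 2 ≤ ε →
      errQ P h X (V t) + errU P h u (U t) ≤ smallness P →
      |E1h P h X u - s t| ≤ C * √(errQ P h X (V t) + errU P h u (U t) + ε ^ 2) := by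
  obtain ⟨C, hC, hlip⟩ := E1h_lipschitz (d := d) P hL hd hR
  refine ⟨C * sobC P + R, ?_, ?_⟩
  · have := three_le_sobC hK hB
    positivity
  intro J _ h V U s ρ ς G hhL t ht X u ε hε hsm
  have hh : 0 ≤ h := by rw [hhL]; positivity
  have h1 := hlip (G.cfg hK hB hhL hh ht X u (sobC_mul_sqrt_le hK hB hsm))
  have h2 := G.E1_le t ht
  simp only [cfg] at h1
  have e1 := errQ_nonneg hK hh X (V t)
  have e2 := errU_nonneg hB hh u (U t)
  have h0 : 0 ≤ h ^ 2 := by positivity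
  have h3 : √(errQ P h X (V t) + errU P h u (U t))
      ≤ √(errQ P h X (V t) + errU P h u (U t) + ε ^ 2) :=
    sqrt_le_sqrt (by linarith [sq_nonneg ε])
  have h4 : h ^ 2 ≤ √(errQ P h X (V t) + errU P h u (U t) + ε ^ 2) :=
    hε.trans (le_sqrt_of_sq_le (by linarith))
  have hs := three_le_sobC hK hB
  calc |E1h P h X u - s t| ≤ |E1h P h X u - E1h P h (V t) (U t)| + |E1h P h (V t) (U t) - s t| :=
        abs_sub_le _ _ _
    _ ≤ C * (sobC P * √(errQ P h X (V t) + errU P h u (U t))) + R * h ^ 2 := add_le_add h1 h2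
    _ ≤ C * (sobC P * √(errQ P h X (V t) + errU P h u (U t) + ε ^ 2))
        + R * √(errQ P h X (V t) + errU P h u (U t) + ε ^ 2) := by gcongr
    _ = _ := by ring

/-- All errors of a state, squared. -/
def errAll {J : ℕ} [NeZero J] (P : Params) (h ε : ℝ) (X : Grid d J → Mat d) (u : GridFun d J)
    (r : ℝ) (X' : Grid d J → Mat d) (u' : GridFun d J) (r' : ℝ) : ℝ :=
  errQ P h X X' + errU P h u u' + |r - r'| ^ 2 + ε ^ 2

/-- The nonlinear terms are consistent, up to a rough part that is small in a dual norm. -/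
theorem nonlinear_sub_le (hL : 0 < L) (hd : d = 2 ∨ d = 3) (hR : 0 ≤ R) (hK : 0 < P.K)
    (hB : 0 < P.B0) :
    ∃ C, 1 ≤ C ∧ ∀ {J : ℕ} [NeZero J] {h : ℝ} {V : ℝ → Grid d J → Mat d} {U : ℝ → GridFun d J}
      {s : ℝ → ℝ} {ρ : ℝ → Fin d → Fin d → GridFun d J} {ς : ℝ → GridFun d J}
      (_ : GridSolution P T R h V U s ρ ς) (_ : h = L / J) {t : ℝ} (_ : t ∈ Icc 0 T)
      (X : Grid d J → Mat d) (u : GridFun d J) (r : ℝ) {ε : ℝ}, h ^ 2 ≤ ε →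
      errAll P h ε X u r (V t) (U t) (s t) ≤ smallness P →
      0 < gH P h X u r ∧ gH P h X u r ≤ C ∧
      (∀ i j, N0 h (gH P h X u r • entry (HH P h X u) i j - entry (HH P h (V t) (U t)) i j)
        ≤ C * √(errAll P h ε X u r (V t) (U t) (s t))) ∧
      ∃ Y : GridFun d J,
        N0 h (gH P h X u r • muH P h X u - muH P h (V t) (U t) - Y)
          ≤ C * √(errAll P h ε X u r (V t) (U t) (s t)) ∧
        N0 h Y ≤ C * √(strongErrQ h X (V t)) ∧
        ∀ w, |ip h Y w| ≤ C * √(errAll P h ε X u r (V t) (U t) (s t)) * N2 h w := by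
  obtain ⟨CE, hCE, hE⟩ := E1h_sub_le (d := d) (P := P) (T := T) hL hd hR hK hB
  obtain ⟨CH, hCH, hH⟩ := HH_lipschitz (d := d) P hL hd hR
  obtain ⟨Cm, hCm, hm⟩ := muH_lipschitz (d := d) P hL hd hR
  obtain ⟨Cr, hCr, hr⟩ := muRough_le (d := d) P hL hd hR
  obtain ⟨Cp, hCp, hp⟩ := ip_muRough_le (d := d) P hL hd hR
  have hs3 := three_le_sobC hK hB
  set c := sobC P with hc
  have hc0 : 0 ≤ c := by linarith
  set Λ := exp (1 + CE) with hΛ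
  have hΛ1 : 1 ≤ Λ := Real.one_le_exp (by positivity)
  set C := Λ * (1 + (1 + CE) * R + (CH + Cm + Cp) * c + Cr) with hCdef
  have hCΛ : Λ ≤ C := by
    rw [hCdef]; refine le_mul_of_one_le_right (by positivity) ?_
    have : 0 ≤ (1 + CE) * R + (CH + Cm + Cp) * c + Cr := by positivity
    linarith
  refine ⟨C, hΛ1.trans hCΛ, ?_⟩
  intro J _ h V U s ρ ς G hhL t ht X u r ε hε hsm
  have hh : 0 ≤ h := by rw [hhL]; positivity
  set S := errAll P h ε X u r (V t) (U t) (s t) with hS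
  have e1 := errQ_nonneg hK hh X (V t)
  have e2 := errU_nonneg hB hh u (U t)
  have hQU : errQ P h X (V t) + errU P h u (U t) ≤ S := by
    rw [hS, errAll]; linarith [sq_nonneg ε, sq_nonneg |r - s t|]
  have hS1 : S ≤ 1 := hsm.trans (smallness_le hK hB)
  have hS0 : 0 ≤ S := by linarith
  have hsq1 : √S ≤ 1 := Real.sqrt_le_one.mpr hS1
  have hδ := sobC_mul_sqrt_le hK hB (hQU.trans hsm)
  set cf := G.cfg hK hB hhL hh ht X u hδ with hcf
  have hδS : cf.δ ≤ c * √S := by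
    simp only [hcf, cfg]; gcongr
  have hη : |r - E1h P h X u| ≤ (1 + CE) * √S := by
    have h1 := hE G hhL ht X u hε (hQU.trans hsm)
    have h2 : √(errQ P h X (V t) + errU P h u (U t) + ε ^ 2) ≤ √S :=
      sqrt_le_sqrt (by rw [hS, errAll]; linarith [sq_nonneg |r - s t|])
    have h3 : |r - s t| ≤ √S :=
      le_sqrt_of_sq_le (by rw [hS, errAll]; linarith [sq_nonneg ε])
    have h4 := abs_sub_le r (s t) (E1h P h X u); rw [abs_sub_comm (s t)] at h4
    have h5 := mul_le_left h2 hCE; linarith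
  have hη1 : |r - E1h P h X u| ≤ 1 + CE :=
    hη.trans (mul_le_of_le_one_right (by positivity) hsq1)
  have hg : gH P h X u r = exp (r - E1h P h X u) := by rw [gH, Real.exp_sub]
  set g := gH P h X u r with hgdef
  have hg0 : 0 < g := by rw [hg]; exact exp_pos _
  have hgΛ : g ≤ Λ := by
    rw [hg]; exact exp_le_exp.mpr ((le_abs_self _).trans hη1)
  have hg1 : |g - 1| ≤ Λ * (1 + CE) * √S := by
    rw [hg]; refine (abs_exp_sub_one_le_mul hη1).trans ?_; rw [mul_assoc]; gcongr
  have comb : ∀ (f f' y : GridFun d J) (B : ℝ), N0 h f' ≤ R → 0 ≤ B → B ≤ (CH + Cm + Cp) * c →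
      N0 h (f - f' - y) ≤ B * √S → N0 h (g • f - f' - g • y) ≤ C * √S := by
    intro f f' y B hf' hB0 hB1 hfy
    have e : g • f - f' - g • y = (g - 1) • f' + g • (f - f' - y) := by module
    rw [e]; refine (map_add_le_add _ _ _).trans ?_
    rw [map_smul_eq_mul, map_smul_eq_mul, norm_eq_abs, norm_of_nonneg hg0.le]
    have i1 : |g - 1| * N0 h f' ≤ Λ * (1 + CE) * √S * R :=
      mul_le_mul hg1 hf' (apply_nonneg _ _) (by positivity)
    have i2 : g * N0 h (f - f' - y) ≤ Λ * (B * √S) :=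
      mul_le_mul hgΛ hfy (apply_nonneg _ _) (by positivity)
    have i3 : Λ * (B * √S) ≤ Λ * ((CH + Cm + Cp) * c * √S) := by gcongr
    have i4 : 0 ≤ Λ * ((1 + Cr) * √S) := by positivity
    have i5 : C * √S = Λ * (1 + CE) * √S * R + Λ * ((CH + Cm + Cp) * c * √S)
        + Λ * ((1 + Cr) * √S) := by rw [hCdef]; ring
    linarith
  have hgC : g ≤ C := hgΛ.trans hCΛ
  refine ⟨hg0, hgC, fun i j => ?_, g • muRough P h X (V t) u (U t), ?_, ?_, fun w => ?_⟩
  · have := comb (entry (HH P h X u) i j) (entry (HH P h (V t) (U t)) i j) 0 (CH * c)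
      (G.H_bd t ht i j) (by positivity) (by nlinarith [mul_nonneg hCm hc0, mul_nonneg hCp hc0]) (by
        rw [sub_zero, mul_assoc]
        exact (hH cf i j).trans (mul_le_left hδS hCH))
    simpa using this
  · exact comb (muH P h X u) (muH P h (V t) (U t)) (muRough P h X (V t) u (U t)) (Cm * c)
      (G.mu_bd t ht) (by positivity) (by nlinarith [mul_nonneg hCH hc0, mul_nonneg hCp hc0]) (by
        rw [mul_assoc]
        exact (hm cf).trans (mul_le_left hδS hCm))
  · have h1 := hr cf (√(strongErrQ h X (V t))) fun i j =>
      le_sqrt_of_sq_le (N2_sq_le_strongErrQ X (V t) i j)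
    rw [map_smul_eq_mul, norm_of_nonneg hg0.le]
    have h2 : g * N0 h (muRough P h X (V t) u (U t)) ≤ Λ * (Cr * √(strongErrQ h X (V t))) :=
      mul_le_mul hgΛ h1 (apply_nonneg _ _) (by positivity)
    refine h2.trans ?_; rw [← mul_assoc]; gcongr; rw [hCdef]
    have : 0 ≤ Λ * (1 + (1 + CE) * R + (CH + Cm + Cp) * c) := by positivity
    linarith
  · rw [ip_smul_left, abs_mul, abs_of_pos hg0]
    have h1 : |ip h (muRough P h X (V t) u (U t)) w| ≤ Cp * cf.δ * N2 h w := hp cf w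
    have hN : 0 ≤ N2 h w := apply_nonneg _ _
    have h2 : |ip h (muRough P h X (V t) u (U t)) w| ≤ Cp * (c * √S) * N2 h w :=
      h1.trans (by gcongr)
    have h3 : g * |ip h (muRough P h X (V t) u (U t)) w| ≤ Λ * (Cp * (c * √S) * N2 h w) :=
      mul_le_mul hgΛ h2 (abs_nonneg _) (by positivity)
    refine h3.trans ?_
    have h4 : Λ * (Cp * (c * √S) * N2 h w) = Λ * (Cp * c) * (√S * N2 h w) := by ring
    rw [h4, mul_assoc C]; refine mul_le_right ?_ (by positivity); rw [hCdef]
    have : 0 ≤ Λ * (1 + (1 + CE) * R + (CH + Cm) * c + Cr) := by positivity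
    linarith

theorem abs_convex_sub_le {ξ x y z : ℝ} (hξ : ξ ∈ Icc (0 : ℝ) 1) :
    |ξ * x + (1 - ξ) * y - z| ≤ |x - z| ∨ |ξ * x + (1 - ξ) * y - z| ≤ |y - z| := by
  have e : ξ * x + (1 - ξ) * y - z = ξ * (x - z) + (1 - ξ) * (y - z) := by ring
  have h1 : |ξ * x + (1 - ξ) * y - z| ≤ ξ * |x - z| + (1 - ξ) * |y - z| := by
    rw [e]; refine (abs_add_le _ _).trans ?_
    rw [abs_mul, abs_mul, abs_of_nonneg hξ.1, abs_of_nonneg (by linarith [hξ.2] : 0 ≤ 1 - ξ)]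
  rcases le_total |x - z| |y - z| with h | h
  · right; nlinarith [hξ.1, hξ.2]
  · left; nlinarith [hξ.1, hξ.2]

/-- The error of the provisional auxiliary variable. -/
theorem abs_provisional_sub_le {J : ℕ} [NeZero J] {h : ℝ} {V : ℝ → Grid d J → Mat d}
    {U : ℝ → GridFun d J} {s : ℝ → ℝ} {ρ : ℝ → Fin d → Fin d → GridFun d J} {ς : ℝ → GridFun d J}
    (G : GridSolution P T R h V U s ρ ς) (hR : 0 ≤ R) (hh : 0 ≤ h) {t τ : ℝ} (ht : 0 ≤ t)
    (hτ : 0 ≤ τ) (htT : t + τ ≤ T) {X X' : Grid d J → Mat d} {u u' : GridFun d J} {r g A D : ℝ}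
    (hA : ∀ i j, N0 h (g • entry (HH P h X u) i j - entry (HH P h (V t) (U t)) i j) ≤ A)
    (hD : ∀ i j, N0 h ((entry X' i j - entry (V (t + τ)) i j) - (entry X i j - entry (V t) i j))
      ≤ D) :
    |r + g * ((∑ i, ∑ j, ip h (entry (HH P h X u) i j) (entry (X' - X) i j))
      + ip h (muH P h X u) (u' - u)) - s (t + τ)|
    ≤ |r - s t| + d ^ 2 * (A * (R * τ + D) + R * D)
      + |ip h (g • muH P h X u - muH P h (V t) (U t)) (u' - u)|
      + R * N0 h ((u' - U (t + τ)) - (u - U t)) + R * τ * (τ + h ^ 2) := by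
  have h1 : t ∈ Icc 0 T := ⟨ht, by linarith⟩
  have h2 : t + τ ∈ Icc 0 T := ⟨by linarith, htT⟩
  have inc := G.s_increment t h1 (t + τ) h2 (by linarith)
  rw [add_sub_cancel_left] at inc
  have hQ : ∀ i j, |g * ip h (entry (HH P h X u) i j) (entry (X' - X) i j)
      - ip h (entry (HH P h (V t) (U t)) i j) (entry (V (t + τ)) i j - entry (V t) i j)|
      ≤ A * (R * τ + D) + R * D := by
    intro i j
    set H := entry (HH P h X u) i j
    set Hd := entry (HH P h (V t) (U t)) i j with hHd
    set δV := entry (V (t + τ)) i j - entry (V t) i j with hδV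
    set δE := (entry X' i j - entry (V (t + τ)) i j) - (entry X i j - entry (V t) i j) with hδE
    have e1 : entry (X' - X) i j = δV + δE := by
      have : entry (X' - X) i j = entry X' i j - entry X i j := rfl; rw [this, hδV, hδE]; abel
    have e2 : g * ip h H (entry (X' - X) i j) - ip h Hd δV
        = ip h (g • H - Hd) δV + ip h (g • H - Hd) δE + ip h Hd δE := by
      rw [e1]; simp only [ip_sub_left, ip_add_right, ip_smul_left]; ring
    have hV : N0 h δV ≤ R * τ := by
      have := G.V_lip (t + τ) h2 t h1 i j; rwa [add_sub_cancel_left, abs_of_nonneg hτ] at this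
    have hA0 : 0 ≤ A := (apply_nonneg _ _).trans (hA i j)
    have i1 := (abs_ip_le hh (g • H - Hd) δV).trans
      (mul_le_mul (hA i j) hV (apply_nonneg _ _) hA0)
    have i2 := (abs_ip_le hh (g • H - Hd) δE).trans
      (mul_le_mul (hA i j) (hD i j) (apply_nonneg _ _) hA0)
    have i3 := (abs_ip_le hh Hd δE).trans
      (mul_le_mul (G.H_bd t h1 i j) (hD i j) (apply_nonneg _ _) hR)
    rw [e2]; have := abs_add_three (ip h (g • H - Hd) δV) (ip h (g • H - Hd) δE) (ip h Hd δE)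
    linarith
  have hQs : |∑ i, ∑ j, (g * ip h (entry (HH P h X u) i j) (entry (X' - X) i j)
      - ip h (entry (HH P h (V t) (U t)) i j) (entry (V (t + τ)) i j - entry (V t) i j))|
      ≤ d ^ 2 * (A * (R * τ + D) + R * D) := by
    refine (abs_sum_le_sum_abs _ _).trans ?_
    calc _ ≤ ∑ _i : Fin d, ∑ _j : Fin d, (A * (R * τ + D) + R * D) :=
          sum_le_sum fun i _ => (abs_sum_le_sum_abs _ _).trans
            (sum_le_sum fun j _ => hQ i j)
      _ = _ := by simp; ring
  set δe := (u' - U (t + τ)) - (u - U t) with hδe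
  have hu : |ip h (muH P h (V t) (U t)) δe| ≤ R * N0 h δe :=
    (abs_ip_le hh _ _).trans (mul_le_right (G.mu_bd t h1) (apply_nonneg _ _))
  have e3 : u' - u = (U (t + τ) - U t) + δe := by rw [hδe]; abel
  have e4 : g * ip h (muH P h X u) (u' - u) - ip h (muH P h (V t) (U t)) (U (t + τ) - U t)
      = ip h (g • muH P h X u - muH P h (V t) (U t)) (u' - u)
        + ip h (muH P h (V t) (U t)) δe := by
    have : ip h (muH P h (V t) (U t)) (u' - u) = ip h (muH P h (V t) (U t)) (U (t + τ) - U t)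
        + ip h (muH P h (V t) (U t)) δe := by rw [e3, ip_add_right]
    rw [ip_sub_left, ip_smul_left, this]; ring
  have e5 : r + g * ((∑ i, ∑ j, ip h (entry (HH P h X u) i j) (entry (X' - X) i j))
      + ip h (muH P h X u) (u' - u)) - s (t + τ)
      = (r - s t) + (∑ i, ∑ j, (g * ip h (entry (HH P h X u) i j) (entry (X' - X) i j)
        - ip h (entry (HH P h (V t) (U t)) i j) (entry (V (t + τ)) i j - entry (V t) i j)))
        + (ip h (g • muH P h X u - muH P h (V t) (U t)) (u' - u)
          + ip h (muH P h (V t) (U t)) δe)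
        - (s (t + τ) - s t - ((∑ i, ∑ j, ip h (entry (HH P h (V t) (U t)) i j)
          (entry (V (t + τ)) i j - entry (V t) i j))
          + ip h (muH P h (V t) (U t)) (U (t + τ) - U t))) := by
    rw [← e4]; simp only [sum_sub_distrib, ← mul_sum]; ring
  rw [e5]
  refine (abs_sub _ _).trans ?_
  refine add_le_add ?_ inc
  refine (abs_add_le _ _).trans ?_
  have a1 := abs_add_le (r - s t) (∑ i, ∑ j, (g * ip h (entry (HH P h X u) i j) (entry (X' - X) i j)
        - ip h (entry (HH P h (V t) (U t)) i j) (entry (V (t + τ)) i j - entry (V t) i j)))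
  have a2 := abs_add_le (ip h (g • muH P h X u - muH P h (V t) (U t)) (u' - u))
    (ip h (muH P h (V t) (U t)) δe)
  linarith

theorem sum_sum_const (x : ℝ) : ∑ _i : Fin d, ∑ _j : Fin d, x = d ^ 2 * x := by
  simp; ring

theorem sqrt_mul_le_of_le {τ x p : ℝ} (hτ : 0 ≤ τ) (hxp : x ≤ p) : √(τ * x) ≤ √τ * √p := by
  rw [sqrt_mul hτ]
  exact mul_le_left (sqrt_le_sqrt hxp) (sqrt_nonneg _)

theorem mul_sqrt_le_of_le {τ x p : ℝ} (hτ : 0 ≤ τ) (hxp : τ * x ≤ p) : τ * √x ≤ √τ * √p := by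
  calc τ * √x = √τ * √(τ * x) := by
        rw [sqrt_mul hτ, ← mul_assoc, Real.mul_self_sqrt hτ]
    _ ≤ _ := mul_le_left (sqrt_le_sqrt hxp) (sqrt_nonneg _)

variable {κ₁ κ₂ : ℝ}

/-- The tensor part of a step. -/
theorem tensor_step_le (hL : 0 < L) (hR : 0 ≤ R) (hK : 0 < P.K) {Λ : ℝ} (hΛ : 1 ≤ Λ)
    (hκ : 0 < κ₁) :
    ∃ C, 0 ≤ C ∧ ∀ {J : ℕ} [NeZero J] {h : ℝ} {V : ℝ → Grid d J → Mat d} {U : ℝ → GridFun d J}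
      {s : ℝ → ℝ} {ρ : ℝ → Fin d → Fin d → GridFun d J} {ς : ℝ → GridFun d J}
      (_ : GridSolution P T R h V U s ρ ς) (_ : h = L / J) {t τ : ℝ} (_ : 0 ≤ t) (_ : 0 < τ)
      (_ : τ ≤ 1) (_ : t + τ ≤ T) {X X' : Grid d J → Mat d} {u : GridFun d J} {g S : ℝ}
      (_ : 0 < g) (_ : g ≤ Λ) (_ : errQ P h X (V t) ≤ S) (_ : (τ + h ^ 2) ^ 2 ≤ S)
      (_ : ∀ i j, N0 h (g • entry (HH P h X u) i j - entry (HH P h (V t) (U t)) i j) ≤ Λ * √S)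
      (_ : ∀ i j, entry X' i j = NormedSpace.exp (-(τ • opL P h κ₁ g)) (entry X i j)
        + τ • phi1 (-(τ • opL P h κ₁ g))
          (-(g • entry (HH P h X u) i j) + (g * κ₁) • entry X i j)),
      ∃ x, 0 ≤ x ∧ errQ P h X' (V (t + τ)) + x ≤ errQ P h X (V t) + C * τ * S ∧
        τ * strongErrQ h X' (V (t + τ)) ≤ C * x + C * τ * (S + errQ P h X' (V (t + τ))) ∧
        ∀ i j, N0 h ((entry X' i j - entry (V (t + τ)) i j) - (entry X i j - entry (V t) i j))
          ≤ √(τ * x) := by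
  obtain ⟨C, hC, hstep⟩ := step_error_le hR (by linarith : 0 ≤ Λ) hκ
  have hKi : 0 < P.K⁻¹ := by positivity
  set B := 1 + d ^ 2 * (Λ ^ 2 + 1) with hBdef
  have hB1 : 1 ≤ B := by rw [hBdef]; exact le_add_of_nonneg_right (by positivity)
  refine ⟨C * B + (P.K⁻¹) ^ 2 * (C * B) + (1 + P.K⁻¹), by positivity, ?_⟩
  intro J _ h V U s ρ ς G hhL t τ ht hτ hτ1 htT X X' u g S hg hgΛ hQS hεS hA hX'
  have hh : 0 < h := mesh_pos hL hhL
  have hS0 : 0 ≤ S := (sq_nonneg _).trans hεS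
  have key := fun i j => hstep (G.stepData_Q hK hR hh ht hτ hτ1 htT hg hgΛ i j)
    (q := entry X i j) (q' := entry X' i j) (Fh := entry (HH P h X u) i j) (β := Λ * √S)
    (hX' i j) (hA i j)
  choose x hx0 hx1 hx2 hx3 using key
  have hβ : (Λ * √S) ^ 2 = Λ ^ 2 * S := by rw [mul_pow, sq_sqrt hS0]
  have hX0 : 0 ≤ ∑ i, ∑ j, x i j :=
    sum_nonneg fun i _ => sum_nonneg fun j _ => hx0 i j
  have hτS : 0 ≤ τ * S := by positivity
  have hQ'0 := errQ_nonneg hK hh.le X' (V (t + τ))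
  obtain ⟨e, he⟩ : ∃ e : Fin d → Fin d → ℝ, ∀ i j,
    energy h (elastic P h) (entry X i j - entry (V t) i j) = e i j := ⟨_, fun _ _ => rfl⟩
  obtain ⟨e', he'⟩ : ∃ e : Fin d → Fin d → ℝ, ∀ i j,
    energy h (elastic P h) (entry X' i j - entry (V (t + τ)) i j) = e i j := ⟨_, fun _ _ => rfl⟩
  have hq : errQ P h X (V t) = ∑ i, ∑ j, e i j := by simp only [errQ, he]
  have hq' : errQ P h X' (V (t + τ)) = ∑ i, ∑ j, e' i j := by simp only [errQ, he']
  simp only [he, he', hβ] at hx1 hx3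
  refine ⟨∑ i, ∑ j, x i j, hX0, ?_, ?_, fun i j => ?_⟩
  · have h1 : errQ P h X' (V (t + τ)) + ∑ i, ∑ j, x i j
        ≤ ∑ i, ∑ j, (e i j + C * τ * (e i j + (Λ ^ 2 + 1) * S)) := by
      rw [hq', ← sum_add_distrib]; refine sum_le_sum fun i _ => ?_
      rw [← sum_add_distrib]; refine sum_le_sum fun j _ => (hx1 i j).trans (add_le_add_right ?_ _)
      exact mul_le_left (by linarith) (by positivity)
    refine h1.trans ?_; simp only [sum_add_distrib, ← mul_sum, ← hq, sum_sum_const]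
    have h2 : C * τ * (errQ P h X (V t) + d ^ 2 * ((Λ ^ 2 + 1) * S)) ≤ C * τ * (B * S) := by
      refine mul_le_left ?_ (by positivity); rw [hBdef]; linarith
    have h3 : 0 ≤ ((P.K⁻¹) ^ 2 * (C * B) + (1 + P.K⁻¹)) * (τ * S) := by positivity
    linarith
  · have h1 : τ * strongErrQ h X' (V (t + τ)) ≤ ∑ i, ∑ j, ((1 + P.K⁻¹) * τ * e' i j
        + (P.K⁻¹) ^ 2 * (C * x i j + C * τ * (e i j + e' i j + (Λ ^ 2 + 1) * S))) := by
      rw [strongErrQ, mul_sum]; refine sum_le_sum fun i _ => ?_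
      rw [mul_sum]; refine sum_le_sum fun j _ => ?_
      have g1 := mul_le_left
        (N2_sq_le_elastic hK hh.le (entry X' i j - entry (V (t + τ)) i j)) hτ.le
      have g2 := hx3 i j fun a ha r hr => G.ρ_lip a ⟨by linarith [ha.1], by linarith [ha.2]⟩ r
        ⟨by linarith [hr.1], by linarith [hr.2]⟩ i j
      have g3 : C * τ * (e i j + e' i j + Λ ^ 2 * S + (τ + h ^ 2) ^ 2)
          ≤ C * τ * (e i j + e' i j + (Λ ^ 2 + 1) * S) :=
        mul_le_left (by linarith) (by positivity)
      have g4 := mul_le_left (g2.trans (add_le_add_right g3 _))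
        (by positivity : 0 ≤ (P.K⁻¹) ^ 2)
      rw [he'] at g1; linarith
    refine h1.trans ?_; simp only [sum_add_distrib, ← mul_sum, ← hq, ← hq', sum_sum_const]
    obtain ⟨q', hq'⟩ : ∃ q, q = errQ P h X' (V (t + τ)) := ⟨_, rfl⟩
    obtain ⟨y, hy⟩ : ∃ y, y = ∑ i, ∑ j, x i j := ⟨_, rfl⟩; rw [← hq', ← hy]; rw [← hq'] at hQ'0
    rw [← hy] at hX0
    have h2 : C * τ * (errQ P h X (V t) + q' + d ^ 2 * ((Λ ^ 2 + 1) * S))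
        ≤ C * τ * (B * (S + q')) := by
      refine mul_le_left ?_ (by positivity); have : q' ≤ B * q' := le_mul_of_one_le_left hQ'0 hB1
      rw [hBdef] at this ⊢; linarith
    have h3 : C * y ≤ C * B * y :=
      mul_le_right (le_mul_of_one_le_right hC hB1) hX0
    have h4 := mul_le_left (add_le_add h3 h2) (by positivity : 0 ≤ (P.K⁻¹) ^ 2)
    have h5 : 0 ≤ (C * B + (1 + P.K⁻¹)) * y := by positivity
    have h6 : 0 ≤ C * B * (τ * (S + q')) := by positivity
    have h7 : 0 ≤ (1 + P.K⁻¹) * (τ * S) := by positivity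
    linarith
  · refine le_sqrt_of_sq_le ((hx2 i j).trans ?_)
    exact mul_le_left (le_sum_sum hx0 i j) hτ.le

/-- Growth of the auxiliary variable when the errors of the chemical potential are controlled
in `L²`. -/
theorem provisional_growth_le {R Λ τ S y x z p Xu Du A D w ε : ℝ} {d : ℕ} (hR : 0 ≤ R) (hΛ : 0 ≤ Λ)
    (hτ : 0 ≤ τ) (hS : 0 ≤ S) (hS1 : S ≤ 1) (hy : 0 ≤ y) (hx : 0 ≤ x) (hz : 0 ≤ z)
    (hp : p = τ * (S + y) + x + z) (hA : A = Λ * √S) (hD : D = √(τ * x)) (hDu : Du ≤ √(τ * z))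
    (hXu : Xu ≤ (Λ * √S + Λ * √y) * (R * τ + Du)) (hε : ε ≤ √S) :
    w + d ^ 2 * (A * (R * τ + D) + R * D) + Xu + R * Du + R * τ * ε
      ≤ w + (d ^ 2 * (Λ * R + Λ + R) + (2 * Λ * R + 2 * Λ) + 2 * R) * (√τ * √p + p) := by
  have hτS : 0 ≤ τ * S := by positivity
  have hτy : 0 ≤ τ * y := by positivity
  have hp0 : 0 ≤ p := by rw [hp]; positivity
  have q0 : 0 ≤ √τ * √p := by positivity
  have hrS : √S ≤ 1 := Real.sqrt_le_one.mpr hS1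
  have b1 : τ * √S ≤ √τ * √p := mul_sqrt_le_of_le hτ (by rw [hp]; linarith)
  have b2 : τ * √y ≤ √τ * √p := mul_sqrt_le_of_le hτ (by rw [hp]; linarith)
  have b3 : √(τ * x) ≤ √τ * √p := sqrt_mul_le_of_le hτ (by rw [hp]; linarith)
  have b4 : √(τ * z) ≤ √τ * √p := sqrt_mul_le_of_le hτ (by rw [hp]; linarith)
  have b5 : √y * √(τ * z) ≤ p := by
    calc √y * √(τ * z) = √(τ * y) * √z := by
          rw [sqrt_mul hτ, sqrt_mul hτ]; ring
      _ ≤ √p * √p := mul_le_mul (sqrt_le_sqrt (by rw [hp]; linarith))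
          (sqrt_le_sqrt (by rw [hp]; linarith)) (sqrt_nonneg _) (sqrt_nonneg _)
      _ = p := Real.mul_self_sqrt hp0
  have b6 : √S * √(τ * x) ≤ √τ * √p :=
    (mul_le_of_le_one_left (sqrt_nonneg _) hrS).trans b3
  have b7 : √S * √(τ * z) ≤ √τ * √p :=
    (mul_le_of_le_one_left (sqrt_nonneg _) hrS).trans b4
  have hnS := sqrt_nonneg S
  have hny := sqrt_nonneg y
  have k1 : A * (R * τ + D) + R * D ≤ (Λ * R + Λ + R) * (√τ * √p) := by
    rw [hA, hD]; have m1 := mul_le_left b1 (by positivity : 0 ≤ Λ * R); have m2 := mul_le_left b6 hΛ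
    have m3 := mul_le_left b3 hR; linarith
  have k2 : Xu ≤ (2 * Λ * R + Λ) * (√τ * √p) + Λ * p := by
    have m0 : (Λ * √S + Λ * √y) * (R * τ + Du) ≤ (Λ * √S + Λ * √y) * (R * τ + √(τ * z)) := by
      gcongr
    have m1 := mul_le_left b1 (by positivity : 0 ≤ Λ * R)
    have m2 := mul_le_left b2 (by positivity : 0 ≤ Λ * R); have m3 := mul_le_left b7 hΛ
    have m4 := mul_le_left b5 hΛ; linarith
  have k3 : R * Du ≤ R * (√τ * √p) := mul_le_left (hDu.trans b4) hR
  have k4 : R * τ * ε ≤ R * (√τ * √p) := by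
    rw [mul_assoc]; exact mul_le_left ((mul_le_left hε hτ).trans b1) hR
  have k5 := mul_le_left k1 (by positivity : 0 ≤ (d : ℝ) ^ 2)
  have k6 : 0 ≤ (d ^ 2 * (Λ * R + Λ + R) + (2 * Λ * R + Λ) + 2 * R) * p := by positivity
  have k7 : 0 ≤ Λ * (√τ * √p) := by positivity
  linarith

/-- Growth of the auxiliary variable over the first step. -/
theorem provisional_growth_first_le {R Λ τ S v Xu Du A D w ε : ℝ} {d : ℕ} (hR : 0 ≤ R) (hΛ : 0 ≤ Λ)
    (hτ : 0 ≤ τ) (hτ1 : τ ≤ 1) (hS1 : S ≤ 1) (hv : √S ≤ v)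
    (hA : A = Λ * √S) (hD : D = 2 * v) (hDu : Du ≤ 2 * v)
    (hXu : Xu ≤ Λ * √S * (R * τ + Du) + Λ * √S * (2 * R + 2)) (hε : ε ≤ √S) :
    w + d ^ 2 * (A * (R * τ + D) + R * D) + Xu + R * Du + R * τ * ε
      ≤ w + (d ^ 2 * (Λ * R + 2 * Λ + 2 * R) + (3 * Λ * R + 4 * Λ) + 3 * R) * v := by
  have hrS : √S ≤ 1 := Real.sqrt_le_one.mpr hS1
  have hnS := sqrt_nonneg S
  have hv0 : 0 ≤ v := hnS.trans hv
  have b1 : √S * τ ≤ v := (mul_le_of_le_one_right hnS hτ1).trans hv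
  have b2 : √S * v ≤ v := mul_le_of_le_one_left hv0 hrS
  have k1 : A * (R * τ + D) + R * D ≤ (Λ * R + 2 * Λ + 2 * R) * v := by
    rw [hA, hD]; have m1 := mul_le_left b1 (by positivity : 0 ≤ Λ * R)
    have m2 := mul_le_left b2 (by positivity : 0 ≤ 2 * Λ); linarith
  have k2 : Xu ≤ (3 * Λ * R + 4 * Λ) * v := by
    have m0 : Λ * √S * (R * τ + Du) ≤ Λ * √S * (R * τ + 2 * v) := by gcongr
    have m1 := mul_le_left b1 (by positivity : 0 ≤ Λ * R)
    have m2 := mul_le_left b2 (by positivity : 0 ≤ 2 * Λ)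
    have m3 := mul_le_left hv (by positivity : 0 ≤ Λ * (2 * R + 2)); linarith
  have k3 : R * Du ≤ R * (2 * v) := mul_le_left hDu hR
  have k4 : R * τ * ε ≤ R * v := by
    rw [mul_assoc]; refine mul_le_left ?_ hR; rw [mul_comm] at b1
    exact (mul_le_left hε hτ).trans b1
  have k5 := mul_le_left k1 (by positivity : 0 ≤ (d : ℝ) ^ 2)
  linarith

set_option maxHeartbeats 1000000 in
/-- One step of the scheme satisfies the inequalities of the convergence proof. -/
theorem exists_stepIneq (hL : 0 < L) (hd : d = 2 ∨ d = 3) (hR : 0 ≤ R) (hK : 0 < P.K)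
    (hB : 0 < P.B0) (hκ₁ : 0 < κ₁) (hκ₂ : 0 < κ₂) :
    ∃ C, 1 ≤ C ∧ ∀ {J : ℕ} [NeZero J] {h : ℝ} {V : ℝ → Grid d J → Mat d} {U : ℝ → GridFun d J}
      {s : ℝ → ℝ} {ρ : ℝ → Fin d → Fin d → GridFun d J} {ς : ℝ → GridFun d J}
      (_ : GridSolution P T R h V U s ρ ς) (_ : h = L / J) {t τ : ℝ} (_ : 0 ≤ t) (_ : 0 < τ)
      (_ : τ ≤ 1) (_ : t + τ ≤ T) {X X' : Grid d J → Mat d} {u u' : GridFun d J} {r r' η₀ : ℝ}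
      (_ : IsStep P h τ κ₁ κ₂ η₀ X u r X' u' r') (first : Prop),
      errQ P h X (V t) + errU P h u (U t) + |r - s t| ^ 2 + (τ + h ^ 2) ^ 2 ≤ smallness P →
      ∃ x z, StepIneq C (smallness P) τ (τ + h ^ 2) first
        (errQ P h X (V t)) (errU P h u (U t)) |r - s t| (strongErrQ h X (V t))
        (errQ P h X' (V (t + τ))) (errU P h u' (U (t + τ))) |r' - s (t + τ)|
        (strongErrQ h X' (V (t + τ))) x z := by
  obtain ⟨Λ, hΛ1, hnl⟩ := nonlinear_sub_le (d := d) (P := P) (T := T) hL hd hR hK hB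
  have hΛ : 0 ≤ Λ := by linarith
  obtain ⟨CQ, hCQ, hQ⟩ := tensor_step_le (d := d) (P := P) (T := T) hL hR hK hΛ1 hκ₁
  obtain ⟨Cu, hCu, hu⟩ := step_error_le hR hΛ hκ₂
  obtain ⟨Cv, hCv, hv⟩ := step_error_rough_le hR hΛ hκ₂
  obtain ⟨CE, hCE, hE⟩ := E1h_sub_le (d := d) (P := P) (T := T) hL hd hR hK hB
  set b₀ := 2 + P.B0⁻¹ with hb₀
  have hb1 : 1 ≤ b₀ := by
    have : 0 < P.B0⁻¹ := by positivity
    linarith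
  set C₁ := Cu * (2 + 2 * Λ ^ 2) with hC₁
  set C₂ := Cv * (2 + (Λ * b₀) ^ 2) with hC₂
  set C₃ := d ^ 2 * (Λ * R + Λ + R) + (2 * Λ * R + 2 * Λ) + 2 * R with hC₃
  set C₄ := d ^ 2 * (Λ * R + 2 * Λ + 2 * R) + (3 * Λ * R + 4 * Λ) + 3 * R with hC₄
  have hC₁0 : 0 ≤ C₁ := by positivity
  have hC₂0 : 0 ≤ C₂ := by positivity
  have hC₃0 : 0 ≤ C₃ := by positivity
  have hC₄0 : 0 ≤ C₄ := by positivity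
  obtain ⟨C, hC⟩ : ∃ C, C = 1 + CQ + C₁ + C₂ + C₃ + C₄ + CE := ⟨_, rfl⟩
  obtain ⟨c0, cQ, c1, c2, c3, c4, cE⟩ : 1 ≤ C ∧ CQ ≤ C ∧ C₁ ≤ C ∧ C₂ ≤ C ∧ C₃ ≤ C ∧ C₄ ≤ C ∧
      CE ≤ C := by
    rw [hC]; refine ⟨?_, ?_, ?_, ?_, ?_, ?_, ?_⟩ <;> linarith
  refine ⟨C, c0, ?_⟩
  intro J _ h V U s ρ ς G hhL t τ ht hτ hτ1 htT X X' u u' r r' η₀ hst first hsm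
  have hh : 0 < h := mesh_pos hL hhL
  have htI : t ∈ Icc 0 T := ⟨ht, by linarith⟩
  have htI' : t + τ ∈ Icc 0 T := ⟨by linarith, htT⟩
  have hhε : h ^ 2 ≤ τ + h ^ 2 := by linarith
  obtain ⟨hg0, hgΛ, hA, Y, hY1, hY2, hY3⟩ := hnl G hhL htI X u r hhε hsm
  obtain ⟨S, hS⟩ : ∃ S, S = errQ P h X (V t) + errU P h u (U t) + |r - s t| ^ 2 + (τ + h ^ 2) ^ 2 :=
    ⟨_, rfl⟩
  have hSall : errAll P h (τ + h ^ 2) X u r (V t) (U t) (s t) = S := by rw [hS]; rfl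
  rw [hSall] at hA hY1 hY3
  obtain ⟨hX', hu', st, ξ, hst, hξ, hr', -⟩ := hst
  set g := gH P h X u r with hg
  have e1 := errQ_nonneg hK hh.le X (V t)
  have e2 := errU_nonneg hB hh.le u (U t)
  have e1' := errQ_nonneg hK hh.le X' (V (t + τ))
  have e2' := errU_nonneg hB hh.le u' (U (t + τ))
  have y0 := strongErrQ_nonneg (h := h) X (V t)
  have y0' := strongErrQ_nonneg (h := h) X' (V (t + τ))
  have hQUS : errQ P h X (V t) + errU P h u (U t) ≤ S := by
    rw [hS]; linarith [sq_nonneg |r - s t|, sq_nonneg (τ + h ^ 2)]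
  have hQS : errQ P h X (V t) ≤ S := by linarith
  have hUS : errU P h u (U t) ≤ S := by linarith
  have hεS : (τ + h ^ 2) ^ 2 ≤ S := by rw [hS]; linarith [sq_nonneg |r - s t|]
  have hS0 : 0 ≤ S := e1.trans hQS
  rw [← hS] at hsm
  have hS1 : S ≤ 1 := hsm.trans (smallness_le hK hB)
  have hεr : τ + h ^ 2 ≤ √S := le_sqrt_of_sq_le hεS
  obtain ⟨x, hx0, hxa, hxy, hxD⟩ := hQ G hhL ht hτ hτ1 htT hg0 hgΛ hQS hεS hA hX'
  have dat := G.stepData_u hB hR hh ht hτ hτ1 htT hg0 hgΛ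
  have hτS : 0 ≤ τ * S := by positivity
  have relax : errQ P h X' (V (t + τ)) + errU P h u' (U (t + τ)) ≤ smallness P →
      ∀ b, |st - s (t + τ)| ≤ |r - s t| + b → |r' - s (t + τ)| ≤ |r - s t| + b ∨
        |r' - s (t + τ)| ≤ C * √(errQ P h X' (V (t + τ)) + errU P h u' (U (t + τ))
          + (τ + h ^ 2) ^ 2) := by
    intro hsm' b hb; have hEE := hE G hhL htI' X' u' hhε hsm'; rw [hr']
    rcases abs_convex_sub_le hξ (x := st) (y := E1h P h X' u') (z := s (t + τ)) with h1 | h1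
    · exact Or.inl (h1.trans hb)
    · refine Or.inr (h1.trans (hEE.trans ?_))
      gcongr
  have hUlip : N0 h (U (t + τ) - U t) ≤ R * τ := by
    have := G.U_lip (t + τ) htI' t htI; rwa [add_sub_cancel_left, abs_of_pos hτ] at this
  have hδu : N0 h (u' - u) ≤ R * τ + N0 h ((u' - U (t + τ)) - (u - U t)) := by
    have e : u' - u = (U (t + τ) - U t) + ((u' - U (t + τ)) - (u - U t)) := by abel
    rw [e]; exact (map_add_le_add _ _ _).trans (by linarith)
  by_cases hf : first
  · have hβ1 : N0 h (g • muH P h X u - muH P h (V t) (U t) - Y) ≤ Λ * b₀ * √S := by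
      refine hY1.trans ?_; have : Λ ≤ Λ * b₀ := le_mul_of_one_le_right hΛ hb1; gcongr
    have hβ2 : ∀ w, ip h Y w ^ 2 ≤ (Λ * b₀ * √S) ^ 2 * energy h (smectic P h) w := by
      intro w; have h1 := pow_le_pow_left₀ (abs_nonneg _) (hY3 w) 2; rw [sq_abs] at h1
      refine h1.trans ?_; rw [mul_pow, mul_pow, mul_pow, mul_pow]
      have h2 := N2_sq_le_energy hB hh.le w; have h3 := energy_nonneg hh.le (smectic_pos hB hh.le) w
      have h4 : b₀ * energy h (smectic P h) w ≤ b₀ ^ 2 * energy h (smectic P h) w := by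
        refine mul_le_right ?_ h3; rw [sq]; exact le_mul_of_one_le_left (by linarith) hb1
      calc Λ ^ 2 * √S ^ 2 * N2 h w ^ 2
          ≤ Λ ^ 2 * √S ^ 2 * (b₀ ^ 2 * energy h (smectic P h) w) :=
            mul_le_left (h2.trans h4) (by positivity)
        _ = _ := by ring
    obtain ⟨z, hz0, hz1, hz2⟩ := hv dat hu' hβ1 hβ2; refine ⟨x, 0, ?_⟩
    refine { x_nonneg := hx0, z_nonneg := le_rfl, ineq_a := ?_, ineq_y := ?_,
             ineq_b_first := fun _ => ?_, ineq_b := fun h => absurd hf h,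
             ineq_σ_first := fun _ hsm' => ?_, ineq_σ := fun h => absurd hf h }
    · rw [← hS]
      exact hxa.trans (by gcongr)
    · rw [← hS]
      exact hxy.trans (by gcongr)
    · rw [← hS]
      have hz1' : errU P h u' (U (t + τ)) ≤ Cv * (errU P h u (U t) + (Λ * b₀ * √S) ^ 2
          + (τ + h ^ 2) ^ 2) := by unfold errU; linarith
      refine hz1'.trans ?_; rw [mul_pow, sq_sqrt hS0]
      calc Cv * (errU P h u (U t) + (Λ * b₀) ^ 2 * S + (τ + h ^ 2) ^ 2)
          ≤ Cv * (S + (Λ * b₀) ^ 2 * S + S) := by gcongr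
        _ = C₂ * S := by rw [hC₂]; ring
        _ ≤ _ := by gcongr
    · rw [← hS]
      set v := √(S + (errQ P h X' (V (t + τ)) + errU P h u' (U (t + τ)))) with hvdef
      have hSv : √S ≤ v := sqrt_le_sqrt (by linarith)
      have hen : ∀ {𝒜 : GridOp d J}, (∀ f, 0 ≤ ip h (𝒜 f) f) → ∀ f f' : GridFun d J,
          energy h 𝒜 f' ≤ S + (errQ P h X' (V (t + τ)) + errU P h u' (U (t + τ))) →
          energy h 𝒜 f ≤ S + (errQ P h X' (V (t + τ)) + errU P h u' (U (t + τ))) →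
          N0 h (f' - f) ≤ 2 * v := by
        intro 𝒜 hpos f f' h1 h2
        have i1 : N0 h f' ≤ v := le_sqrt_of_sq_le ((N0_sq_le_energy hh.le hpos f').trans h1)
        have i2 : N0 h f ≤ v := le_sqrt_of_sq_le ((N0_sq_le_energy hh.le hpos f).trans h2)
        have := map_sub_le_add (N0 h) f' f; linarith
      have hD : ∀ i j, N0 h ((entry X' i j - entry (V (t + τ)) i j)
          - (entry X i j - entry (V t) i j)) ≤ 2 * v := fun i j =>
        hen (elastic_pos hK hh.le) _ _
          (by linarith [energy_le_errQ hK hh.le X' (V (t + τ)) i j])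
          (by linarith [energy_le_errQ hK hh.le X (V t) i j])
      have hDu : N0 h ((u' - U (t + τ)) - (u - U t)) ≤ 2 * v :=
        hen (smectic_pos hB hh.le) _ _ (by unfold errU at *; linarith)
          (by unfold errU at *; linarith)
      have hN2 : N2 h (u' - u) ≤ 2 * R + 2 := by
        have i1 := (N2_sub_le hK hB hh.le X' (V (t + τ)) u' (U (t + τ))).trans
          (sobC_mul_sqrt_le hK hB hsm')
        have i2 := (N2_sub_le hK hB hh.le X (V t) u (U t)).trans
          (sobC_mul_sqrt_le hK hB (hQUS.trans hsm))
        have i3 := G.U_bd (t + τ) htI'; have i4 := G.U_bd t htI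
        have e : u' - u = (u' - U (t + τ)) - (u - U t) + (U (t + τ) - U t) := by abel
        rw [e]; have j1 := map_add_le_add (N2 h) ((u' - U (t + τ)) - (u - U t)) (U (t + τ) - U t)
        have j2 := map_sub_le_add (N2 h) (u' - U (t + τ)) (u - U t)
        have j3 := map_sub_le_add (N2 h) (U (t + τ)) (U t); linarith
      have hXu : |ip h (g • muH P h X u - muH P h (V t) (U t)) (u' - u)|
          ≤ Λ * √S * (R * τ + N0 h ((u' - U (t + τ)) - (u - U t))) + Λ * √S * (2 * R + 2) := by
        rw [← sub_add_cancel (g • muH P h X u - muH P h (V t) (U t)) Y, ip_add_left]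
        refine (abs_add_le _ _).trans (add_le_add ?_ ?_)
        · exact (abs_ip_le hh.le _ _).trans
            (mul_le_mul hY1 hδu (apply_nonneg _ _) (by positivity))
        · exact (hY3 _).trans (mul_le_left hN2 (by positivity))
      have prov := G.abs_provisional_sub_le (r := r) (u' := u') hR hh.le ht hτ.le htT hA hD
      rw [← hst] at prov
      exact relax hsm' _ (prov.trans ((provisional_growth_first_le hR hΛ hτ.le hτ1 hS1 hSv rfl
        rfl hDu hXu hεr).trans (by gcongr)))
  · set y := strongErrQ h X (V t) with hy
    have hβ : N0 h (g • muH P h X u - muH P h (V t) (U t)) ≤ Λ * √S + Λ * √y := by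
      rw [← sub_add_cancel (g • muH P h X u - muH P h (V t) (U t)) Y]
      exact (map_add_le_add _ _ _).trans (add_le_add hY1 hY2)
    obtain ⟨z, hz0, hz1, hz2, -⟩ := hu dat hu' hβ; refine ⟨x, z, ?_⟩
    refine { x_nonneg := hx0, z_nonneg := hz0, ineq_a := ?_, ineq_y := ?_,
             ineq_b_first := fun h => absurd h hf, ineq_b := fun _ => ?_,
             ineq_σ_first := fun h => absurd h hf, ineq_σ := fun _ hsm' => ?_ }
    · rw [← hS]
      exact hxa.trans (by gcongr)
    · rw [← hS]
      exact hxy.trans (by gcongr)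
    · rw [← hS]
      have hz1' : errU P h u' (U (t + τ)) + z ≤ errU P h u (U t)
          + Cu * τ * (errU P h u (U t) + (Λ * √S + Λ * √y) ^ 2 + (τ + h ^ 2) ^ 2) := hz1
      refine hz1'.trans (add_le_add_right ?_ _)
      have hsq : (Λ * √S + Λ * √y) ^ 2 ≤ 2 * Λ ^ 2 * (S + y) := by
        have := add_sq_le (a := Λ * √S) (b := Λ * √y)
        rw [mul_pow, mul_pow, sq_sqrt hS0, sq_sqrt y0] at this; linarith
      calc Cu * τ * (errU P h u (U t) + (Λ * √S + Λ * √y) ^ 2 + (τ + h ^ 2) ^ 2)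
          ≤ Cu * τ * ((2 + 2 * Λ ^ 2) * (S + y)) := by
            refine mul_le_left ?_ (by positivity); linarith
        _ = C₁ * τ * (S + y) := by rw [hC₁]; ring
        _ ≤ _ := by gcongr
    · rw [← hS]
      have hDu : N0 h ((u' - U (t + τ)) - (u - U t)) ≤ √(τ * z) := le_sqrt_of_sq_le hz2
      have hXu : |ip h (g • muH P h X u - muH P h (V t) (U t)) (u' - u)|
          ≤ (Λ * √S + Λ * √y) * (R * τ + N0 h ((u' - U (t + τ)) - (u - U t))) :=
        (abs_ip_le hh.le _ _).trans (mul_le_mul hβ hδu (apply_nonneg _ _) (by positivity))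
      have prov := G.abs_provisional_sub_le (r := r) (u' := u') hR hh.le ht hτ.le htT hA hxD
      rw [← hst] at prov; have hp0 : 0 ≤ τ * (S + y) + x + z := by positivity
      exact relax hsm' _ (prov.trans ((provisional_growth_le hR hΛ hτ.le hS0 hS1 y0 hx0 hz0 rfl rfl
        rfl hDu hXu hεr).trans (by gcongr)))

theorem h1NormT_sq {J : ℕ} [NeZero J] {h : ℝ} (hh : 0 ≤ h) (X Y : Grid d J → Mat d) :
    h1NormT h (fun p => X p - Y p) ^ 2 = ∑ i, ∑ j, N1 h (entry X i j - entry Y i j) ^ 2 := by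
  have e : ∀ i j, h1Sq h (fun p => (X p - Y p) i j) = N1 h (entry X i j - entry Y i j) ^ 2 :=
    fun i j => (N1_sq hh _).symm
  rw [h1NormT, sq_sqrt]
  · simp only [e]
  · simp only [e]
    exact sum_nonneg fun _ _ => sum_nonneg fun _ _ => sq_nonneg _

theorem h1NormT_sq_le (hK : 0 < P.K) {J : ℕ} [NeZero J] {h : ℝ} (hh : 0 ≤ h)
    (X Y : Grid d J → Mat d) :
    h1NormT h (fun p => X p - Y p) ^ 2 ≤ (1 + P.K⁻¹) * errQ P h X Y := by
  rw [h1NormT_sq hh, errQ, mul_sum]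
  refine sum_le_sum fun i _ => ?_
  rw [mul_sum]
  exact sum_le_sum fun j _ => N1_sq_le_energy hK hh _

theorem errQ_le (hK : 0 < P.K) {J : ℕ} [NeZero J] {h : ℝ} (hh : 0 ≤ h) (X Y : Grid d J → Mat d) :
    errQ P h X Y ≤ (1 + P.K) * h1NormT h (fun p => X p - Y p) ^ 2 := by
  rw [h1NormT_sq hh, errQ, mul_sum]
  refine sum_le_sum fun i _ => ?_
  rw [mul_sum]
  exact sum_le_sum fun j _ => energy_elastic_le hK hh _

/-- Convergence of the scheme towards a trajectory that solves the semi-discrete system up to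
small residuals. -/
theorem convergence (hL : 0 < L) (hd : d = 2 ∨ d = 3) (hR : 0 ≤ R) (hK : 0 < P.K)
    (hB : 0 < P.B0) (hκ₁ : 0 < κ₁) (hκ₂ : 0 < κ₂) (C₀ : ℝ) :
    ∃ C > 0, ∃ τ₀ > 0, ∃ h₀ > 0, ∀ {J : ℕ} [NeZero J] {h τ : ℝ}, h = L / J → h ≤ h₀ →
      0 < τ → τ ≤ τ₀ → ∀ {V : ℝ → Grid d J → Mat d} {U : ℝ → GridFun d J}
      {s : ℝ → ℝ} {ρ : ℝ → Fin d → Fin d → GridFun d J} {ς : ℝ → GridFun d J},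
      GridSolution P T R h V U s ρ ς → ∀ {η₀ : ℝ} {Qh : ℕ → Grid d J → Mat d}
      {uh : ℕ → GridFun d J} {sh : ℕ → ℝ},
      (∀ n, IsStep P h τ κ₁ κ₂ η₀ (Qh n) (uh n) (sh n) (Qh (n + 1)) (uh (n + 1)) (sh (n + 1))) →
      h1NormT h (fun p => Qh 0 p - V 0 p) + h2Norm h (fun p => uh 0 p - U 0 p) + |sh 0 - s 0|
        ≤ C₀ * (τ + h ^ 2) →
      ∀ n : ℕ, n * τ ≤ T →
        h1NormT h (fun p => Qh n p - V (n * τ) p) + h2Norm h (fun p => uh n p - U (n * τ) p)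
          + |sh n - s (n * τ)| ≤ C * (τ + h ^ 2) := by
  obtain ⟨C, hC1, hstep⟩ := exists_stepIneq (d := d) (P := P) (T := T) hL hd hR hK hB hκ₁ hκ₂
  obtain ⟨M, hM, ε₀, hε₀, hseq⟩ := error_sequence_le (T := T) (C₀ := (3 + P.K + 2 * P.B0) * C₀ ^ 2 + 1)
    hC1 (smallness_pos hK hB) (by positivity)
  have hs3 := three_le_sobC hK hB
  refine ⟨3 * (sobC P * √M), by positivity, min 1 (ε₀ / 2), by positivity, √(ε₀ / 2), by positivity,
    ?_⟩
  intro J _ h τ hhL hh₀ hτ hτ₀ V U s ρ ς G η₀ Qh uh sh hnum h0 n hn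
  have hh : 0 < h := mesh_pos hL hhL
  have hε : 0 < τ + h ^ 2 := by positivity
  have hεε₀ : τ + h ^ 2 ≤ ε₀ := by
    have h1 := hτ₀.trans (min_le_right _ _); have h2 := pow_le_pow_left₀ hh.le hh₀ 2
    rw [sq_sqrt (by positivity)] at h2; linarith
  have eu : ∀ (v w : GridFun d J), h2Norm h (fun p => v p - w p) = N2 h (v - w) := fun v w =>
    N2_eq hh.le (v - w)
  simp only [eu] at h0 ⊢
  have nn1 : ∀ X Y : Grid d J → Mat d, 0 ≤ h1NormT h (fun p => X p - Y p) := fun X Y =>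
    sqrt_nonneg _
  have nn2 : ∀ v w : GridFun d J, 0 ≤ N2 h (v - w) := fun v w => apply_nonneg _ _
  have main := hseq τ (τ + h ^ 2) hτ (hτ₀.trans (min_le_left _ _)) hε hεε₀ n hn
    (fun k => errQ P h (Qh k) (V (k * τ))) (fun k => errU P h (uh k) (U (k * τ)))
    (fun k => |sh k - s (k * τ)|) (fun k => strongErrQ h (Qh k) (V (k * τ)))
    (fun k => errQ_nonneg hK hh.le _ _) (fun k => errU_nonneg hB hh.le _ _)
    (fun k => abs_nonneg _) (fun k => strongErrQ_nonneg _ _) (by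
      simp only [Nat.cast_zero, zero_mul]; have n1 := nn1 (Qh 0) (V 0); have n2 := nn2 (uh 0) (U 0)
      have n3 := abs_nonneg (sh 0 - s 0)
      have a1 := pow_le_pow_left₀ n1 (by linarith : _ ≤ C₀ * (τ + h ^ 2)) 2
      have a2 := pow_le_pow_left₀ n2 (by linarith : _ ≤ C₀ * (τ + h ^ 2)) 2
      have a3 := pow_le_pow_left₀ n3 (by linarith : _ ≤ C₀ * (τ + h ^ 2)) 2
      have b1 := (errQ_le hK hh.le (Qh 0) (V 0)).trans
        (mul_le_left a1 (by positivity))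
      have b2 : errU P h (uh 0) (U 0) ≤ _ := (energy_smectic_le hB hh.le (uh 0 - U 0)).trans
        (mul_le_left a2 (by positivity))
      rw [mul_pow] at a3 b1 b2
      linarith)
    (fun k hk hsm => by
      have hkT : (k : ℝ) * τ + τ ≤ T := by
        have : ((k + 1 : ℕ) : ℝ) ≤ n := by exact_mod_cast hk
        have := mul_le_right this hτ.le; push_cast at this; linarith
      have e : ((k + 1 : ℕ) : ℝ) * τ = k * τ + τ := by push_cast; ring
      simp only [e]
      exact hstep G hhL (by positivity) hτ (hτ₀.trans (min_le_left _ _)) hkT (hnum k) (k = 0) hsm)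
  beta_reduce at main
  have p1 := errQ_nonneg hK hh.le (Qh n) (V (n * τ))
  have p2 := errU_nonneg hB hh.le (uh n) (U (n * τ))
  have p3 := sq_nonneg |sh n - s (n * τ)|
  have p4 := sq_nonneg (τ + h ^ 2)
  have hroot : ∀ x : ℝ, 0 ≤ x → x ^ 2 ≤ sobC P ^ 2 * (M * (τ + h ^ 2) ^ 2) →
      x ≤ sobC P * √M * (τ + h ^ 2) := fun x hx hx2 => by
    refine le_of_sq_le_sq ?_ (by positivity); rw [mul_pow, mul_pow, sq_sqrt hM.le]; linarith
  have q1 := hroot _ (nn1 (Qh n) (V (n * τ))) (by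
    refine (h1NormT_sq_le hK hh.le _ _).trans ?_
    refine mul_le_mul ?_ (by linarith) p1 (by positivity); have : 0 < P.B0⁻¹ := by positivity
    have : 1 + P.K⁻¹ ≤ sobC P := by unfold sobC; linarith
    nlinarith)
  have q2 := hroot _ (nn2 (uh n) (U (n * τ))) (by
    refine (N2_sq_le_energy hB hh.le _).trans ?_
    refine mul_le_mul ?_ (by unfold errU at *; linarith) p2 (by positivity)
    have : 0 < P.K⁻¹ := by positivity
    have : 2 + P.B0⁻¹ ≤ sobC P := by unfold sobC; linarith
    nlinarith)
  have q3 := hroot _ (abs_nonneg (sh n - s (n * τ))) (by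
    have h1 : |sh n - s (n * τ)| ^ 2 ≤ M * (τ + h ^ 2) ^ 2 := by linarith
    refine h1.trans (le_mul_of_one_le_left (by positivity) ?_)
    nlinarith)
  linarith

end GridSolution

/-! ### Absolutely convergent trigonometric series -/

section Wiener

variable {d : ℕ}

/-- The frequency weight `1 + |m|₁`. -/
def wgt (m : Fin d → ℤ) : ℝ := 1 + ∑ k, |(m k : ℝ)|

theorem one_le_wgt (m : Fin d → ℤ) : 1 ≤ wgt m :=
  le_add_of_nonneg_right (sum_nonneg fun _ _ => abs_nonneg _)

theorem wgt_pos (m : Fin d → ℤ) : 0 < wgt m := one_pos.trans_le (one_le_wgt m)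

theorem abs_le_wgt (m : Fin d → ℤ) (k : Fin d) : |(m k : ℝ)| ≤ wgt m := by
  have := single_le_sum (f := fun k => |(m k : ℝ)|) (fun _ _ => abs_nonneg _)
    (Finset.mem_univ k)
  unfold wgt; linarith

theorem wgt_add_mul_le (m n : Fin d → ℤ) (ε : ℤ) (hε : |ε| = 1) :
    wgt (fun k => m k + ε * n k) ≤ wgt m * wgt n := by
  have hε' : |(ε : ℝ)| = 1 := by exact_mod_cast hε
  have h1 : ∑ k, |((m k + ε * n k : ℤ) : ℝ)| ≤ ∑ k, |(m k : ℝ)| + ∑ k, |(n k : ℝ)| := by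
    rw [← sum_add_distrib]; refine sum_le_sum fun k _ => ?_
    push_cast; refine (abs_add_le _ _).trans ?_; rw [abs_mul, hε', one_mul]
  have h2 : 0 ≤ ∑ k, |(m k : ℝ)| := sum_nonneg fun _ _ => abs_nonneg _
  have h3 : 0 ≤ ∑ k, |(n k : ℝ)| := sum_nonneg fun _ _ => abs_nonneg _
  unfold wgt
  nlinarith [mul_nonneg h2 h3]

/-- A countable family of waves `a cos(κ m·x + θ)`. -/
structure Rep (d : ℕ) where
  ι : Type
  cnt : Countable ι
  a : ι → ℝ
  m : ι → Fin d → ℤ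
  θ : ι → ℝ

attribute [instance] Rep.cnt

/-- The linear phase `κ m·x` with `κ = 2π / L`. -/
def lin (L : ℝ) (m : Fin d → ℤ) (x : Pt d) : ℝ := 2 * π / L * ∑ k, (m k : ℝ) * x k

theorem lin_add (L : ℝ) (m : Fin d → ℤ) (x y : Pt d) : lin L m (x + y) = lin L m x + lin L m y := by
  simp only [lin, Pi.add_apply, mul_add, sum_add_distrib]

theorem lin_single (L : ℝ) (m : Fin d → ℤ) (k : Fin d) (h : ℝ) :
    lin L m (Pi.single k h) = 2 * π / L * m k * h := by
  simp [lin, Pi.single_apply, mul_assoc]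

theorem continuous_lin (L : ℝ) (m : Fin d → ℤ) : Continuous (lin L m) := by
  unfold lin; fun_prop

theorem cos_lin_periodic {L : ℝ} (hL : L ≠ 0) (m : Fin d → ℤ) (θ : ℝ) :
    IsPer L (fun x : Pt d => cos (lin L m x + θ)) := fun x i => by
  beta_reduce
  have e : lin L m (x + Pi.single i L) + θ = lin L m x + θ + (m i : ℤ) * (2 * π) := by
    rw [lin_add, lin_single]; field_simp; ring
  rw [e, Real.cos_add_int_mul_two_pi]

namespace Rep

variable {L : ℝ} (D : Rep d)

/-- The sum of the waves. -/
def eval (L : ℝ) (D : Rep d) (x : Pt d) : ℝ := ∑' i, D.a i * cos (lin L (D.m i) x + D.θ i)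

/-- Weighted absolute convergence. -/
def Sm (k : ℕ) : Prop := Summable fun i => |D.a i| * wgt (D.m i) ^ k

/-- Weighted `ℓ¹` norm of the amplitudes. -/
def nrm (k : ℕ) : ℝ := ∑' i, |D.a i| * wgt (D.m i) ^ k

/-- Multiplying the amplitudes by a symbol and shifting the phases. -/
def map (l : (Fin d → ℤ) → ℝ) (φ : ℝ) : Rep d :=
  { D with a := fun i => D.a i * l (D.m i), θ := fun i => D.θ i + φ }

variable {D}

theorem Sm.mono {j k : ℕ} (h : D.Sm k) (hjk : j ≤ k) : D.Sm j :=
  Summable.of_nonneg_of_le (fun _ => mul_nonneg (abs_nonneg _) (pow_nonneg (wgt_pos _).le _))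
    (fun _ => mul_le_left (pow_le_pow_right₀ (one_le_wgt _) hjk) (abs_nonneg _)) h

theorem Sm.nrm_mono {j k : ℕ} (h : D.Sm k) (hjk : j ≤ k) : D.nrm j ≤ D.nrm k :=
  (h.mono hjk).tsum_le_tsum
    (fun _ => mul_le_left (pow_le_pow_right₀ (one_le_wgt _) hjk) (abs_nonneg _)) h

theorem Sm.abs {k : ℕ} (h : D.Sm k) : Summable fun i => |D.a i| := by
  simpa [Sm] using h.mono (Nat.zero_le k)

theorem map_bound {j k : ℕ} {c : ℝ} {l : (Fin d → ℤ) → ℝ} (φ : ℝ)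
    (hl : ∀ m, |l m| ≤ c * wgt m ^ j) (h : D.Sm (k + j)) :
    (D.map l φ).Sm k ∧ (D.map l φ).nrm k ≤ c * D.nrm (k + j) := by
  have h1 : ∀ i, |D.a i * l (D.m i)| * wgt (D.m i) ^ k
      ≤ c * (|D.a i| * wgt (D.m i) ^ (k + j)) := fun i => by
    rw [abs_mul, pow_add]
    have := mul_le_left (hl (D.m i))
      (mul_nonneg (abs_nonneg (D.a i)) (pow_nonneg (wgt_pos (D.m i)).le k))
    linarith
  have h2 : (D.map l φ).Sm k := Summable.of_nonneg_of_le
    (fun i => mul_nonneg (abs_nonneg _) (pow_nonneg (wgt_pos _).le _)) h1 (Summable.mul_left c h)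
  refine ⟨h2, ?_⟩
  unfold nrm
  rw [← tsum_mul_left]
  exact h2.tsum_le_tsum h1 (Summable.mul_left c h)

theorem abs_term_le (i : D.ι) (x : Pt d) :
    |D.a i * cos (lin L (D.m i) x + D.θ i)| ≤ |D.a i| := by
  rw [abs_mul]
  exact mul_le_of_le_one_right (abs_nonneg _) (abs_cos_le_one _)

theorem Sm.summable {k : ℕ} (h : D.Sm k) (x : Pt d) :
    Summable fun i => D.a i * cos (lin L (D.m i) x + D.θ i) :=
  Summable.of_norm_bounded h.abs fun i => abs_term_le i x

theorem Sm.abs_eval_le {k : ℕ} (h : D.Sm k) (x : Pt d) : |D.eval L x| ≤ D.nrm 0 := by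
  have := tsum_of_norm_bounded (f := fun i => D.a i * cos (lin L (D.m i) x + D.θ i))
    h.abs.hasSum fun i => abs_term_le (L := L) i x
  simpa [eval, nrm] using this

theorem Sm.continuous {k : ℕ} (h : D.Sm k) : Continuous (D.eval L) :=
  continuous_tsum (fun _ => continuous_const.mul
    (Real.continuous_cos.comp ((continuous_lin L _).add continuous_const))) h.abs
    fun i x => abs_term_le i x

theorem eval_periodic (hL : L ≠ 0) : IsPer L (D.eval L) := fun x i => by
  unfold eval
  exact tsum_congr fun j => congrArg (D.a j * ·) (cos_lin_periodic hL (D.m j) (D.θ j) x i)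

/-- The phase as a continuous linear map. -/
def linL (L : ℝ) (m : Fin d → ℤ) : Pt d →L[ℝ] ℝ :=
  (2 * π / L) • ∑ k, (m k : ℝ) • ContinuousLinearMap.proj k

theorem linL_apply (L : ℝ) (m : Fin d → ℤ) (x : Pt d) : linL L m x = lin L m x := by
  simp [linL, lin]

theorem norm_linL_le (hL : 0 < L) (m : Fin d → ℤ) : ‖linL L m‖ ≤ 2 * π / L * wgt m := by
  have hκ : 0 ≤ 2 * π / L := by positivity
  refine ContinuousLinearMap.opNorm_le_bound _ (mul_nonneg hκ (wgt_pos m).le) fun x => ?_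
  rw [linL_apply, lin, norm_eq_abs, abs_mul, abs_of_nonneg hκ, mul_assoc]
  refine mul_le_left ?_ hκ
  calc |∑ k, (m k : ℝ) * x k| ≤ ∑ k, |(m k : ℝ)| * ‖x‖ := by
        refine (abs_sum_le_sum_abs _ _).trans (sum_le_sum fun k _ => ?_); rw [abs_mul]
        exact mul_le_left (norm_le_pi_norm x k) (abs_nonneg _)
    _ = (∑ k, |(m k : ℝ)|) * ‖x‖ := (sum_mul _ _ _).symm
    _ ≤ _ := mul_le_right (by unfold wgt; linarith) (norm_nonneg x)

theorem hasFDerivAt_wave (L a : ℝ) (m : Fin d → ℤ) (θ : ℝ) (y : Pt d) :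
    HasFDerivAt (fun y => a * cos (lin L m y + θ))
      ((a * -sin (lin L m y + θ)) • linL L m) y := by
  have h1 : HasFDerivAt (fun y => lin L m y + θ) (linL L m) y := by
    simp only [← linL_apply]; exact (linL L m).hasFDerivAt.add_const _
  refine ((h1.cos).const_mul a).congr_fderiv ?_
  rw [smul_smul]

theorem Sm.hasFDerivAt (hL : 0 < L) (h : D.Sm 1) (x : Pt d) :
    HasFDerivAt (D.eval L)
      (∑' i, (D.a i * -sin (lin L (D.m i) x + D.θ i)) • linL L (D.m i)) x ∧
    Summable fun i => (D.a i * -sin (lin L (D.m i) x + D.θ i)) • linL L (D.m i) := by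
  have hb : ∀ i (x : Pt d), ‖(D.a i * -sin (lin L (D.m i) x + D.θ i)) • linL L (D.m i)‖
      ≤ 2 * π / L * (|D.a i| * wgt (D.m i) ^ 1) := fun i x => by
    rw [norm_smul, norm_eq_abs, abs_mul, abs_neg]
    have h1 : |D.a i| * |sin (lin L (D.m i) x + D.θ i)| ≤ |D.a i| :=
      mul_le_of_le_one_right (abs_nonneg _) (Real.abs_sin_le_one _)
    calc _ ≤ |D.a i| * (2 * π / L * wgt (D.m i)) :=
          mul_le_mul h1 (norm_linL_le hL _) (norm_nonneg _) (abs_nonneg _)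
      _ = _ := by ring
  have hs : Summable fun i => 2 * π / L * (|D.a i| * wgt (D.m i) ^ 1) := h.mul_left _
  have hd : ∀ i (y : Pt d), HasFDerivAt (fun y => D.a i * cos (lin L (D.m i) y + D.θ i))
      ((D.a i * -sin (lin L (D.m i) y + D.θ i)) • linL L (D.m i)) y :=
    fun i y => hasFDerivAt_wave _ _ _ _ _
  refine ⟨?_, Summable.of_norm_bounded hs fun i => hb i x⟩
  exact hasFDerivAt_tsum (x₀ := x) hs hd hb (h.summable x) x

end Rep

/-- The classical partial derivative. -/
def pd (k : Fin d) (f : Pt d → ℝ) (x : Pt d) : ℝ := fderiv ℝ f x (Pi.single k 1)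

namespace Rep

variable {L : ℝ} {D : Rep d}

theorem Sm.pd_eval (hL : 0 < L) (h : D.Sm 1) (k : Fin d) :
    pd k (D.eval L) = (D.map (fun m => 2 * π / L * m k) (π / 2)).eval L := by
  funext x
  obtain ⟨h1, h2⟩ := h.hasFDerivAt hL x
  rw [pd, h1.fderiv]
  have := (ContinuousLinearMap.apply ℝ ℝ (Pi.single k 1 : Pt d)).map_tsum h2
  rw [ContinuousLinearMap.apply_apply] at this
  rw [this]
  refine tsum_congr fun i => ?_
  simp only [ContinuousLinearMap.apply_apply, smul_apply, linL_apply, lin_single,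
    smul_eq_mul, map]
  rw [← add_assoc, Real.cos_add_pi_div_two]
  ring

theorem abs_symbol_pd (hL : 0 < L) (k : Fin d) (m : Fin d → ℤ) :
    |2 * π / L * m k| ≤ 2 * π / L * wgt m ^ 1 := by
  rw [abs_mul, abs_of_nonneg (by positivity : 0 ≤ 2 * π / L), pow_one]
  exact mul_le_left (abs_le_wgt m k) (by positivity)

/-- Central difference. -/
theorem Sm.central (h : D.Sm 0) (k : Fin d) (η : ℝ) (x : Pt d) :
    (2 * η)⁻¹ * (D.eval L (x + Pi.single k η) - D.eval L (x - Pi.single k η))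
      = (D.map (fun m => sin (2 * π / L * m k * η) / η) (π / 2)).eval L x := by
  unfold eval
  rw [← (h.summable _).tsum_sub (h.summable _), ← tsum_mul_left]
  refine tsum_congr fun i => ?_
  have e1 := lin_add L (D.m i) x (Pi.single k η)
  have e2 : lin L (D.m i) (x - Pi.single k η) = lin L (D.m i) x - lin L (D.m i) (Pi.single k η) := by
    have := lin_add L (D.m i) (x - Pi.single k η) (Pi.single k η)
    rw [sub_add_cancel] at this; linarith
  simp only [map]
  rw [e1, e2, lin_single, ← add_assoc, Real.cos_add_pi_div_two, add_right_comm,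
    sub_add_eq_add_sub, cos_add, cos_sub]
  by_cases hη : η = 0
  · simp [hη]
  · field_simp; ring

/-- Second difference. -/
theorem Sm.second (h : D.Sm 0) (k : Fin d) (η : ℝ) (x : Pt d) :
    η⁻¹ * (η⁻¹ * (D.eval L (x + Pi.single k η) - D.eval L x)
        - η⁻¹ * (D.eval L x - D.eval L (x - Pi.single k η)))
      = (D.map (fun m => -((2 - 2 * cos (2 * π / L * m k * η)) / η ^ 2)) 0).eval L x := by
  unfold eval
  rw [← (h.summable _).tsum_sub (h.summable _), ← (h.summable _).tsum_sub (h.summable _),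
    ← tsum_mul_left, ← tsum_mul_left, ← Summable.tsum_sub, ← tsum_mul_left]
  · refine tsum_congr fun i => ?_
    have e1 := lin_add L (D.m i) x (Pi.single k η)
    have e2 : lin L (D.m i) (x - Pi.single k η)
        = lin L (D.m i) x - lin L (D.m i) (Pi.single k η) := by
      have := lin_add L (D.m i) (x - Pi.single k η) (Pi.single k η)
      rw [sub_add_cancel] at this; linarith
    simp only [map]
    rw [e1, e2, lin_single, add_zero, add_right_comm, sub_add_eq_add_sub, cos_add,
      cos_sub]
    by_cases hη : η = 0
    · simp [hη]
    · field_simp; ring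
  · exact Summable.mul_left _ ((h.summable _).sub (h.summable _))
  · exact Summable.mul_left _ ((h.summable _).sub (h.summable _))

theorem eval_map_sub {l l' : (Fin d → ℤ) → ℝ} {φ : ℝ} (h : (D.map l φ).Sm 0)
    (h' : (D.map l' φ).Sm 0) (x : Pt d) :
    (D.map l φ).eval L x - (D.map l' φ).eval L x = (D.map (fun m => l m - l' m) φ).eval L x := by
  refine ((h.summable (L := L) x).tsum_sub (h'.summable (L := L) x)).symm.trans
    (tsum_congr fun i => ?_)
  simp only [map]; ring

end Rep

/-- `f` is a trigonometric series with weighted `ℓ¹` norm at most `R`. -/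
def W (L : ℝ) (k : ℕ) (R : ℝ) (f : Pt d → ℝ) : Prop :=
  ∃ D : Rep d, D.Sm k ∧ D.nrm k ≤ R ∧ f = D.eval L

namespace W

variable {L R R' : ℝ} {j k : ℕ} {f g : Pt d → ℝ}

theorem mono (h : W L k R f) (hjk : j ≤ k) (hR : R ≤ R') : W L j R' f := by
  obtain ⟨D, h1, h2, h3⟩ := h
  exact ⟨D, h1.mono hjk, (h1.nrm_mono hjk).trans (h2.trans hR), h3⟩

theorem nonneg (h : W L k R f) : 0 ≤ R := by
  obtain ⟨D, _, h2, _⟩ := h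
  exact (tsum_nonneg fun i => mul_nonneg (abs_nonneg _) (pow_nonneg (wgt_pos _).le _)).trans h2

theorem abs_le (h : W L k R f) (x : Pt d) : |f x| ≤ R := by
  obtain ⟨D, h1, h2, rfl⟩ := h
  exact (h1.abs_eval_le x).trans ((h1.nrm_mono (Nat.zero_le k)).trans h2)

theorem continuous (h : W L k R f) : Continuous f := by
  obtain ⟨D, h1, h2, rfl⟩ := h
  exact h1.continuous

theorem periodic (hL : L ≠ 0) (h : W L k R f) : IsPer L f := by
  obtain ⟨D, h1, h2, rfl⟩ := h
  exact Rep.eval_periodic hL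

theorem pd (hL : 0 < L) (h : W L (k + 1) R f) (l : Fin d) :
    W L k (2 * π / L * R) (SmA.pd l f) := by
  obtain ⟨D, h1, h2, rfl⟩ := h
  have := Rep.map_bound (D := D) (k := k) (π / 2) (Rep.abs_symbol_pd hL l) h1
  exact ⟨_, this.1, this.2.trans (mul_le_left h2 (by positivity)),
    (h1.mono (by omega)).pd_eval hL l⟩

theorem differentiable (hL : 0 < L) (h : W L 1 R f) : Differentiable ℝ f := by
  obtain ⟨D, h1, h2, rfl⟩ := h
  exact fun x => (h1.hasFDerivAt hL x).1.differentiableAt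

theorem smul (c : ℝ) (h : W L k R f) : W L k (|c| * R) (fun x => c * f x) := by
  obtain ⟨D, h1, h2, rfl⟩ := h
  have := Rep.map_bound (D := D) (k := k) (j := 0) (c := |c|) (l := fun _ => c) 0
    (fun m => by simp) h1
  refine ⟨_, this.1, this.2.trans (mul_le_left h2 (abs_nonneg c)), ?_⟩
  funext x
  simp only [Rep.eval, Rep.map, ← tsum_mul_left]
  exact tsum_congr fun i => by rw [add_zero]; ring

theorem add (hf : W L k R f) (hg : W L k R' g) : W L k (R + R') (fun x => f x + g x) := by
  obtain ⟨D, h1, h2, rfl⟩ := hf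
  obtain ⟨D', h1', h2', rfl⟩ := hg
  have key : ∀ (F : D.ι → ℝ) (G : D'.ι → ℝ), Summable F → Summable G →
      HasSum (Sum.elim F G) ((∑' i, F i) + ∑' i, G i) := fun F G hF hG =>
    HasSum.sum (f := Sum.elim F G) hF.hasSum hG.hasSum
  let E : Rep d := ⟨D.ι ⊕ D'.ι, inferInstance, Sum.elim D.a D'.a, Sum.elim D.m D'.m, Sum.elim D.θ D'.θ⟩
  have e1 : (fun i => |E.a i| * wgt (E.m i) ^ k) = Sum.elim (fun i => |D.a i| * wgt (D.m i) ^ k)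
      (fun i => |D'.a i| * wgt (D'.m i) ^ k) := by funext i; cases i <;> rfl
  have k1 := key _ _ h1 h1'
  rw [← e1] at k1
  refine ⟨E, k1.summable, k1.tsum_eq.le.trans (add_le_add h2 h2'), ?_⟩
  funext x
  have e2 : (fun i => E.a i * cos (lin L (E.m i) x + E.θ i))
      = Sum.elim (fun i => D.a i * cos (lin L (D.m i) x + D.θ i))
        (fun i => D'.a i * cos (lin L (D'.m i) x + D'.θ i)) := by funext i; cases i <;> rfl
  have k2 := key _ _ (h1.summable (L := L) x) (h1'.summable (L := L) x)
  rw [← e2] at k2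
  exact k2.tsum_eq.symm

theorem const (c : ℝ) : W L k |c| (fun _ : Pt d => c) := by
  let E : Rep d := ⟨Unit, inferInstance, fun _ => c, fun _ => 0, fun _ => 0⟩
  have hw : wgt (0 : Fin d → ℤ) = 1 := by simp [wgt]
  refine ⟨E, (hasSum_fintype _).summable, ?_, ?_⟩
  · simp [Rep.nrm, E, hw]
  · funext x; simp [Rep.eval, E, lin]

theorem mul (hf : W L k R f) (hg : W L k R' g) : W L k (R * R') (fun x => f x * g x) := by
  have hR := hf.nonneg
  have hR' := hg.nonneg
  obtain ⟨D, h1, h2, rfl⟩ := hf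
  obtain ⟨D', h1', h2', rfl⟩ := hg
  have half : ∀ ε : ℤ, |ε| = 1 → W L k (2⁻¹ * (R * R')) (fun x : Pt d =>
      ∑' i : D.ι × D'.ι, 2⁻¹ * (D.a i.1 * D'.a i.2) *
        cos ((lin L (D.m i.1) x + D.θ i.1) + ε * (lin L (D'.m i.2) x + D'.θ i.2))) := by
    intro ε hε
    let E : Rep d := ⟨D.ι × D'.ι, inferInstance, fun i => 2⁻¹ * (D.a i.1 * D'.a i.2),
      fun i k => D.m i.1 k + ε * D'.m i.2 k, fun i => D.θ i.1 + ε * D'.θ i.2⟩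
    have hn : ∀ i : D.ι × D'.ι, 0 ≤ |E.a i| * wgt (E.m i) ^ k := fun i =>
      mul_nonneg (abs_nonneg _) (pow_nonneg (wgt_pos _).le _)
    have hle : ∀ i : D.ι × D'.ι, |E.a i| * wgt (E.m i) ^ k ≤ 2⁻¹ *
        ((|D.a i.1| * wgt (D.m i.1) ^ k) * (|D'.a i.2| * wgt (D'.m i.2) ^ k)) := fun i => by
      have := pow_le_pow_left₀ (wgt_pos _).le (wgt_add_mul_le (D.m i.1) (D'.m i.2) ε hε) k
      simp only [E, abs_mul]; rw [abs_of_nonneg (by norm_num : (0 : ℝ) ≤ 2⁻¹)]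
      calc _ ≤ 2⁻¹ * (|D.a i.1| * |D'.a i.2|) * (wgt (D.m i.1) * wgt (D'.m i.2)) ^ k :=
            mul_le_left this (by positivity)
        _ = _ := by rw [mul_pow]; ring
    have hnn : ∀ (D : Rep d), 0 ≤ fun i => |D.a i| * wgt (D.m i) ^ k := fun D i =>
      mul_nonneg (abs_nonneg _) (pow_nonneg (wgt_pos _).le _)
    have hs := (Summable.mul_of_nonneg h1 h1' (hnn D) (hnn D')).mul_left (2⁻¹ : ℝ)
    have hE : E.Sm k := Summable.of_nonneg_of_le hn hle hs; refine ⟨E, hE, ?_, ?_⟩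
    · refine (hE.tsum_le_tsum hle hs).trans ?_
      rw [tsum_mul_left, ← Summable.tsum_mul_tsum h1 h1' (Summable.mul_of_nonneg h1 h1' (hnn D) (hnn D'))]
      gcongr
      · exact tsum_nonneg (hnn D')
      · exact h2
      · exact h2'
    · funext x
      refine tsum_congr fun i => ?_
      simp only [E]
      congr 2
      simp only [lin]; push_cast; simp only [add_mul, sum_add_distrib, mul_assoc, ← mul_sum]; ring
  have h := (half 1 (by simp)).add (half (-1) (by simp))
  convert h using 1
  · ring
  · funext x
    have s0 := fun D0 : Rep d => fun (hD : D0.Sm k) => (hD.summable (L := L) x)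
    have sp : Summable fun i : D.ι × D'.ι => |D.a i.1| * |D'.a i.2| :=
      Summable.mul_of_nonneg (f := fun i => |D.a i|) (g := fun i => |D'.a i|) h1.abs h1'.abs
        (fun i => abs_nonneg (D.a i)) (fun i => abs_nonneg (D'.a i))
    have sq : ∀ (c : D.ι × D'.ι → ℝ), Summable fun i : D.ι × D'.ι =>
        2⁻¹ * (D.a i.1 * D'.a i.2) * cos (c i) := fun c => by
      refine Summable.of_norm_bounded sp fun i => ?_
      rw [norm_eq_abs, abs_mul, abs_mul, abs_mul, abs_of_nonneg (by norm_num : (0 : ℝ) ≤ 2⁻¹)]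
      have := abs_cos_le_one (c i); have h3 : 0 ≤ |D.a i.1| * |D'.a i.2| := by positivity
      nlinarith [abs_nonneg (cos (c i))]
    rw [← (sq _).tsum_add (sq _)]; unfold Rep.eval
    have hprod : ∀ i : D.ι × D'.ι, D.a i.1 * cos (lin L (D.m i.1) x + D.θ i.1) *
        (D'.a i.2 * cos (lin L (D'.m i.2) x + D'.θ i.2)) =
        2⁻¹ * (D.a i.1 * D'.a i.2) * cos ((lin L (D.m i.1) x + D.θ i.1)
          + (1 : ℤ) * (lin L (D'.m i.2) x + D'.θ i.2))
        + 2⁻¹ * (D.a i.1 * D'.a i.2) * cos ((lin L (D.m i.1) x + D.θ i.1)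
          + (-1 : ℤ) * (lin L (D'.m i.2) x + D'.θ i.2)) := fun i => by
      generalize lin L (D.m i.1) x + D.θ i.1 = α
      generalize lin L (D'.m i.2) x + D'.θ i.2 = β
      push_cast; rw [one_mul, neg_one_mul, ← sub_eq_add_neg, cos_add, cos_sub]; ring
    rw [Summable.tsum_mul_tsum (s0 D h1) (s0 D' h1')]
    · exact tsum_congr hprod
    · exact (summable_congr hprod).mpr ((sq _).add (sq _))

end W

end Wiener

/-! ### Fourier coefficients on the periodic cell -/

section Torus

variable {d : ℕ} {L : ℝ}

theorem IsPer.add_int {f : Pt d → ℝ} (hf : IsPer L f) (x : Pt d) (z : Fin d → ℤ) :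
    f (x + fun i => z i * L) = f x := by
  have h1 : ∀ (x : Pt d) (i : Fin d) (n : ℤ), f (x + Pi.single i (n * L)) = f x := by
    intro x i n
    have hp : Function.Periodic (fun t : ℝ => f (x + Pi.single i t)) L := fun t => by
      beta_reduce
      rw [Pi.single_add, ← add_assoc]; exact hf _ i
    have := hp.int_mul n 0; simpa using this
  have h2 : ∀ s : Finset (Fin d), f (x + ∑ i ∈ s, Pi.single i ((z i : ℝ) * L)) = f x := by
    intro s
    induction s using Finset.induction_on with
    | empty => simp
    | insert a s ha ih => rw [Finset.sum_insert ha, add_comm (Pi.single _ _), ← add_assoc, h1, ih]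
  have := h2 Finset.univ
  rwa [Finset.univ_sum_single (fun i => (z i : ℝ) * L)] at this

instance : IsFiniteMeasure (cellMeasure d L) :=
  ⟨by rw [cellMeasure, Measure.restrict_apply_univ]; exact isCompact_Icc.measure_lt_top⟩

/-- The pairing of `f` with the wave `cos(κ m·x + θ)` over the cell. -/
def cf (L : ℝ) (f : Pt d → ℝ) (m : Fin d → ℤ) (θ : ℝ) : ℝ :=
  ∫ x, f x * cos (lin L m x + θ) ∂(ℳ L)

theorem _root_.MeasureTheory.Integrable.mul_wave {f : Pt d → ℝ} {μ : Measure (Pt d)}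
    (hf : Integrable f μ) (L : ℝ) (n : Fin d → ℤ) (θ : ℝ) :
    Integrable (fun x => f x * cos (lin L n x + θ)) μ :=
  hf.mul_bdd (c := 1) (Real.continuous_cos.comp
    ((continuous_lin L n).add continuous_const)).aestronglyMeasurable
    (Filter.Eventually.of_forall fun _ => abs_cos_le_one _)

local instance : MeasureSpace UnitAddCircle := ⟨AddCircle.haarAddCircle⟩

/-- The representative of a point of the torus in the cell `(0, L]^d`. -/
def torRep (L : ℝ) (y : UnitAddTorus (Fin d)) : Pt d :=
  fun i => L * (AddCircle.equivIoc 1 0 (y i) : ℝ)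

theorem measurePreserving_torRep (hL : 0 < L) :
    MeasurePreserving (torRep L) volume ((ENNReal.ofReal (L ^ d))⁻¹ • cellMeasure d L) := by
  have h1 := UnitAddTorus.measurePreserving_equivPiIoc (0 : Fin d → ℝ)
  have hb : MeasurableSet {x : Pt d | ∀ i, x i ∈ Ioc ((0 : Fin d → ℝ) i) ((0 : Fin d → ℝ) i + 1)} :=
    MeasurableSet.univ_pi' fun _ => measurableSet_Ioc
  have h2 := measurePreserving_subtype_coe (μa := (volume : Measure (Pt d))) hb
  have h3 : MeasurePreserving (fun x : Pt d => L • x) volume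
      ((ENNReal.ofReal (L ^ d))⁻¹ • volume) := by
    refine ⟨by fun_prop, ?_⟩
    rw [Measure.map_addHaar_smul _ hL.ne', Module.finrank_fin_fun, abs_of_pos (by positivity),
      ENNReal.ofReal_inv_of_pos (by positivity)]
  have hs : MeasurableSet (pi univ fun i : Fin d => Ioc ((0 : Pt d) i) L) :=
    MeasurableSet.univ_pi fun _ => measurableSet_Ioc
  have h4 := h3.restrict_preimage hs
  have e1 : (fun x : Pt d => L • x) ⁻¹' (pi univ fun i : Fin d => Ioc ((0 : Pt d) i) L)
      = {x : Pt d | ∀ i, x i ∈ Ioc ((0 : Fin d → ℝ) i) ((0 : Fin d → ℝ) i + 1)} := by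
    ext x
    simp only [mem_preimage, mem_pi, mem_univ, true_imp_iff, mem_ofPred_eq, Pi.smul_apply,
      smul_eq_mul, Pi.zero_apply, zero_add, mem_Ioc]
    refine forall_congr' fun i => and_congr (by constructor <;> intro h <;> nlinarith) ?_
    exact ⟨fun h => by nlinarith, fun h => by nlinarith⟩
  have e2 : (pi univ fun i : Fin d => Ioc ((0 : Pt d) i) L) =ᵐ[volume] Icc (0 : Pt d) fun _ => L :=
    Measure.univ_pi_Ioc_ae_eq_Icc
  rw [e1, Measure.restrict_smul, Measure.restrict_congr_set e2] at h4
  exact h4.comp (h2.comp h1)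

theorem mFourier_torRep (hL : 0 < L) (n : Fin d → ℤ) (y : UnitAddTorus (Fin d)) :
    UnitAddTorus.mFourier n y = Complex.exp (lin L n (torRep L y) * Complex.I) := by
  have h1 : ∀ i, fourier (n i) (y i)
      = Complex.exp ((2 * π * (n i * (AddCircle.equivIoc 1 0 (y i) : ℝ)) : ℝ)
        * Complex.I) := fun i => by
    conv_lhs => rw [← AddCircle.coe_equivIoc (p := (1 : ℝ)) (a := 0) (y := y i)]
    rw [fourier_coe_apply]
    congr 1
    push_cast; ring
  simp only [UnitAddTorus.mFourier, ContinuousMap.coe_mk, h1]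
  rw [← Complex.exp_sum, ← sum_mul, ← Complex.ofReal_sum]
  congr 3
  rw [lin, mul_sum]
  refine sum_congr rfl fun i _ => ?_
  simp only [torRep]
  field_simp

theorem integral_torRep (hL : 0 < L) {E : Type*} [NormedAddCommGroup E] [NormedSpace ℝ E]
    {G : Pt d → E} (hG : AEStronglyMeasurable G (ℳ L)) :
    ∫ y : UnitAddTorus (Fin d), G (torRep L y) = (L ^ d)⁻¹ • ∫ x, G x ∂(ℳ L) := by
  have h := measurePreserving_torRep (d := d) hL
  have hG' : AEStronglyMeasurable G (Measure.map (torRep L) volume) := by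
    rw [h.map_eq]; exact hG.smul_measure _
  rw [← integral_map h.measurable.aemeasurable hG', h.map_eq, integral_smul_measure,
    ENNReal.toReal_inv, ENNReal.toReal_ofReal (by positivity)]

theorem mFourierCoeff_torRep (hL : 0 < L) {f : Pt d → ℝ} (hf : Integrable f (ℳ L))
    (n : Fin d → ℤ) :
    UnitAddTorus.mFourierCoeff (fun y => (f (torRep L y) : ℂ)) n
      = (L ^ d)⁻¹ • ((cf L f n 0 : ℂ) - cf L f n (-(π / 2)) * Complex.I) := by
  have hc : ∀ θ : ℝ, Integrable (fun x => f x * cos (lin L n x + θ)) (ℳ L) :=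
    fun θ => hf.mul_wave L n θ
  have e1 : ∀ y : UnitAddTorus (Fin d), UnitAddTorus.mFourier (-n) y • (f (torRep L y) : ℂ)
      = (fun x => ((f x * cos (lin L n x + 0) : ℝ) : ℂ)
        - ((f x * cos (lin L n x + -(π / 2)) : ℝ) : ℂ) * Complex.I) (torRep L y) := by
    intro y; rw [UnitAddTorus.mFourier_neg, mFourier_torRep hL, ← Complex.exp_conj, smul_eq_mul]
    simp only [map_mul, Complex.conj_ofReal, Complex.conj_I]
    rw [mul_neg, ← neg_mul, ← Complex.ofReal_neg, Complex.exp_mul_I, ← Complex.ofReal_cos,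
      ← Complex.ofReal_sin, Real.cos_neg, Real.sin_neg, add_zero, ← sub_eq_add_neg,
      Real.cos_sub_pi_div_two]
    push_cast; ring
  unfold UnitAddTorus.mFourierCoeff
  rw [integral_congr_ae (Filter.Eventually.of_forall e1), integral_torRep
    (G := fun x => ((f x * cos (lin L n x + 0) : ℝ) : ℂ)
        - ((f x * cos (lin L n x + -(π / 2)) : ℝ) : ℂ) * Complex.I) hL
    ((hc 0).ofReal.sub ((hc _).ofReal.mul_const Complex.I)).aestronglyMeasurable,
    integral_sub (hc 0).ofReal ((hc _).ofReal.mul_const _), integral_mul_const]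
  simp only [cf, integral_complex_ofReal]

/-- **Parseval's identity** on the cell. -/
theorem hasSum_sq_cf (hL : 0 < L) {f : Pt d → ℝ} (hf : MemLp f 2 (ℳ L)) :
    HasSum (fun n : Fin d → ℤ => cf L f n 0 ^ 2 + cf L f n (-(π / 2)) ^ 2)
      (L ^ d * ∫ x, f x ^ 2 ∂(ℳ L)) := by
  have hi : Integrable f (ℳ L) := hf.integrable one_le_two
  have hm : MemLp (fun y : UnitAddTorus (Fin d) => (f (torRep L y) : ℂ)) 2 volume :=
    ((hf.smul_measure (c := (ENNReal.ofReal (L ^ d))⁻¹) (by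
      rw [ENNReal.inv_ne_top, Ne, ENNReal.ofReal_eq_zero, not_le]; positivity)).comp_measurePreserving
      (measurePreserving_torRep hL)).ofReal
  have h1 := UnitAddTorus.hasSum_sq_mFourierCoeff hm.toLp
  have e1 : ∀ n, UnitAddTorus.mFourierCoeff (hm.toLp : UnitAddTorus (Fin d) → ℂ) n
      = (L ^ d)⁻¹ • ((cf L f n 0 : ℂ) - cf L f n (-(π / 2)) * Complex.I) := fun n => by
    rw [← mFourierCoeff_torRep hL hi]; refine integral_congr_ae ?_
    filter_upwards [hm.coeFn_toLp] with y hy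
    rw [hy]
  have e2 : ∫ y, ‖(hm.toLp : UnitAddTorus (Fin d) → ℂ) y‖ ^ 2
      = (L ^ d)⁻¹ * ∫ x, f x ^ 2 ∂(ℳ L) := by
    rw [← smul_eq_mul, ← integral_torRep (G := fun x => f x ^ 2) hL (hi.aestronglyMeasurable.pow 2)]
    refine integral_congr_ae ?_
    filter_upwards [hm.coeFn_toLp] with y hy
    rw [hy]; simp
  simp only [e1] at h1
  rw [e2] at h1
  have h2 := h1.mul_left ((L ^ d) ^ 2)
  have hp : L ^ d ≠ 0 := by positivity
  have e4 : (L ^ d) ^ 2 * ((L ^ d)⁻¹ * ∫ x, f x ^ 2 ∂(ℳ L))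
      = L ^ d * ∫ x, f x ^ 2 ∂(ℳ L) := by
    rw [sq, mul_assoc, mul_inv_cancel_left₀ hp]
  rw [e4] at h2
  refine h2.congr_fun fun n => ?_
  · 
    have e3 : (cf L f n 0 : ℂ) - cf L f n (-(π / 2)) * Complex.I
        = ⟨cf L f n 0, -cf L f n (-(π / 2))⟩ := by
      apply Complex.ext <;> simp
    rw [norm_smul, mul_pow, e3, Complex.sq_norm, Complex.normSq_mk, norm_eq_abs, sq_abs,
      inv_pow, mul_inv_cancel_left₀ (pow_ne_zero 2 hp)]
    ring

/-- A continuous periodic function with absolutely summable coefficients is the sum of its series. -/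
theorem hasSum_cf (hL : 0 < L) {f : Pt d → ℝ} (hf : Continuous f) (hp : IsPer L f)
    (hs : Summable fun n : Fin d → ℤ => |cf L f n 0| + |cf L f n (-(π / 2))|) (x : Pt d) :
    HasSum (fun n : Fin d → ℤ => (L ^ d)⁻¹ * (cf L f n 0 * cos (lin L n x)
      + cf L f n (-(π / 2)) * sin (lin L n x))) (f x) := by
  have hi : Integrable f (ℳ L) := by
    have := hf.continuousOn.integrableOn_compact (μ := (volume : Measure (Pt d)))
      (isCompact_Icc (a := (0 : Pt d)) (b := fun _ => L))
    exact this
  have key : ∀ {f : Pt d → ℝ}, IsPer L f → ∀ x : Pt d,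
      f (torRep L (fun i => ((x i / L : ℝ) : UnitAddCircle))) = f x := by
    intro f hp x
    have h1 : ∀ i, ∃ z : ℤ, torRep L (fun i => ((x i / L : ℝ) : UnitAddCircle)) i
        = x i + z * L := by
      intro i
      have := AddCircle.coe_equivIoc (p := (1 : ℝ)) (a := 0) (y := ((x i / L : ℝ) : UnitAddCircle))
      rw [← sub_eq_zero, ← AddCircle.coe_sub, AddCircle.coe_eq_zero_iff] at this
      obtain ⟨z, hz⟩ := this; refine ⟨z, ?_⟩; simp only [torRep]
      rw [sub_eq_iff_eq_add.mp hz.symm, zsmul_eq_mul, mul_one, mul_add, mul_div_cancel₀ _ hL.ne']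
      ring
    choose z hz using h1
    have h2 : torRep L (fun i => ((x i / L : ℝ) : UnitAddCircle)) = x + fun i => z i * L := by
      funext i; exact hz i
    rw [h2, hp.add_int]
  have hq : IsOpenQuotientMap (fun (x : Fin d → ℝ) i => ((x i : ℝ) : UnitAddCircle)) :=
    IsOpenQuotientMap.piMap fun _ => QuotientAddGroup.isOpenQuotientMap_mk
  have hc : Continuous fun y : UnitAddTorus (Fin d) => (f (torRep L y) : ℂ) := by
    rw [← hq.continuous_comp_iff]
    have : ((fun y : UnitAddTorus (Fin d) => (f (torRep L y) : ℂ)) ∘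
        fun (x : Fin d → ℝ) i => ((x i : ℝ) : UnitAddCircle)) = fun x => (f (L • x) : ℂ) := by
      funext x; have := key hp (L • x)
      simp only [Pi.smul_apply, smul_eq_mul, mul_div_cancel_left₀ _ hL.ne'] at this
      simp only [Function.comp_apply, this]
    rw [this]
    fun_prop
  have e1 := mFourierCoeff_torRep hL hi
  have hs' : Summable (UnitAddTorus.mFourierCoeff (fun y => (f (torRep L y) : ℂ))) := by
    refine Summable.of_norm_bounded (hs.mul_left (L ^ d)⁻¹) fun n => ?_
    rw [e1, norm_smul, norm_of_nonneg (by positivity)]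
    refine mul_le_left ((norm_sub_le _ _).trans ?_) (by positivity); simp
  have h := UnitAddTorus.hasSum_mFourier_series_apply_of_summable (f := ⟨_, hc⟩) hs'
    (fun i => ((x i / L : ℝ) : UnitAddCircle))
  have h2 := Complex.hasSum_re h
  simp only [ContinuousMap.coe_mk, key hp, Complex.ofReal_re] at h2
  refine h2.congr_fun ?_
  intro n
  rw [e1, mFourier_torRep hL, Complex.exp_mul_I, ← Complex.ofReal_cos, ← Complex.ofReal_sin]
  have k1 := key (cos_lin_periodic hL.ne' n 0) x
  have k2 := key (cos_lin_periodic hL.ne' n (-(π / 2))) x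
  simp only [add_zero] at k1
  simp only [← sub_eq_add_neg, Real.cos_sub_pi_div_two] at k2
  rw [k1, k2]
  simp only [Complex.real_smul, smul_eq_mul, Complex.mul_re, Complex.mul_im, Complex.sub_re,
    Complex.sub_im, Complex.add_re, Complex.add_im, Complex.ofReal_re, Complex.ofReal_im,
    Complex.I_re, Complex.I_im]
  ring

end Torus

/-! ### Weak derivatives and Fourier coefficients -/

section WeakDeriv

variable {d : ℕ} {L R : ℝ} {f g f' g' : Pt d → ℝ}

theorem cf_congr (h : f =ᵐ[ℳ L] g) (m : Fin d → ℤ) (θ : ℝ) :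
    cf L f m θ = cf L g m θ :=
  integral_congr_ae (h.mono fun x hx => by beta_reduce; rw [hx])

theorem cf_add (hf : Integrable f (ℳ L)) (hg : Integrable g (ℳ L))
    (m : Fin d → ℤ) (θ : ℝ) : cf L (fun x => f x + g x) m θ = cf L f m θ + cf L g m θ := by
  simp only [cf, add_mul]
  exact integral_add (hf.mul_wave L m θ) (hg.mul_wave L m θ)

theorem cf_smul (c : ℝ) (m : Fin d → ℤ) (θ : ℝ) :
    cf L (fun x => c * f x) m θ = c * cf L f m θ := by
  simp only [cf, mul_assoc]
  exact integral_const_mul _ _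

theorem cf_sub (hf : Integrable f (ℳ L)) (hg : Integrable g (ℳ L))
    (m : Fin d → ℤ) (θ : ℝ) : cf L (fun x => f x - g x) m θ = cf L f m θ - cf L g m θ := by
  simp only [cf, sub_mul]
  exact integral_sub (hf.mul_wave L m θ) (hg.mul_wave L m θ)

theorem cf_add_pi (m : Fin d → ℤ) (θ : ℝ) : cf L f m (θ + π) = -cf L f m θ := by
  simp only [cf, ← add_assoc, Real.cos_add_pi, mul_neg]
  exact integral_neg _

theorem cf_sq_le (hf : Integrable f (ℳ L)) (m : Fin d → ℤ) (θ : ℝ) :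
    cf L f m θ ^ 2 ≤ cf L f m 0 ^ 2 + cf L f m (-(π / 2)) ^ 2 := by
  have e : cf L f m θ = cos θ * cf L f m 0 - sin θ * cf L f m (-(π / 2)) := by
    simp only [cf]
    rw [← integral_const_mul, ← integral_const_mul, ← integral_sub
      ((hf.mul_wave L m 0).const_mul _) ((hf.mul_wave L m _).const_mul _)]
    congr 1
    funext x; rw [add_zero, ← sub_eq_add_neg, Real.cos_sub_pi_div_two, cos_add]; ring
  rw [e]
  nlinarith [Real.sin_sq_add_cos_sq θ,
    sq_nonneg (sin θ * cf L f m 0 + cos θ * cf L f m (-(π / 2)))]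

theorem bessel_cf (hL : 0 < L) (hf : MemLp f 2 (ℳ L)) (F : Finset (Fin d → ℤ))
    (θ : (Fin d → ℤ) → ℝ) :
    ∑ m ∈ F, cf L f m (θ m) ^ 2 ≤ L ^ d * ∫ x, f x ^ 2 ∂(ℳ L) :=
  (sum_le_sum fun m _ => cf_sq_le (hf.integrable one_le_two) m (θ m)).trans
    (sum_le_hasSum F (fun _ _ => by positivity) (hasSum_sq_cf hL hf))

theorem ae_eq_of_cf_eq (hL : 0 < L) (hf : MemLp f 2 (ℳ L))
    (hg : MemLp g 2 (ℳ L)) (h : ∀ m θ, cf L f m θ = cf L g m θ) :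
    f =ᵐ[ℳ L] g := by
  have h1 := hasSum_sq_cf hL (hf.sub hg)
  have h0 : ∀ m θ, cf L (f - g) m θ = 0 := fun m θ => by
    have := cf_sub (hf.integrable one_le_two) (hg.integrable one_le_two) m θ
    rw [h, sub_self] at this; exact this
  simp only [h0] at h1
  norm_num at h1
  have h2 := h1.unique hasSum_zero
  have h3 : ∫ x, (f - g) x ^ 2 ∂(ℳ L) = 0 :=
    (mul_eq_zero.mp h2).resolve_left (by positivity)
  rw [integral_eq_zero_iff_of_nonneg (fun x => sq_nonneg _) (hf.sub hg).integrable_sq] at h3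
  filter_upwards [h3] with x hx
  have : (f - g) x ^ 2 = 0 := hx
  rw [Pi.sub_apply] at this
  exact sub_eq_zero.mp (pow_eq_zero_iff two_ne_zero |>.mp this)

theorem contDiff_wave (L : ℝ) (m : Fin d → ℤ) (θ : ℝ) :
    ContDiff ℝ ∞ fun x : Pt d => cos (lin L m x + θ) := by
  unfold lin; fun_prop

theorem HasWeakPartial.cf_eq (hL : 0 < L) {k : Fin d} (h : HasWeakPartial L k f g)
    (m : Fin d → ℤ) (θ : ℝ) :
    cf L g m θ = -(2 * π / L * m k * cf L f m (θ + π / 2)) := by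
  have h1 := h.2 _ (contDiff_wave L m θ) (cos_lin_periodic hL.ne' m θ)
  have h2 : ∀ x : Pt d, fderiv ℝ (fun x : Pt d => cos (lin L m x + θ)) x (Pi.single k 1)
      = 2 * π / L * m k * cos (lin L m x + (θ + π / 2)) := fun x => by
    have := Rep.hasFDerivAt_wave L 1 m θ x; simp only [one_mul] at this
    rw [this.fderiv, smul_apply, Rep.linL_apply, lin_single, smul_eq_mul, ← add_assoc,
      Real.cos_add_pi_div_two]
    ring
  simp only [h2] at h1
  rw [cf, cf, ← neg_eq_iff_eq_neg.mpr h1, ← integral_const_mul]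
  congr 2
  funext x; ring

theorem HasWeakPartial.unique (hL : 0 < L) {k : Fin d} (h : HasWeakPartial L k f g)
    (h' : HasWeakPartial L k f g') : g =ᵐ[ℳ L] g' :=
  ae_eq_of_cf_eq hL h.1 h'.1 fun m θ => by rw [h.cf_eq hL, h'.cf_eq hL]

theorem HasWeakPartial.congr {k : Fin d} (h : HasWeakPartial L k f g)
    (hf : f =ᵐ[ℳ L] f') : HasWeakPartial L k f' g :=
  ⟨h.1, fun φ h1 h2 => by
    rw [← h.2 φ h1 h2]
    exact integral_congr_ae (hf.mono fun x hx => by beta_reduce; rw [hx])⟩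

theorem HasWeakPartial.wd {k : Fin d} (h : HasWeakPartial L k f g) :
    HasWeakPartial L k f (wd L k f) := by
  have : ∃ g, HasWeakPartial L k f g := ⟨g, h⟩
  rw [SmA.wd, dif_pos this]
  exact this.choose_spec

theorem SobolevBound.memLp {n : ℕ} (h : SobolevBound L R n f) :
    MemLp f 2 (ℳ L) ∧ eLpNorm f 2 (ℳ L) ≤ ENNReal.ofReal R := by
  cases n with
  | zero => exact h
  | succ n => exact h.1

theorem SobolevBound.congr {n : ℕ} (h : SobolevBound L R n f) (hf : f =ᵐ[ℳ L] g) :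
    SobolevBound L R n g := by
  have h0 : MemLp g 2 (ℳ L) ∧ eLpNorm g 2 (ℳ L) ≤ ENNReal.ofReal R :=
    ⟨(memLp_congr_ae hf).mp h.memLp.1, by rw [← eLpNorm_congr_ae hf]; exact h.memLp.2⟩
  cases n with
  | zero => exact h0
  | succ n =>
    exact ⟨h0, fun i => by
      obtain ⟨g', h1, h2⟩ := h.2 i
      exact ⟨g', h1.congr hf, h2⟩⟩

theorem SobolevBound.wd (hL : 0 < L) {n : ℕ} (h : SobolevBound L R (n + 1) f) (k : Fin d) :
    HasWeakPartial L k f (wd L k f) ∧ SobolevBound L R n (wd L k f) := by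
  obtain ⟨g, h1, h2⟩ := h.2 k
  exact ⟨h1.wd, h2.congr (h1.unique hL h1.wd)⟩

/-- The symbol of a pure second derivative. -/
theorem SobolevBound.cf_wd_wd (hL : 0 < L) {n : ℕ} (h : SobolevBound L R (n + 2) f) (k : Fin d)
    (m : Fin d → ℤ) (θ : ℝ) : cf L (SmA.wd L k (SmA.wd L k f)) m θ
      = -((2 * π / L * m k) ^ 2 * cf L f m θ) := by
  obtain ⟨h1, h2⟩ := h.wd hL k
  rw [(h2.wd hL k).1.cf_eq hL, h1.cf_eq hL, add_assoc, add_halves, cf_add_pi]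
  ring

theorem integral_pd_eq_zero (hL : 0 < L) {k : Fin d} {ψ : Pt d → ℝ} (h1 : Differentiable ℝ ψ)
    (h2 : Continuous (pd k ψ)) (hp : IsPer L ψ) : ∫ x, pd k ψ x ∂(ℳ L) = 0 := by
  cases d with
  | zero => exact k.elim0
  | succ n =>
    have e : ∀ x, ∑ i, (if i = k then fderiv ℝ ψ x else 0) (Pi.single i 1) = pd k ψ x := fun x => by
      rw [Finset.sum_eq_single k (fun i _ hi => by simp [hi]) (by simp)]; simp [pd]
    have h := integral_divergence_of_hasFDerivAt_off_countable' (0 : Pt (n + 1)) (fun _ => L)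
      (fun _ => hL.le) (fun i => if i = k then ψ else 0)
      (fun i x => if i = k then fderiv ℝ ψ x else 0) ∅ countable_empty
      (fun i => by
        split_ifs
        · exact h1.continuous.continuousOn
        · exact continuousOn_const)
      (fun x _ i => by
        split_ifs
        · exact (h1 x).hasFDerivAt
        · exact hasFDerivAt_const _ _)
      (by
        simp only [e]
        exact h2.continuousOn.integrableOn_compact isCompact_Icc)
    simp only [e] at h; rw [cellMeasure, h]; refine Finset.sum_eq_zero fun i _ => ?_
    split_ifs with hi
    · subst hi
      rw [sub_eq_zero]
      congr 1
      funext x; have := hp (i.insertNth ((0 : Pt (n + 1)) i) x) i; rw [← this]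
      congr 1
      funext j; refine Fin.succAboveCases i ?_ (fun j => ?_) j
      · simp
      · simp
    · simp

theorem W.hasWeakPartial (hL : 0 < L) (h : W L 1 R f) (k : Fin d) :
    HasWeakPartial L k f (SmA.pd k f) := by
  have hc := (h.pd (k := 0) hL k).continuous
  have hd := h.differentiable hL
  have hi : ∀ g : Pt d → ℝ, Continuous g → Integrable g (ℳ L) := fun g hg =>
    hg.continuousOn.integrableOn_compact isCompact_Icc
  refine ⟨?_, fun φ h1 h2 => ?_⟩
  · refine MemLp.of_bound hc.aestronglyMeasurable (2 * π / L * R)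
      (Filter.Eventually.of_forall fun x => (h.pd (k := 0) hL k).abs_le x)
  · have hφd : Differentiable ℝ φ := h1.differentiable (by simp)
    have hφ : Continuous fun x => fderiv ℝ φ x (Pi.single k 1) :=
      (h1.continuous_fderiv (by simp)).clm_apply continuous_const
    have e : ∀ x, SmA.pd k (fun x => f x * φ x) x
        = f x * fderiv ℝ φ x (Pi.single k 1) + SmA.pd k f x * φ x := fun x => by
      rw [SmA.pd, fderiv_fun_mul (hd x) (hφd x)]
      simp only [SmA.pd, add_apply, smul_apply, smul_eq_mul]; ring
    have h3 := integral_pd_eq_zero (ψ := fun x => f x * φ x) (k := k) hL (hd.mul hφd)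
      (by simp only [funext e]; exact (h.continuous.mul hφ).add (hc.mul h1.continuous))
      (fun x i => by beta_reduce; rw [h.periodic hL.ne' x i, h2 x i])
    simp only [e] at h3
    rw [integral_add (hi (fun x => f x * fderiv ℝ φ x (Pi.single k 1)) (h.continuous.mul hφ))
      (hi (fun x => SmA.pd k f x * φ x) (hc.mul h1.continuous))] at h3
    linarith

theorem wd_ae_eq_pd (hL : 0 < L) (h : W L 1 R f) (hg : g =ᵐ[ℳ L] f) (k : Fin d) :
    wd L k g =ᵐ[ℳ L] pd k f := by
  have := (h.hasWeakPartial hL k).congr hg.symm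
  exact this.wd.unique hL this

theorem cell_real_univ (hL : 0 < L) : (cellMeasure d L).real univ = L ^ d := by
  rw [cellMeasure, measureReal_restrict_apply_univ, Measure.real,
    Real.volume_Icc_pi_toReal (a := 0) (fun _ => hL.le)]
  simp

theorem integral_wave (hL : 0 < L) {m : Fin d → ℤ} (hm : m ≠ 0) (θ : ℝ) :
    ∫ x, cos (lin L m x + θ) ∂(ℳ L) = 0 := by
  obtain ⟨k, hk⟩ := Function.ne_iff.mp hm
  have h := ((W.const (L := L) (k := 1) (d := d) 1).hasWeakPartial hL k).cf_eq hL m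
    (θ - π / 2)
  have e : pd k (fun _ : Pt d => (1 : ℝ)) = fun _ => 0 := by
    funext x; simp [pd]
  rw [e, sub_add_cancel] at h
  simp only [cf, zero_mul, integral_zero, one_mul] at h
  have hk' : (2 * π / L * m k : ℝ) ≠ 0 :=
    mul_ne_zero (by positivity) (Int.cast_ne_zero.mpr hk)
  exact (mul_eq_zero.mp (neg_eq_zero.mp h.symm)).resolve_left hk'

theorem abs_integral_wave_le (hL : 0 < L) (m : Fin d → ℤ) (θ : ℝ) :
    |∫ x, cos (lin L m x + θ) ∂(ℳ L)| ≤ if m = 0 then L ^ d else 0 := by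
  split_ifs with hm
  · have := norm_integral_le_of_norm_le_const (μ := cellMeasure d L)
      (f := fun x => cos (lin L m x + θ)) (C := 1)
      (Filter.Eventually.of_forall fun x => abs_cos_le_one _)
    rwa [cell_real_univ hL, one_mul] at this
  · rw [integral_wave hL hm, abs_zero]

end WeakDeriv

/-! ### Weighted summability of the coefficients and the Sobolev embedding -/

section Embedding

variable {d : ℕ} {L R R' : ℝ} {f g : Pt d → ℝ} {j k : ℕ}

/-- The coefficients of `f` are summable with the weight `wgt ^ k`. -/
def SB (L : ℝ) (k : ℕ) (R : ℝ) (f : Pt d → ℝ) : Prop :=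
  ∀ (F : Finset (Fin d → ℤ)) (θ : (Fin d → ℤ) → ℝ), ∑ m ∈ F, wgt m ^ k * |cf L f m (θ m)| ≤ R

theorem wgt_neg (m : Fin d → ℤ) : wgt (-m) = wgt m := by simp [wgt]

theorem Rep.Sm.hasSum_integral {D : Rep d} (h : D.Sm 0) (m : Fin d → ℤ) (θ : ℝ) :
    HasSum (fun i => D.a i * ∫ x, cos (lin L (D.m i) x + D.θ i)
      * cos (lin L m x + θ) ∂(ℳ L)) (cf L (D.eval L) m θ) := by
  have hc : ∀ (m : Fin d → ℤ) θ, Continuous fun x : Pt d => cos (lin L m x + θ) :=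
    fun m θ => (contDiff_wave L m θ).continuous
  have hitg : ∀ i, Integrable (fun x => D.a i * (cos (lin L (D.m i) x + D.θ i)
      * cos (lin L m x + θ))) (ℳ L) := fun i =>
    ((hc _ _).mul (hc _ _)).continuousOn.integrableOn_compact isCompact_Icc |>.const_mul _
  have hb : ∀ i (x : Pt d), ‖D.a i * (cos (lin L (D.m i) x + D.θ i)
      * cos (lin L m x + θ))‖ ≤ |D.a i| := fun i x => by
    rw [norm_eq_abs, abs_mul, abs_mul]
    exact mul_le_of_le_one_right (abs_nonneg _) (mul_le_one₀ (abs_cos_le_one _)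
      (abs_nonneg _) (abs_cos_le_one _))
  have h1 := hasSum_integral_of_summable_integral_norm hitg (Summable.of_nonneg_of_le
    (fun i => integral_nonneg fun x => norm_nonneg _) (fun i => by
      have := norm_integral_le_of_norm_le_const (μ := cellMeasure d L) (C := |D.a i|)
        (f := fun x => ‖D.a i * (cos (lin L (D.m i) x + D.θ i)
          * cos (lin L m x + θ))‖) (Filter.Eventually.of_forall fun x => by
            rw [norm_norm]; exact hb i x)
      exact (le_abs_self _).trans this) (h.abs.mul_right ((cellMeasure d L).real univ)))
  simp only [integral_const_mul] at h1
  have e : cf L (D.eval L) m θ = ∫ x, ∑' i, D.a i * (cos (lin L (D.m i) x + D.θ i)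
      * cos (lin L m x + θ)) ∂(ℳ L) := by
    unfold cf
    congr 1
    funext x; rw [Rep.eval, ← tsum_mul_right]; exact tsum_congr fun i => by ring
  rw [e]
  exact h1

theorem abs_integral_wave_mul_wave_le (hL : 0 < L) (m n : Fin d → ℤ) (θ φ : ℝ) :
    |∫ x, cos (lin L n x + φ) * cos (lin L m x + θ) ∂(ℳ L)|
      ≤ L ^ d * ((if m = n then 1 else 0) + if m = -n then 1 else 0) := by
  have hp : 0 ≤ L ^ d := by positivity
  have hi : ∀ (m : Fin d → ℤ) θ, Integrable (fun x : Pt d => cos (lin L m x + θ))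
      (ℳ L) := fun m θ =>
    (contDiff_wave L m θ).continuous.continuousOn.integrableOn_compact isCompact_Icc
  have e : ∀ x : Pt d, cos (lin L n x + φ) * cos (lin L m x + θ)
      = 2⁻¹ * cos (lin L (n + m) x + (φ + θ)) + 2⁻¹ * cos (lin L (n - m) x + (φ - θ)) := by
    intro x
    have e1 : lin L (n + m) x + (φ + θ) = (lin L n x + φ) + (lin L m x + θ) := by
      simp only [lin, Pi.add_apply, Int.cast_add, add_mul, sum_add_distrib]; ring
    have e2 : lin L (n - m) x + (φ - θ) = (lin L n x + φ) - (lin L m x + θ) := by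
      simp only [lin, Pi.sub_apply, Int.cast_sub, sub_mul, sum_sub_distrib]; ring
    rw [e1, e2]
    generalize lin L n x + φ = α
    generalize lin L m x + θ = β
    rw [cos_add, cos_sub]; ring
  simp only [e]
  rw [integral_add ((hi _ _).const_mul _) ((hi _ _).const_mul _), integral_const_mul,
    integral_const_mul]
  have h1 := abs_integral_wave_le hL (n + m) (φ + θ)
  have h2 := abs_integral_wave_le hL (n - m) (φ - θ)
  have c1 : (n + m = 0) = (m = -n) := propext (by rw [add_comm]; exact add_eq_zero_iff_eq_neg)
  have c2 : (n - m = 0) = (m = n) := propext (by rw [sub_eq_zero]; exact eq_comm)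
  simp only [c1] at h1
  simp only [c2] at h2
  refine (abs_add_le _ _).trans ?_
  rw [abs_mul, abs_mul, abs_of_pos (by norm_num : (0 : ℝ) < 2⁻¹)]
  split_ifs at * <;> linarith

theorem W.sb (hL : 0 < L) (h : W L k R f) : SB L k (2 * L ^ d * R) f := by
  obtain ⟨D, h1, h2, rfl⟩ := h
  intro F θ
  have hp : 0 ≤ L ^ d := by positivity
  have hb := fun m i => abs_integral_wave_mul_wave_le hL m (D.m i) (θ m) (D.θ i)
  obtain ⟨b, hbd⟩ : ∃ b : (Fin d → ℤ) → D.ι → ℝ, b = fun m i =>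
    L ^ d * ((if m = D.m i then 1 else 0) + if m = -D.m i then 1 else 0) := ⟨_, rfl⟩
  have hb0 : ∀ m i, 0 ≤ b m i := fun m i => by rw [hbd]; dsimp only; split_ifs <;> positivity
  have hb2 : ∀ m i, b m i ≤ 2 * L ^ d := fun m i => by
    rw [hbd]; dsimp only; split_ifs <;> linarith
  have hsum : ∀ m, Summable fun i => |D.a i| * b m i := fun m =>
    Summable.of_nonneg_of_le (fun i => mul_nonneg (abs_nonneg _) (hb0 m i))
      (fun i => mul_le_left (hb2 m i) (abs_nonneg _)) (h1.abs.mul_right _)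
  have h3 : ∀ m ∈ F, wgt m ^ k * |cf L (D.eval L) m (θ m)|
      ≤ ∑' i, wgt m ^ k * (|D.a i| * b m i) := fun m _ => by
    rw [tsum_mul_left]; refine mul_le_left ?_ (pow_nonneg (wgt_pos m).le k)
    have hs := (h1.mono (Nat.zero_le k)).hasSum_integral (L := L) m (θ m); rw [← hs.tsum_eq]
    refine tsum_of_norm_bounded (E := ℝ) (hsum m).hasSum fun i => ?_
    rw [norm_eq_abs, abs_mul, hbd]; exact mul_le_left (hb m i) (abs_nonneg _)
  refine (sum_le_sum h3).trans ?_
  rw [← Summable.tsum_finsetSum fun m _ => (hsum m).mul_left _]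
  have h4 : ∀ i, ∑ m ∈ F, wgt m ^ k * (|D.a i| * b m i)
      ≤ 2 * L ^ d * (|D.a i| * wgt (D.m i) ^ k) := fun i => by
    have e : ∀ m ∈ F, wgt m ^ k * (|D.a i| * b m i) = (L ^ d * |D.a i|) *
        ((if m = D.m i then wgt m ^ k else 0) + if m = -D.m i then wgt m ^ k else 0) := by
      intro m _; rw [hbd]; dsimp only; split_ifs <;> ring
    rw [sum_congr rfl e, ← mul_sum, sum_add_distrib, Finset.sum_ite_eq',
      Finset.sum_ite_eq', wgt_neg]
    have h5 : 0 ≤ wgt (D.m i) ^ k := pow_nonneg (wgt_pos _).le k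
    calc _ ≤ (L ^ d * |D.a i|) * (wgt (D.m i) ^ k + wgt (D.m i) ^ k) := by
          refine mul_le_left (add_le_add ?_ ?_) (by positivity) <;>
            split_ifs <;> linarith
      _ = _ := by ring
  calc _ ≤ ∑' i, 2 * L ^ d * (|D.a i| * wgt (D.m i) ^ k) :=
        Summable.tsum_le_tsum h4 (summable_sum fun m _ => (hsum m).mul_left _) (h1.mul_left _)
    _ = 2 * L ^ d * D.nrm k := tsum_mul_left
    _ ≤ _ := mul_le_left h2 (by positivity)

theorem SB.w (hL : 0 < L) (hf : Continuous f) (hp : IsPer L f) (h : SB L k R f) :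
    W L k (2 * (L ^ d)⁻¹ * R) f := by
  have hL' : 0 < (L ^ d)⁻¹ := by positivity
  have key : ∀ θ φ : ℝ, Summable (fun m : Fin d → ℤ => |cf L f m θ|) ∧
      W L k ((L ^ d)⁻¹ * R) (fun x : Pt d =>
        ∑' m : Fin d → ℤ, (L ^ d)⁻¹ * cf L f m θ * cos (lin L m x + φ)) := fun θ φ => by
    let D : Rep d := ⟨Fin d → ℤ, inferInstance, fun m => (L ^ d)⁻¹ * cf L f m θ, id, fun _ => φ⟩
    have e : ∀ m, |(L ^ d)⁻¹ * cf L f m θ| * wgt m ^ k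
        = (L ^ d)⁻¹ * (wgt m ^ k * |cf L f m θ|) := fun m => by
      rw [abs_mul, abs_of_pos hL']; ring
    have hle : ∀ F : Finset (Fin d → ℤ), ∑ m ∈ F, |(L ^ d)⁻¹ * cf L f m θ| * wgt m ^ k
        ≤ (L ^ d)⁻¹ * R := fun F => by
      simp only [e, ← mul_sum]; exact mul_le_left (h F fun _ => θ) hL'.le
    have hnn : ∀ m : Fin d → ℤ, 0 ≤ |(L ^ d)⁻¹ * cf L f m θ| * wgt m ^ k := fun m =>
      mul_nonneg (abs_nonneg _) (pow_nonneg (wgt_pos m).le k)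
    have hs : D.Sm k := summable_of_sum_le hnn hle
    refine ⟨?_, D, hs, Real.tsum_le_of_sum_le hnn hle, rfl⟩; have := hs.abs.mul_left (L ^ d)
    refine this.congr fun m => ?_
    simp only [D, abs_mul, abs_of_pos hL']; field_simp
  have h1 := key 0 0
  have h2 := key (-(π / 2)) (-(π / 2))
  have h3 := h1.2.add h2.2
  convert h3 using 1
  · ring
  · funext x
    have hs := hasSum_cf hL hf hp (h1.1.add h2.1) x
    have s1 : ∀ θ φ, Summable fun m : Fin d → ℤ =>
        (L ^ d)⁻¹ * cf L f m θ * cos (lin L m x + φ) := fun θ φ =>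
      Summable.of_norm_bounded ((key θ 0).1.mul_left (L ^ d)⁻¹) fun m => by
        rw [norm_eq_abs, abs_mul, abs_mul, abs_of_pos hL']
        exact mul_le_of_le_one_right (by positivity) (abs_cos_le_one _)
    rw [← (s1 _ _).tsum_add (s1 _ _), ← hs.tsum_eq]; refine tsum_congr fun m => ?_
    rw [add_zero, ← sub_eq_add_neg, Real.cos_sub_pi_div_two]; ring

theorem wgt_pow_le (m : Fin d → ℤ) (n : ℕ) :
    wgt m ^ (n + 1) ≤ (d + 1) ^ n * (1 + ∑ k, |(m k : ℝ)| ^ (n + 1)) := by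
  have h := pow_sum_div_card_le_sum_pow (s := (Finset.univ : Finset (Option (Fin d))))
    (f := fun o => o.elim 1 fun k => |(m k : ℝ)|)
    (fun o _ => by cases o <;> simp) n
  simp only [Fintype.sum_option, Option.elim, one_pow, Finset.card_univ, Fintype.card_option,
    Fintype.card_fin, Nat.cast_add, Nat.cast_one] at h
  rwa [div_le_iff₀' (by positivity)] at h

theorem sum_wgt_le (hd : d ≤ 3) (F : Finset (Fin d → ℤ)) :
    ∑ m ∈ F, (wgt m ^ 4)⁻¹ ≤ (∑' j, latt 1 j) ^ d := by
  have h1 : ∀ m : Fin d → ℤ, (wgt m ^ 4)⁻¹ ≤ ∏ k, latt 1 (m k) := fun m => by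
    have := inv_sq_le_prod_latt hd one_pos m (x := wgt m ^ 2) ?_
    · rwa [← pow_mul] at this
    · have h2 : ∑ k, 1 * (m k : ℝ) ^ 2 ≤ (∑ k, |(m k : ℝ)|) ^ 2 := by
        rw [sq, sum_mul]; refine sum_le_sum fun k hk => ?_
        rw [one_mul, ← sq_abs, sq]
        exact mul_le_left
          (single_le_sum (f := fun k => |(m k : ℝ)|) (fun _ _ => abs_nonneg _) hk)
          (abs_nonneg _)
      have h3 : 0 ≤ ∑ k, |(m k : ℝ)| := sum_nonneg fun _ _ => abs_nonneg _
      unfold wgt; nlinarith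
  have h2 : F ⊆ Fintype.piFinset fun k => F.image fun m => m k := fun m hm =>
    Fintype.mem_piFinset.mpr fun k => Finset.mem_image_of_mem _ hm
  calc _ ≤ ∑ m ∈ Fintype.piFinset fun k => F.image fun m => m k, ∏ k, latt 1 (m k) :=
        (sum_le_sum fun m _ => h1 m).trans (Finset.sum_le_sum_of_subset_of_nonneg h2
          fun m _ _ => Finset.prod_nonneg fun k _ => latt_nonneg one_pos _)
    _ = ∏ k : Fin d, ∑ j ∈ F.image fun m => m k, latt 1 j :=
        (Finset.prod_univ_sum _ _).symm
    _ ≤ ∏ _k : Fin d, ∑' j, latt 1 j := Finset.prod_le_prod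
        (fun k _ => sum_nonneg fun _ _ => latt_nonneg one_pos _)
        (fun k _ => (summable_latt one_pos).sum_le_tsum _ fun _ _ => latt_nonneg one_pos _)
    _ = _ := by simp

theorem SobolevBound.integral_sq_le {n : ℕ} (h : SobolevBound L R n f) :
    ∫ x, f x ^ 2 ∂(ℳ L) ≤ R ^ 2 := by
  obtain ⟨h1, h2⟩ := h.memLp
  have h3 := h2.trans (ENNReal.ofReal_le_ofReal (le_abs_self R))
  rw [h1.eLpNorm_eq_integral_rpow_norm (by norm_num) (by norm_num),
    ENNReal.ofReal_le_ofReal_iff (abs_nonneg R)] at h3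
  simp only [ENNReal.toReal_ofNat, Real.rpow_ofNat, norm_eq_abs, sq_abs] at h3
  have h0 : 0 ≤ ∫ x, f x ^ 2 ∂(ℳ L) := integral_nonneg fun x => sq_nonneg _
  have h4 := pow_le_pow_left₀ (by positivity) h3 2
  rwa [sq_abs, ← rpow_natCast, ← rpow_mul h0, Nat.cast_ofNat,
    inv_mul_cancel₀ two_ne_zero, Real.rpow_one] at h4

/-- **Sobolev embedding**: in dimension at most three, `H⁴` functions have coefficients summable
with the weight `wgt ^ 2`. -/
theorem SobolevBound.sb (hL : 0 < L) (hd : d ≤ 3) :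
    ∃ C, 0 ≤ C ∧ ∀ {R : ℝ} {f : Pt d → ℝ}, SobolevBound L R 4 f → SB L 2 (C * |R|) f := by
  have hκ : 0 < 2 * π / L := by positivity
  obtain ⟨κ, hκe⟩ : ∃ κ, κ = 2 * π / L := ⟨_, rfl⟩
  rw [← hκe] at hκ
  obtain ⟨Z, hZ⟩ : ∃ Z, Z = (∑' j, latt 1 j) ^ d := ⟨_, rfl⟩
  have hZ0 : 0 ≤ Z := by
    rw [hZ]; exact pow_nonneg (tsum_nonneg fun j => latt_nonneg one_pos j) _
  refine ⟨√(Z * ((d + 1) ^ 7 * (1 + d * (κ ^ 8)⁻¹) * L ^ d)), sqrt_nonneg _,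
    fun {R f} h F θ => ?_⟩
  have hf := h.memLp.1
  have b0 := (bessel_cf hL hf F θ).trans
    (mul_le_left h.integral_sq_le (by positivity))
  have bk : ∀ k, ∑ m ∈ F, |(m k : ℝ)| ^ 8 * cf L f m (θ m) ^ 2 ≤ (κ ^ 8)⁻¹ * (L ^ d * R ^ 2) := by
    intro k
    obtain ⟨_, g1⟩ := h.wd hL k
    obtain ⟨_, g2⟩ := g1.wd hL k
    obtain ⟨_, g3⟩ := g2.wd hL k
    obtain ⟨_, g4⟩ := g3.wd hL k
    have b := (bessel_cf hL g4.memLp.1 F θ).trans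
      (mul_le_left g4.integral_sq_le (by positivity))
    have e : ∀ m, cf L (SmA.wd L k (SmA.wd L k (SmA.wd L k (SmA.wd L k f)))) m (θ m) ^ 2
        = κ ^ 8 * (|(m k : ℝ)| ^ 8 * cf L f m (θ m) ^ 2) := fun m => by
      rw [g2.cf_wd_wd (n := 0) hL, h.cf_wd_wd (n := 2) hL, ← hκe, Even.pow_abs ⟨4, rfl⟩]; ring
    simp only [e, ← mul_sum] at b; rwa [inv_mul_eq_div, le_div_iff₀' (by positivity)]
  have hw : ∑ m ∈ F, (wgt m ^ 4 * |cf L f m (θ m)|) ^ 2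
      ≤ (d + 1) ^ 7 * (1 + d * (κ ^ 8)⁻¹) * L ^ d * R ^ 2 := by
    have h1 : ∀ m ∈ F, (wgt m ^ 4 * |cf L f m (θ m)|) ^ 2 ≤ (d + 1) ^ 7 * (cf L f m (θ m) ^ 2
        + ∑ k, |(m k : ℝ)| ^ 8 * cf L f m (θ m) ^ 2) := fun m _ => by
      have := mul_le_right (wgt_pow_le m 7) (sq_nonneg (cf L f m (θ m)))
      rw [mul_pow, ← pow_mul, sq_abs, ← sum_mul]
      calc _ ≤ _ := this
        _ = _ := by ring
    refine (sum_le_sum h1).trans ?_; rw [← mul_sum, sum_add_distrib, sum_comm]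
    have h2 : ∑ k : Fin d, ∑ m ∈ F, |(m k : ℝ)| ^ 8 * cf L f m (θ m) ^ 2
        ≤ d * ((κ ^ 8)⁻¹ * (L ^ d * R ^ 2)) := by
      refine (sum_le_sum fun k _ => bk k).trans ?_; simp
    calc _ ≤ ((d : ℝ) + 1) ^ 7 * (L ^ d * R ^ 2 + d * ((κ ^ 8)⁻¹ * (L ^ d * R ^ 2))) :=
          mul_le_left (add_le_add b0 h2) (by positivity)
      _ = _ := by ring
  have hcs := Finset.sum_mul_sq_le_sq_mul_sq F (fun m => (wgt m ^ 2)⁻¹)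
    (fun m => wgt m ^ 4 * |cf L f m (θ m)|)
  have e1 : ∀ m : Fin d → ℤ, (wgt m ^ 2)⁻¹ * (wgt m ^ 4 * |cf L f m (θ m)|)
      = wgt m ^ 2 * |cf L f m (θ m)| := fun m => by
    have := (wgt_pos m).ne'; field_simp
  have e2 : ∀ m : Fin d → ℤ, ((wgt m ^ 2)⁻¹) ^ 2 = (wgt m ^ 4)⁻¹ := fun m => by
    rw [inv_pow, ← pow_mul]
  simp only [e1, e2] at hcs
  refine abs_le_of_sq_le_sq' ?_ (by positivity) |>.2
  rw [mul_pow, sq_sqrt (by positivity), sq_abs]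
  calc _ ≤ _ := hcs
    _ ≤ Z * ((d + 1) ^ 7 * (1 + d * (κ ^ 8)⁻¹) * L ^ d * R ^ 2) :=
        mul_le_mul (hZ ▸ sum_wgt_le hd F) hw (sum_nonneg fun _ _ => sq_nonneg _) hZ0
    _ = _ := by ring

end Embedding

/-! ### Difference quotients of trigonometric series -/

section Differences

variable {d : ℕ} {L R R' h : ℝ} {f g : Pt d → ℝ} {j k : ℕ}

/-- Central difference quotient. -/
def cd (h : ℝ) (l : Fin d) (f : Pt d → ℝ) (x : Pt d) : ℝ :=
  (2 * h)⁻¹ * (f (x + Pi.single l h) - f (x - Pi.single l h))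

/-- Second difference quotient. -/
def sd (h : ℝ) (l : Fin d) (f : Pt d → ℝ) (x : Pt d) : ℝ :=
  h⁻¹ * (h⁻¹ * (f (x + Pi.single l h) - f x) - h⁻¹ * (f x - f (x - Pi.single l h)))

theorem abs_sin_sub_le (z : ℝ) : |sin z - z| ≤ 2 * |z| ^ 3 := by
  have key : ∀ z : ℝ, 0 ≤ z → |sin z - z| ≤ 2 * z ^ 3 := fun z hz => by
    rw [abs_of_nonpos (by linarith [Real.sin_le hz])]
    rcases hz.eq_or_lt with rfl | h0
    · simp
    · linarith [Real.sin_gt_sub_cube h0, pow_pos h0 3]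
  rcases le_total 0 z with hz | hz
  · rw [abs_of_nonneg hz]; exact key z hz
  · have := key (-z) (by linarith)
    rwa [Real.sin_neg, neg_sub_neg, abs_sub_comm, ← abs_of_nonpos hz] at this

theorem abs_two_sub_cos_le (z : ℝ) : |2 - 2 * cos z| ≤ |z| ^ 2 := by
  rw [abs_of_nonneg (by linarith [Real.cos_le_one z]), sq_abs]
  linarith [Real.one_sub_sq_div_two_le_cos (x := z)]

theorem abs_two_sub_cos_sub_le (z : ℝ) : |2 - 2 * cos z - z ^ 2| ≤ |z| ^ 4 := by
  have h1 := abs_sin_sub_le (z / 2)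
  have e : 2 - 2 * cos z - z ^ 2
      = 4 * (sin (z / 2) - z / 2) * (sin (z / 2) + z / 2) := by
    have h2 := Real.cos_two_mul (z / 2); rw [mul_div_cancel₀ _ two_ne_zero, Real.cos_sq'] at h2
    rw [h2]; ring
  have h2 : |sin (z / 2) + z / 2| ≤ |z| := by
    refine (abs_add_le _ _).trans ?_; have := Real.abs_sin_le_abs (x := z / 2)
    rw [abs_div, abs_two] at *; linarith
  rw [e, abs_mul, abs_mul, abs_of_pos (by norm_num : (0 : ℝ) < 4)]
  have h3 : |sin (z / 2) - z / 2| ≤ |z| ^ 3 / 4 := by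
    rw [abs_div, abs_two] at h1
    calc _ ≤ _ := h1
      _ = _ := by ring
  calc _ ≤ 4 * (|z| ^ 3 / 4) * |z| := by gcongr
    _ = _ := by ring

theorem W.map {c φ : ℝ} {l : (Fin d → ℤ) → ℝ} {T : (Pt d → ℝ) → Pt d → ℝ}
    (hT : ∀ D : Rep d, D.Sm j → T (D.eval L) = (D.map l φ).eval L)
    (hl : ∀ m, |l m| ≤ c * wgt m ^ j) (hf : W L (k + j) R f) : W L k (c * R) (T f) := by
  obtain ⟨D, h1, h2, rfl⟩ := hf
  have hc : 0 ≤ c := by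
    have := (abs_nonneg _).trans (hl 0); simpa [wgt] using this
  obtain ⟨h3, h4⟩ := Rep.map_bound φ hl h1
  exact ⟨_, h3, h4.trans (mul_le_left h2 hc), hT D (h1.mono (by omega))⟩

theorem Rep.Sm.map {D : Rep d} {l : (Fin d → ℤ) → ℝ} {c : ℝ} (h : D.Sm j) (φ : ℝ)
    (hl : ∀ m, |l m| ≤ c * wgt m ^ j) : (D.map l φ).Sm 0 :=
  (Rep.map_bound (k := 0) φ hl (by rwa [zero_add])).1

theorem abs_phase_le (hL : 0 < L) (m : Fin d → ℤ) (l : Fin d) (n : ℕ) :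
    |2 * π / L * m l| ^ n ≤ (2 * π / L) ^ n * wgt m ^ n := by
  rw [← mul_pow]
  have := Rep.abs_symbol_pd hL l m
  rw [pow_one] at this
  exact pow_le_pow_left₀ (abs_nonneg _) this n

theorem abs_symbol_cd (hL : 0 < L) (hh : 0 < h) (l : Fin d) (m : Fin d → ℤ) :
    |sin (2 * π / L * m l * h) / h| ≤ 2 * π / L * wgt m ^ 1 := by
  refine le_trans ?_ (Rep.abs_symbol_pd hL l m)
  rw [abs_div, div_le_iff₀ (abs_pos.mpr hh.ne'), ← abs_mul]
  exact Real.abs_sin_le_abs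

theorem abs_symbol_cd_sub (hL : 0 < L) (hh : 0 < h) (l : Fin d) (m : Fin d → ℤ) :
    |sin (2 * π / L * m l * h) / h - 2 * π / L * m l|
      ≤ 2 * (2 * π / L) ^ 3 * h ^ 2 * wgt m ^ 3 := by
  have h1 := abs_sin_sub_le (2 * π / L * m l * h)
  have h2 := abs_phase_le hL m l 3
  generalize 2 * π / L * (m l : ℝ) = w at *
  rw [div_sub' hh.ne', abs_div, abs_of_pos hh, div_le_iff₀ hh, mul_comm h w]
  rw [abs_mul, abs_of_pos hh, mul_pow] at h1
  calc _ ≤ _ := h1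
    _ = 2 * h ^ 3 * |w| ^ 3 := by ring
    _ ≤ 2 * h ^ 3 * ((2 * π / L) ^ 3 * wgt m ^ 3) := by gcongr
    _ = _ := by ring

theorem abs_symbol_sd (hL : 0 < L) (hh : 0 < h) (l : Fin d) (m : Fin d → ℤ) :
    |-((2 - 2 * cos (2 * π / L * m l * h)) / h ^ 2)|
      ≤ (2 * π / L) ^ 2 * wgt m ^ 2 := by
  have h1 := abs_two_sub_cos_le (2 * π / L * m l * h)
  refine le_trans ?_ (abs_phase_le hL m l 2)
  rw [abs_neg, abs_div, abs_of_pos (pow_pos hh 2), div_le_iff₀ (pow_pos hh 2)]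
  rwa [abs_mul, abs_of_pos hh, mul_pow] at h1

theorem abs_symbol_sd_sub (hL : 0 < L) (hh : 0 < h) (l : Fin d) (m : Fin d → ℤ) :
    |-((2 - 2 * cos (2 * π / L * m l * h)) / h ^ 2) - -(2 * π / L * m l) ^ 2|
      ≤ (2 * π / L) ^ 4 * h ^ 2 * wgt m ^ 4 := by
  have h1 := abs_two_sub_cos_sub_le (2 * π / L * m l * h)
  have h2 := abs_phase_le hL m l 4
  generalize 2 * π / L * (m l : ℝ) = w at *
  rw [neg_sub_neg, abs_sub_comm, div_sub' (pow_pos hh 2).ne', abs_div, abs_of_pos (pow_pos hh 2),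
    div_le_iff₀ (pow_pos hh 2), mul_comm (h ^ 2) (w ^ 2), ← mul_pow]
  rw [abs_mul, abs_of_pos hh, mul_pow |w|] at h1
  calc _ ≤ |w| ^ 4 * h ^ 4 := h1
    _ ≤ ((2 * π / L) ^ 4 * wgt m ^ 4) * h ^ 4 := by gcongr
    _ = _ := by ring

theorem Rep.Sm.pd_pd_eval (hL : 0 < L) {D : Rep d} (hD : D.Sm 2) (l : Fin d) :
    SmA.pd l (SmA.pd l (D.eval L)) = (D.map (fun m => -(2 * π / L * m l) ^ 2) 0).eval L := by
  have h1 := (Rep.map_bound (k := 1) (π / 2) (Rep.abs_symbol_pd hL l) hD).1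
  rw [(hD.mono one_le_two).pd_eval hL, h1.pd_eval hL]
  funext x
  refine tsum_congr fun i => ?_
  simp only [Rep.map]
  rw [← add_assoc, ← add_assoc, Real.cos_add_pi_div_two, Real.sin_add_pi_div_two, add_zero]
  ring

namespace W

theorem cd (hL : 0 < L) (hh : 0 < h) (hf : W L (k + 1) R f) (l : Fin d) :
    W L k (2 * π / L * R) (SmA.cd h l f) :=
  hf.map (T := SmA.cd h l)
    (fun _ hD => funext fun x => (hD.mono (Nat.zero_le 1)).central l h x) (abs_symbol_cd hL hh l)

theorem cd_sub (hL : 0 < L) (hh : 0 < h) (hf : W L (k + 3) R f) (l : Fin d) :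
    W L k (2 * (2 * π / L) ^ 3 * h ^ 2 * R) (fun x => SmA.cd h l f x - SmA.pd l f x) :=
  hf.map (T := fun f x => SmA.cd h l f x - SmA.pd l f x) (fun D hD => funext fun x => by
    have h1 : D.Sm 1 := hD.mono (by norm_num)
    rw [h1.pd_eval hL, ← Rep.eval_map_sub (h1.map _ (abs_symbol_cd hL hh l))
      (h1.map _ (Rep.abs_symbol_pd hL l)), ← (h1.mono (Nat.zero_le 1)).central l h x, SmA.cd])
    (abs_symbol_cd_sub hL hh l)

theorem sd (hL : 0 < L) (hh : 0 < h) (hf : W L (k + 2) R f) (l : Fin d) :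
    W L k ((2 * π / L) ^ 2 * R) (SmA.sd h l f) :=
  hf.map (T := SmA.sd h l)
    (fun _ hD => funext fun x => (hD.mono (Nat.zero_le 2)).second l h x) (abs_symbol_sd hL hh l)

theorem sd_sub (hL : 0 < L) (hh : 0 < h) (hf : W L (k + 4) R f) (l : Fin d) :
    W L k ((2 * π / L) ^ 4 * h ^ 2 * R)
      (fun x => SmA.sd h l f x - SmA.pd l (SmA.pd l f) x) :=
  hf.map (T := fun f x => SmA.sd h l f x - SmA.pd l (SmA.pd l f) x) (fun D hD => funext fun x => by
    have h1 : D.Sm 2 := hD.mono (by norm_num)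
    have h2 : ∀ m : Fin d → ℤ, |-(2 * π / L * m l) ^ 2| ≤ (2 * π / L) ^ 2 * wgt m ^ 2 :=
      fun m => by rw [abs_neg, abs_pow]; exact abs_phase_le hL m l 2
    rw [h1.pd_pd_eval hL, ← Rep.eval_map_sub (h1.map _ (abs_symbol_sd hL hh l))
      (h1.map _ h2), ← (h1.mono (Nat.zero_le 2)).second l h x, SmA.sd])
    (abs_symbol_sd_sub hL hh l)

theorem congr (hf : W L k R f) (hR : R ≤ R') (e : ∀ x, f x = g x) : W L k R' g :=
  (funext e) ▸ hf.mono le_rfl hR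

theorem sub (hf : W L k R f) (hg : W L k R' g) : W L k (R + R') (fun x => f x - g x) :=
  (hf.add (hg.smul (-1))).congr (by simp) fun x => by ring

end W

end Differences

/-! ### Families of functions and their differences -/

section Families

variable {d : ℕ} {L : ℝ} {k : ℕ} {α : Type} {S : Set α} {δ : α → ℝ}
  {f f' g g' : α → Pt d → ℝ}

/-- Two families, bounded in the weighted norm, at distance `O(δ)`. -/
structure Cl (L : ℝ) (k : ℕ) (S : Set α) (δ : α → ℝ) (f f' : α → Pt d → ℝ) : Prop where
  left : ∃ R, ∀ a ∈ S, W L k R (f a)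
  right : ∃ R, ∀ a ∈ S, W L k R (f' a)
  diff : ∃ R, ∀ a ∈ S, W L k (R * δ a) (fun x => f a x - f' a x)

namespace Cl

theorem refl (h : ∃ R, ∀ a ∈ S, W L k R (f a)) : Cl L k S δ f f :=
  ⟨h, h, 0, fun _ _ => (W.const 0).congr (by simp) fun x => by simp⟩

theorem const (c : ℝ) : Cl (d := d) L k S δ (fun _ _ => c) (fun _ _ => c) :=
  refl ⟨|c|, fun _ _ => W.const c⟩

theorem add (h : Cl L k S δ f f') (h' : Cl L k S δ g g') :
    Cl L k S δ (fun a x => f a x + g a x) (fun a x => f' a x + g' a x) := by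
  obtain ⟨⟨R1, h1⟩, ⟨R2, h2⟩, R3, h3⟩ := h
  obtain ⟨⟨R1', h1'⟩, ⟨R2', h2'⟩, R3', h3'⟩ := h'
  exact ⟨⟨_, fun a ha => (h1 a ha).add (h1' a ha)⟩, ⟨_, fun a ha => (h2 a ha).add (h2' a ha)⟩,
    R3 + R3', fun a ha => ((h3 a ha).add (h3' a ha)).congr (by rw [add_mul]) fun x => by ring⟩

theorem mul (h : Cl L k S δ f f') (h' : Cl L k S δ g g') :
    Cl L k S δ (fun a x => f a x * g a x) (fun a x => f' a x * g' a x) := by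
  obtain ⟨⟨R1, h1⟩, ⟨R2, h2⟩, R3, h3⟩ := h
  obtain ⟨⟨R1', h1'⟩, ⟨R2', h2'⟩, R3', h3'⟩ := h'
  exact ⟨⟨_, fun a ha => (h1 a ha).mul (h1' a ha)⟩, ⟨_, fun a ha => (h2 a ha).mul (h2' a ha)⟩,
    R1 * R3' + R3 * R2', fun a ha => (((h1 a ha).mul (h3' a ha)).add
      ((h3 a ha).mul (h2' a ha))).congr (le_of_eq (by ring)) fun x => by ring⟩

theorem smul (c : ℝ) (h : Cl L k S δ f f') :
    Cl L k S δ (fun a x => c * f a x) (fun a x => c * f' a x) := (const c).mul h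

theorem sub (h : Cl L k S δ f f') (h' : Cl L k S δ g g') :
    Cl L k S δ (fun a x => f a x - g a x) (fun a x => f' a x - g' a x) := by
  have := h.add (h'.smul (-1))
  simpa only [neg_one_mul, ← sub_eq_add_neg] using this

theorem sum {n : ℕ} {F F' : Fin n → α → Pt d → ℝ} (h : ∀ i, Cl L k S δ (F i) (F' i)) :
    Cl L k S δ (fun a x => ∑ i, F i a x) (fun a x => ∑ i, F' i a x) := by
  have : ∀ s : Finset (Fin n), Cl L k S δ (fun a x => ∑ i ∈ s, F i a x)
      (fun a x => ∑ i ∈ s, F' i a x) := fun s => by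
    induction s using Finset.induction_on with
    | empty => simpa using const (S := S) (δ := δ) 0
    | insert i s hi ih => simpa only [Finset.sum_insert hi] using (h i).add ih
  exact this _

end Cl

variable {X X' D D' : α → Pt d → Mat d} {v v' w w' : α → Pt d → ℝ}

theorem Cl.mten (P : Params) (hX : ∀ i j, Cl L k S δ (fun a x => X a x i j) (fun a x => X' a x i j))
    (i j : Fin d) :
    Cl L k S δ (fun a x => Mten P (X a x) i j) (fun a x => Mten P (X' a x) i j) := by
  simp only [Mten, Matrix.add_apply, Matrix.smul_apply, smul_eq_mul]
  exact ((hX i j).smul _).add (const _)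

theorem Cl.hVar (P : Params) (hX : ∀ i j, Cl L k S δ (fun a x => X a x i j) (fun a x => X' a x i j))
    (hv : Cl L k S δ v v') (hD : ∀ i j, Cl L k S δ (fun a x => D a x i j) (fun a x => D' a x i j))
    (i j : Fin d) :
    Cl L k S δ (fun a x => HVar P (X a x) (v a x) (D a x) i j)
      (fun a x => HVar P (X' a x) (v' a x) (D' a x) i j) := by
  simp only [HVar, Matrix.add_apply, Matrix.sub_apply, Matrix.smul_apply, Matrix.mul_apply,
    Matrix.trace, Matrix.diag_apply, smul_eq_mul, div_eq_mul_inv, sq]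
  repeat' first
    | exact hX _ _ | exact hD _ _ | exact hv | apply Cl.const | apply Cl.sub | apply Cl.add
    | apply Cl.mul | (apply Cl.sum; intro _)

theorem Cl.muVar (P : Params)
    (hX : ∀ i j, Cl L k S δ (fun a x => X a x i j) (fun a x => X' a x i j))
    (hv : Cl L k S δ v v') (hD : ∀ i j, Cl L k S δ (fun a x => D a x i j) (fun a x => D' a x i j))
    (hw : Cl L k S δ w w') :
    Cl L k S δ (fun a x => SmA.muVar P (X a x) (v a x) (D a x) (w a x))
      (fun a x => SmA.muVar P (X' a x) (v' a x) (D' a x) (w' a x)) := by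
  have hM := Cl.mten P hX
  simp only [SmA.muVar, frob, sq, pow_three]
  repeat' first
    | exact hM _ _ | exact hD _ _ | exact hv | exact hw | apply Cl.const | apply Cl.sub
    | apply Cl.add | apply Cl.mul | (apply Cl.sum; intro _)

theorem Cl.e1Density (P : Params)
    (hX : ∀ i j, Cl L k S δ (fun a x => X a x i j) (fun a x => X' a x i j))
    (hv : Cl L k S δ v v') (hD : ∀ i j, Cl L k S δ (fun a x => D a x i j) (fun a x => D' a x i j)) :
    Cl L k S δ (fun a x => SmA.e1Density P (X a x) (v a x) (D a x))
      (fun a x => SmA.e1Density P (X' a x) (v' a x) (D' a x)) := by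
  have hM := Cl.mten P hX
  simp only [SmA.e1Density, frob, fbn, fs, Matrix.smul_apply, Matrix.trace, Matrix.diag_apply,
    Matrix.mul_apply, smul_eq_mul, pow_succ, pow_zero]
  repeat' first
    | exact hM _ _ | exact hX _ _ | exact hD _ _ | exact hv | apply Cl.const | apply Cl.sub
    | apply Cl.add | apply Cl.mul | (apply Cl.sum; intro _)

end Families

section FamilyOps

variable {d : ℕ} {L : ℝ} {j k : ℕ} {α : Type} {S : Set α} {δ : α → ℝ}
  {f f' g g' : α → Pt d → ℝ} {h : α → ℝ}

namespace Cl

theorem mono (hf : Cl L k S δ f f') (hjk : j ≤ k) : Cl L j S δ f f' := by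
  obtain ⟨⟨R1, h1⟩, ⟨R2, h2⟩, R3, h3⟩ := hf
  exact ⟨⟨R1, fun a ha => (h1 a ha).mono hjk le_rfl⟩, ⟨R2, fun a ha => (h2 a ha).mono hjk le_rfl⟩,
    R3, fun a ha => (h3 a ha).mono hjk le_rfl⟩

theorem trans (hf : Cl L k S δ f f') (hg : Cl L k S δ f' g) : Cl L k S δ f g := by
  obtain ⟨h1, -, R3, h3⟩ := hf
  obtain ⟨-, h2, R3', h3'⟩ := hg
  exact ⟨h1, h2, R3 + R3', fun a ha => ((h3 a ha).add (h3' a ha)).congr (by rw [add_mul])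
    fun x => by ring⟩

theorem pd (hL : 0 < L) (hf : Cl L (k + 1) S δ f f') (l : Fin d) :
    Cl L k S δ (fun a => SmA.pd l (f a)) (fun a => SmA.pd l (f' a)) := by
  obtain ⟨⟨R1, h1⟩, ⟨R2, h2⟩, R3, h3⟩ := hf
  refine ⟨⟨_, fun a ha => (h1 a ha).pd hL l⟩, ⟨_, fun a ha => (h2 a ha).pd hL l⟩,
    2 * π / L * R3, fun a ha => ((h3 a ha).pd hL l).congr (by rw [mul_assoc]) fun x => ?_⟩
  have e := fderiv_fun_sub (((h1 a ha).mono (by omega) le_rfl).differentiable hL x)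
    (((h2 a ha).mono (by omega) le_rfl).differentiable hL x)
  rw [SmA.pd, e, sub_apply, SmA.pd, SmA.pd]

theorem cd (hL : 0 < L) (hh : ∀ a ∈ S, 0 < h a) (hf : Cl L (k + 1) S δ f f') (l : Fin d) :
    Cl L k S δ (fun a => SmA.cd (h a) l (f a)) (fun a => SmA.cd (h a) l (f' a)) := by
  obtain ⟨⟨R1, h1⟩, ⟨R2, h2⟩, R3, h3⟩ := hf
  exact ⟨⟨_, fun a ha => (h1 a ha).cd hL (hh a ha) l⟩, ⟨_, fun a ha => (h2 a ha).cd hL (hh a ha) l⟩,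
    2 * π / L * R3, fun a ha => ((h3 a ha).cd hL (hh a ha) l).congr (by rw [mul_assoc])
      fun x => by simp only [SmA.cd]; ring⟩

theorem sd (hL : 0 < L) (hh : ∀ a ∈ S, 0 < h a) (hf : Cl L (k + 2) S δ f f') (l : Fin d) :
    Cl L k S δ (fun a => SmA.sd (h a) l (f a)) (fun a => SmA.sd (h a) l (f' a)) := by
  obtain ⟨⟨R1, h1⟩, ⟨R2, h2⟩, R3, h3⟩ := hf
  exact ⟨⟨_, fun a ha => (h1 a ha).sd hL (hh a ha) l⟩, ⟨_, fun a ha => (h2 a ha).sd hL (hh a ha) l⟩,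
    (2 * π / L) ^ 2 * R3, fun a ha => ((h3 a ha).sd hL (hh a ha) l).congr (by rw [mul_assoc])
      fun x => by simp only [SmA.sd]; ring⟩

/-- Consistency of the central difference. -/
theorem cd_pd (hL : 0 < L) (hh : ∀ a ∈ S, 0 < h a) (hf : ∃ R, ∀ a ∈ S, W L (k + 3) R (f a))
    (l : Fin d) :
    Cl L k S (fun a => h a ^ 2) (fun a => SmA.cd (h a) l (f a)) (fun a => SmA.pd l (f a)) := by
  obtain ⟨R, hR⟩ := hf
  have h1 := fun a ha => (hR a ha).mono (Nat.le_succ_of_le (Nat.le_succ (k + 1))) le_rfl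
  exact ⟨⟨_, fun a ha => (h1 a ha).cd hL (hh a ha) l⟩, ⟨_, fun a ha => (h1 a ha).pd hL l⟩,
    2 * (2 * π / L) ^ 3 * R, fun a ha => ((hR a ha).cd_sub hL (hh a ha) l).congr
      (le_of_eq (by ring)) fun _ => rfl⟩

/-- Consistency of the second difference. -/
theorem sd_pd (hL : 0 < L) (hh : ∀ a ∈ S, 0 < h a) (hf : ∃ R, ∀ a ∈ S, W L (k + 4) R (f a))
    (l : Fin d) : Cl L k S (fun a => h a ^ 2) (fun a => SmA.sd (h a) l (f a))
      (fun a => SmA.pd l (SmA.pd l (f a))) := by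
  obtain ⟨R, hR⟩ := hf
  have h1 := fun a ha => (hR a ha).mono (Nat.le_succ_of_le (Nat.le_succ (k + 2))) le_rfl
  exact ⟨⟨_, fun a ha => (h1 a ha).sd hL (hh a ha) l⟩,
    ⟨_, fun a ha => ((h1 a ha).pd (k := k + 1) hL l).pd hL l⟩,
    (2 * π / L) ^ 4 * R, fun a ha => ((hR a ha).sd_sub hL (hh a ha) l).congr
      (le_of_eq (by ring)) fun _ => rfl⟩

/-- Consistency of mixed central differences. -/
theorem cd_cd_pd_pd (hL : 0 < L) (hh : ∀ a ∈ S, 0 < h a) (hf : ∃ R, ∀ a ∈ S, W L (k + 4) R (f a))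
    (l l' : Fin d) : Cl L k S (fun a => h a ^ 2) (fun a => SmA.cd (h a) l (SmA.cd (h a) l' (f a)))
      (fun a => SmA.pd l (SmA.pd l' (f a))) := by
  have h1 := (cd_pd (k := k + 1) hL hh hf l').cd hL hh l
  have h2 : ∃ R, ∀ a ∈ S, W L (k + 3) R (SmA.pd l' (f a)) := by
    obtain ⟨R, hR⟩ := hf; exact ⟨_, fun a ha => (hR a ha).pd (k := k + 3) hL l'⟩
  exact h1.trans (cd_pd hL hh h2 l)

end Cl

end FamilyOps

/-! ### Time dependence of the coefficients -/

section Time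

variable {d : ℕ} {L T R : ℝ} {n k : ℕ} {w wt : ℝ → Pt d → ℝ}

theorem TimeSobolev.integrable (hw : TimeSobolev L T n w wt) :
    Integrable (Function.uncurry wt) ((volume.restrict (Ioc 0 T)).prod (ℳ L)) := by
  obtain ⟨R, hR⟩ := hw.bound_deriv
  rw [integrable_prod_iff hw.meas]
  have hb : ∀ f : Pt d → ℝ, SobolevBound L R n f → ∫ x, ‖f x‖ ∂(ℳ L)
      ≤ (cellMeasure d L).real univ + R ^ 2 := fun f hf => by
    have h1 := hf.memLp.1
    have h2 := integral_mono (h1.integrable one_le_two).norm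
      ((integrable_const (1 : ℝ)).add h1.integrable_sq) (fun x => by
        simp only [Pi.add_apply, norm_eq_abs]
        nlinarith [sq_abs (f x), sq_nonneg (|f x| - 1)])
    refine h2.trans ?_; simp only [Pi.add_apply]
    rw [integral_add (integrable_const _) h1.integrable_sq, integral_const, smul_eq_mul, mul_one]
    exact add_le_add le_rfl hf.integral_sq_le
  refine ⟨hR.mono fun t ht => ht.memLp.1.integrable one_le_two, ?_⟩
  refine Integrable.of_bound hw.meas.norm.integral_prod_right'
    ((cellMeasure d L).real univ + R ^ 2) (hR.mono fun t ht => ?_)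
  rw [norm_of_nonneg (integral_nonneg fun x => norm_nonneg _)]
  exact hb _ ht

theorem TimeSobolev.integrable_cf (hw : TimeSobolev L T n w wt) (m : Fin d → ℤ) (θ : ℝ) :
    Integrable (fun z : ℝ × Pt d => wt z.1 z.2 * cos (lin L m z.2 + θ))
      ((volume.restrict (Ioc 0 T)).prod (ℳ L)) :=
  hw.integrable.mul_bdd (c := 1) ((contDiff_wave L m θ).continuous.comp
    continuous_snd).aestronglyMeasurable (Filter.Eventually.of_forall fun _ => abs_cos_le_one _)

theorem TimeSobolev.cont_integrable (hw : TimeSobolev L T n w wt) {t : ℝ} (ht : t ∈ Icc 0 T) :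
    Integrable (w t) (ℳ L) :=
  (hw.cont t ht).continuousOn.integrableOn_compact isCompact_Icc

theorem TimeSobolev.cf_eq (hw : TimeSobolev L T n w wt) {t : ℝ} (ht : t ∈ Icc 0 T)
    (m : Fin d → ℤ) (θ : ℝ) :
    cf L (w t) m θ = cf L (w 0) m θ + ∫ r in (0 : ℝ)..t, cf L (wt r) m θ := by
  have hle : (volume.restrict (Ioc 0 t)).prod (cellMeasure d L)
      ≤ (volume.restrict (Ioc 0 T)).prod (cellMeasure d L) :=
    Measure.prod_mono (Measure.restrict_mono (Ioc_subset_Ioc_right ht.2) le_rfl) le_rfl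
  have h1 := hw.integrable.mono_measure hle
  have h2 := (hw.integrable_cf m θ).mono_measure hle
  have h0 : (0 : ℝ) ∈ Icc 0 T := ⟨le_rfl, ht.1.trans ht.2⟩
  rw [cf_congr (hw.integral_deriv t ht), cf_add (hw.cont_integrable h0)]
  · congr 1
    simp only [cf, intervalIntegral.integral_of_le ht.1, ← integral_mul_const]
    exact (integral_integral_swap h2).symm
  · simp only [intervalIntegral.integral_of_le ht.1]
    exact h1.integral_prod_right

theorem TimeSobolev.cf_sub_eq (hw : TimeSobolev L T n w wt) {t r : ℝ} (ht : t ∈ Icc 0 T)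
    (hr : r ∈ Icc 0 T) (m : Fin d → ℤ) (θ : ℝ) :
    IntervalIntegrable (fun ρ => cf L (wt ρ) m θ) volume r t ∧
    cf L (fun x => w t x - w r x) m θ = ∫ ρ in r..t, cf L (wt ρ) m θ := by
  have hi : IntervalIntegrable (fun ρ => cf L (wt ρ) m θ) volume 0 T :=
    (intervalIntegrable_iff_integrableOn_Ioc_of_le (ht.1.trans ht.2)).mpr
      (hw.integrable_cf m θ).integral_prod_left
  have hi' : ∀ t ∈ Icc 0 T, IntervalIntegrable (fun ρ => cf L (wt ρ) m θ) volume 0 t :=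
    fun t ht => hi.mono_set (by
      rw [uIcc_of_le ht.1, uIcc_of_le (ht.1.trans ht.2)]; exact Icc_subset_Icc_right ht.2)
  refine ⟨(hi' r hr).symm.trans (hi' t ht), ?_⟩
  rw [cf_sub (hw.cont_integrable ht) (hw.cont_integrable hr), hw.cf_eq ht, hw.cf_eq hr,
    ← intervalIntegral.integral_interval_sub_left (hi' t ht) (hi' r hr)]
  ring

theorem TimeSobolev.sb_increment (hw : TimeSobolev L T n w wt) {t r : ℝ} (ht : t ∈ Icc 0 T)
    (hr : r ∈ Icc 0 T) {g : Pt d → ℝ} (hg : Integrable g (ℳ L)) {C : ℝ}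
    (h : ∀ᵐ ρ ∂(volume.restrict (Ioc 0 T)), ρ ∈ uIoc r t → SB L k C (fun x => wt ρ x - g x)) :
    SB L k (C * |t - r|) (fun x => w t x - w r x - (t - r) * g x) := by
  obtain ⟨R, hR⟩ := hw.bound_deriv
  intro F θ
  have hZ : ∀ m, cf L (fun x => w t x - w r x - (t - r) * g x) m (θ m)
      = ∫ ρ in r..t, (cf L (wt ρ) m (θ m) - cf L g m (θ m)) := fun m => by
    rw [cf_sub (f := fun x => w t x - w r x) ((hw.cont_integrable ht).sub (hw.cont_integrable hr))
      (hg.const_mul _), cf_smul,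
      (hw.cf_sub_eq ht hr m (θ m)).2, intervalIntegral.integral_sub (hw.cf_sub_eq ht hr m (θ m)).1
      intervalIntegrable_const, intervalIntegral.integral_const, smul_eq_mul]
  have hi : ∀ m, IntervalIntegrable (fun ρ => cf L (wt ρ) m (θ m) - cf L g m (θ m)) volume r t :=
    fun m => (hw.cf_sub_eq ht hr m (θ m)).1.sub intervalIntegrable_const
  obtain ⟨Z, hZe⟩ : ∃ Z : (Fin d → ℤ) → ℝ, Z = fun m =>
    cf L (fun x => w t x - w r x - (t - r) * g x) m (θ m) := ⟨_, rfl⟩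
  obtain ⟨ε, hε⟩ : ∃ ε : (Fin d → ℤ) → ℝ, ∀ m, |ε m| = 1 ∧ |Z m| = ε m * Z m := by
    refine ⟨fun m => if 0 ≤ Z m then 1 else -1, fun m => ?_⟩; dsimp only
    split_ifs with h
    · exact ⟨by simp, by rw [abs_of_nonneg h, one_mul]⟩
    · exact ⟨by simp, by rw [abs_of_neg (not_le.mp h), neg_one_mul]⟩
  have e : ∑ m ∈ F, wgt m ^ k * |Z m|
      = ∫ ρ in r..t, ∑ m ∈ F, wgt m ^ k * ε m * (cf L (wt ρ) m (θ m) - cf L g m (θ m)) := by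
    rw [intervalIntegral.integral_finsetSum fun m _ => (hi m).const_mul _]
    refine sum_congr rfl fun m _ => ?_
    rw [(hε m).2, intervalIntegral.integral_const_mul, ← hZ m, mul_assoc, hZe]
  rw [hZe] at e
  rw [e]
  refine (Real.le_norm_self _).trans (intervalIntegral.norm_integral_le_of_norm_le_const_ae ?_)
  rw [ae_restrict_iff' measurableSet_Ioc] at hR h
  filter_upwards [hR, h] with ρ hρ hρ' hm
  have hm' : ρ ∈ Ioc 0 T := ⟨(le_min hr.1 ht.1).trans_lt hm.1, hm.2.trans (max_le hr.2 ht.2)⟩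
  refine (abs_sum_le_sum_abs _ _).trans (le_trans ?_ (hρ' hm' hm F θ))
  refine sum_le_sum fun m _ => ?_
  rw [abs_mul, abs_mul, (hε m).1, mul_one, abs_of_nonneg (pow_nonneg (wgt_pos m).le k),
    cf_sub ((hρ hm').memLp.1.integrable one_le_two) hg]

theorem TimeSobolev.sb_lip (hL : 0 < L) (hd : d ≤ 3) (hw : TimeSobolev L T 4 w wt) :
    ∃ C, 0 ≤ C ∧ ∀ t ∈ Icc 0 T, ∀ r ∈ Icc 0 T, SB L 2 (C * |t - r|) (fun x => w t x - w r x) := by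
  obtain ⟨C, hC, hS⟩ := SobolevBound.sb (d := d) hL hd
  obtain ⟨R, hR⟩ := hw.bound_deriv
  refine ⟨C * |R|, by positivity, fun t ht r hr => ?_⟩
  have := hw.sb_increment (k := 2) (C := C * |R|) ht hr (integrable_zero _ _ _)
    (hR.mono fun ρ hρ _ => by simpa using hS hρ)
  simpa using this

theorem TimeSobolev.sb_bound (hL : 0 < L) (hd : d ≤ 3) (hw : TimeSobolev L T 4 w wt) :
    ∃ C, ∀ t ∈ Icc 0 T, SB L 2 C (w t) := by
  obtain ⟨C, hC, hS⟩ := SobolevBound.sb (d := d) hL hd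
  obtain ⟨R, hR⟩ := hw.bound
  exact ⟨C * |R|, fun t ht => hS (hR t ht)⟩

theorem TimeSobolev.sb_of_ae (hL : 0 < L) (hd : d ≤ 3) (hT : 0 < T) (hw : TimeSobolev L T 4 w wt)
    (h : ∀ᵐ t ∂(volume.restrict (Ioc 0 T)), SB L k R (w t)) : ∀ t ∈ Icc 0 T, SB L k R (w t) := by
  obtain ⟨C, hC, hS⟩ := hw.sb_lip hL hd
  intro t ht F θ
  have hc : ∀ m, ContinuousOn (fun r => cf L (w r) m (θ m)) (Icc 0 T) := fun m => by
    refine LipschitzOnWith.continuousOn (K := C.toNNReal) (LipschitzOnWith.of_dist_le_mul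
      fun r hr ρ hρ => ?_)
    have h1 := hS r hr ρ hρ {m} θ
    rw [Finset.sum_singleton, cf_sub (hw.cont_integrable hr) (hw.cont_integrable hρ)] at h1
    rw [Real.coe_toNNReal C hC, Real.dist_eq, Real.dist_eq]
    exact (le_mul_of_one_le_left (abs_nonneg _) (one_le_pow₀ (one_le_wgt m))).trans h1
  have hc' : ContinuousOn (fun r => ∑ m ∈ F, wgt m ^ k * |cf L (w r) m (θ m)|) (Icc 0 T) :=
    continuousOn_finsetSum _ fun m _ => continuousOn_const.mul (hc m).abs
  rw [ae_restrict_iff' measurableSet_Ioc] at h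
  have hD := Measure.dense_of_ae h
  have hcl : t ∈ closure (Ioo 0 T ∩ {r | r ∈ Ioc 0 T → SB L k R (w r)}) := by
    rw [← closure_Ioo hT.ne] at ht
    exact closure_minimal (Dense.open_subset_closure_inter hD isOpen_Ioo) isClosed_closure ht
  exact ContinuousWithinAt.closure_le hcl
    ((hc' t ht).mono fun r hr => Ioo_subset_Icc_self hr.1) continuousWithinAt_const
    fun r hr => hr.2 (Ioo_subset_Ioc_self hr.1) F θ

end Time

/-! ### Classical form of the equations and regularity of the exact solution -/

section Classical

variable {d : ℕ} {L R R' : ℝ} {j k : ℕ}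

/-- Classical Hessian. -/
def hessC (u : Pt d → ℝ) (x : Pt d) : Mat d := Matrix.of fun k l => pd k (pd l u) x

/-- Classical double divergence. -/
def ddC (F : Pt d → Mat d) (x : Pt d) : ℝ := ∑ k, ∑ l, pd k (pd l fun y => F y k l) x

/-- Classical Laplacian. -/
def lapC (f : Pt d → ℝ) (x : Pt d) : ℝ := ∑ k, pd k (pd k f) x

/-- `H` with classical derivatives. -/
def HC (P : Params) (Q : Pt d → Mat d) (u : Pt d → ℝ) (x : Pt d) : Mat d :=
  HVar P (Q x) (u x) (hessC u x)

/-- `μ` with classical derivatives. -/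
def muC (P : Params) (Q : Pt d → Mat d) (u : Pt d → ℝ) (x : Pt d) : ℝ :=
  muVar P (Q x) (u x) (hessC u x) (ddC (fun y => u y • Mten P (Q y)) x)

section ClFields

variable {α : Type} {S : Set α} {δ : α → ℝ} {f f' : α → Pt d → ℝ} {X X' : α → Pt d → Mat d}
  {v v' : α → Pt d → ℝ}

theorem Cl.lapC (hL : 0 < L) (hf : Cl L (k + 2) S δ f f') :
    Cl L k S δ (fun a => SmA.lapC (f a)) (fun a => SmA.lapC (f' a)) :=
  Cl.sum fun l => (hf.pd (k := k + 1) hL l).pd hL l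

theorem Cl.uMten (P : Params) (hX : ∀ i j, Cl L k S δ (fun a x => X a x i j) fun a x => X' a x i j)
    (hv : Cl L k S δ v v') (i j : Fin d) : Cl L k S δ (fun a x => (v a x • Mten P (X a x)) i j)
      (fun a x => (v' a x • Mten P (X' a x)) i j) := by
  simp only [Matrix.smul_apply, smul_eq_mul]
  exact hv.mul (Cl.mten P hX i j)

theorem Cl.hC (P : Params) (hL : 0 < L)
    (hX : ∀ i j, Cl L k S δ (fun a x => X a x i j) fun a x => X' a x i j)
    (hv : Cl L (k + 2) S δ v v') (i j : Fin d) :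
    Cl L k S δ (fun a x => HC P (X a) (v a) x i j) (fun a x => HC P (X' a) (v' a) x i j) :=
  Cl.hVar P hX (hv.mono (by omega)) (fun k' l => (hv.pd (k := k + 1) hL l).pd hL k') i j

theorem Cl.muC (P : Params) (hL : 0 < L)
    (hX : ∀ i j, Cl L (k + 2) S δ (fun a x => X a x i j) fun a x => X' a x i j)
    (hv : Cl L (k + 2) S δ v v') :
    Cl L k S δ (fun a x => SmA.muC P (X a) (v a) x) (fun a x => SmA.muC P (X' a) (v' a) x) :=
  Cl.muVar P (fun i j => (hX i j).mono (by omega)) (hv.mono (by omega))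
    (fun k' l => (hv.pd (k := k + 1) hL l).pd hL k')
    (Cl.sum fun k' => Cl.sum fun l => ((Cl.uMten P hX hv k' l).pd (k := k + 1) hL l).pd hL k')

end ClFields

variable {f g u : Pt d → ℝ} {Q : Pt d → Mat d}

theorem wd_wd_ae (hL : 0 < L) (h : W L 2 R f) (k l : Fin d) :
    wd L k (wd L l f) =ᵐ[ℳ L] pd k (pd l f) :=
  wd_ae_eq_pd hL (h.pd (k := 1) hL l) (wd_ae_eq_pd hL (h.mono one_le_two le_rfl)
    (Filter.EventuallyEq.refl _ _) l) k

theorem hess_ae (hL : 0 < L) (h : W L 2 R u) :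
    ∀ᵐ x ∂(ℳ L), hess L u x = hessC u x := by
  have : ∀ᵐ x ∂(ℳ L), ∀ k l, wd L k (wd L l u) x = pd k (pd l u) x :=
    ae_all_iff.mpr fun k => ae_all_iff.mpr fun l => wd_wd_ae hL h k l
  filter_upwards [this] with x hx
  ext k l
  exact hx k l

theorem lap_ae (hL : 0 < L) (h : W L 2 R f) : lap L f =ᵐ[ℳ L] lapC f := by
  have : ∀ᵐ x ∂(ℳ L), ∀ k, wd L k (wd L k f) x = pd k (pd k f) x :=
    ae_all_iff.mpr fun k => wd_wd_ae hL h k k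
  filter_upwards [this] with x hx
  exact sum_congr rfl fun k _ => hx k

theorem biLap_ae (hL : 0 < L) (h : W L 4 R f) :
    biLap L f =ᵐ[ℳ L] lapC (lapC f) := by
  have h1 : ∀ k l, wd L k (wd L k (wd L l (wd L l f))) =ᵐ[ℳ L]
      pd k (pd k (pd l (pd l f))) := fun k l => by
    have h2 := (h.pd (k := 3) hL l).pd (k := 2) hL l
    exact wd_ae_eq_pd hL (h2.pd (k := 1) hL k) (wd_ae_eq_pd hL (h2.mono one_le_two le_rfl)
      (wd_wd_ae hL (h.mono (by norm_num) le_rfl) l l) k) k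
  have h3 : ∀ᵐ x ∂(ℳ L), ∀ k l, wd L k (wd L k (wd L l (wd L l f))) x
      = pd k (pd k (pd l (pd l f))) x :=
    ae_all_iff.mpr fun k => ae_all_iff.mpr fun l => h1 k l
  filter_upwards [h3] with x hx
  refine sum_congr rfl fun k _ => ?_
  have hs : ∀ F : Fin d → Pt d → ℝ, (∀ l, ∃ R, W L 1 R (F l)) → SmA.pd k (fun y => ∑ l, F l y)
      = fun y => ∑ l, SmA.pd k (F l) y := fun F hF => by
    funext y; simp only [SmA.pd]
    rw [fderiv_fun_sum fun l _ => by
      obtain ⟨R, hR⟩ := hF l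
      exact hR.differentiable hL y, sum_apply]
  have e : lapC f = fun y => ∑ l, pd l (pd l f) y := rfl
  have h2 := fun l => (h.pd (k := 3) hL l).pd (k := 2) hL l
  rw [e, hs _ fun l => ⟨_, (h2 l).mono one_le_two le_rfl⟩,
    hs _ fun l => ⟨_, (h2 l).pd (k := 1) hL k⟩]
  exact sum_congr rfl fun l _ => hx k l

theorem HField_ae (P : Params) (hL : 0 < L) (hu : W L 2 R u) :
    ∀ᵐ x ∂(ℳ L), HField P L Q u x = HC P Q u x := by
  filter_upwards [hess_ae hL hu] with x hx
  rw [HField, HC, hx]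

theorem muField_ae (P : Params) (hL : 0 < L) (hu : W L 2 R u)
    (hQ : ∀ i j, W L 2 R' fun x => Q x i j) :
    ∀ᵐ x ∂(ℳ L), muField P L Q u x = muC P Q u x := by
  have hM : ∀ i j, ∃ r, W L 2 r fun y => (u y • Mten P (Q y)) i j := fun i j => by
    obtain ⟨⟨r, hr⟩, -⟩ := Cl.uMten (S := (univ : Set Unit)) (δ := fun _ => 0)
      (X := fun _ => Q) (X' := fun _ => Q) (v := fun _ => u) (v' := fun _ => u) P
      (fun i j => Cl.refl ⟨R', fun _ _ => hQ i j⟩) (Cl.refl ⟨R, fun _ _ => hu⟩) i j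
    exact ⟨r, hr () trivial⟩
  have h1 : ∀ᵐ x ∂(ℳ L), ∀ k l, wd L k (wd L l fun y => (u y • Mten P (Q y)) k l) x
      = pd k (pd l fun y => (u y • Mten P (Q y)) k l) x :=
    ae_all_iff.mpr fun k => ae_all_iff.mpr fun l => by
      obtain ⟨r, hr⟩ := hM k l; exact wd_wd_ae hL hr k l
  filter_upwards [hess_ae hL hu, h1] with x hx hx'
  rw [muField, muC, hx]
  congr 1
  exact sum_congr rfl fun k _ => sum_congr rfl fun l _ => hx' k l

/-! Elliptic regularity on the level of coefficients. -/

theorem W.integrable (h : W L k R f) : Integrable f (ℳ L) :=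
  h.continuous.continuousOn.integrableOn_compact isCompact_Icc

theorem SB.mono (h : SB L k R f) (hjk : j ≤ k) (hR : R ≤ R') : SB L j R' f := fun F θ =>
  (sum_le_sum fun m _ => mul_le_right
    (pow_le_pow_right₀ (one_le_wgt m) hjk) (abs_nonneg _)).trans ((h F θ).trans hR)

theorem SB.gain {σ : (Fin d → ℤ) → ℝ} {c : ℝ} (hc : 0 ≤ c)
    (hσ : ∀ m, wgt m ^ j ≤ c * (1 + |σ m|)) {f g₁ g₂ : Pt d → ℝ}
    (he : ∀ m θ, |σ m * cf L f m θ| ≤ |cf L g₁ m θ| + |cf L g₂ m θ|) {R₀ R₁ R₂ : ℝ}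
    (hf : SB L k R₀ f) (h₁ : SB L k R₁ g₁) (h₂ : SB L k R₂ g₂) :
    SB L (k + j) (c * (R₀ + (R₁ + R₂))) f := fun F θ => by
  have h : ∀ m ∈ F, wgt m ^ (k + j) * |cf L f m (θ m)| ≤ c * (wgt m ^ k * |cf L f m (θ m)|
      + (wgt m ^ k * |cf L g₁ m (θ m)| + wgt m ^ k * |cf L g₂ m (θ m)|)) := fun m _ => by
    have hw := pow_nonneg (wgt_pos m).le k
    calc wgt m ^ (k + j) * |cf L f m (θ m)| = wgt m ^ j * (wgt m ^ k * |cf L f m (θ m)|) := by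
          rw [pow_add]; ring
      _ ≤ c * (1 + |σ m|) * (wgt m ^ k * |cf L f m (θ m)|) :=
          mul_le_right (hσ m) (by positivity)
      _ = c * (wgt m ^ k * |cf L f m (θ m)| + wgt m ^ k * |σ m * cf L f m (θ m)|) := by
          rw [abs_mul]; ring
      _ ≤ _ := by
          rw [← mul_add (wgt m ^ k) |cf L g₁ m (θ m)|]
          exact mul_le_left (add_le_add le_rfl
            (mul_le_left (he m _) hw)) hc
  refine (sum_le_sum h).trans ?_
  rw [← mul_sum, sum_add_distrib, sum_add_distrib]
  exact mul_le_left (add_le_add (hf F θ) (add_le_add (h₁ F θ) (h₂ F θ))) hc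

theorem SB.interp (hf : SB L 2 R f) (hf' : SB L 6 R' f) {ε : ℝ} (hε : 0 < ε) :
    SB L 4 (ε * R' + ε⁻¹ * R) f := fun F θ => by
  have h : ∀ m ∈ F, wgt m ^ 4 * |cf L f m (θ m)| ≤ ε * (wgt m ^ 6 * |cf L f m (θ m)|)
      + ε⁻¹ * (wgt m ^ 2 * |cf L f m (θ m)|) := fun m _ => by
    have h1 : wgt m ^ 4 ≤ ε * wgt m ^ 6 + ε⁻¹ * wgt m ^ 2 := by
      have e : ε * wgt m ^ 6 + ε⁻¹ * wgt m ^ 2 - wgt m ^ 4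
          = ε⁻¹ * wgt m ^ 2 * ((ε * wgt m ^ 2 - 2⁻¹) ^ 2 + 3 / 4) := by
        field_simp; ring
      have : 0 ≤ ε⁻¹ * wgt m ^ 2 * ((ε * wgt m ^ 2 - 2⁻¹) ^ 2 + 3 / 4) := by positivity
      linarith
    have := mul_le_right h1 (abs_nonneg (cf L f m (θ m))); linarith
  refine (sum_le_sum h).trans ?_
  rw [sum_add_distrib, ← mul_sum, ← mul_sum]
  exact add_le_add (mul_le_left (hf' F θ) hε.le)
    (mul_le_left (hf F θ) (inv_pos.mpr hε).le)

theorem cf_sum {ι : Type*} (s : Finset ι) {F : ι → Pt d → ℝ}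
    (hF : ∀ i, Integrable (F i) (ℳ L)) (m : Fin d → ℤ) (θ : ℝ) :
    cf L (fun x => ∑ i ∈ s, F i x) m θ = ∑ i ∈ s, cf L (F i) m θ := by
  simp only [cf, sum_mul]
  exact integral_finsetSum _ fun i _ => (hF i).mul_wave L m θ

/-- The symbol of `-Δ`. -/
def lsym (L : ℝ) (m : Fin d → ℤ) : ℝ := ∑ k, (2 * π / L * m k) ^ 2

theorem SobolevBound.cf_lap (hL : 0 < L) {n : ℕ} (h : SobolevBound L R (n + 2) f)
    (m : Fin d → ℤ) (θ : ℝ) : cf L (lap L f) m θ = -(lsym L m * cf L f m θ) := by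
  have hi : ∀ k, Integrable (SmA.wd L k (SmA.wd L k f)) (ℳ L) := fun k =>
    ((h.wd hL k).2.wd hL k).2.memLp.1.integrable one_le_two
  have := cf_sum Finset.univ hi m θ
  simp only [h.cf_wd_wd hL] at this
  rw [sum_neg_distrib, ← sum_mul] at this
  exact this

theorem SobolevBound.cf_biLap (hL : 0 < L) (h : SobolevBound L R 4 f)
    (m : Fin d → ℤ) (θ : ℝ) : cf L (biLap L f) m θ = lsym L m ^ 2 * cf L f m θ := by
  have h2 : ∀ l, SobolevBound L R 2 (SmA.wd L l (SmA.wd L l f)) := fun l =>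
    ((h.wd hL l).2.wd hL l).2
  have hi : ∀ l k, Integrable (SmA.wd L k (SmA.wd L k (SmA.wd L l (SmA.wd L l f))))
      (ℳ L) := fun l k =>
    (((h2 l).wd hL k).2.wd hL k).2.memLp.1.integrable one_le_two
  have h3 := cf_sum Finset.univ (F := fun k x => ∑ l, SmA.wd L k (SmA.wd L k
    (SmA.wd L l (SmA.wd L l f))) x) (fun k => integrable_finsetSum _ fun l _ => hi l k) m θ
  have h4 : ∀ k, cf L (fun x => ∑ l, SmA.wd L k (SmA.wd L k (SmA.wd L l (SmA.wd L l f))) x) m θ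
      = (2 * π / L * m k) ^ 2 * (lsym L m * cf L f m θ) := fun k => by
    rw [cf_sum Finset.univ (fun l => hi l k)]
    have : ∀ l, cf L (SmA.wd L k (SmA.wd L k (SmA.wd L l (SmA.wd L l f)))) m θ
        = (2 * π / L * m k) ^ 2 * ((2 * π / L * m l) ^ 2 * cf L f m θ) := fun l => by
      rw [(h2 l).cf_wd_wd (n := 0) hL, h.cf_wd_wd (n := 2) hL]; ring
    simp only [this, ← mul_sum, ← sum_mul, lsym]
  simp only [h4, ← sum_mul] at h3
  rw [sq, mul_assoc]
  exact h3

theorem wgt_sq_le_lsym (hL : 0 < L) {a : ℝ} (ha : 0 < a) :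
    ∃ c, 0 ≤ c ∧ ∀ m : Fin d → ℤ, wgt m ^ 2 ≤ c * (1 + |a * lsym L m|) := by
  have hκ : 0 < 2 * π / L := by positivity
  obtain ⟨κ, hκe⟩ : ∃ κ, κ = 2 * π / L := ⟨_, rfl⟩
  rw [← hκe] at hκ
  refine ⟨(d + 1) * (1 + (a * κ ^ 2)⁻¹), by positivity, fun m => ?_⟩
  have h := wgt_pow_le m 1
  simp only [sq_abs, pow_one, Nat.reduceAdd] at h
  have hs : lsym L m = κ ^ 2 * ∑ k, (m k : ℝ) ^ 2 := by
    simp only [lsym, ← hκe, mul_pow, mul_sum]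
  have hy : 0 ≤ ∑ k, (m k : ℝ) ^ 2 := sum_nonneg fun _ _ => sq_nonneg _
  rw [hs, abs_of_nonneg (by positivity)]
  refine h.trans ?_
  rw [mul_assoc]
  refine mul_le_left ?_ (by positivity)
  have e : (1 + (a * κ ^ 2)⁻¹) * (1 + a * (κ ^ 2 * ∑ k, (m k : ℝ) ^ 2))
      = 1 + ∑ k, (m k : ℝ) ^ 2 + ((a * κ ^ 2)⁻¹ + a * (κ ^ 2 * ∑ k, (m k : ℝ) ^ 2)) := by
    field_simp; ring
  rw [e]
  exact le_add_of_nonneg_right (by positivity)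

theorem wgt_pow_four_le_lsym (hL : 0 < L) {a : ℝ} (ha : 0 < a) :
    ∃ c, 0 ≤ c ∧ ∀ m : Fin d → ℤ, wgt m ^ 4 ≤ c * (1 + |a * lsym L m ^ 2|) := by
  obtain ⟨c, hc, h⟩ := wgt_sq_le_lsym (d := d) hL (Real.sqrt_pos.mpr ha)
  refine ⟨2 * c ^ 2, by positivity, fun m => ?_⟩
  have h1 := pow_le_pow_left₀ (by have := wgt_pos m; positivity) (h m) 2
  rw [← pow_mul] at h1
  have e : |a * lsym L m ^ 2| = |√a * lsym L m| ^ 2 := by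
    rw [sq_abs, mul_pow, sq_sqrt ha.le, abs_of_nonneg (by positivity)]
  rw [e]
  calc _ ≤ _ := h1
    _ ≤ _ := by
      rw [mul_pow, mul_assoc, mul_left_comm]
      exact mul_le_left (by nlinarith [sq_nonneg (1 - |√a * lsym L m|)])
        (sq_nonneg c)

end Classical

section Regularity

variable {d : ℕ} {L T : ℝ} {k : ℕ} {P : Params} {Q Qt : ℝ → Pt d → Mat d} {u ut : ℝ → Pt d → ℝ}
  {s : ℝ → ℝ}

theorem TimeSobolev.w_of_sb (hL : 0 < L) {w wt : ℝ → Pt d → ℝ} {R : ℝ}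
    (hw : TimeSobolev L T 4 w wt) (h : ∀ t ∈ Icc 0 T, SB L k R (w t)) :
    ∃ R, ∀ t ∈ Icc 0 T, W L k R (w t) :=
  ⟨_, fun t ht => (h t ht).w hL (hw.cont t ht) (hw.per t ht)⟩

theorem TimeSobolev.w_bound (hL : 0 < L) (hd : d ≤ 3) {w wt : ℝ → Pt d → ℝ}
    (hw : TimeSobolev L T 4 w wt) : ∃ R, ∀ t ∈ Icc 0 T, W L 2 R (w t) := by
  obtain ⟨R, hR⟩ := hw.sb_bound hL hd
  exact hw.w_of_sb hL hR

theorem IsExactSolution.gFactor_eq (h : IsExactSolution P L T 4 Q Qt u ut s) {t : ℝ}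
    (ht : t ∈ Icc 0 T) : gFactor P L (Q t) (u t) (s t) = 1 := by
  rw [gFactor, h.s_def t ht, div_self (exp_pos _).ne']

/-- The equations hold with classical spatial derivatives, at almost every time, in the form used
for the bootstrap. -/
theorem IsExactSolution.ae_eqs (hL : 0 < L) (hd : d ≤ 3)
    (h : IsExactSolution P L T 4 Q Qt u ut s) :
    ∀ᵐ t ∂(volume.restrict (Ioc 0 T)), t ∈ Icc 0 T ∧
      (∀ i j, ∀ᵐ x ∂(ℳ L), P.K * lap L (fun y => Q t y i j) x
        = Qt t x i j + HC P (Q t) (u t) x i j) ∧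
      ∀ᵐ x ∂(ℳ L), 2 * P.B0 * biLap L (u t) x
        = -1 * (ut t x + muC P (Q t) (u t) x) := by
  obtain ⟨Ru, hRu⟩ := h.reg_u.w_bound hL hd
  choose Rq hRq using fun i j => (h.reg_Q i j).w_bound hL hd
  filter_upwards [h.eq_Q, h.eq_u, ae_restrict_mem measurableSet_Ioc] with t h1 h2 h3
  have ht : t ∈ Icc 0 T := Ioc_subset_Icc_self h3
  have hq : ∀ i j, W L 2 (∑ i, ∑ j, |Rq i j|) fun x => Q t x i j := fun i j =>
    (hRq i j t ht).mono le_rfl ((le_abs_self _).trans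
      (le_sum_sum (f := fun i j => |Rq i j|) (fun _ _ => abs_nonneg _) i j))
  rw [h.gFactor_eq ht] at h1 h2
  refine ⟨ht, fun i j => ?_, ?_⟩
  · filter_upwards [h1, HField_ae (Q := Q t) P hL (hRu t ht)] with x hx hx'
    have := hx i j; rw [hx'] at this; linarith
  · filter_upwards [h2, muField_ae (Q := Q t) P hL (hRu t ht) hq] with x hx hx'
    rw [hx'] at hx; linarith

theorem IsExactSolution.u_gain (hL : 0 < L) (hd : d ≤ 3) (hT : 0 < T) (hB : 0 < P.B0) (hk : k ≤ 2)
    (h : IsExactSolution P L T 4 Q Qt u ut s)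
    (hm : ∃ R, ∀ t ∈ Icc 0 T, W L k R (muC P (Q t) (u t))) :
    ∃ R, ∀ t ∈ Icc 0 T, W L (k + 4) R (u t) := by
  obtain ⟨Rm, hRm⟩ := hm
  obtain ⟨C, hC, hS⟩ := SobolevBound.sb (d := d) hL hd
  obtain ⟨R1, hR1⟩ := h.reg_u.bound
  obtain ⟨R2, hR2⟩ := h.reg_u.bound_deriv
  obtain ⟨c, hc, hσ⟩ := wgt_pow_four_le_lsym (d := d) hL (by positivity : 0 < 2 * P.B0)
  refine h.reg_u.w_of_sb (R := c * (C * |R1| + (C * |R2| + 2 * L ^ d * Rm))) hL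
    (h.reg_u.sb_of_ae hL hd hT ?_)
  filter_upwards [h.ae_eqs hL hd, hR2] with t ht0 ht2
  obtain ⟨ht, -, he⟩ := ht0
  refine SB.gain hc hσ (fun m θ => ?_) ((hS (hR1 t ht)).mono hk le_rfl)
    ((hS ht2).mono hk le_rfl) ((hRm t ht).sb hL)
  have e := cf_congr he m θ
  rw [cf_smul, cf_smul, cf_add (ht2.memLp.1.integrable one_le_two) (hRm t ht).integrable,
    (hR1 t ht).cf_biLap hL, ← mul_assoc] at e
  rw [e, neg_one_mul, abs_neg]
  exact abs_add_le _ _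

theorem IsExactSolution.Q_gain (hL : 0 < L) (hd : d ≤ 3) (hT : 0 < T) (hK : 0 < P.K)
    (h : IsExactSolution P L T 4 Q Qt u ut s) (i j : Fin d)
    (hm : ∃ R, ∀ t ∈ Icc 0 T, W L 2 R fun x => HC P (Q t) (u t) x i j) :
    ∃ R, ∀ t ∈ Icc 0 T, W L 4 R fun x => Q t x i j := by
  obtain ⟨Rm, hRm⟩ := hm
  obtain ⟨C, hC, hS⟩ := SobolevBound.sb (d := d) hL hd
  obtain ⟨R1, hR1⟩ := (h.reg_Q i j).bound
  obtain ⟨R2, hR2⟩ := (h.reg_Q i j).bound_deriv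
  obtain ⟨c, hc, hσ⟩ := wgt_sq_le_lsym (d := d) hL hK
  refine (h.reg_Q i j).w_of_sb (R := c * (C * |R1| + (C * |R2| + 2 * L ^ d * Rm))) hL
    ((h.reg_Q i j).sb_of_ae hL hd hT ?_)
  filter_upwards [h.ae_eqs hL hd, hR2] with t ht0 ht2
  obtain ⟨ht, he, -⟩ := ht0
  refine SB.gain (k := 2) (j := 2) hc hσ (fun m θ => ?_) (hS (hR1 t ht)) (hS ht2) ((hRm t ht).sb hL)
  have e := cf_congr (he i j) m θ
  rw [cf_smul, cf_add (ht2.memLp.1.integrable one_le_two) (hRm t ht).integrable,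
    (hR1 t ht).cf_lap (n := 2) hL, mul_neg, ← mul_assoc] at e
  rw [← abs_neg, e]
  exact abs_add_le _ _

/-- Bootstrapped regularity of the exact solution. -/
theorem IsExactSolution.regularity (hL : 0 < L) (hd : d ≤ 3) (hT : 0 < T) (hK : 0 < P.K)
    (hB : 0 < P.B0) (h : IsExactSolution P L T 4 Q Qt u ut s) :
    (∃ R, ∀ t ∈ Icc 0 T, W L 6 R (u t)) ∧ ∀ i j, ∃ R, ∀ t ∈ Icc 0 T, W L 4 R fun x => Q t x i j := by
  have hu2 := Cl.refl (δ := fun _ => 0) (h.reg_u.w_bound hL hd)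
  have hQ2 := fun i j => Cl.refl (δ := fun _ => 0) ((h.reg_Q i j).w_bound hL hd)
  have hu4 := Cl.refl (δ := fun _ => 0)
    (h.u_gain hL hd hT hB (Nat.zero_le 2) (Cl.muC (k := 0) P hL hQ2 hu2).left)
  have hQ4 := fun i j => h.Q_gain hL hd hT hK i j (Cl.hC (k := 2) P hL hQ2 hu4 i j).left
  exact ⟨h.u_gain hL hd hT hB le_rfl (Cl.muC (k := 2) P hL
    (fun i j => Cl.refl (δ := fun _ => 0) (hQ4 i j)) hu4).left, hQ4⟩

/-- Lipschitz dependence on time. -/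
theorem TimeSobolev.w_lip (hL : 0 < L) (hd : d ≤ 3) {w wt : ℝ → Pt d → ℝ}
    (hw : TimeSobolev L T 4 w wt) :
    ∃ C, ∀ t ∈ Icc 0 T, ∀ r ∈ Icc 0 T, W L 2 (C * |t - r|) (fun x => w t x - w r x) := by
  obtain ⟨C, hC, hS⟩ := hw.sb_lip hL hd
  refine ⟨2 * (L ^ d)⁻¹ * C, fun t ht r hr => ?_⟩
  have := (hS t ht r hr).w hL ((hw.cont t ht).sub (hw.cont r hr))
    (fun x i => by rw [Pi.sub_apply, Pi.sub_apply, hw.per t ht x i, hw.per r hr x i])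
  rwa [← mul_assoc] at this

/-- Continuity in time of the fourth derivatives of `u`. -/
theorem IsExactSolution.u_cont (hL : 0 < L) (hd : d ≤ 3) (hT : 0 < T) (hK : 0 < P.K)
    (hB : 0 < P.B0) (h : IsExactSolution P L T 4 Q Qt u ut s) {ε : ℝ} (hε : 0 < ε) :
    ∃ C, ∀ t ∈ Icc 0 T, ∀ r ∈ Icc 0 T, W L 4 (ε + C * |t - r|) (fun x => u t x - u r x) := by
  obtain ⟨R, hR⟩ := (h.regularity hL hd hT hK hB).1
  obtain ⟨C, hC, hS⟩ := h.reg_u.sb_lip hL hd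
  have hp : 0 < 2 * (L ^ d)⁻¹ := by positivity
  have hR0 : 0 ≤ R := (hR 0 ⟨le_rfl, hT.le⟩).nonneg
  obtain ⟨q, hq⟩ : ∃ q, q = 2 * L ^ d * (R + R) := ⟨_, rfl⟩
  have hq0 : 0 ≤ q := by rw [hq]; positivity
  obtain ⟨η, hη⟩ : ∃ η, η = ε / (2 * (L ^ d)⁻¹ * (q + 1)) := ⟨_, rfl⟩
  have hη0 : 0 < η := by rw [hη]; positivity
  refine ⟨2 * (L ^ d)⁻¹ * (η⁻¹ * C), fun t ht r hr => ?_⟩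
  have h1 := ((hS t ht r hr).interp (((hR t ht).sub (hR r hr)).sb hL) hη0).w hL
    ((h.reg_u.cont t ht).sub (h.reg_u.cont r hr))
    (fun x i => by rw [Pi.sub_apply, Pi.sub_apply, h.reg_u.per t ht x i, h.reg_u.per r hr x i])
  refine h1.mono le_rfl ?_
  rw [← hq, mul_add, ← mul_assoc η⁻¹, ← mul_assoc (2 * (L ^ d)⁻¹) (η⁻¹ * C)]
  refine add_le_add ?_ le_rfl
  rw [hη, div_mul_eq_mul_div, mul_div_assoc', div_le_iff₀ (by positivity)]
  have : 0 ≤ 2 * (L ^ d)⁻¹ * ε := by positivity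
  nlinarith

end Regularity

/-! ### Pointwise time derivatives -/

section PointwiseTime

variable {d : ℕ} {L T : ℝ} {w wt Φ : ℝ → Pt d → ℝ}

theorem TimeSobolev.hasDerivWithinAt (hL : 0 < L) (hw : TimeSobolev L T 4 w wt)
    (hΦ : ∀ᵐ t ∂(volume.restrict (Ioc 0 T)), wt t =ᵐ[ℳ L] Φ t)
    (hb : ∃ R, ∀ t ∈ Icc 0 T, W L 0 R (Φ t))
    (hc : ∀ ε > 0, ∃ C, ∀ t ∈ Icc 0 T, ∀ r ∈ Icc 0 T,
      W L 0 (ε + C * |t - r|) (fun x => Φ t x - Φ r x)) {r : ℝ} (hr : r ∈ Icc 0 T) (x : Pt d) :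
    HasDerivWithinAt (fun t => w t x) (Φ r x) (Icc 0 T) r := by
  obtain ⟨R, hR⟩ := hb
  rw [hasDerivWithinAt_iff_isLittleO, Asymptotics.isLittleO_iff]
  intro c hc0
  obtain ⟨C, hC⟩ := hc (c / 8) (by positivity)
  have hδ : 0 < c / (8 * (|C| + 1)) := by positivity
  filter_upwards [inter_mem_nhdsWithin (Icc 0 T) (Metric.ball_mem_nhds r hδ)] with t ht
  obtain ⟨htI, htb⟩ := ht
  rw [Metric.mem_ball, Real.dist_eq, lt_div_iff₀ (by positivity)] at htb
  have hp : 0 < L ^ d := by positivity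
  have h1 : SB L 0 (2 * L ^ d * (c / 8 + |C| * |t - r|) * |t - r|)
      (fun x => w t x - w r x - (t - r) * Φ r x) := by
    refine hw.sb_increment htI hr (hR r hr).integrable ?_
    filter_upwards [hΦ, ae_restrict_mem measurableSet_Ioc] with ρ h2 h3 h4
    have h5 : |ρ - r| ≤ |t - r| := abs_sub_left_of_mem_uIcc (uIoc_subset_uIcc h4)
    have h6 := (hC ρ (Ioc_subset_Icc_self h3) r hr).mono le_rfl
      (add_le_add le_rfl ((mul_le_right (le_abs_self C) (abs_nonneg _)).trans
        (mul_le_left h5 (abs_nonneg C))))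
    intro F θ; refine le_trans (le_of_eq (sum_congr rfl fun m _ => ?_)) (h6.sb hL F θ)
    rw [cf_congr (h2.mono fun x hx => show wt ρ x - Φ r x = Φ ρ x - Φ r x by rw [hx])]
  have hc1 := (((hw.cont t htI).sub (hw.cont r hr)).sub ((hR r hr).continuous.const_mul (t - r)))
  have h2 := (h1.w hL hc1 (fun y i => by
    have := (hR r hr).periodic hL.ne' y i; simp only [Pi.sub_apply]
    rw [hw.per t htI y i, hw.per r hr y i, this])).abs_le x
  simp only [smul_eq_mul, norm_eq_abs]
  have e : 2 * (L ^ d)⁻¹ * (2 * L ^ d * (c / 8 + |C| * |t - r|) * |t - r|)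
      = 4 * (c / 8 + |C| * |t - r|) * |t - r| := by
    field_simp; ring
  rw [e] at h2
  refine le_trans h2 (mul_le_right ?_ (abs_nonneg _))
  nlinarith [abs_nonneg (t - r), abs_nonneg C]

end PointwiseTime

/-! ### Restriction to the grid -/

section Restriction

variable {d J : ℕ} [NeZero J] {L h R : ℝ} {f : Pt d → ℝ}

/-- Restriction to the nodes. -/
def res (J : ℕ) (h : ℝ) (f : Pt d → ℝ) : GridFun d J := fun p => f (node h p)

theorem IsPer.node_add (hf : IsPer L f) (hh : h = L / J) (p : Grid d J) (e : Fin d → ℤ) :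
    f (node h (p + fun i => (e i : ZMod J))) = f (node h p + fun i => h * e i) := by
  have hJ : (J : ℝ) ≠ 0 := Nat.cast_ne_zero.mpr (NeZero.ne J)
  have h1 : ∀ i, ∃ z : ℤ, (((p i + (e i : ZMod J)).val : ℕ) : ℤ) = (p i).val + e i + z * J := by
    intro i
    have h2 : (((((p i + (e i : ZMod J)).val : ℕ) : ℤ)) : ZMod J)
        = (((p i).val + e i : ℤ) : ZMod J) := by
      push_cast; simp
    rw [ZMod.intCast_eq_intCast_iff_dvd_sub] at h2
    obtain ⟨z, hz⟩ := h2; exact ⟨-z, by linarith⟩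
  choose z hz using h1
  rw [← hf.add_int (node h p + fun i => h * e i) z]
  congr 1
  funext i
  have := congrArg (Int.cast : ℤ → ℝ) (hz i)
  push_cast at this
  simp only [node, Pi.add_apply]
  rw [this, hh]
  field_simp

theorem IsPer.node_add_single (hf : IsPer L f) (hh : h = L / J) (p : Grid d J) (k : Fin d) :
    f (node h (p + Pi.single k 1)) = f (node h p + Pi.single k h) ∧
    f (node h (p + -Pi.single k 1)) = f (node h p - Pi.single k h) := by
  have h1 := hf.node_add hh p (Pi.single k 1)
  have h2 := hf.node_add hh p (-Pi.single k 1)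
  have e1 : (fun i => ((Pi.single k 1 : Fin d → ℤ) i : ZMod J)) = Pi.single k 1 := by
    funext i; rcases eq_or_ne i k with rfl | hi <;> simp [*]
  have e2 : (fun i => h * ((Pi.single k 1 : Fin d → ℤ) i : ℝ)) = Pi.single k h := by
    funext i; rcases eq_or_ne i k with rfl | hi <;> simp [*]
  have e3 : (fun i => ((-Pi.single k 1 : Fin d → ℤ) i : ZMod J)) = -Pi.single k 1 := by
    rw [← e1]; funext i; simp
  have e4 : (fun i => h * ((-Pi.single k 1 : Fin d → ℤ) i : ℝ)) = -Pi.single k h := by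
    rw [← e2]; funext i; simp
  rw [e1, e2] at h1
  rw [e3, e4, ← sub_eq_add_neg (node h p)] at h2
  exact ⟨h1, h2⟩

theorem IsPer.cd (hf : IsPer L f) (η : ℝ) (k : Fin d) : IsPer L (cd η k f) := fun x i => by
  simp only [SmA.cd]
  rw [add_right_comm, hf, add_sub_right_comm, hf]

theorem Dc_res (hf : IsPer L f) (hh : h = L / J) (k : Fin d) :
    Dc h k (res J h f) = res J h (cd h k f) := by
  funext p
  rw [Dc_apply_apply, res, res, (hf.node_add_single hh p k).1, (hf.node_add_single hh p k).2]
  rfl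

theorem Dc_Dc_res (hf : IsPer L f) (hh : h = L / J) (k l : Fin d) :
    Dc h k (Dc h l (res J h f)) = res J h (cd h k (cd h l f)) := by
  rw [Dc_res hf hh, Dc_res (hf.cd h l) hh]

/-- The discrete Laplacian of a function on the whole space. -/
def dlap (h : ℝ) (f : Pt d → ℝ) (x : Pt d) : ℝ := ∑ k, sd h k f x

theorem lapOp_res (hf : IsPer L f) (hh : h = L / J) :
    lapOp h (res J h f) = res J h (dlap h f) := by
  funext p
  rw [lapOp_apply, Finset.sum_apply]
  refine sum_congr rfl fun k _ => ?_
  rw [Dp_apply_apply, Dm_apply]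
  simp only [Pi.smul_apply, Pi.sub_apply, smul_eq_mul, shift_apply, add_neg_cancel_right, res]
  rw [(hf.node_add_single hh p k).1, (hf.node_add_single hh p k).2]
  rfl

theorem IsPer.dlap (hf : IsPer L f) (η : ℝ) : IsPer L (dlap η f) := fun x i => by
  simp only [SmA.dlap, SmA.sd]
  refine sum_congr rfl fun k _ => ?_
  rw [add_right_comm, hf, hf, add_sub_right_comm, hf]

/-! Quadrature. -/

theorem sum_wave_eq_zero (hL : 0 < L) (hh : h = L / J) {m : Fin d → ℤ} {k : Fin d}
    (hk : ¬ (J : ℤ) ∣ m k) (θ : ℝ) : ∑ p : Grid d J, cos (lin L m (node h p) + θ) = 0 := by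
  have hJ : (J : ℝ) ≠ 0 := Nat.cast_ne_zero.mpr (NeZero.ne J)
  obtain ⟨α, hα⟩ : ∃ α, α = 2 * π / L * m k * h := ⟨_, rfl⟩
  have h1 : ∀ θ, ∑ p : Grid d J, cos (lin L m (node h p) + (θ + α))
      = ∑ p : Grid d J, cos (lin L m (node h p) + θ) := fun θ => by
    rw [← Equiv.sum_comp (Equiv.addRight (Pi.single k (1 : ZMod J)))
      (fun p : Grid d J => cos (lin L m (node h p) + θ))]
    refine sum_congr rfl fun p _ => ?_
    rw [Equiv.coe_addRight, ((cos_lin_periodic hL.ne' m θ).node_add_single hh p k).1, lin_add,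
      lin_single, ← hα]
    congr 1; ring
  have h2 : ∀ p : Grid d J, cos (lin L m (node h p) + (θ + α))
      + cos (lin L m (node h p) + (θ - α + α - α)) = 2 * cos α
        * cos (lin L m (node h p) + θ) := fun p => by
    rw [add_sub_cancel_right, ← add_assoc, ← add_sub_assoc, cos_add, cos_sub]; ring
  have h3 : ∑ p : Grid d J, cos (lin L m (node h p) + (θ - α + α - α))
      = ∑ p : Grid d J, cos (lin L m (node h p) + θ) := by
    have := h1 (θ - α); rw [sub_add_cancel] at this ⊢; exact this.symm
  have h4 := sum_congr (rfl : (Finset.univ : Finset (Grid d J)) = _) fun p _ => h2 p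
  rw [sum_add_distrib, h1, h3, ← mul_sum] at h4
  by_contra hne
  have hc : cos α = 1 := by
    have : (1 - cos α) * ∑ p : Grid d J, cos (lin L m (node h p) + θ) = 0 := by linarith
    linarith [(mul_eq_zero.mp this).resolve_right hne]
  obtain ⟨n, hn⟩ := (Real.cos_eq_one_iff α).mp hc
  refine hk ⟨n, ?_⟩
  rw [hα, hh] at hn
  field_simp at hn
  have : (m k : ℝ) = J * n := by linarith
  exact_mod_cast this

theorem quadrature_wave (hL : 0 < L) (hh : h = L / J) (m : Fin d → ℤ) (θ : ℝ) :
    |h ^ d * ∑ p : Grid d J, cos (lin L m (node h p) + θ)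
      - ∫ x, cos (lin L m x + θ) ∂(ℳ L)| ≤ L ^ d / L ^ 2 * h ^ 2 * wgt m ^ 2 := by
  have hJ : 0 < (J : ℝ) := Nat.cast_pos.mpr (NeZero.pos J)
  have hh0 : 0 < h := by rw [hh]; positivity
  have hnn : 0 ≤ L ^ d / L ^ 2 * h ^ 2 * wgt m ^ 2 := by have := wgt_pos m; positivity
  rcases eq_or_ne m 0 with rfl | hm
  · have e : ∀ x : Pt d, lin L 0 x = 0 := fun x => by simp [lin]
    simp only [e, zero_add, Finset.sum_const, Finset.card_univ, nsmul_eq_mul, integral_const,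
      cell_real_univ hL, smul_eq_mul]
    rwa [← mul_assoc, vol_grid hh, sub_self, abs_zero]
  · rw [integral_wave hL hm, sub_zero]
    by_cases hk : ∃ k, ¬ (J : ℤ) ∣ m k
    · obtain ⟨k, hk⟩ := hk
      rwa [sum_wave_eq_zero hL hh hk, mul_zero, abs_zero]
    · push Not at hk
      obtain ⟨k, hmk⟩ := Function.ne_iff.mp hm
      have h1 : (J : ℝ) ≤ wgt m := by
        refine le_trans ?_ (abs_le_wgt m k)
        have := Int.le_of_dvd (abs_pos.mpr hmk) ((dvd_abs _ _).mpr (hk k))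
        exact_mod_cast this
      rw [abs_mul, abs_of_pos (pow_pos hh0 d)]
      calc _ ≤ h ^ d * (Fintype.card (Grid d J) : ℝ) := by
            refine mul_le_left ((abs_sum_le_sum_abs _ _).trans ?_)
              (pow_pos hh0 d).le
            refine (sum_le_sum fun p _ => abs_cos_le_one _).trans ?_; simp
        _ = L ^ d / L ^ 2 * h ^ 2 * J ^ 2 := by rw [vol_grid hh, hh]; field_simp
        _ ≤ _ := by gcongr

theorem W.quadrature (hL : 0 < L) (hf : W L 2 R f) (hh : h = L / J) :
    |h ^ d * ∑ p : Grid d J, f (node h p) - ∫ x, f x ∂(ℳ L)|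
      ≤ L ^ d / L ^ 2 * R * h ^ 2 := by
  obtain ⟨D, h1, h2, rfl⟩ := hf
  have s1 := (hasSum_sum (s := (Finset.univ : Finset (Grid d J)))
    fun p _ => (h1.summable (L := L) (node h p)).hasSum).mul_left (h ^ d)
  have s2 := (h1.mono (Nat.zero_le 2)).hasSum_integral (L := L) 0 0
  have e : ∀ x : Pt d, lin L 0 x = 0 := fun x => by simp [lin]
  simp only [cf, e, add_zero, Real.cos_zero, mul_one] at s2
  have s3 := s1.sub s2
  have h3 : 0 ≤ L ^ d / L ^ 2 * h ^ 2 := by positivity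
  calc _ = |∑' i, _| := congrArg abs s3.tsum_eq.symm
    _ ≤ L ^ d / L ^ 2 * h ^ 2 * D.nrm 2 := by
      refine tsum_of_norm_bounded (E := ℝ) (h1.hasSum.mul_left _) fun i => ?_
      have := mul_le_left (quadrature_wave (J := J) hL hh (D.m i) (D.θ i))
        (abs_nonneg (D.a i))
      rw [← abs_mul] at this; refine le_trans (le_of_eq ?_) (this.trans (le_of_eq (by ring)))
      rw [norm_eq_abs, ← mul_sum]
      congr 1; ring
    _ ≤ _ := by
      rw [mul_right_comm]; exact mul_le_right (mul_le_left h2 (by positivity)) (sq_nonneg h)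

end Restriction

/-! ### Consistency and time regularity of the fields -/

section Consistency

variable {d : ℕ} {L : ℝ} {k : ℕ}

/-- The discrete Hessian of a function on the whole space. -/
def hessD (h : ℝ) (u : Pt d → ℝ) (x : Pt d) : Mat d := Matrix.of fun k l => cd h k (cd h l u) x

/-- `H` with difference quotients. -/
def HD (P : Params) (h : ℝ) (Q : Pt d → Mat d) (u : Pt d → ℝ) (x : Pt d) : Mat d :=
  HVar P (Q x) (u x) (hessD h u x)

/-- `μ` with difference quotients. -/
def muD (P : Params) (h : ℝ) (Q : Pt d → Mat d) (u : Pt d → ℝ) (x : Pt d) : ℝ :=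
  muVar P (Q x) (u x) (hessD h u x)
    (∑ k, ∑ l, cd h k (cd h l fun y => (u y • Mten P (Q y)) k l) x)

/-- The time derivative of `Q`. -/
def phiQ (P : Params) (Q : Pt d → Mat d) (u : Pt d → ℝ) (i j : Fin d) (x : Pt d) : ℝ :=
  P.K * lapC (fun y => Q y i j) x - HC P Q u x i j

/-- The time derivative of `u`. -/
def phiU (P : Params) (Q : Pt d → Mat d) (u : Pt d → ℝ) (x : Pt d) : ℝ :=
  -(2 * P.B0) * lapC (lapC u) x - muC P Q u x

variable {α : Type} {S : Set α} {δ h : α → ℝ} {f f' v v' : α → Pt d → ℝ} {X X' : α → Pt d → Mat d}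

theorem Cl.dlap (hL : 0 < L) (hh : ∀ a ∈ S, 0 < h a) (hf : Cl L (k + 2) S δ f f') :
    Cl L k S δ (fun a => SmA.dlap (h a) (f a)) (fun a => SmA.dlap (h a) (f' a)) :=
  Cl.sum fun l => hf.sd hL hh l

theorem Cl.dlap_lapC (hL : 0 < L) (hh : ∀ a ∈ S, 0 < h a) (hf : ∃ R, ∀ a ∈ S, W L (k + 4) R (f a)) :
    Cl L k S (fun a => h a ^ 2) (fun a => SmA.dlap (h a) (f a)) (fun a => SmA.lapC (f a)) :=
  Cl.sum fun l => Cl.sd_pd hL hh hf l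

theorem Cl.hD (P : Params) (hL : 0 < L) (hh : ∀ a ∈ S, 0 < h a)
    (hX : ∀ i j, Cl L k S δ (fun a x => X a x i j) fun a x => X' a x i j)
    (hv : Cl L (k + 2) S δ v v') (i j : Fin d) :
    Cl L k S δ (fun a x => HD P (h a) (X a) (v a) x i j)
      (fun a x => HD P (h a) (X' a) (v' a) x i j) :=
  Cl.hVar P hX (hv.mono (by omega)) (fun k' l => (hv.cd (k := k + 1) hL hh l).cd hL hh k') i j

theorem Cl.muD (P : Params) (hL : 0 < L) (hh : ∀ a ∈ S, 0 < h a)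
    (hX : ∀ i j, Cl L (k + 2) S δ (fun a x => X a x i j) fun a x => X' a x i j)
    (hv : Cl L (k + 2) S δ v v') :
    Cl L k S δ (fun a x => SmA.muD P (h a) (X a) (v a) x)
      (fun a x => SmA.muD P (h a) (X' a) (v' a) x) :=
  Cl.muVar P (fun i j => (hX i j).mono (by omega)) (hv.mono (by omega))
    (fun k' l => (hv.cd (k := k + 1) hL hh l).cd hL hh k')
    (Cl.sum fun k' => Cl.sum fun l =>
      ((Cl.uMten P hX hv k' l).cd (k := k + 1) hL hh l).cd hL hh k')

theorem Cl.hessD_hessC (hL : 0 < L) (hh : ∀ a ∈ S, 0 < h a) (hv : ∃ R, ∀ a ∈ S, W L (k + 4) R (v a))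
    (i j : Fin d) : Cl L k S (fun a => h a ^ 2) (fun a x => hessD (h a) (v a) x i j)
      (fun a x => hessC (v a) x i j) := Cl.cd_cd_pd_pd hL hh hv i j

theorem Cl.hD_hC (P : Params) (hL : 0 < L) (hh : ∀ a ∈ S, 0 < h a)
    (hX : ∀ i j, ∃ R, ∀ a ∈ S, W L k R fun x => X a x i j)
    (hv : ∃ R, ∀ a ∈ S, W L (k + 4) R (v a)) (i j : Fin d) :
    Cl L k S (fun a => h a ^ 2) (fun a x => HD P (h a) (X a) (v a) x i j)
      (fun a x => HC P (X a) (v a) x i j) :=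
  Cl.hVar P (fun i j => Cl.refl (hX i j)) ((Cl.refl hv).mono (by omega))
    (Cl.hessD_hessC hL hh hv) i j

theorem Cl.muD_muC (P : Params) (hL : 0 < L) (hh : ∀ a ∈ S, 0 < h a)
    (hX : ∀ i j, ∃ R, ∀ a ∈ S, W L (k + 4) R fun x => X a x i j)
    (hv : ∃ R, ∀ a ∈ S, W L (k + 4) R (v a)) :
    Cl L k S (fun a => h a ^ 2) (fun a x => SmA.muD P (h a) (X a) (v a) x)
      (fun a x => SmA.muC P (X a) (v a) x) :=
  Cl.muVar P (fun i j => (Cl.refl (hX i j)).mono (by omega)) ((Cl.refl hv).mono (by omega))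
    (Cl.hessD_hessC hL hh hv) (Cl.sum fun k' => Cl.sum fun l => Cl.cd_cd_pd_pd hL hh
      (Cl.uMten (δ := fun _ => 0) P (fun i j => Cl.refl (hX i j)) (Cl.refl hv) k' l).left k' l)

theorem Cl.phiQ (P : Params) (hL : 0 < L)
    (hX : ∀ i j, Cl L (k + 2) S δ (fun a x => X a x i j) fun a x => X' a x i j)
    (hv : Cl L (k + 2) S δ v v') (i j : Fin d) :
    Cl L k S δ (fun a => SmA.phiQ P (X a) (v a) i j) (fun a => SmA.phiQ P (X' a) (v' a) i j) :=
  ((Cl.lapC hL (hX i j)).smul P.K).sub (Cl.hC P hL (fun i j => (hX i j).mono (by omega)) hv i j)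

theorem Cl.phiU (P : Params) (hL : 0 < L)
    (hX : ∀ i j, Cl L (k + 2) S δ (fun a x => X a x i j) fun a x => X' a x i j)
    (hv : Cl L (k + 4) S δ v v') :
    Cl L k S δ (fun a => SmA.phiU P (X a) (v a)) (fun a => SmA.phiU P (X' a) (v' a)) :=
  ((Cl.lapC hL (Cl.lapC (k := k + 2) hL hv)).smul _).sub
    (Cl.muC P hL hX (hv.mono (by omega)))

/-- The power `H : ∂ₜQ + μ ∂ₜu` of given fields. -/
def power (A : Pt d → Mat d) (b : Pt d → ℝ) (F : Fin d → Fin d → Pt d → ℝ) (g : Pt d → ℝ)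
    (x : Pt d) : ℝ := ∑ i, ∑ j, A x i j * F i j x + b x * g x

theorem Cl.power {F F' : α → Fin d → Fin d → Pt d → ℝ}
    (hX : ∀ i j, Cl L k S δ (fun a x => X a x i j) fun a x => X' a x i j) (hv : Cl L k S δ v v')
    (hF : ∀ i j, Cl L k S δ (fun a => F a i j) fun a => F' a i j) (hf : Cl L k S δ f f') :
    Cl L k S δ (fun a => SmA.power (X a) (v a) (F a) (f a))
      (fun a => SmA.power (X' a) (v' a) (F' a) (f' a)) :=
  (Cl.sum fun i => Cl.sum fun j => (hX i j).mul (hF i j)).add (hv.mul hf)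

theorem Cl.ev_left (hf : Cl L k S δ f f') :
    ∀ᶠ M in Filter.atTop, ∀ a ∈ S, ∀ x, |f a x| ≤ M := by
  obtain ⟨R, hR⟩ := hf.left
  filter_upwards [Filter.eventually_ge_atTop R] with M hM a ha x
  exact ((hR a ha).abs_le x).trans hM

theorem Cl.ev_diff (hf : Cl L k S δ f f') (hδ : ∀ a ∈ S, 0 ≤ δ a) :
    ∀ᶠ M in Filter.atTop, ∀ a ∈ S, ∀ x, |f a x - f' a x| ≤ M * δ a := by
  obtain ⟨R, hR⟩ := hf.diff
  filter_upwards [Filter.eventually_ge_atTop R] with M hM a ha x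
  exact ((hR a ha).abs_le x).trans (mul_le_right hM (hδ a ha))

end Consistency

section SolutionTime

variable {d : ℕ} {L T : ℝ} {P : Params} {Q Qt : ℝ → Pt d → Mat d} {u ut : ℝ → Pt d → ℝ}
  {s : ℝ → ℝ}

/-- What the discretization needs to know about the exact solution. -/
structure Classical (P : Params) (L T : ℝ) (Q : ℝ → Pt d → Mat d) (u : ℝ → Pt d → ℝ) : Prop where
  Q_reg : ∀ i j, ∃ R, ∀ t ∈ Icc 0 T, W L 4 R fun x => Q t x i j
  u_reg : ∃ R, ∀ t ∈ Icc 0 T, W L 6 R (u t)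
  Q_lip : ∀ i j, ∃ R, ∀ t ∈ Icc 0 T, ∀ r ∈ Icc 0 T, W L 2 (R * |t - r|) fun x => Q t x i j - Q r x i j
  u_lip : ∃ R, ∀ t ∈ Icc 0 T, ∀ r ∈ Icc 0 T, W L 2 (R * |t - r|) fun x => u t x - u r x
  Q_deriv : ∀ t ∈ Icc 0 T, ∀ i j x,
    HasDerivWithinAt (fun t => Q t x i j) (phiQ P (Q t) (u t) i j x) (Icc 0 T) t
  u_deriv : ∀ t ∈ Icc 0 T, ∀ x,
    HasDerivWithinAt (fun t => u t x) (phiU P (Q t) (u t) x) (Icc 0 T) t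
  phiU_cont : ∀ x, ContinuousOn (fun t => phiU P (Q t) (u t) x) (Icc 0 T)

theorem continuousOn_of_modulus {φ : ℝ → ℝ} {I : Set ℝ}
    (h : ∀ ε > 0, ∃ C, ∀ t ∈ I, ∀ r ∈ I, |φ t - φ r| ≤ ε + C * |t - r|) : ContinuousOn φ I := by
  rw [Metric.continuousOn_iff]
  intro r hr ε hε
  obtain ⟨C, hC⟩ := h (ε / 2) (by positivity)
  refine ⟨ε / (2 * (|C| + 1)), by positivity, fun t ht htr => ?_⟩
  rw [Real.dist_eq, lt_div_iff₀ (by positivity)] at htr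
  rw [Real.dist_eq]
  have := hC t ht r hr
  have h2 := mul_le_right (le_abs_self C) (abs_nonneg (t - r))
  nlinarith [abs_nonneg (t - r), abs_nonneg C]

/-- Pairs of times. -/
def Pairs (T : ℝ) : Set (ℝ × ℝ × ℝ) := {a | a.1 ∈ Icc 0 T ∧ a.2.1 ∈ Icc 0 T ∧ 0 < a.2.2}

theorem Cl.pairs {k : ℕ} {w : ℝ → Pt d → ℝ} (h1 : ∃ R, ∀ t ∈ Icc 0 T, W L k R (w t))
    (h2 : ∃ R, ∀ t ∈ Icc 0 T, ∀ r ∈ Icc 0 T, W L k (R * |t - r|) fun x => w t x - w r x) :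
    Cl L k (Pairs T) (fun a => |a.1 - a.2.1|) (fun a => w a.1) (fun a => w a.2.1) := by
  obtain ⟨R1, h1⟩ := h1
  obtain ⟨R2, h2⟩ := h2
  exact ⟨⟨R1, fun a ha => h1 _ ha.1⟩, ⟨R1, fun a ha => h1 _ ha.2.1⟩, R2,
    fun a ha => h2 _ ha.1 _ ha.2.1⟩

theorem IsExactSolution.classical (hL : 0 < L) (hd : d ≤ 3) (hT : 0 < T) (hK : 0 < P.K)
    (hB : 0 < P.B0) (h : IsExactSolution P L T 4 Q Qt u ut s) : Classical P L T Q u ∧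
      ∀ᵐ t ∂(volume.restrict (Ioc 0 T)), t ∈ Icc 0 T ∧ ∀ᵐ x ∂(ℳ L),
        (∀ i j, Qt t x i j = phiQ P (Q t) (u t) i j x) ∧ ut t x = phiU P (Q t) (u t) x := by
  obtain ⟨hu, hQ⟩ := h.regularity hL hd hT hK hB
  have hul := h.reg_u.w_lip hL hd
  have hQl := fun i j => (h.reg_Q i j).w_lip hL hd
  have hQ2 : ∀ i j, ∃ R, ∀ t ∈ Icc 0 T, W L 2 R fun x => Q t x i j := fun i j => by
    obtain ⟨R, hR⟩ := hQ i j; exact ⟨R, fun t ht => (hR t ht).mono (by norm_num) le_rfl⟩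
  have hu4 : ∃ R, ∀ t ∈ Icc 0 T, W L 4 R (u t) := by
    obtain ⟨R, hR⟩ := hu; exact ⟨R, fun t ht => (hR t ht).mono (by norm_num) le_rfl⟩
  have hu2 : ∃ R, ∀ t ∈ Icc 0 T, W L 2 R (u t) := by
    obtain ⟨R, hR⟩ := hu; exact ⟨R, fun t ht => (hR t ht).mono (by norm_num) le_rfl⟩
  have hae : ∀ᵐ t ∂(volume.restrict (Ioc 0 T)), t ∈ Icc 0 T ∧ ∀ᵐ x ∂(ℳ L),
      (∀ i j, Qt t x i j = phiQ P (Q t) (u t) i j x) ∧ ut t x = phiU P (Q t) (u t) x := by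
    filter_upwards [h.ae_eqs hL hd] with t ht
    obtain ⟨ht, h1, h2⟩ := ht
    obtain ⟨R, hR⟩ := hu4
    choose Rq hRq using hQ2
    have h1' : ∀ᵐ x ∂(ℳ L), ∀ i j, Qt t x i j = phiQ P (Q t) (u t) i j x := by
      refine ae_all_iff.mpr fun i => ae_all_iff.mpr fun j => ?_
      filter_upwards [h1 i j, lap_ae hL (hRq i j t ht)] with x hx hx'
      rw [phiQ, ← hx', hx]; ring
    refine ⟨ht, ?_⟩
    filter_upwards [h1', h2, biLap_ae hL (hR t ht)] with x hx hx2 hx3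
    refine ⟨hx, ?_⟩; rw [hx3] at hx2; rw [phiU]; linarith
  have clQ := fun i j => Cl.pairs (hQ2 i j) (hQl i j)
  have clu := Cl.pairs hu2 hul
  have hmQ : ∀ i j, ∀ ε > 0, ∃ C, ∀ t ∈ Icc 0 T, ∀ r ∈ Icc 0 T, W L 0 (ε + C * |t - r|)
      fun x => phiQ P (Q t) (u t) i j x - phiQ P (Q r) (u r) i j x := fun i j ε hε => by
    obtain ⟨C, hC⟩ := (Cl.phiQ (k := 0) P hL clQ clu i j).diff
    exact ⟨C, fun t ht r hr => (hC (t, r, 1) ⟨ht, hr, one_pos⟩).mono le_rfl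
      (le_add_of_nonneg_left hε.le)⟩
  have hmU : ∀ ε > 0, ∃ C, ∀ t ∈ Icc 0 T, ∀ r ∈ Icc 0 T, W L 0 (ε + C * |t - r|)
      fun x => phiU P (Q t) (u t) x - phiU P (Q r) (u r) x := by
    choose! c hc using fun ε (hε : 0 < ε) => h.u_cont hL hd hT hK hB hε
    have cl4 : Cl L 4 (Pairs T) (fun a => a.2.2 + c a.2.2 * |a.1 - a.2.1|) (fun a => u a.1)
        (fun a => u a.2.1) := by
      obtain ⟨R, hR⟩ := hu4
      refine ⟨⟨R, fun a ha => hR _ ha.1⟩, ⟨R, fun a ha => hR _ ha.2.1⟩, 1, fun a ha => ?_⟩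
      rw [one_mul]; exact hc _ ha.2.2 _ ha.1 _ ha.2.1
    obtain ⟨R1, h1⟩ := ((Cl.lapC (k := 0) hL (Cl.lapC (k := 2) hL cl4)).smul (-(2 * P.B0))).diff
    obtain ⟨R2, h2⟩ := (Cl.muC (k := 0) P hL clQ clu).diff
    intro ε hε; have hη : 0 < ε / (|R1| + 1) := by positivity
    refine ⟨R1 * c (ε / (|R1| + 1)) + R2, fun t ht r hr => ?_⟩
    have h3 := (h1 (t, r, ε / (|R1| + 1)) ⟨ht, hr, hη⟩).sub (h2 (t, r, 1) ⟨ht, hr, one_pos⟩)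
    refine h3.congr ?_ fun x => by simp only [phiU]; ring
    have h4 : R1 * (ε / (|R1| + 1)) ≤ ε := by
      rw [mul_div_assoc', div_le_iff₀ (by positivity), mul_comm]
      exact mul_le_left (by linarith [le_abs_self R1]) hε.le
    dsimp only; linarith
  refine ⟨⟨hQ, hu, hQl, hul, fun t ht i j x => ?_, fun t ht x => ?_, fun x => ?_⟩, hae⟩
  · obtain ⟨R, hR⟩ := (Cl.phiQ (k := 0) P hL clQ clu i j).left
    exact (h.reg_Q i j).hasDerivWithinAt hL (hae.mono fun t ht => ht.2.mono fun x hx => hx.1 i j)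
      ⟨R, fun t ht => hR (t, t, 1) ⟨ht, ht, one_pos⟩⟩ (hmQ i j) ht x
  · refine h.reg_u.hasDerivWithinAt hL (hae.mono fun t ht => ht.2.mono fun x hx => hx.2) ?_ hmU ht x
    exact (Cl.phiU (k := 0) P hL (δ := fun _ => 0) (fun i j => Cl.refl (hQ2 i j))
      (Cl.refl hu4)).left
  · refine continuousOn_of_modulus fun ε hε => ?_
    obtain ⟨C, hC⟩ := hmU ε hε; exact ⟨C, fun t ht r hr => (hC t ht r hr).abs_le x⟩

end SolutionTime

/-! ### The exact solution on the grid -/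

section Sampling

variable {d : ℕ} {L h : ℝ} {J : ℕ} [NeZero J] {P : Params} {Q : Pt d → Mat d} {u f : Pt d → ℝ}

theorem hessH_res (hu : IsPer L u) (hh : h = L / J) (p : Grid d J) :
    hessH h (fun p => u (node h p)) p = hessD h u (node h p) := by
  ext k l
  exact congrFun (Dc_Dc_res hu hh k l) p

theorem HH_res (hu : IsPer L u) (hh : h = L / J) (i j : Fin d) :
    entry (HH P h (fun p : Grid d J => Q (node h p)) fun p => u (node h p)) i j
      = res J h fun x => HD P h Q u x i j := by
  funext p
  rw [entry, HH, hessH_res hu hh]; rfl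

theorem muH_res (hQ : ∀ i j, IsPer L fun x => Q x i j) (hu : IsPer L u) (hh : h = L / J) :
    muH P h (fun p : Grid d J => Q (node h p)) (fun p => u (node h p)) = res J h (muD P h Q u) := by
  funext p
  rw [muH, hessH_res hu hh, res, muD]
  congr 1
  refine sum_congr rfl fun k _ => sum_congr rfl fun l _ => ?_
  refine congrFun (Dc_Dc_res (f := fun y => (u y • Mten P (Q y)) k l) (fun x i => ?_) hh k l) p
  simp only [hu x i, (Matrix.ext fun a b => hQ a b x i : Q (x + Pi.single i L) = Q x)]

theorem abs_sum_node_le (hh : h = L / J) (h0 : 0 ≤ h) {M : ℝ} (hf : ∀ x, |f x| ≤ M) :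
    |h ^ d * ∑ p : Grid d J, f (node h p)| ≤ L ^ d * M := by
  rw [abs_mul, abs_of_nonneg (pow_nonneg h0 d), ← vol_grid hh, mul_assoc]
  refine mul_le_left ((abs_sum_le_sum_abs _ _).trans ?_) (pow_nonneg h0 d)
  exact (sum_le_sum fun p _ => hf _).trans (by simp)

theorem abs_integral_cell_le (hL : 0 < L) {M : ℝ} (hf : ∀ x, |f x| ≤ M) :
    |∫ x, f x ∂(ℳ L)| ≤ L ^ d * M := by
  have := norm_integral_le_of_norm_le_const (μ := cellMeasure d L) (f := f) (C := M)
    (ae_of_all _ fun x => hf x)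
  rwa [cell_real_univ hL, mul_comm] at this

end Sampling

section Eventually

open Filter

variable {d : ℕ} {L : ℝ} {k : ℕ} {α : Type} {S : Set α} {δ : α → ℝ} {f f' : α → Pt d → ℝ}

theorem Cl.ev_N0 (hL : 0 < L) (hf : Cl L k S δ f f') : ∀ᶠ R in atTop, ∀ a ∈ S, ∀ (J : ℕ) [NeZero J]
    (h : ℝ), h = L / J → N0 h (res J h (f a)) ≤ R := by
  obtain ⟨M, hM⟩ := hf.ev_left.exists
  filter_upwards [eventually_ge_atTop (√(L ^ d) * M)] with R hR a ha J _ h hh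
  exact (N0_le_sup hL.le hh fun p => hM a ha _).trans hR

theorem Cl.ev_N0_sub (hL : 0 < L) (hf : Cl L k S δ f f') (hδ : ∀ a ∈ S, 0 ≤ δ a) :
    ∀ᶠ R in atTop, ∀ a ∈ S, ∀ (J : ℕ) [NeZero J] (h : ℝ), h = L / J →
      N0 h (res J h (f a) - res J h (f' a)) ≤ R * δ a := by
  obtain ⟨M, hM⟩ := (hf.ev_diff hδ).exists
  filter_upwards [eventually_ge_atTop (√(L ^ d) * M)] with R hR a ha J _ h hh
  refine (N0_le_sup hL.le hh (f := res J h (f a) - res J h (f' a)) fun p => hM a ha _).trans ?_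
  rw [← mul_assoc]
  exact mul_le_right hR (hδ a ha)

theorem ev_N2 {T : ℝ} {w : ℝ → Pt d → ℝ} (hL : 0 < L) (hw : ∃ R, ∀ t ∈ Icc 0 T, W L 2 R (w t)) :
    ∀ᶠ R in atTop, ∀ t ∈ Icc 0 T, ∀ (J : ℕ) [NeZero J] (h : ℝ), h = L / J →
      N2 h (res J h (w t)) ≤ R := by
  have hw' : ∃ R, ∀ a ∈ Icc 0 T ×ˢ Ioi (0 : ℝ), W L 2 R (w a.1) := by
    obtain ⟨R, hR⟩ := hw; exact ⟨R, fun a ha => hR _ ha.1⟩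
  have c := Cl.refl (δ := fun _ => 0) hw'
  obtain ⟨M, h1, h2, hM⟩ := ((c.ev_N0 hL).and (((c.dlap (k := 0) (h := fun a => a.2) hL
    fun a ha => ha.2).ev_N0 hL).and (eventually_ge_atTop 0))).exists
  filter_upwards [eventually_ge_atTop (2 * M)] with R hR t ht J _ h hh
  have h0 : 0 < h := mesh_pos hL hh
  obtain ⟨Rw, hRw⟩ := hw
  refine (abs_le_of_sq_le_sq' ((N2_sq_le h0.le _).trans ?_) (by positivity : 0 ≤ 2 * M)).2.trans hR
  rw [lapOp_res ((hRw t ht).periodic hL.ne') hh]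
  have a1 := pow_le_pow_left₀ (apply_nonneg _ _) (h1 (t, h) ⟨ht, h0⟩ J h hh) 2
  have a2 := pow_le_pow_left₀ (apply_nonneg _ _) (h2 (t, h) ⟨ht, h0⟩ J h hh) 2
  dsimp only at a1 a2
  linarith

end Eventually

section Residual

variable {d : ℕ} {L : ℝ} {k : ℕ} {α : Type} {S : Set α} {δ h : α → ℝ} {v v' : α → Pt d → ℝ}
  {X X' : α → Pt d → Mat d}

/-- The semi-discrete time derivative of `Q`. -/
def psiQ (P : Params) (h : ℝ) (Q : Pt d → Mat d) (u : Pt d → ℝ) (i j : Fin d) (x : Pt d) : ℝ :=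
  P.K * dlap h (fun y => Q y i j) x - HD P h Q u x i j

/-- The semi-discrete time derivative of `u`. -/
def psiU (P : Params) (h : ℝ) (Q : Pt d → Mat d) (u : Pt d → ℝ) (x : Pt d) : ℝ :=
  -(2 * P.B0) * dlap h (dlap h u) x - muD P h Q u x

theorem Cl.psiQ (P : Params) (hL : 0 < L) (hh : ∀ a ∈ S, 0 < h a)
    (hX : ∀ i j, Cl L (k + 2) S δ (fun a x => X a x i j) fun a x => X' a x i j)
    (hv : Cl L (k + 2) S δ v v') (i j : Fin d) :
    Cl L k S δ (fun a => SmA.psiQ P (h a) (X a) (v a) i j)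
      (fun a => SmA.psiQ P (h a) (X' a) (v' a) i j) :=
  ((Cl.dlap hL hh (hX i j)).smul P.K).sub
    (Cl.hD P hL hh (fun i j => (hX i j).mono (by omega)) hv i j)

theorem Cl.psiQ_phiQ (P : Params) (hL : 0 < L) (hh : ∀ a ∈ S, 0 < h a)
    (hX : ∀ i j, ∃ R, ∀ a ∈ S, W L (k + 4) R fun x => X a x i j)
    (hv : ∃ R, ∀ a ∈ S, W L (k + 4) R (v a)) (i j : Fin d) :
    Cl L k S (fun a => h a ^ 2) (fun a => SmA.psiQ P (h a) (X a) (v a) i j)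
      (fun a => SmA.phiQ P (X a) (v a) i j) :=
  ((Cl.dlap_lapC hL hh (hX i j)).smul P.K).sub (Cl.hD_hC P hL hh
    (fun i j => ((Cl.refl (δ := fun _ => 0) (hX i j)).mono (by omega)).left) hv i j)

theorem Cl.psiU_phiU (P : Params) (hL : 0 < L) (hh : ∀ a ∈ S, 0 < h a)
    (hX : ∀ i j, ∃ R, ∀ a ∈ S, W L (k + 4) R fun x => X a x i j)
    (hv : ∃ R, ∀ a ∈ S, W L (k + 6) R (v a)) :
    Cl L k S (fun a => h a ^ 2) (fun a => SmA.psiU P (h a) (X a) (v a))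
      (fun a => SmA.phiU P (X a) (v a)) := by
  have hr := Cl.refl (δ := fun a => h a ^ 2) hv
  have h1 := Cl.dlap hL hh (Cl.dlap_lapC (k := k + 2) hL hh hv)
  have h2 := Cl.dlap_lapC hL hh (Cl.lapC (k := k + 4) hL hr).left
  exact ((h1.trans h2).smul _).sub
    (Cl.muD_muC P hL hh hX (hr.mono (by omega : k + 4 ≤ k + 6)).left)

end Residual

section Continuity

variable {d : ℕ} {L T : ℝ} {k : ℕ}

theorem Cl.continuousOn (w : ℝ → ℝ → Pt d → ℝ) (hf : Cl L k (Pairs T) (fun a => |a.1 - a.2.1|)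
    (fun a => w a.2.2 a.1) (fun a => w a.2.2 a.2.1)) {η : ℝ} (hη : 0 < η) (x : Pt d) :
    ContinuousOn (fun t => w η t x) (Icc 0 T) := by
  obtain ⟨M, hM⟩ := (hf.ev_diff fun _ _ => abs_nonneg _).exists
  exact continuousOn_of_modulus fun ε hε => ⟨M, fun t ht r hr =>
    (hM (t, r, η) ⟨ht, hr, hη⟩ x).trans (le_add_of_nonneg_left hε.le)⟩

theorem continuousOn_dlap {w : ℝ → Pt d → ℝ} {I : Set ℝ}
    (hw : ∀ x, ContinuousOn (fun t => w t x) I) (η : ℝ) (x : Pt d) :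
    ContinuousOn (fun t => dlap η (w t) x) I := by
  simp only [dlap, sd]
  exact continuousOn_finsetSum _ fun k _ => continuousOn_const.mul
    ((continuousOn_const.mul ((hw _).sub (hw _))).sub (continuousOn_const.mul ((hw _).sub (hw _))))

end Continuity

/-! ### The energy along the exact solution -/

section Energy

open Filter

variable {d : ℕ} {L T : ℝ} {P : Params} {Q Qt : ℝ → Pt d → Mat d} {u ut : ℝ → Pt d → ℝ}
  {s : ℝ → ℝ}

namespace Classical

theorem cl_Q (C : Classical P L T Q u) (i j : Fin d) : Cl L 2 (Pairs T) (fun a => |a.1 - a.2.1|)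
    (fun a x => Q a.1 x i j) (fun a x => Q a.2.1 x i j) := by
  obtain ⟨R, hR⟩ := C.Q_reg i j
  exact Cl.pairs ⟨R, fun t ht => (hR t ht).mono (by norm_num) le_rfl⟩ (C.Q_lip i j)

theorem cl_u (C : Classical P L T Q u) : Cl L 2 (Pairs T) (fun a => |a.1 - a.2.1|)
    (fun a => u a.1) (fun a => u a.2.1) := by
  obtain ⟨R, hR⟩ := C.u_reg
  exact Cl.pairs ⟨R, fun t ht => (hR t ht).mono (by norm_num) le_rfl⟩ C.u_lip

theorem Q_bd (C : Classical P L T Q u) (i j : Fin d) :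
    ∃ R, ∀ a ∈ Pairs T, W L 4 R fun x => Q a.1 x i j := by
  obtain ⟨R, hR⟩ := C.Q_reg i j
  exact ⟨R, fun a ha => hR _ ha.1⟩

theorem u_bd (C : Classical P L T Q u) : ∃ R, ∀ a ∈ Pairs T, W L 6 R (u a.1) := by
  obtain ⟨R, hR⟩ := C.u_reg
  exact ⟨R, fun a ha => hR _ ha.1⟩

theorem u_bd_four (C : Classical P L T Q u) : ∃ R, ∀ a ∈ Pairs T, W L 4 R (u a.1) := by
  obtain ⟨R, hR⟩ := C.u_bd
  exact ⟨R, fun a ha => (hR a ha).mono (by norm_num) le_rfl⟩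

theorem ev_E1 (hL : 0 < L) (C : Classical P L T Q u) : ∀ᶠ R in atTop, ∀ t ∈ Icc 0 T, ∀ (J : ℕ)
    [NeZero J] (h : ℝ), h = L / J → |E1h P h (fun p : Grid d J => Q t (node h p))
      (fun p => u t (node h p)) - E1 P L (Q t) (u t)| ≤ R * h ^ 2 := by
  have hQ := fun i j => (Cl.refl (δ := fun a : ℝ × ℝ × ℝ => a.2.2 ^ 2) (C.Q_bd i j))
  have hu := Cl.refl (δ := fun a : ℝ × ℝ × ℝ => a.2.2 ^ 2) C.u_bd_four
  obtain ⟨M, hM⟩ := (Cl.ev_diff (Cl.e1Density P (k := 0) (fun i j => (hQ i j).mono (by omega))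
    (hu.mono (by omega)) (Cl.hessD_hessC hL (h := fun a => a.2.2) (fun a ha => ha.2.2) C.u_bd_four))
    fun a _ => sq_nonneg _).exists
  obtain ⟨⟨N, hN⟩, -⟩ := Cl.e1Density P (k := 2) (fun i j => (hQ i j).mono (by omega))
    (hu.mono (by omega)) (fun k l => (hu.pd (k := 3) hL l).pd (k := 2) hL k)
  obtain ⟨Ru, hRu⟩ := C.u_reg
  filter_upwards [eventually_ge_atTop (L ^ d * M + L ^ d / L ^ 2 * N)] with R hR t ht J _ h hh
  have h0 : 0 < h := mesh_pos hL hh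
  have ha : (t, t, h) ∈ Pairs T := ⟨ht, ht, h0⟩
  have e1 : E1 P L (Q t) (u t)
      = ∫ x, e1Density P (Q t x) (u t x) (hessC (u t) x) ∂(ℳ L) := by
    refine integral_congr_ae ?_
    filter_upwards [hess_ae hL ((hRu t ht).mono (by norm_num) le_rfl)] with x hx
    rw [hx]
  have q1 := (hN _ ha).quadrature hL hh
  have q2 := abs_sum_node_le hh h0.le (f := fun x => e1Density P (Q t x) (u t x) (hessD h (u t) x)
    - e1Density P (Q t x) (u t x) (hessC (u t) x)) fun x => hM _ ha x
  dsimp only at q1 q2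
  rw [sum_sub_distrib, mul_sub] at q2
  rw [E1h, e1]
  simp only [hessH_res ((hRu t ht).periodic hL.ne') hh]
  refine (abs_sub_le _ _ _).trans ((add_le_add q2 q1).trans ?_)
  rw [← mul_assoc, ← add_mul]
  exact mul_le_right hR (sq_nonneg h)

/-- The rate of change of the energy. -/
def rate (P : Params) (L : ℝ) (Q : ℝ → Pt d → Mat d) (u : ℝ → Pt d → ℝ) (t : ℝ) : ℝ :=
  ∫ x, power (HC P (Q t) (u t)) (muC P (Q t) (u t)) (phiQ P (Q t) (u t)) (phiU P (Q t) (u t)) x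
    ∂(ℳ L)

theorem continuousOn_rate (hL : 0 < L) (C : Classical P L T Q u) :
    ContinuousOn (rate P L Q u) (Icc 0 T) := by
  have hQ := fun i j => Cl.refl (δ := fun _ => 0) (C.Q_reg i j)
  have hu := Cl.refl (δ := fun _ => 0) C.u_reg
  have hb := Cl.power (Cl.hC (k := 0) P hL (fun i j => (hQ i j).mono (by omega))
      (hu.mono (by omega)))
    (Cl.muC (k := 0) P hL (fun i j => (hQ i j).mono (by omega)) (hu.mono (by omega)))
    (Cl.phiQ (k := 0) P hL (fun i j => (hQ i j).mono (by omega)) (hu.mono (by omega)))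
    (Cl.phiU (k := 0) P hL (fun i j => (hQ i j).mono (by omega)) (hu.mono (by omega)))
  obtain ⟨M, hM⟩ := hb.ev_left.exists
  obtain ⟨N, hN⟩ := hb.left
  refine continuousOn_of_dominated (bound := fun _ => M)
    (fun t ht => (hN t ht).continuous.aestronglyMeasurable)
    (fun t ht => ae_of_all _ fun x => hM t ht x) (integrable_const M) (ae_of_all _ fun x => ?_)
  have c1 := fun i j => Cl.continuousOn (fun _ t x => HC P (Q t) (u t) x i j)
    (Cl.hC (k := 0) P hL (fun i j => (C.cl_Q i j).mono (by omega)) C.cl_u i j) one_pos x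
  have c2 := Cl.continuousOn (fun _ t x => muC P (Q t) (u t) x)
    (Cl.muC (k := 0) P hL C.cl_Q C.cl_u) one_pos x
  have c3 := fun i j => Cl.continuousOn (fun _ t x => phiQ P (Q t) (u t) i j x)
    (Cl.phiQ (k := 0) P hL C.cl_Q C.cl_u i j) one_pos x
  exact (continuousOn_finsetSum _ fun i _ => continuousOn_finsetSum _ fun j _ =>
    (c1 i j).mul (c3 i j)).add (c2.mul (C.phiU_cont x))

theorem hasDerivWithinAt_s (hL : 0 < L) (C : Classical P L T Q u)
    (h : IsExactSolution P L T 4 Q Qt u ut s)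
    (hae : ∀ᵐ t ∂(volume.restrict (Ioc 0 T)), t ∈ Icc 0 T ∧ ∀ᵐ x ∂(ℳ L),
      (∀ i j, Qt t x i j = phiQ P (Q t) (u t) i j x) ∧ ut t x = phiU P (Q t) (u t) x)
    {t : ℝ} (ht : t ∈ Icc 0 T) : HasDerivWithinAt s (rate P L Q u t) (Icc 0 T) t := by
  obtain ⟨Ru, hRu⟩ := C.u_reg
  have hQ2 : ∀ t ∈ Icc 0 T, ∃ R, ∀ i j, W L 2 R fun x => Q t x i j := fun t ht => by
    choose R hR using C.Q_reg
    exact ⟨∑ i, ∑ j, |R i j|, fun i j => (hR i j t ht).mono (by norm_num) ((le_abs_self _).trans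
      (le_sum_sum (f := fun i j => |R i j|) (fun _ _ => abs_nonneg _) i j))⟩
  have hQ := fun i j => Cl.refl (δ := fun _ => 0) (C.Q_reg i j)
  have hu := Cl.refl (δ := fun _ => 0) C.u_reg
  obtain ⟨⟨N1, hN1⟩, -⟩ := Cl.sum fun i => Cl.sum fun j =>
    (Cl.hC (k := 0) P hL (fun i j => (hQ i j).mono (by omega)) (hu.mono (by omega)) i j).mul
    (Cl.phiQ (k := 0) P hL (fun i j => (hQ i j).mono (by omega)) (hu.mono (by omega)) i j)
  obtain ⟨⟨N2, hN2⟩, -⟩ :=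
    (Cl.muC (k := 0) P hL (fun i j => (hQ i j).mono (by omega)) (hu.mono (by omega))).mul
    (Cl.phiU (k := 0) P hL (fun i j => (hQ i j).mono (by omega)) (hu.mono (by omega)))
  have hr : ∀ᵐ r ∂(volume.restrict (Ioc 0 T)), gFactor P L (Q r) (u r) (s r) *
      (∫ x, frob (HField P L (Q r) (u r) x) (Qt r x) ∂(ℳ L)
        + ∫ x, muField P L (Q r) (u r) x * ut r x ∂(ℳ L)) = rate P L Q u r := by
    filter_upwards [hae] with r hr
    obtain ⟨hr, hx⟩ := hr
    obtain ⟨R', hR'⟩ := hQ2 r hr; have hu2 := (hRu r hr).mono (by norm_num : 2 ≤ 6) le_rfl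
    have e1 : ∫ x, frob (HField P L (Q r) (u r) x) (Qt r x) ∂(ℳ L)
        = ∫ x, ∑ i, ∑ j, HC P (Q r) (u r) x i j * phiQ P (Q r) (u r) i j x ∂(ℳ L) := by
      refine integral_congr_ae ?_
      filter_upwards [hx, HField_ae (Q := Q r) P hL hu2] with x hx h1
      rw [h1, frob]; exact sum_congr rfl fun i _ => sum_congr rfl fun j _ => by rw [hx.1 i j]
    have e2 : ∫ x, muField P L (Q r) (u r) x * ut r x ∂(ℳ L)
        = ∫ x, muC P (Q r) (u r) x * phiU P (Q r) (u r) x ∂(ℳ L) := by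
      refine integral_congr_ae ?_
      filter_upwards [hx, muField_ae (Q := Q r) P hL hu2 hR'] with x hx h1
      rw [h1, hx.2]
    rw [h.gFactor_eq hr, one_mul, e1, e2, ← integral_add (hN1 r hr).integrable
      (hN2 r hr).integrable]
    rfl
  have hs : ∀ t ∈ Icc 0 T, s t = s 0 + ∫ r in (0 : ℝ)..t, rate P L Q u r := fun t ht => by
    rw [h.eq_s t ht]
    congr 1
    rw [intervalIntegral.integral_of_le ht.1, intervalIntegral.integral_of_le ht.1]
    exact integral_congr_ae (ae_restrict_of_ae_restrict_of_subset (Ioc_subset_Ioc_right ht.2) hr)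
  have hc := C.continuousOn_rate hL
  have : Fact (t ∈ Icc 0 T) := ⟨ht⟩
  have hi : IntervalIntegrable (rate P L Q u) volume 0 t :=
    (hc.mono (Icc_subset_Icc_right ht.2)).intervalIntegrable_of_Icc ht.1
  refine HasDerivWithinAt.congr ?_ hs (hs t ht)
  exact (intervalIntegral.integral_hasDerivWithinAt_right hi
    (hc.stronglyMeasurableAtFilter_nhdsWithin measurableSet_Icc t) (hc t ht)).const_add _

theorem ev_rate (hL : 0 < L) (C : Classical P L T Q u) : ∀ᶠ R in atTop, ∀ r ∈ Icc 0 T,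
    ∀ t ∈ Icc 0 T, ∀ (J : ℕ) [NeZero J] (h : ℝ), h = L / J →
      |rate P L Q u r - h ^ d * ∑ p : Grid d J, power (HD P h (Q t) (u t)) (muD P h (Q t) (u t))
        (phiQ P (Q r) (u r)) (phiU P (Q r) (u r)) (node h p)| ≤ R * (|r - t| + h ^ 2) := by
  have hQ : ∀ {δ : ℝ × ℝ × ℝ → ℝ} (i j : Fin d), Cl L 4 (Pairs T) δ (fun a x => Q a.1 x i j)
    (fun a x => Q a.1 x i j) := fun i j => Cl.refl (C.Q_bd i j)
  have hu : ∀ {δ : ℝ × ℝ × ℝ → ℝ}, Cl L 6 (Pairs T) δ (fun a => u a.1) (fun a => u a.1) :=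
    Cl.refl C.u_bd
  have hQ' : ∀ i j, ∃ R, ∀ a ∈ Pairs T, W L 4 R fun x => Q a.2.1 x i j := fun i j => by
    obtain ⟨R, hR⟩ := C.Q_reg i j; exact ⟨R, fun a ha => hR _ ha.2.1⟩
  have hu' : ∃ R, ∀ a ∈ Pairs T, W L 4 R (u a.2.1) := by
    obtain ⟨R, hR⟩ := C.u_reg; exact ⟨R, fun a ha => (hR _ ha.2.1).mono (by norm_num) le_rfl⟩
  have fQ : ∀ {δ : ℝ × ℝ × ℝ → ℝ} (i j : Fin d), Cl L 2 (Pairs T) δ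
      (fun a => phiQ P (Q a.1) (u a.1) i j) (fun a => phiQ P (Q a.1) (u a.1) i j) :=
    Cl.phiQ (k := 2) P hL hQ (hu.mono (by omega))
  have fU : ∀ {δ : ℝ × ℝ × ℝ → ℝ}, Cl L 2 (Pairs T) δ
      (fun a => phiU P (Q a.1) (u a.1)) (fun a => phiU P (Q a.1) (u a.1)) :=
    Cl.phiU (k := 2) P hL hQ hu
  have c1 := Cl.power (Cl.hC (k := 0) P hL (fun i j => (C.cl_Q i j).mono (by omega)) C.cl_u)
    (Cl.muC (k := 0) P hL C.cl_Q C.cl_u) (fun i j => (fQ i j).mono (by omega))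
    (fU.mono (by omega))
  have c2 := Cl.power (Cl.hC (k := 2) P hL
      (fun i j => (Cl.refl (δ := fun _ => 0) (hQ' i j)).mono (by omega)) (Cl.refl hu'))
    (Cl.muC (k := 2) P hL (fun i j => Cl.refl (hQ' i j)) (Cl.refl hu')) fQ fU
  have c3 := Cl.power (Cl.hD_hC (k := 0) (h := fun a => a.2.2) P hL (fun a ha => ha.2.2)
      (fun i j => ((Cl.refl (δ := fun _ => 0) (hQ' i j)).mono (by omega)).left) hu')
    (Cl.muD_muC (k := 0) (h := fun a => a.2.2) P hL (fun a ha => ha.2.2) hQ' hu') (fun i j => (fQ i j).mono (by omega))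
    (fU.mono (by omega))
  obtain ⟨M1, hM1⟩ := (c1.ev_diff fun _ _ => abs_nonneg _).exists
  obtain ⟨⟨M2, hM2⟩, -⟩ := c2
  obtain ⟨M3, hM3⟩ := (c3.ev_diff fun _ _ => sq_nonneg _).exists
  obtain ⟨N, hN⟩ := c1.left
  filter_upwards [eventually_ge_atTop (L ^ d * M1), eventually_ge_atTop
    (L ^ d / L ^ 2 * M2 + L ^ d * M3)] with R hR1 hR2 r hr t ht J _ h hh
  have h0 : 0 < h := mesh_pos hL hh
  have ha : (r, t, h) ∈ Pairs T := ⟨hr, ht, h0⟩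
  have q1 := abs_integral_cell_le hL fun x => hM1 _ ha x
  rw [integral_sub (hN _ ha).integrable (hM2 _ ha).integrable] at q1
  have q2 := (hM2 _ ha).quadrature hL hh
  have q3 := abs_sum_node_le (J := J) hh h0.le fun x => hM3 _ ha x
  rw [sum_sub_distrib, mul_sub, abs_sub_comm] at q3
  rw [abs_sub_comm] at q2
  refine (abs_sub_le _ _ _).trans ((add_le_add q1 ((abs_sub_le _ _ _).trans
    (add_le_add q2 q3))).trans ?_)
  have b1 := mul_le_right hR1 (abs_nonneg (r - t))
  have b2 := mul_le_right hR2 (sq_nonneg h)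
  dsimp only
  linarith

theorem ev_s_increment (hL : 0 < L) (C : Classical P L T Q u)
    (hs : ∀ t ∈ Icc 0 T, HasDerivWithinAt s (rate P L Q u t) (Icc 0 T) t) :
    ∀ᶠ R in atTop, ∀ (J : ℕ) [NeZero J] (h : ℝ), h = L / J → ∀ t ∈ Icc 0 T, ∀ r ∈ Icc 0 T, t ≤ r →
      |s r - s t - ((∑ i, ∑ j, ip h (res J h fun x => HD P h (Q t) (u t) x i j)
        (res J h (fun x => Q r x i j) - res J h fun x => Q t x i j))
        + ip h (res J h (muD P h (Q t) (u t))) (res J h (u r) - res J h (u t)))|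
      ≤ R * (r - t) * (r - t + h ^ 2) := by
  filter_upwards [C.ev_rate hL, eventually_ge_atTop 0] with R hR hR0 J _ h hh t ht r hr htr
  have hsub : Icc t r ⊆ Icc 0 T := Icc_subset_Icc ht.1 hr.2
  obtain ⟨F, hF⟩ : ∃ F : ℝ → ℝ, F = fun θ => h ^ d * ∑ p : Grid d J,
      (∑ i, ∑ j, HD P h (Q t) (u t) (node h p) i j * Q θ (node h p) i j
        + muD P h (Q t) (u t) (node h p) * u θ (node h p)) := ⟨_, rfl⟩
  have hd : ∀ θ ∈ Icc t r, HasDerivWithinAt (fun θ => s θ - F θ) (rate P L Q u θ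
      - h ^ d * ∑ p : Grid d J, power (HD P h (Q t) (u t)) (muD P h (Q t) (u t))
        (phiQ P (Q θ) (u θ)) (phiU P (Q θ) (u θ)) (node h p)) (Icc t r) θ := fun θ hθ => by
    rw [hF]
    refine HasDerivWithinAt.mono ((hs θ (hsub hθ)).sub (HasDerivWithinAt.const_mul _
      (HasDerivWithinAt.fun_sum fun p _ => HasDerivWithinAt.add (HasDerivWithinAt.fun_sum fun i _ =>
        HasDerivWithinAt.fun_sum fun j _ => (C.Q_deriv θ (hsub hθ) i j _).const_mul _)
        ((C.u_deriv θ (hsub hθ) _).const_mul _)))) hsub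
  have hb := Convex.norm_image_sub_le_of_norm_hasDerivWithin_le (C := R * (r - t + h ^ 2)) hd
    (fun θ hθ => by
      refine (hR θ (hsub hθ) t ht J h hh).trans (mul_le_left ?_ hR0)
      rw [abs_of_nonneg (sub_nonneg.mpr hθ.1)]
      linarith [hθ.2]) (convex_Icc t r) (left_mem_Icc.mpr htr) (right_mem_Icc.mpr htr)
  rw [norm_eq_abs, norm_eq_abs, abs_of_nonneg (sub_nonneg.mpr htr)] at hb
  have e : s r - s t - ((∑ i, ∑ j, ip h (res J h fun x => HD P h (Q t) (u t) x i j)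
        (res J h (fun x => Q r x i j) - res J h fun x => Q t x i j))
        + ip h (res J h (muD P h (Q t) (u t))) (res J h (u r) - res J h (u t)))
      = s r - F r - (s t - F t) := by
    have e1 : (∑ i, ∑ j, ip h (res J h fun x => HD P h (Q t) (u t) x i j)
        (res J h (fun x => Q r x i j) - res J h fun x => Q t x i j))
        + ip h (res J h (muD P h (Q t) (u t))) (res J h (u r) - res J h (u t)) = F r - F t := by
      simp only [hF, ip, res, Pi.sub_apply, ← mul_sum]; rw [← mul_add, ← mul_sub, ← sum_sub_distrib]
      congr 1
      rw [sum_congr rfl fun i _ => sum_comm, sum_comm, ← sum_add_distrib]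
      refine sum_congr rfl fun p _ => ?_
      simp only [mul_sub, sum_sub_distrib]; ring
    rw [e1]; ring
  rw [e]
  exact hb.trans_eq (by ring)

end Classical

end Energy

/-! ### The sampled exact solution solves the semi-discrete system -/

section Sampled

open Filter

variable {d : ℕ} {L T : ℝ} {P : Params} {Q Qt : ℝ → Pt d → Mat d} {u ut : ℝ → Pt d → ℝ}
  {s : ℝ → ℝ}

theorem Classical.continuousOn_psiU (hL : 0 < L) (C : Classical P L T Q u) {η : ℝ} (hη : 0 < η)
    (x : Pt d) : ContinuousOn (fun t => psiU P η (Q t) (u t) x) (Icc 0 T) := by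
  have hu : ∀ x, ContinuousOn (fun t => u t x) (Icc 0 T) := fun x t ht =>
    (C.u_deriv t ht x).continuousWithinAt
  exact (continuousOn_const.mul (continuousOn_dlap (continuousOn_dlap hu η) η x)).sub
    (Cl.continuousOn (fun η t x => muD P η (Q t) (u t) x)
      (Cl.muD (k := 0) P hL (fun a ha => ha.2.2) C.cl_Q C.cl_u) hη x)

/-- The residual of the sampled `Q`. -/
def resQ (P : Params) (J : ℕ) (h : ℝ) (Q : Pt d → Mat d) (u : Pt d → ℝ) (i j : Fin d) :
    GridFun d J := res J h (phiQ P Q u i j) - res J h (psiQ P h Q u i j)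

/-- The residual of the sampled `u`. -/
def resU (P : Params) (J : ℕ) (h : ℝ) (Q : Pt d → Mat d) (u : Pt d → ℝ) : GridFun d J :=
  res J h (phiU P Q u) - res J h (psiU P h Q u)

theorem IsExactSolution.gridSolution (hL : 0 < L) (hd : d ≤ 3) (hT : 0 < T) (hK : 0 < P.K)
    (hB : 0 < P.B0) (hs : IsExactSolution P L T 4 Q Qt u ut s) :
    ∃ R, 0 ≤ R ∧ ∀ (J : ℕ) [NeZero J] (h : ℝ), h = L / J →
      GridSolution P T R h (fun t (p : Grid d J) => Q t (node h p)) (fun t p => u t (node h p)) s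
        (fun t => resQ P J h (Q t) (u t)) (fun t => resU P J h (Q t) (u t)) := by
  obtain ⟨C, hae⟩ := hs.classical hL hd hT hK hB
  have hp : ∀ a ∈ Pairs T, 0 < a.2.2 := fun a ha => ha.2.2
  have hδ : ∀ a ∈ Pairs T, 0 ≤ |a.1 - a.2.1| := fun a _ => abs_nonneg _
  have hδ' : ∀ a ∈ Pairs T, 0 ≤ a.2.2 ^ 2 := fun a _ => sq_nonneg _
  have cH := Cl.hD (k := 0) (h := fun a => a.2.2) P hL hp (fun i j => (C.cl_Q i j).mono (by omega))
    C.cl_u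
  have cmu := Cl.muD (k := 0) (h := fun a => a.2.2) P hL hp C.cl_Q C.cl_u
  have cρ := fun i j => (Cl.phiQ (k := 0) P hL C.cl_Q C.cl_u i j).sub
    (Cl.psiQ (k := 0) (h := fun a => a.2.2) P hL hp C.cl_Q C.cl_u i j)
  have chess := fun k l => (C.cl_u.cd (k := 1) (h := fun a => a.2.2) hL hp l).cd hL hp k
  obtain ⟨RQ, hRQ⟩ : ∃ R : Fin d → Fin d → ℝ, ∀ i j, ∀ t ∈ Icc 0 T, W L 4 (R i j)
    fun x => Q t x i j := by choose R hR using C.Q_reg; exact ⟨R, hR⟩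
  obtain ⟨Ru, hRu⟩ := C.u_reg
  have all : ∀ {p : Fin d → Fin d → ℝ → Prop}, (∀ i j, ∀ᶠ R in atTop, p i j R) →
      ∀ᶠ R in atTop, ∀ i j, p i j R := fun h =>
    eventually_all.mpr fun i => eventually_all.mpr fun j => h i j
  have a1 := all fun i j => ev_N2 hL
    ⟨RQ i j, fun t ht => (hRQ i j t ht).mono (by norm_num : 2 ≤ 4) le_rfl⟩
  have a2 := ev_N2 hL ⟨Ru, fun t ht => (hRu t ht).mono (by norm_num : 2 ≤ 6) le_rfl⟩
  have a3 := all fun i j => (C.cl_Q i j).ev_left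
  have a4 := all fun k l => (chess k l).ev_left
  have a5 := all fun i j => (cH i j).ev_N0 hL
  have a6 := cmu.ev_N0 hL
  have a7 := all fun i j => (C.cl_Q i j).ev_N0_sub hL hδ
  have a8 := C.cl_u.ev_N0_sub hL hδ
  have a9 := all fun i j => (cH i j).ev_N0_sub hL hδ
  have a10 := cmu.ev_N0_sub hL hδ
  have a11 := all fun i j => (cρ i j).ev_N0_sub hL hδ
  have a12 := all fun i j => (Cl.psiQ_phiQ (k := 0) (h := fun a => a.2.2) P hL hp C.Q_bd
    C.u_bd_four i j).ev_N0_sub hL hδ'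
  have a13 := (Cl.psiU_phiU (k := 0) (h := fun a => a.2.2) P hL hp C.Q_bd
    C.u_bd).ev_N0_sub hL hδ'
  have a14 := C.ev_s_increment hL fun t ht => C.hasDerivWithinAt_s hL hs hae ht
  obtain ⟨R, ⟨b1, b2, b3, b4, b5, b6, b7⟩, b8, b9, b10, b11, b12, b13, b14, b15, hR⟩ :=
    ((a1.and (a2.and (a3.and (a4.and (a5.and (a6.and a7)))))).and (a8.and (a9.and (a10.and
      (a11.and (a12.and (a13.and (a14.and ((C.ev_E1 hL).and (eventually_ge_atTop 0)))))))))).exists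
  refine ⟨R, hR, fun J _ h hh => ?_⟩
  have h0 : 0 < h := mesh_pos hL hh
  have pa : ∀ {t r : ℝ}, t ∈ Icc 0 T → r ∈ Icc 0 T → (t, r, h) ∈ Pairs T := fun ht hr =>
    ⟨ht, hr, h0⟩
  have perQ : ∀ t ∈ Icc 0 T, ∀ i j, IsPer L fun x => Q t x i j := fun t ht i j =>
    (hRQ i j t ht).periodic hL.ne'
  have peru : ∀ t ∈ Icc 0 T, IsPer L (u t) := fun t ht => (hRu t ht).periodic hL.ne'
  have eH : ∀ t ∈ Icc 0 T, ∀ i j, entry (HH P h (fun p : Grid d J => Q t (node h p))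
      fun p => u t (node h p)) i j = res J h fun x => HD P h (Q t) (u t) x i j := fun t ht i j =>
    HH_res (peru t ht) hh i j
  have em : ∀ t ∈ Icc 0 T, muH P h (fun p : Grid d J => Q t (node h p))
      (fun p => u t (node h p)) = res J h (muD P h (Q t) (u t)) := fun t ht =>
    muH_res (perQ t ht) (peru t ht) hh
  refine
    { V_bd := fun t ht i j => b1 i j t ht J h hh
      U_bd := fun t ht => b2 t ht J h hh
      V_sup := fun t ht i j p => b3 i j _ (pa ht ht) _
      hess_sup := fun t ht k l p => ?_
      H_bd := fun t ht i j => by rw [eH t ht]; exact b5 i j _ (pa ht ht) J h hh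
      mu_bd := fun t ht => by rw [em t ht]; exact b6 _ (pa ht ht) J h hh
      V_deriv := fun t ht i j => ?_
      U_deriv := fun t ht => ?_
      V_lip := fun t ht r hr i j => b7 i j _ (pa ht hr) J h hh
      U_lip := fun t ht r hr => b8 _ (pa ht hr) J h hh
      H_lip := fun t ht r hr i j => by
        rw [eH t ht, eH r hr]; exact b9 i j _ (pa ht hr) J h hh
      mu_lip := fun t ht r hr => by rw [em t ht, em r hr]; exact b10 _ (pa ht hr) J h hh
      ρ_lip := fun t ht r hr i j => b11 i j _ (pa ht hr) J h hh
      ς_cont := continuousOn_pi.mpr fun p => (C.phiU_cont _).sub (C.continuousOn_psiU hL h0 _)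
      ρ_le := fun t ht i j => by
        rw [resQ, map_sub_rev]; exact b12 i j _ (pa ht ht) J h hh
      ς_le := fun t ht => by rw [resU, map_sub_rev]; exact b13 _ (pa ht ht) J h hh
      E1_le := fun t ht => by rw [hs.s_def t ht]; exact b15 t ht J h hh
      s_increment := fun t ht r hr htr => by
        simp only [eH t ht]; rw [em t ht]; exact b14 J h hh t ht r hr htr }
  · rw [show Dc h k (Dc h l fun p : Grid d J => u t (node h p)) p
      = cd h k (cd h l (u t)) (node h p) from congrFun (Dc_Dc_res (peru t ht) hh k l) p]
    exact b4 k l _ (pa ht ht) _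
  · refine hasDerivWithinAt_pi.mpr fun p => ?_
    refine (C.Q_deriv t ht i j (node h p)).congr_deriv ?_
    rw [eH t ht, elastic_apply, show lapOp h (entry (fun p : Grid d J => Q t (node h p)) i j)
      = res J h (dlap h fun x => Q t x i j) from lapOp_res (perQ t ht i j) hh]
    simp only [resQ, res, psiQ, Pi.add_apply, Pi.sub_apply, Pi.neg_apply, Pi.smul_apply,
      smul_eq_mul]
    ring
  · refine hasDerivWithinAt_pi.mpr fun p => ?_
    refine (C.u_deriv t ht (node h p)).congr_deriv ?_
    rw [em t ht, smectic_apply, show lapOp h (fun p : Grid d J => u t (node h p))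
      = res J h (dlap h (u t)) from lapOp_res (peru t ht) hh, lapOp_res ((peru t ht).dlap h) hh]
    simp only [resU, res, psiU, Pi.add_apply, Pi.sub_apply, Pi.neg_apply, Pi.smul_apply,
      smul_eq_mul]
    ring

end Sampled

end

end SmA

theorem theorem5p3 {d : ℕ} (P : SmA.Params) (hP : P.Admissible d)
    (L T κ₁ κ₂ η₀ : ℝ) (hL : 0 < L) (hT : 0 < T) (hκ₁ : 0 < κ₁) (hκ₂ : 0 < κ₂)
    (hη₀ : η₀ ∈ Set.Icc (0 : ℝ) 1)
    (Q Qt : ℝ → SmA.Pt d → SmA.Mat d) (u ut : ℝ → SmA.Pt d → ℝ) (s : ℝ → ℝ)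
    (hsol : SmA.IsExactSolution P L T 4 Q Qt u ut s)
    (C₀ : ℝ) :
    ∃ C > 0, ∃ τ₀ > 0, ∃ h₀ > 0, ∀ (J : ℕ) [NeZero J] (h τ : ℝ),
      h = L / J → h ≤ h₀ → 0 < τ → τ ≤ τ₀ →
      ∀ (Qh : ℕ → SmA.Grid d J → SmA.Mat d) (uh : ℕ → SmA.GridFun d J) (sh : ℕ → ℝ),
        SmA.IsNumericalSolution P h τ κ₁ κ₂ η₀ Qh uh sh →
        SmA.totalError h (Qh 0) (uh 0) (sh 0) (Q 0) (u 0) (s 0) ≤ C₀ * (τ + h ^ 2) →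
        ∀ n : ℕ, n * τ ≤ T →
          SmA.totalError h (Qh n) (uh n) (sh n) (Q (n * τ)) (u (n * τ)) (s (n * τ))
            ≤ C * (τ + h ^ 2) := by
  have hd : d = 2 ∨ d = 3 := hP.regime.imp And.left And.left
  obtain ⟨R, hR, hG⟩ := hsol.gridSolution hL (by omega) hT hP.K_pos hP.B0_pos
  obtain ⟨C, hC, τ₀, hτ₀, h₀, hh₀, H⟩ := SmA.GridSolution.convergence (T := T) hL hd hR hP.K_pos
    hP.B0_pos hκ₁ hκ₂ C₀
  exact ⟨C, hC, τ₀, hτ₀, h₀, hh₀, fun J _ h τ hh hle hτ hττ Qh uh sh hnum h0 =>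
    H hh hle hτ hττ (hG J h hh) hnum.step (by simpa [SmA.totalError] using h0)⟩
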